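/- **Theorem (hook length property for class 10, tagged swivels).** Let $\lambda=(\lambda_1\ge\lambda_2\ge\lambda_3\ge\lambda_4\ge\lambda_5\ge0)$ be any partition of length at most $5$, and let $P=P_6^{\lambda_1+4}(X_{10})$ with $$X_{10}=\{(\lambda,5,1),(\emptyset,2,1),((1),2,2),(\emptyset,2,3),(\emptyset,3,4),(\emptyset,2,5)\}$$ be the corresponding tagged swivel, as defined below. Then $P$ is $d$-complete and has the hook length property: as formal power series in $q$, $$\sum_{\sigma:P\to\mathbb N}q^{|\sigma|}=\prod_{u\in P}\frac1{1-q^{h(u)}},$$ where the sum is over all $P$-partitions $\sigma$ (maps $\sigma:P\to\mathbb N=\{0,1,2,\dots\}$ such that $x\le y$ implies $\sigma(x)\ge\sigma(y)$), $|\sigma|=\sum_{x\in P}\sigma(x)$, and $h(u)$ is the hook length of $u$. *The posets $P_n^m(X)$.* Let $\delta_{n+1}=(n,n-1,\dots,1,0)$. For a partition $\lambda$ of length at most $n$, the shifted Young poset $(\lambda+\delta_{n+1})^*$ has the cells $(i,j)$ with $1\le i\le n$ and $i\le j\le\lambda_i+n$, where $(i,j)\le(i',j')$ if $i\ge i'$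 and $j\ge j'$; its diagonal cells are the $(i,i)$. For a set $X$ of triples $(\lambda^{(i)},n_i,s_i)$, where $n_i,s_i\ge1$, $s_i+n_i-1\le n$ and $\lambda^{(i)}$ is a partition of length at most $n_i$, start with a chain $x_1<\dots<x_n$ and, for each triple, glue on $(\lambda^{(i)}+\delta_{n_i+1})^*$ by identifying its diagonal cells $(1,1),(2,2),\dots,(n_i,n_i)$ with $x_{s_i+n_i-1},x_{s_i+n_i-2},\dots,x_{s_i}$, respectively; finally attach a chain of $m$ elements above $x_n$. The order of $P_n^m(X)$ is the one generated by the orders of these pieces. *$d$-complete posets and hook lengths.* For $k\ge3$ the double-tailed diamond $d_k(1)$ is the poset of $2k-2$ elements that consists of two incomparable elements (the sides), a chain of $k-2$ elements above both (the neck), and a chain of $k-2$ elements below both. A $d_k$-interval is an interval $[w,z]$ isomorphic to $d_k(1)$; a $d_k^-$-convex set is a convex set isomorphic to $d_k(1)$ without its maximal element. A poset is $d$-complete if for every $k\ge3$: (1) for every $d_k^-$-convex set $I$ there is an element $z$ that covers the maximal elements of $I$ such that $I\cup\{z\}$ is a $d_k$-interval; (2) if $[w,z]$ is a $d_k$-interval,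 then $z$ covers no element outside $[w,z]$; (3) no two different $d_k^-$-convex sets differ only in their minimal elements. In a finite $d$-complete poset the hook length $h(z)$ is defined recursively: if $z$ is not in the neck of any $d_k$-interval, then $h(z)=\#\{x: x\le z\}$; otherwise $h(z)=h(x)+h(y)-h(w)$, where $[w,z]$ is the $d_\ell$-interval with top $z$, and $x,y$ are its sides. -/

import Mathlib

/-! ### Partitions and shifted Young diagrams -/

/-- `Par n`: the partitions of length at most `n`, as weakly decreasing sequences of `n`
nonnegative integers (rows are numbered from `0`). -/
def Par (n : ℕ) : Type := {lam : Fin n → ℕ // Antitone lam}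

/-- The parts of a partition. -/
def Par.part {n : ℕ} (lam : Par n) : Fin n → ℕ := lam.1

/-- The strict partition `lam + δ_{n+1}`, where `δ_{n+1} = (n, n - 1, …, 1, 0)`; its last part,
which is `0`, is left out, so that row `r` has `lam r + (n - r)` cells. -/
def Par.addStaircase {n : ℕ} (lam : Par n) (r : Fin n) : ℕ := lam.part r + (n - r)

/-- The cells of the shifted Young diagram `(lam + δ_{n+1})^*`. The cell `⟨r, j⟩` is the `j`-th cell
of row `r`, which stands in column `r + j`; the cells `⟨r, 0⟩` are the diagonal ones. -/
structure ShiftedCell {n : ℕ} (lam : Par n) : Type where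
  row : Fin n
  pos : Fin (lam.addStaircase row)

/-- The order of the shifted Young poset: `a ≤ b` if `a` is weakly below and weakly to the right
of `b`. -/
def ShiftedCell.Below {n : ℕ} {lam : Par n} (a b : ShiftedCell lam) : Prop :=
  b.row ≤ a.row ∧ (b.row : ℕ) + (b.pos : ℕ) ≤ (a.row : ℕ) + (a.pos : ℕ)

/-! ### The posets `P_n^m(X)` -/

/-- A triple `(lam, len, start)` with `lam ∈ Par_len`, `len, start ≥ 1` and
`start + len - 1 ≤ n`. -/
structure Attachment (n : ℕ) where
  len : ℕ
  lam : Par len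
  start : ℕ
  one_le_len : 1 ≤ len
  one_le_start : 1 ≤ start
  start_add_len_le : start + len ≤ n + 1

/-- The underlying set of `P_n^m(X)`: the diagonal entries `x_1, …, x_n` (`diag i` is `x_{i+1}`),
the off-diagonal cells of the shifted diagrams `(lam + δ_{len+1})^*` for the triples in `X`
(`cell t r j` is the `(j+1)`-st cell of row `r` of the `t`-th diagram), and a chain of
`m` further elements. The diagonal cells are not listed again, since they are identified with
diagonal entries. -/
inductive DiagPoset (n m : ℕ) (X : List (Attachment n)) : Type
  | diag (i : Fin n) : DiagPoset n m X
  | cell (t : Fin X.length) (r : Fin (X.get t).len)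
      (j : Fin ((X.get t).lam.addStaircase r - 1)) : DiagPoset n m X
  | top (j : Fin m) : DiagPoset n m X

namespace DiagPoset

variable {n m : ℕ} {X : List (Attachment n)}

/-- The underlying set as a disjoint union. -/
def equivSum (n m : ℕ) (X : List (Attachment n)) :
    DiagPoset n m X ≃ (Fin n ⊕ Fin m) ⊕
      ((t : Fin X.length) × (r : Fin (X.get t).len) ×
        Fin ((X.get t).lam.addStaircase r - 1)) where
  toFun
    | diag i => Sum.inl (Sum.inl i)
    | top j => Sum.inl (Sum.inr j)
    | cell t r j => Sum.inr ⟨t, r, j⟩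
  invFun
    | Sum.inl (Sum.inl i) => diag i
    | Sum.inl (Sum.inr j) => top j
    | Sum.inr ⟨t, r, j⟩ => cell t r j
  left_inv x := by cases x <;> rfl
  right_inv x := by rcases x with (_ | _) | ⟨_, _, _⟩ <;> rfl

instance : Fintype (DiagPoset n m X) := Fintype.ofEquiv _ (equivSum n m X).symm

/-- The diagonal entry with which the diagonal cell of row `r` of the `t`-th diagram is
identified: from the last row to the first these are `x_start, …, x_{start+len-1}`. -/
def diagIndex (t : Fin X.length) (r : Fin (X.get t).len) : Fin n :=
  ⟨(X.get t).start - 1 + ((X.get t).len - 1 - r), by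
    have h1 := (X.get t).one_le_start
    have h2 := (X.get t).start_add_len_le
    have h3 := r.isLt
    omega⟩

/-- The element of `P_n^m(X)` given by a cell of the `t`-th shifted diagram. -/
def place (t : Fin X.length) (c : ShiftedCell (X.get t).lam) : DiagPoset n m X :=
  if h : (c.pos : ℕ) = 0 then diag (diagIndex t c.row)
  else cell t c.row ⟨(c.pos : ℕ) - 1, by have := c.pos.isLt; omega⟩

/-- The relations that generate the order of `P_n^m(X)`: the chain `x_1 < ⋯ < x_n`, the orders of
the shifted Young posets, and the chain of `m` elements attached above `x_n`. -/
inductive Gen : DiagPoset n m X → DiagPoset n m X → Prop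
  | diag {i j : Fin n} (h : i ≤ j) : Gen (diag i) (diag j)
  | cell (t : Fin X.length) {a b : ShiftedCell (X.get t).lam} (h : a.Below b) :
      Gen (place t a) (place t b)
  | attach (i : Fin n) (j : Fin m) : Gen (diag i) (top j)
  | top {i j : Fin m} (h : i ≤ j) : Gen (top i) (top j)

/-- First coordinate of a linear extension, used only to prove antisymmetry. -/
def level : DiagPoset n m X → ℕ
  | diag i => i
  | cell t r _ => diagIndex t r
  | top j => n + j

/-- Second coordinate of a linear extension, used only to prove antisymmetry. -/
def offset : DiagPoset n m X → ℕ
  | diag _ => 0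
  | cell _ _ j => j + 1
  | top _ => 0

theorem level_place (t : Fin X.length) (c : ShiftedCell (X.get t).lam) :
    level (place (m := m) t c) = diagIndex t c.row := by
  unfold place
  split <;> rfl

theorem offset_place (t : Fin X.length) (c : ShiftedCell (X.get t).lam) :
    offset (place (m := m) t c) = c.pos := by
  unfold place
  split
  · rename_i h
    exact h.symm
  · rename_i h
    simp only [offset]
    omega

theorem Gen.lex {x y : DiagPoset n m X} (h : Gen x y) :
    x = y ∨ level x < level y ∨ (level x = level y ∧ offset y < offset x) := by
  cases h with
  | @diag i j h =>
    rcases h.lt_or_eq with h | h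
    · exact Or.inr (Or.inl h)
    · exact Or.inl (by rw [h])
  | @cell t a b h =>
    obtain ⟨ra, ja⟩ := a
    obtain ⟨rb, jb⟩ := b
    obtain ⟨h1, h2⟩ := h
    simp only at h1 h2
    have h3 := ra.isLt
    rcases h1.lt_or_eq with h1 | h1
    · refine Or.inr (Or.inl ?_)
      rw [level_place, level_place]
      have : (rb : ℕ) < ra := h1
      simp only [diagIndex]
      omega
    · subst h1
      have h4 : (jb : ℕ) ≤ ja := by omega
      rcases h4.lt_or_eq with h4 | h4
      · refine Or.inr (Or.inr ⟨?_, ?_⟩)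
        · rw [level_place, level_place]
        · rw [offset_place, offset_place]
          exact h4
      · have : jb = ja := Fin.ext h4
        subst this
        exact Or.inl rfl
  | attach i j =>
    refine Or.inr (Or.inl ?_)
    have := i.isLt
    simp only [level]
    omega
  | @top i j h =>
    rcases h.lt_or_eq with h | h
    · refine Or.inr (Or.inl ?_)
      have : (i : ℕ) < j := h
      simp only [level]
      omega
    · exact Or.inl (by rw [h])

theorem reflTransGen_lex {x y : DiagPoset n m X} (h : Relation.ReflTransGen Gen x y) :
    x = y ∨ level x < level y ∨ (level x = level y ∧ offset y < offset x) := by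
  induction h with
  | refl => exact Or.inl rfl
  | tail _ hg ih =>
    rcases ih with rfl | ih
    · exact hg.lex
    · rcases hg.lex with rfl | hg
      · exact Or.inr ih
      · right
        omega

/-- The order of `P_n^m(X)` is the reflexive and transitive closure of the generating relations. -/
instance : PartialOrder (DiagPoset n m X) where
  le := Relation.ReflTransGen Gen
  le_refl _ := Relation.ReflTransGen.refl
  le_trans _ _ _ := Relation.ReflTransGen.trans
  le_antisymm x y hxy hyx := by
    rcases reflTransGen_lex hxy with h | h
    · exact h
    · rcases reflTransGen_lex hyx with h' | h'
      · exact h'.symm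
      · omega

end DiagPoset

/-! ### `P`-partition generating functions -/

/-- The generating function `∑_σ q^{|σ|}` over all `P`-partitions `σ`, that is, order-reversing
maps `σ : P → ℕ`: the coefficient of `q^N` is the number of those of size `N`. -/
noncomputable def pPartitionGF (P : Type) [PartialOrder P] [Fintype P] : PowerSeries ℚ :=
  PowerSeries.mk fun N => (Nat.card {σ : P → ℕ // Antitone σ ∧ ∑ x, σ x = N} : ℚ)

/-! ### Double-tailed diamonds and `d`-complete posets -/

/-- The elements of the double-tailed diamond `d_k(1)`, `k ≥ 3`: the two sides, the `k - 2` neck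
elements above them and the `k - 2` elements below them. -/
inductive DoubleTailedDiamond (k : ℕ) : Type
  | tail (i : Fin (k - 2)) : DoubleTailedDiamond k
  | left : DoubleTailedDiamond k
  | right : DoubleTailedDiamond k
  | neck (i : Fin (k - 2)) : DoubleTailedDiamond k

namespace DoubleTailedDiamond

variable {k : ℕ}

/-- The rank; only the two sides share their rank. -/
def rank : DoubleTailedDiamond k → ℕ
  | tail i => i
  | left => k - 2
  | right => k - 2
  | neck i => k - 1 + i

/-- Elements of different rank are comparable, and the two sides are not. -/
instance : PartialOrder (DoubleTailedDiamond k) where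
  le a b := a = b ∨ a.rank < b.rank
  le_refl _ := Or.inl rfl
  le_trans a b c hab hbc := by
    rcases hab with rfl | hab
    · exact hbc
    · rcases hbc with rfl | hbc
      · exact Or.inr hab
      · exact Or.inr (hab.trans hbc)
  le_antisymm a b hab hba := by
    rcases hab with h | hab
    · exact h
    · rcases hba with h | hba
      · exact h.symm
      · omega

end DoubleTailedDiamond

section

variable (P : Type) [PartialOrder P]

variable {P} in
/-- `[w, z]` is a `d_k`-interval. -/
def IsDInterval (k : ℕ) (w z : P) : Prop :=
  Nonempty (Set.Icc w z ≃o DoubleTailedDiamond k)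

variable {P} in
/-- `I` is a `d_k^-`-convex set: it is convex and isomorphic to `d_k(1)` without its maximal
element. -/
def IsDMinusConvex (k : ℕ) (I : Set P) : Prop :=
  I.OrdConnected ∧ Nonempty (I ≃o {a : DoubleTailedDiamond k // ¬ IsMax a})

/-- `d`-complete posets. -/
structure IsDComplete : Prop where
  /-- Every `d_k^-`-convex set is completed to a `d_k`-interval by an element that covers its
  maximal elements. -/
  exists_top : ∀ k, 3 ≤ k → ∀ I : Set P, IsDMinusConvex k I →
    ∃ z, (∀ a, Maximal (· ∈ I) a → a ⋖ z) ∧ ∃ w, insert z I = Set.Icc w z ∧ IsDInterval k w z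
  /-- The top of a `d_k`-interval covers no element outside of the interval. -/
  covby_mem : ∀ k, 3 ≤ k → ∀ w z : P, IsDInterval k w z → ∀ y, y ⋖ z → y ∈ Set.Icc w z
  /-- No two `d_k^-`-convex sets differ only in their minimal elements. -/
  eq_of_eq_off_min : ∀ k, 3 ≤ k → ∀ I J : Set P, IsDMinusConvex k I → IsDMinusConvex k J →
    {a ∈ I | ¬ Minimal (· ∈ I) a} = {a ∈ J | ¬ Minimal (· ∈ J) a} → I = J

variable {P} in
/-- `z` is in the neck of some `d_k`-interval. -/
def InNeck (z : P) : Prop :=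
  ∃ k, 3 ≤ k ∧ ∃ (w t : P) (e : Set.Icc w t ≃o DoubleTailedDiamond k) (i : Fin (k - 2)),
    (e.symm (.neck i) : P) = z

variable {P} in
/-- `h` is the hook length function of `P`: `h z` is the number of elements `≤ z` if `z` is in no
neck, and `h z = h x + h y - h w` if `[w, z]` is a `d_k`-interval with sides `x` and `y`. -/
structure IsHookLength (h : P → ℕ) : Prop where
  of_not_inNeck : ∀ z, ¬ InNeck z → h z = Nat.card (Set.Iic z)
  add_eq : ∀ k, 3 ≤ k → ∀ (w z : P) (e : Set.Icc w z ≃o DoubleTailedDiamond k),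
    h z + h w = h (e.symm .left : P) + h (e.symm .right : P)


variable {P}

namespace DoubleTailedDiamond

variable {k : ℕ}

/-- The double-tailed diamond `d_{i+3}(1)` inside `d_k(1)`, with top `neck i`. -/
def inner (i : Fin (k - 2)) : DoubleTailedDiamond ((i : ℕ) + 3) → DoubleTailedDiamond k
  | tail j => tail ⟨k - 3 - i + j, by have := i.isLt; have := j.isLt; omega⟩
  | left => left
  | right => right
  | neck j => neck ⟨j, by have := i.isLt; have := j.isLt; omega⟩

theorem rank_inner (i : Fin (k - 2)) (a : DoubleTailedDiamond ((i : ℕ) + 3)) :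
    (inner i a).rank = a.rank + (k - 3 - i) := by
  have := i.isLt
  cases a <;> simp only [inner, rank] <;> omega

theorem inner_injective (i : Fin (k - 2)) : Function.Injective (inner i) := by
  intro a b h
  cases a <;> cases b <;> simp_all [inner, Fin.ext_iff]

theorem inner_le_inner (i : Fin (k - 2)) {a b : DoubleTailedDiamond ((i : ℕ) + 3)} :
    inner i a ≤ inner i b ↔ a ≤ b := by
  change inner i a = inner i b ∨ _ < _ ↔ a = b ∨ _ < _
  rw [(inner_injective i).eq_iff, rank_inner, rank_inner, Nat.add_lt_add_iff_right]

theorem exists_inner (i : Fin (k - 2)) (a : DoubleTailedDiamond k)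
    (h1 : k - 3 - i ≤ a.rank) (h2 : a.rank ≤ (neck i : DoubleTailedDiamond k).rank) :
    ∃ b, inner i b = a := by
  have := i.isLt
  cases a with
  | tail j =>
    have := j.isLt
    simp only [rank] at h1
    refine ⟨tail ⟨j - (k - 3 - i), by omega⟩, ?_⟩
    simp only [inner, tail.injEq, Fin.ext_iff]
    omega
  | left => exact ⟨left, rfl⟩
  | right => exact ⟨right, rfl⟩
  | neck j =>
    simp only [rank] at h2
    exact ⟨neck ⟨j, by omega⟩, rfl⟩

theorem rank_le_of_le {a b : DoubleTailedDiamond k} (h : a ≤ b) : a.rank ≤ b.rank := by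
  rcases h with rfl | h
  · exact le_rfl
  · exact h.le

end DoubleTailedDiamond

/-- An element in a neck is the top of a `d_k`-interval. -/
theorem InNeck.exists_iso {z : P} (hz : InNeck z) :
    ∃ k, 3 ≤ k ∧ ∃ w, Nonempty (Set.Icc w z ≃o DoubleTailedDiamond k) := by
  obtain ⟨k, hk, w, t, e, i, rfl⟩ := hz
  have hi := i.isLt
  let bot : DoubleTailedDiamond ((i : ℕ) + 3) := .tail ⟨0, by omega⟩
  let topp : DoubleTailedDiamond ((i : ℕ) + 3) := .neck ⟨i, by omega⟩
  have htop : DoubleTailedDiamond.inner i topp = .neck i := rfl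
  have hbot : (DoubleTailedDiamond.inner i bot).rank = k - 3 - i := by
    rw [DoubleTailedDiamond.rank_inner]
    simp [bot, DoubleTailedDiamond.rank]
  let f : DoubleTailedDiamond ((i : ℕ) + 3) → P := fun a =>
    (e.symm (DoubleTailedDiamond.inner i a) : P)
  have hf : ∀ a b, f a ≤ f b ↔ a ≤ b := fun a b => by
    rw [← DoubleTailedDiamond.inner_le_inner i]
    exact (Subtype.coe_le_coe).trans e.symm.le_iff_le
  have hb : ∀ a, bot ≤ a := fun a => by
    rcases Nat.eq_zero_or_pos a.rank with h | h
    · left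
      cases a with
      | tail j =>
        simp only [bot, DoubleTailedDiamond.tail.injEq, Fin.ext_iff]
        simpa [DoubleTailedDiamond.rank] using h.symm
      | left => simp [DoubleTailedDiamond.rank] at h
      | right => simp [DoubleTailedDiamond.rank] at h
      | neck j => simp [DoubleTailedDiamond.rank] at h
    · right
      simpa [bot, DoubleTailedDiamond.rank] using h
  have ht : ∀ a, a ≤ topp := fun a => by
    cases a with
    | tail j =>
      right
      have := j.isLt
      simp only [topp, DoubleTailedDiamond.rank]
      omega
    | left => right; simp only [topp, DoubleTailedDiamond.rank]; omega
    | right => right; simp only [topp, DoubleTailedDiamond.rank]; omega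
    | neck j =>
      have := j.isLt
      rcases Nat.lt_or_ge j i with h | h
      · right
        simp only [topp, DoubleTailedDiamond.rank]
        omega
      · left
        simp only [topp, DoubleTailedDiamond.neck.injEq, Fin.ext_iff]
        omega
  refine ⟨i + 3, by omega, f bot, ⟨OrderIso.symm ?_⟩⟩
  let g : DoubleTailedDiamond ((i : ℕ) + 3) → Set.Icc (f bot) (f topp) := fun a =>
    ⟨f a, (hf _ _).2 (hb a), (hf _ _).2 (ht a)⟩
  have hg : Function.Bijective g := by
    refine ⟨fun a b hab => ?_, fun y => ?_⟩
    · have : f a = f b := congrArg (fun y : Set.Icc (f bot) (f topp) => (y : P)) hab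
      exact le_antisymm ((hf _ _).1 this.le) ((hf _ _).1 this.ge)
    · obtain ⟨y, h1, h2⟩ := y
      have hy : y ∈ Set.Icc w t := ⟨(e.symm _).2.1.trans h1, h2.trans (e.symm _).2.2⟩
      have h1' : DoubleTailedDiamond.inner i bot ≤ e ⟨y, hy⟩ := by
        rw [← e.symm_apply_le]
        exact h1
      have h2' : e ⟨y, hy⟩ ≤ DoubleTailedDiamond.neck i := by
        rw [← e.le_symm_apply]
        exact h2
      obtain ⟨b, hb'⟩ := DoubleTailedDiamond.exists_inner i (e ⟨y, hy⟩)
        (hbot ▸ DoubleTailedDiamond.rank_le_of_le h1') (DoubleTailedDiamond.rank_le_of_le h2')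
      refine ⟨b, Subtype.ext ?_⟩
      change (e.symm (DoubleTailedDiamond.inner i b) : P) = y
      rw [hb', e.symm_apply_apply]
  exact { Equiv.ofBijective g hg with map_rel_iff' := fun {a b} => hf a b }

/-- A finite poset has at most one hook length function. -/
theorem IsHookLength.unique [Finite P] {h h' : P → ℕ} (hh : IsHookLength h)
    (hh' : IsHookLength h') : h = h' := by
  funext z
  induction z using WellFoundedLT.induction with
  | ind z ih =>
    by_cases hz : InNeck z
    · obtain ⟨k, hk, w, ⟨e⟩⟩ := hz.exists_iso
      have key : ∀ a : DoubleTailedDiamond k, a.rank < k - 1 → (e.symm a : P) < z := by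
        intro a ha
        refine lt_of_le_of_ne (e.symm a).2.2 fun hne => ?_
        have h1 : (e.symm (.neck ⟨0, by omega⟩) : P) ≤ e.symm a := by
          rw [hne]
          exact (e.symm _).2.2
        have h2 := DoubleTailedDiamond.rank_le_of_le (e.symm.le_iff_le.1 (Subtype.coe_le_coe.1 h1))
        have h3 : (DoubleTailedDiamond.neck ⟨0, by omega⟩ : DoubleTailedDiamond k).rank = k - 1 :=
          rfl
        omega
      have hl := ih _ (key .left (by simp only [DoubleTailedDiamond.rank]; omega))
      have hr := ih _ (key .right (by simp only [DoubleTailedDiamond.rank]; omega))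
      have hw : w < z := by
        refine lt_of_le_of_lt ?_ (key .left (by simp only [DoubleTailedDiamond.rank]; omega))
        exact (e.symm _).2.1
      have h1 := hh.add_eq k hk w z e
      have h2 := hh'.add_eq k hk w z e
      have h3 := ih w hw
      omega
    · rw [hh.of_not_inNeck z hz, hh'.of_not_inNeck z hz]

variable (P) in
/-- The hook length property: `P` is `d`-complete and its `P`-partition generating function is
`∏_u 1 / (1 - q^{h(u)})`, where `h` is the hook length function of `P`. -/
def HasHookLengthProperty [Fintype P] : Prop :=
  IsDComplete P ∧ ∃ h : P → ℕ, IsHookLength h ∧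
    pPartitionGF P = ∏ u, (1 - (PowerSeries.X : PowerSeries ℚ) ^ h u)⁻¹

end

/-! ### Class 10 -/

/-- The set `X_10` of the triples `(lam, 5, 1)`, `(∅, 2, 1)`, `((1), 2, 2)`, `(∅, 2, 3)`,
`(∅, 3, 4)` and `(∅, 2, 5)`. -/
def taggedSwivelData (lam : Par 5) : List (Attachment 6) :=
  [⟨5, lam, 1, by decide, by decide, by decide⟩,
    ⟨2, ⟨![0, 0], by decide⟩, 1, by decide, by decide, by decide⟩,
    ⟨2, ⟨![1, 0], by decide⟩, 2, by decide, by decide, by decide⟩,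
    ⟨2, ⟨![0, 0], by decide⟩, 3, by decide, by decide, by decide⟩,
    ⟨3, ⟨![0, 0, 0], by decide⟩, 4, by decide, by decide, by decide⟩,
    ⟨2, ⟨![0, 0], by decide⟩, 5, by decide, by decide, by decide⟩]

/-- The poset `P_6^{lam_1 + 4}(X_10)` of class 10 (tagged swivels); `lam_1` is `lam.part 0`. -/
abbrev TaggedSwivel (lam : Par 5) : Type := DiagPoset 6 (lam.part 0 + 4) (taggedSwivelData lam)

/-! The two sides of the identity are computed independently as products of factors `1 - q ^ n` and
then compared. This is done for real `0 < q < 1`; since a convergent power series is determined by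
its values near `0`, the formal identity follows (`pPartitionGF_eq_prod`).

Generating function. A `P`-partition consists of its values `a_0 ≥ ... ≥ a_5` on the chain `x_1 <
... < x_6`, of the values on the top chain, which are bounded by `a_5`, and, once the `a_i` are
fixed, of independent fillings of the six shifted diagrams. Let `μ` be the off-diagonal row lengths
of one diagram and let `B` be its diagonal, made strictly increasing by adding the row index. Its
fillings have the generating function `det (q ^ (μ_j B_r)) / ∏ (q; q)_{μ_r}` (`fillingSum_eq`): the
cells next to the diagonal interlace with `B` and form the diagonal of a smaller diagram, so that by
induction every row of a determinant undergoes one geometric summation. For the five small diagrams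
the determinants are differences of powers or a Vandermonde product. For the large one it is a `5 ×
5` determinant in the variables `z_j = q ^ M_j`, the `M_j` being its off-diagonal row lengths.

There remains a sum over `c < b_5 < b_4 < b_3 < b_2 < b_1`, where `c = a_5` and the `b_i` are
shifted diagonal values. The determinant is expanded along its rows and the variables are summed
from `b_1` to `b_5` (`tsum_stages`). Each sum is geometric. All powers depending on the next
variable collect into a power of the product of the `z_j` involved, and the alternating sum of
rational functions that is left over factors completely. For two, three and four variables this is a
polynomial identity (`residue_three`, `residue_four`). For five it is a residue theorem with nine
poles (`residue_five`), a consequence of Lagrange interpolation. The sum over `c` and the top chain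
is a product of geometric series (`tsum_below_geometric`).

Order and hook lengths. The swivel embeds in `ℤ²` with the reversed product order (`SwivelCoord`),
and its covering relations become finitely many kinds of local steps. Every element with two upper
covers is the bottom of a square, and this forces all lower tail elements of a double-tailed diamond
to have only one upper cover. Hence all `d_k`-intervals can be listed: squares for `k = 3`, four
exceptional intervals, and a family with its tail in the first row and its neck on the top chain.
The list gives `d`-completeness (`SwivelCoord.isDComplete`) and verifies an explicit formula for the
hook lengths (`SwivelCoord.isHookLength`).

Comparison. In each row of the large diagram, the hook lengths from column `5` on, together with the
differences `M_i - M_j` for `j > i`, are exactly `1, ..., M_i + 1`. The hook lengths of the upper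
part of the chain are the reflections of those of the first row. The remaining hook lengths are the
exponents in the denominator of the five-variable sum (`prod_armHook`, `chainFive_pow`), so both
products agree (`TaggedSwivel.prod_hook`). -/

/-! ### Partial fraction and residue identities. -/

/-- A polynomial of degree at most `n` is recovered by Lagrange interpolation at `n + 1` nodes;
comparing coefficients of `t ^ n` gives the identity. This is the residue theorem for a rational
function with simple poles. -/
theorem sum_prod_div_prod_sub {n : ℕ} (a b : Fin n → ℝ) (v : Fin (n + 1) → ℝ)
    (hv : Function.Injective v) :
    ∑ i, (∏ k, (a k + b k * v i)) / ∏ k, (if k = i then 1 else v i - v k) = ∏ k, b k := by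
  have hdeg : ∀ k, (Polynomial.C (a k) + Polynomial.C (b k) * Polynomial.X).natDegree ≤ 1 := by
    intro k
    rw [add_comm]
    exact Polynomial.natDegree_linear_le
  set p : Polynomial ℝ := ∏ k, (Polynomial.C (a k) + Polynomial.C (b k) * Polynomial.X) with hp
  have hpd : p.natDegree ≤ n := by
    refine (Polynomial.natDegree_prod_le _ _).trans ((Finset.sum_le_sum fun k _ => hdeg k).trans ?_)
    simp
  have h1 := Lagrange.coeff_eq_sum (s := Finset.univ) (v := v) (P := p) hv.injOn
    (lt_of_le_of_lt Polynomial.degree_le_natDegree (by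
      rw [Finset.card_univ, Fintype.card_fin]
      exact_mod_cast Nat.lt_succ_of_le hpd))
  have h2 := Polynomial.coeff_prod_of_natDegree_le (s := Finset.univ)
    (fun k => Polynomial.C (a k) + Polynomial.C (b k) * Polynomial.X) 1 (fun k _ => hdeg k)
  rw [← hp] at h2
  simp only [Finset.card_univ, Fintype.card_fin, Nat.add_sub_cancel, mul_one] at h1 h2
  rw [h2] at h1
  simp only [Polynomial.coeff_add, Polynomial.coeff_C_succ, Polynomial.coeff_C_mul,
    Polynomial.coeff_X_one, mul_one, zero_add] at h1
  rw [h1]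
  refine Finset.sum_congr rfl fun i _ => ?_
  congr 1
  · simp [hp, Polynomial.eval_prod]
  · rw [Finset.prod_ite, Finset.prod_const_one, one_mul]
    refine Finset.prod_congr ?_ fun _ _ => rfl
    ext k
    simp

/-- This is the Laplace sum of three variables brought over a common denominator: the term that
leaves out `z_j` receives exactly the factors involving `z_j`, which its own denominator lacks. -/
theorem residue_three (c q z0 z1 z2 : ℝ) :
    (z2 - z1) * (z1 * z2) * ((1 - q * z0) * (1 - q ^ 2 * z0)) *
        ((1 - c * (z0 * z1)) * (1 - c * (z0 * z2)))
      - (z2 - z0) * (z0 * z2) * ((1 - q * z1) * (1 - q ^ 2 * z1)) *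
        ((1 - c * (z0 * z1)) * (1 - c * (z1 * z2)))
      + (z1 - z0) * (z0 * z1) * ((1 - q * z2) * (1 - q ^ 2 * z2)) *
        ((1 - c * (z0 * z2)) * (1 - c * (z1 * z2)))
      = (z1 - z0) * (z2 - z0) * (z2 - z1) *
        ((1 - q * c * (z0 * z1 * z2)) * (1 - q ^ 2 * c * (z0 * z1 * z2))) := by
  ring

/-- The four-variable analogue. The linear coefficient `u` disappears from the result, so of the
quadratic factor only its leading coefficient `v` matters. -/
theorem residue_four (c u v z0 z1 z2 z3 : ℝ) :
    (z2 - z1) * (z3 - z1) * (z3 - z2) * (z1 * z2 * z3) * (1 - u * z0 + v * z0 ^ 2) *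
        ((1 - c * (z0 * z1)) * (1 - c * (z0 * z2)) * (1 - c * (z0 * z3)))
      - (z2 - z0) * (z3 - z0) * (z3 - z2) * (z0 * z2 * z3) * (1 - u * z1 + v * z1 ^ 2) *
        ((1 - c * (z0 * z1)) * (1 - c * (z1 * z2)) * (1 - c * (z1 * z3)))
      + (z1 - z0) * (z3 - z0) * (z3 - z1) * (z0 * z1 * z3) * (1 - u * z2 + v * z2 ^ 2) *
        ((1 - c * (z0 * z2)) * (1 - c * (z1 * z2)) * (1 - c * (z2 * z3)))
      - (z1 - z0) * (z2 - z0) * (z2 - z1) * (z0 * z1 * z2) * (1 - u * z3 + v * z3 ^ 2) *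
        ((1 - c * (z0 * z3)) * (1 - c * (z1 * z3)) * (1 - c * (z2 * z3)))
      = (z1 - z0) * (z2 - z0) * (z3 - z0) * (z2 - z1) * (z3 - z1) * (z3 - z2) *
        ((1 - c ^ 2 * (z0 * z1 * z2 * z3)) * (1 - c * v * (z0 * z1 * z2 * z3))) := by
  ring

/-- The chain of inequalities only serves to make the nodes distinct. The numerator enters through
its values `N`, so that it can be kept in a convenient factored form. -/
theorem sum_nine_nodes (a b : Fin 8 → ℝ) (N : ℝ → ℝ) (hN : ∀ t, ∏ k, (a k + b k * t) = N t)
    {x0 x1 x2 x3 x4 x5 x6 x7 x8 : ℝ} (h0 : x0 < x1) (h1 : x1 < x2) (h2 : x2 < x3) (h3 : x3 < x4)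
    (h4 : x4 < x5) (h5 : x5 < x6) (h6 : x6 < x7) (h7 : x7 < x8) :
    N x0 / ((x0 - x1) * ((x0 - x2) * ((x0 - x3) * ((x0 - x4) * ((x0 - x5) * ((x0 - x6) *
      ((x0 - x7) * (x0 - x8)))))))) +
    (N x1 / ((x1 - x0) * ((x1 - x2) * ((x1 - x3) * ((x1 - x4) * ((x1 - x5) * ((x1 - x6) *
      ((x1 - x7) * (x1 - x8)))))))) +
    (N x2 / ((x2 - x0) * ((x2 - x1) * ((x2 - x3) * ((x2 - x4) * ((x2 - x5) * ((x2 - x6) *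
      ((x2 - x7) * (x2 - x8)))))))) +
    (N x3 / ((x3 - x0) * ((x3 - x1) * ((x3 - x2) * ((x3 - x4) * ((x3 - x5) * ((x3 - x6) *
      ((x3 - x7) * (x3 - x8)))))))) +
    (N x4 / ((x4 - x0) * ((x4 - x1) * ((x4 - x2) * ((x4 - x3) * ((x4 - x5) * ((x4 - x6) *
      ((x4 - x7) * (x4 - x8)))))))) +
    (N x5 / ((x5 - x0) * ((x5 - x1) * ((x5 - x2) * ((x5 - x3) * ((x5 - x4) * ((x5 - x6) *
      ((x5 - x7) * (x5 - x8)))))))) +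
    (N x6 / ((x6 - x0) * ((x6 - x1) * ((x6 - x2) * ((x6 - x3) * ((x6 - x4) * ((x6 - x5) *
      ((x6 - x7) * (x6 - x8)))))))) +
    (N x7 / ((x7 - x0) * ((x7 - x1) * ((x7 - x2) * ((x7 - x3) * ((x7 - x4) * ((x7 - x5) *
      ((x7 - x6) * (x7 - x8)))))))) +
    N x8 / ((x8 - x0) * ((x8 - x1) * ((x8 - x2) * ((x8 - x3) * ((x8 - x4) * ((x8 - x5) *
      ((x8 - x6) * (x8 - x7))))))))))))))) = ∏ k, b k := by
  have key := sum_prod_div_prod_sub a b ![x0, x1, x2, x3, x4, x5, x6, x7, x8] (by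
      apply StrictMono.injective
      rw [Fin.strictMono_iff_lt_succ]
      intro i
      fin_cases i <;> assumption)
  simp only [hN] at key
  rw [← key]
  simp [Fin.sum_univ_succ, Fin.prod_univ_succ]

/-- In the residue sum of `residue_five`, the poles at `0`, `s` and `-s` together account for the
whole leading coefficient. Hence only the poles at `w` and at the `z_j` remain. -/
theorem residue_square_poles {q s w c α γ : ℝ} (hq : 0 < q) (hc : c = q ^ 5) (hqs : c * s ^ 2 = 1)
    (hα : α = 1 + (q + q ^ 2) * (q * w)) (hγ : γ = q ^ 2 * w ^ 2 * (1 + q + q ^ 3 * w))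
    (hs : s ≠ 0) (hw : w ≠ 0) (hsw : s - w ≠ 0) (hsw' : s + w ≠ 0) :
    γ * q ^ 9 / (s ^ 2 * w ^ 2) + (1 - q * s) * (1 - q ^ 2 * s) * (c * s) ^ 5 * (α * s - γ) /
      ((s + s) * (s * (s - w)))
      - (1 + q * s) * (1 + q ^ 2 * s) * (c * s) ^ 5 * (α * s + γ) / ((s + s) * (s * (s + w))) =
      -(q ^ 3 * c ^ 5 * w / q ^ 9 * α) := by
  have hs2 : s ^ 2 - w ^ 2 ≠ 0 := by rw [sq_sub_sq]; exact mul_ne_zero hsw' hsw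
  have es2 : s ^ 2 = 1 / q ^ 5 := by
    rw [eq_div_iff (by positivity), ← hc, mul_comm]; exact hqs
  -- Combining the poles `s` and `-s` makes the odd powers of `s` cancel; only `s ^ 2 = q⁻⁵` is
  -- left, and no square root of `q` survives.
  have h1 : (1 - q * s) * (1 - q ^ 2 * s) * (c * s) ^ 5 * (α * s - γ) /
      ((s + s) * (s * (s - w)))
      - (1 + q * s) * (1 + q ^ 2 * s) * (c * s) ^ 5 * (α * s + γ) / ((s + s) * (s * (s + w))) =
      c ^ 5 * (s ^ 2) ^ 2 * ((1 + q ^ 3 * s ^ 2) * (α * w - γ) - (q + q ^ 2) * (α * s ^ 2 - γ * w))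
        / (s ^ 2 - w ^ 2) := by
    have : s + s ≠ 0 := by simpa using hs
    rw [div_sub_div _ _ (by positivity) (by positivity), div_eq_div_iff (by positivity) hs2]
    ring
  rw [add_sub_assoc, h1]
  rw [es2] at hs2 ⊢
  have h2 : 1 / q ^ 5 - w ^ 2 = (1 - q ^ 5 * w ^ 2) / q ^ 5 := by field_simp
  have h3 : 1 - q ^ 5 * w ^ 2 ≠ 0 := by
    intro h
    rw [h2, h, zero_div] at hs2
    exact hs2 rfl
  rw [h2, hα, hγ, hc]
  field_simp
  ring

/-- The contribution of the node `zj` to the residue sum for five nodes. -/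
noncomputable def residueTerm (q Z zj z1 z2 z3 z4 : ℝ) : ℝ :=
  (1 - q * zj) * (1 - q ^ 2 * zj) * ((1 - q ^ 5 * (zj * z1)) * (1 - q ^ 5 * (zj * z2)) *
    (1 - q ^ 5 * (zj * z3)) * (1 - q ^ 5 * (zj * z4))) *
    ((1 + (q + q ^ 2) * (q ^ 10 * Z)) * zj
      - q ^ 2 * (q ^ 10 * Z) * ((1 + q) + q ^ 2 * (q ^ 10 * Z)) * (q ^ 8 * Z)) /
    (zj * (zj - q ^ 9 * Z) * ((zj - z1) * (zj - z2) * (zj - z3) * (zj - z4)))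

/-- Since `c s² = 1`, the factor `1 - c t²` equals `-c (t + s) (t - s)`. Thus at a node `t = z_j`
the numerator factor that pairs `z_j` with itself removes the nodes `s` and `-s` from the
denominator. -/
theorem residueTerm_eq {q s w N Z t z1 z2 z3 z4 c α β : ℝ} (hc : c = q ^ 5) (hqs : c * s ^ 2 = 1)
    (hw : w = q ^ 9 * Z) (hα : α = 1 + (q + q ^ 2) * (q * w))
    (hβ : β = q ^ 2 * (q * w) * ((1 + q) + q ^ 2 * (q * w)))
    (hN : N = (1 - q * t) * (1 - q ^ 2 * t) * (1 - c * (t * t)) * ((1 - c * (t * z1)) *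
      (1 - c * (t * z2)) * (1 - c * (t * z3)) * (1 - c * (t * z4))) * (α * t - β * (q ^ 8 * Z)))
    (ht : t < s) (ht' : -s < t) :
    N / (((t + s) * (t - s)) * (t * (t - w) * ((t - z1) * (t - z2) * (t - z3) * (t - z4)))) =
      -c * residueTerm q Z t z1 z2 z3 z4 := by
  have h1 : t + s ≠ 0 := by linarith
  have h2 : t - s ≠ 0 := by linarith
  have h3 : 1 - c * (t * t) = -c * ((t + s) * (t - s)) := by linear_combination -hqs
  rw [hN, h3, residueTerm, ← mul_div_assoc, ← hw, ← hc]
  rw [← mul_div_mul_left _ (t * (t - w) * ((t - z1) * (t - z2) * (t - z3) * (t - z4)))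
    (mul_ne_zero h1 h2)]
  congr 1
  rw [hα, hβ, hw]
  ring

/-- With `c = q ^ 5`, `s = c ^ (-1/2)` and `w = q ^ 9 Z`, the polynomial `N` of degree at most eight
is interpolated at the nine nodes `-s < 0 < w < z0 < ... < z4 < s`. The residues at the `z_j` are
`-c` times the terms on the left, the residue at `w` is `c` times the right side, and the other
three cancel against the leading coefficient by `residue_square_poles`. -/
theorem residue_five {q z0 z1 z2 z3 z4 Z : ℝ} (hq0 : 0 < q) (hq1 : q < 1)
    (hZ : Z = z0 * z1 * z2 * z3 * z4)
    (h0 : 0 < z0) (h1 : z0 < z1) (h2 : z1 < z2) (h3 : z2 < z3) (h4 : z3 < z4) (h5 : z4 ≤ 1) :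
    residueTerm q Z z0 z1 z2 z3 z4 + residueTerm q Z z1 z0 z2 z3 z4 +
      residueTerm q Z z2 z0 z1 z3 z4 + residueTerm q Z z3 z0 z1 z2 z4 +
      residueTerm q Z z4 z0 z1 z2 z3 =
    (1 - q ^ 10 * Z) * (1 - q ^ 11 * Z) * ((1 - q ^ 14 * Z * z0) * (1 - q ^ 14 * Z * z1) *
      (1 - q ^ 14 * Z * z2) * (1 - q ^ 14 * Z * z3) * (1 - q ^ 14 * Z * z4)) /
    ((z0 - q ^ 9 * Z) * (z1 - q ^ 9 * Z) * (z2 - q ^ 9 * Z) * (z3 - q ^ 9 * Z) *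
      (z4 - q ^ 9 * Z)) := by
  obtain ⟨s, hs1, hqs⟩ : ∃ s : ℝ, 1 < s ∧ q ^ 5 * s ^ 2 = 1 := by
    refine ⟨(√(q ^ 5))⁻¹, ?_, ?_⟩
    · rw [one_lt_inv₀ (by positivity), Real.sqrt_lt' one_pos]
      simpa using pow_lt_one₀ hq0.le hq1 (by norm_num)
    · rw [inv_pow, Real.sq_sqrt (by positivity)]
      field_simp
  have hz1 : 0 < z1 := h0.trans h1
  have hz2 : 0 < z2 := hz1.trans h2
  have hz3 : 0 < z3 := hz2.trans h3
  have hz4 : 0 < z4 := hz3.trans h4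
  have hZ0 : 0 < Z := by rw [hZ]; positivity
  -- This places the extra pole strictly between `0` and all the `z_j`.
  have hZle : q ^ 9 * Z < z0 := by
    have e1 : z1 * z2 * z3 * z4 ≤ 1 := by
      have : z1 * z2 ≤ 1 := mul_le_one₀ (by linarith) hz2.le (by linarith)
      have : z1 * z2 * z3 ≤ 1 := mul_le_one₀ this hz3.le (by linarith)
      exact mul_le_one₀ this hz4.le h5
    have e2 : Z ≤ z0 := by
      rw [hZ]
      calc z0 * z1 * z2 * z3 * z4 = z0 * (z1 * z2 * z3 * z4) := by ring
        _ ≤ z0 * 1 := by gcongr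
        _ = z0 := mul_one _
    have e3 : q ^ 9 < 1 := pow_lt_one₀ hq0.le hq1 (by norm_num)
    nlinarith
  obtain ⟨w, hw⟩ : ∃ w, w = q ^ 9 * Z := ⟨_, rfl⟩
  rw [← hw] at hZle ⊢
  have hw0 : 0 < w := by rw [hw]; positivity
  obtain ⟨c, hc⟩ : ∃ c, c = q ^ 5 := ⟨_, rfl⟩
  rw [← hc] at hqs
  obtain ⟨α, hα⟩ : ∃ α, α = 1 + (q + q ^ 2) * (q * w) := ⟨_, rfl⟩
  obtain ⟨β, hβ⟩ : ∃ β, β = q ^ 2 * (q * w) * ((1 + q) + q ^ 2 * (q * w)) := ⟨_, rfl⟩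
  obtain ⟨N, hN⟩ : ∃ N : ℝ → ℝ, ∀ t, N t = (1 - q * t) * (1 - q ^ 2 * t) * ((1 - c * (t * z0)) *
    (1 - c * (t * z1)) * (1 - c * (t * z2)) * (1 - c * (t * z3)) * (1 - c * (t * z4))) *
    (α * t - β * (q ^ 8 * Z)) := ⟨_, fun _ => rfl⟩
  have hN' : ∀ t, ∏ k, (![1, 1, 1, 1, 1, 1, 1, -(β * (q ^ 8 * Z))] k +
      ![-q, -q ^ 2, -c * z0, -c * z1, -c * z2, -c * z3, -c * z4, α] k * t) = N t := by
    intro t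
    simp only [Fin.prod_univ_succ, Fin.prod_univ_zero, Matrix.cons_val_zero, Matrix.cons_val_succ,
      hN, mul_one]
    ring
  have key := sum_nine_nodes _ _ N hN' (show -s < 0 by linarith) hw0 hZle h1 h2 h3 h4
    (show z4 < s by linarith)
  have hb : ∏ k, ![-q, -q ^ 2, -c * z0, -c * z1, -c * z2, -c * z3, -c * z4, α] k =
      -(q ^ 3 * c ^ 5 * (z0 * z1 * z2 * z3 * z4) * α) := by
    simp only [Fin.prod_univ_succ, Fin.prod_univ_zero, Matrix.cons_val_zero, Matrix.cons_val_succ]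
    ring
  rw [hb] at key
  have e0 := residueTerm_eq (z1 := z1) (z2 := z2) (z3 := z3) (z4 := z4) (t := z0) (N := N z0)
    hc hqs hw hα hβ (by rw [hN]; ac_rfl) (by linarith) (by linarith)
  have e1 := residueTerm_eq (z1 := z0) (z2 := z2) (z3 := z3) (z4 := z4) (t := z1) (N := N z1)
    hc hqs hw hα hβ (by rw [hN]; ac_rfl) (by linarith) (by linarith)
  have e2 := residueTerm_eq (z1 := z0) (z2 := z1) (z3 := z3) (z4 := z4) (t := z2) (N := N z2)
    hc hqs hw hα hβ (by rw [hN]; ac_rfl) (by linarith) (by linarith)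
  have e3 := residueTerm_eq (z1 := z0) (z2 := z1) (z3 := z2) (z4 := z4) (t := z3) (N := N z3)
    hc hqs hw hα hβ (by rw [hN]; ac_rfl) (by linarith) (by linarith)
  have e4 := residueTerm_eq (z1 := z0) (z2 := z1) (z3 := z2) (z4 := z3) (t := z4) (N := N z4)
    hc hqs hw hα hβ (by rw [hN]; ac_rfl) (by linarith) (by linarith)
  have hγ : β * (q ^ 8 * Z) = q ^ 2 * w ^ 2 * (1 + q + q ^ 3 * w) := by
    rw [hβ, hw]; ring
  have hs0 : s ≠ 0 := by linarith
  have hsw : s - w ≠ 0 := by linarith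
  have hsw' : s + w ≠ 0 := by linarith
  have hs2 : s ^ 2 - w ^ 2 ≠ 0 := by
    rw [sq_sub_sq]; exact mul_ne_zero hsw' hsw
  have hc0 : c ≠ 0 := by rw [hc]; positivity
  -- the pole at `w`
  have ew : N w / ((w + s) * (w - s) * (w * ((w - z0) * (w - z1) * (w - z2) * (w - z3) *
      (w - z4)))) = c * ((1 - q ^ 10 * Z) * (1 - q ^ 11 * Z) * ((1 - q ^ 14 * Z * z0) *
      (1 - q ^ 14 * Z * z1) * (1 - q ^ 14 * Z * z2) * (1 - q ^ 14 * Z * z3) *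
      (1 - q ^ 14 * Z * z4)) /
    ((z0 - w) * (z1 - w) * (z2 - w) * (z3 - w) * (z4 - w))) := by
    have h1 : N w = c * ((1 - q ^ 10 * Z) * (1 - q ^ 11 * Z) * ((1 - q ^ 14 * Z * z0) *
      (1 - q ^ 14 * Z * z1) * (1 - q ^ 14 * Z * z2) * (1 - q ^ 14 * Z * z3) *
      (1 - q ^ 14 * Z * z4))) * (-((w + s) * (w - s) * w)) := by
      -- The linear factor of `N` takes the value `w (1 - c w²)` at `w`, which cancels the nodes
      -- `0`, `s` and `-s` there.
      have h2 : α * w - β * (q ^ 8 * Z) = -c * ((w + s) * (w - s)) * w := by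
        have : -c * ((w + s) * (w - s)) = 1 - c * w ^ 2 := by linear_combination hqs
        rw [this, hα, hβ, hc, hw]; ring
      have h3 : ∀ z, 1 - c * (w * z) = 1 - q ^ 14 * Z * z := fun z => by rw [hc, hw]; ring
      have h4 : 1 - q * w = 1 - q ^ 10 * Z := by rw [hw]; ring
      have h5 : 1 - q ^ 2 * w = 1 - q ^ 11 * Z := by rw [hw]; ring
      rw [hN, h2, h4, h5]
      simp only [h3, neg_mul, mul_neg]
      ac_rfl
    have h2 : (w + s) * (w - s) * (w * ((w - z0) * (w - z1) * (w - z2) * (w - z3) * (w - z4))) =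
        ((z0 - w) * (z1 - w) * (z2 - w) * (z3 - w) * (z4 - w)) *
          (-((w + s) * (w - s) * w)) := by
      have gen : ∀ a0 a1 a2 a3 a4 b d : ℝ, b * d * (w * (-a0 * -a1 * -a2 * -a3 * -a4)) =
          a0 * a1 * a2 * a3 * a4 * (-(b * d * w)) := by intros; ring
      rw [← gen, neg_sub, neg_sub, neg_sub, neg_sub, neg_sub]
    rw [h1, h2, mul_div_mul_right _ _ (neg_ne_zero.2 (mul_ne_zero (mul_ne_zero
      (by rwa [add_comm]) (by rw [← neg_ne_zero, neg_sub]; exact hsw)) hw0.ne')), mul_div_assoc]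
  -- At `s` and at `-s` the factors `1 - c t z_j` are multiples of `t - z_j`, so the nodes `z_j`
  -- drop out of the denominator.
  have hcs : ∀ z, 1 - c * (s * z) = c * s * (s - z) := fun z => by linear_combination -hqs
  have hcs' : ∀ z, 1 - c * (-s * z) = -(c * s) * (-s - z) := fun z => by linear_combination -hqs
  have es : N s / ((s + s) * (s * (s - w)) * ((s - z0) * (s - z1) * (s - z2) * (s - z3) *
      (s - z4))) = (1 - q * s) * (1 - q ^ 2 * s) * (c * s) ^ 5 * (α * s - β * (q ^ 8 * Z)) /
      ((s + s) * (s * (s - w))) := by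
    have : (s - z0) * (s - z1) * (s - z2) * (s - z3) * (s - z4) ≠ 0 := by
      refine mul_ne_zero (mul_ne_zero (mul_ne_zero (mul_ne_zero ?_ ?_) ?_) ?_) ?_ <;> linarith
    rw [← mul_div_mul_right _ ((s + s) * (s * (s - w))) this]
    rw [hN]
    simp only [hcs]
    congr 1
    simp only [pow_succ, pow_zero, one_mul]
    ac_rfl
  have ens : N (-s) / ((s + s) * (s * (s + w)) * ((-s - z0) * (-s - z1) * (-s - z2) *
      (-s - z3) * (-s - z4))) = (1 + q * s) * (1 + q ^ 2 * s) * (c * s) ^ 5 *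
        (α * s + β * (q ^ 8 * Z)) / ((s + s) * (s * (s + w))) := by
    have : (-s - z0) * (-s - z1) * (-s - z2) * (-s - z3) * (-s - z4) ≠ 0 := by
      refine mul_ne_zero (mul_ne_zero (mul_ne_zero (mul_ne_zero ?_ ?_) ?_) ?_) ?_ <;> linarith
    rw [← mul_div_mul_right _ ((s + s) * (s * (s + w))) this]
    have gen : ∀ a0 a1 a2 a3 a4 e f : ℝ, (1 - q * -s) * (1 - q ^ 2 * -s) *
        (-e * a0 * (-e * a1) * (-e * a2) * (-e * a3) * (-e * a4)) * (α * -s - f) =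
        (1 + q * s) * (1 + q ^ 2 * s) * e ^ 5 * (α * s + f) * (a0 * a1 * a2 * a3 * a4) := by
      intros; ring
    rw [hN]
    simp only [hcs']
    rw [gen]
  have k0 : N z0 / ((z0 - -s) * ((z0 - 0) * ((z0 - w) * ((z0 - z1) * ((z0 - z2) * ((z0 - z3) * ((z0 - z4) * (z0 - s)))))))) =
      -c * residueTerm q Z z0 z1 z2 z3 z4 := by
    rw [← e0]
    congr 1
    simp only [sub_neg_eq_add, sub_zero]
    ac_rfl
  have k1 : N z1 / ((z1 - -s) * ((z1 - 0) * ((z1 - w) * ((z1 - z0) * ((z1 - z2) * ((z1 - z3) * ((z1 - z4) * (z1 - s)))))))) =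
      -c * residueTerm q Z z1 z0 z2 z3 z4 := by
    rw [← e1]
    congr 1
    simp only [sub_neg_eq_add, sub_zero]
    ac_rfl
  have k2 : N z2 / ((z2 - -s) * ((z2 - 0) * ((z2 - w) * ((z2 - z0) * ((z2 - z1) * ((z2 - z3) * ((z2 - z4) * (z2 - s)))))))) =
      -c * residueTerm q Z z2 z0 z1 z3 z4 := by
    rw [← e2]
    congr 1
    simp only [sub_neg_eq_add, sub_zero]
    ac_rfl
  have k3 : N z3 / ((z3 - -s) * ((z3 - 0) * ((z3 - w) * ((z3 - z0) * ((z3 - z1) * ((z3 - z2) * ((z3 - z4) * (z3 - s)))))))) =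
      -c * residueTerm q Z z3 z0 z1 z2 z4 := by
    rw [← e3]
    congr 1
    simp only [sub_neg_eq_add, sub_zero]
    ac_rfl
  have k4 : N z4 / ((z4 - -s) * ((z4 - 0) * ((z4 - w) * ((z4 - z0) * ((z4 - z1) * ((z4 - z2) * ((z4 - z3) * (z4 - s)))))))) =
      -c * residueTerm q Z z4 z0 z1 z2 z3 := by
    rw [← e4]
    congr 1
    simp only [sub_neg_eq_add, sub_zero]
    ac_rfl
  have kw : N w / ((w - -s) * ((w - 0) * ((w - z0) * ((w - z1) * ((w - z2) * ((w - z3) * ((w - z4) * (w - s)))))))) = _ := Eq.trans (by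
    congr 1; simp only [sub_neg_eq_add, sub_zero]; ac_rfl) ew
  have ks : N s / ((s - -s) * ((s - 0) * ((s - w) * ((s - z0) * ((s - z1) * ((s - z2) * ((s - z3) * (s - z4)))))))) = _ := Eq.trans (by
    congr 1; simp only [sub_neg_eq_add, sub_zero]; ac_rfl) es
  have hns : -s - s = -(s + s) := by ring
  have hnw : -s - w = -(s + w) := by ring
  have kns : N (-s) / ((-s - 0) * ((-s - w) * ((-s - z0) * ((-s - z1) * ((-s - z2) * ((-s - z3) * ((-s - z4) * (-s - s)))))))) = -_ := Eq.trans (by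
    rw [← div_neg]; congr 1
    simp only [hns, hnw, sub_zero, neg_mul, mul_neg, neg_neg]; ac_rfl) (congrArg Neg.neg ens)
  have k00 : N 0 / ((0 - -s) * ((0 - w) * ((0 - z0) * ((0 - z1) * ((0 - z2) * ((0 - z3) * ((0 - z4) * (0 - s)))))))) = β * (q ^ 8 * Z) * q ^ 9 / (s ^ 2 * w ^ 2) := by
    have h1 : N 0 = -(β * (q ^ 8 * Z)) := by rw [hN]; ring
    have h2 : ((0 - -s) * ((0 - w) * ((0 - z0) * ((0 - z1) * ((0 - z2) * ((0 - z3) * ((0 - z4) * (0 - s)))))))) = -(s ^ 2 * w * Z) := by rw [hZ]; ring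
    have h3 : w * q ^ 9 * Z = w * w := by rw [hw]; ring
    rw [h1, h2, neg_div_neg_eq, div_eq_div_iff (by positivity) (by positivity)]
    linear_combination -(β * (q ^ 8 * Z)) * s ^ 2 * h3
  have hsum := residue_square_poles hq0 hc hqs hα hγ hs0 hw0.ne' hsw hsw'
  have hlead : w / q ^ 9 = z0 * z1 * z2 * z3 * z4 := by
    rw [hw, ← hZ]; field_simp
  rw [kns, k00, kw, k0, k1, k2, k3, k4, ks] at key
  rw [mul_div_assoc (q ^ 3 * c ^ 5), hlead] at hsum
  refine mul_left_cancel₀ hc0 ?_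
  linear_combination hsum - key

/-! ### Geometric sums in one variable, and the closed forms that the successive sums leave. -/

/-- Laplace expansion along a first row `z_j ^ b`, the complementary minors being replaced by the
values of `φ` at the remaining variables. -/
noncomputable def laplaceRow {k : ℕ} (b : ℕ) (φ : (Fin k → ℝ) → ℝ) (z : Fin (k + 1) → ℝ) : ℝ :=
  ∑ j : Fin (k + 1), (-1) ^ (j : ℕ) * z j ^ b * φ fun i => z (j.succAbove i)

theorem hasSum_laplaceRow {k : ℕ} (b : ℕ) {φ : ℕ → (Fin k → ℝ) → ℝ} {ψ : (Fin k → ℝ) → ℝ}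
    {z : Fin (k + 1) → ℝ}
    (h : ∀ j : Fin (k + 1), HasSum (fun n => φ n fun i => z (j.succAbove i))
      (ψ fun i => z (j.succAbove i))) :
    HasSum (fun n => laplaceRow b (φ n) z) (laplaceRow b ψ z) :=
  hasSum_sum fun j _ => (h j).mul_left _

theorem hasSum_pow_succ_add {x : ℝ} (h0 : 0 ≤ x) (h1 : x < 1) (c : ℕ) :
    HasSum (fun n : ℕ => x ^ (c + 1 + n)) (x ^ c * (x / (1 - x))) := by
  have h := (hasSum_geometric_of_lt_one h0 h1).mul_left (x ^ (c + 1))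
  have e : x ^ (c + 1) * (1 - x)⁻¹ = x ^ c * (x / (1 - x)) := by ring
  rw [e] at h
  simpa only [pow_add] using h

/-- A difference of two geometric series with ratios `x` and `p x`, whose simple fractions combine
to a product. -/
theorem hasSum_sub_mul_pow {p x : ℝ} (hp0 : 0 ≤ p) (hp1 : p ≤ 1) (h0 : 0 ≤ x) (h1 : x < 1)
    (c : ℕ) :
    HasSum (fun n : ℕ => (p ^ c - p ^ (c + 1 + n)) * x ^ (c + 1 + n))
      (p ^ c * x ^ c * (x * (1 - p) / ((1 - x) * (1 - p * x)))) := by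
  have hpx : p * x < 1 := lt_of_le_of_lt (mul_le_of_le_one_left h0 hp1) h1
  have h := ((hasSum_pow_succ_add h0 h1 c).mul_left (p ^ c)).sub
    (hasSum_pow_succ_add (mul_nonneg hp0 h0) hpx c)
  have e : p ^ c * (x ^ c * (x / (1 - x))) - (p * x) ^ c * (p * x / (1 - p * x)) =
      p ^ c * x ^ c * (x * (1 - p) / ((1 - x) * (1 - p * x))) := by
    have h2 : 1 - x ≠ 0 := by linarith
    have h3 : 1 - p * x ≠ 0 := by linarith
    have h4 : x * (1 - p) / ((1 - x) * (1 - p * x)) = x / (1 - x) - p * x / (1 - p * x) := by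
      rw [div_sub_div _ _ h2 h3]
      ring
    rw [h4, mul_pow]
    ring
  rw [e] at h
  refine h.congr_fun ?_
  intro n
  rw [mul_pow]
  ring

/-- The factor `y - p ^ n` splits the series into two copies of the previous one, with ratios `x`
and `p x`. The two fractions are not combined, because `y` will be `q ^ c` for a variable `c` that
is independent of the start of the summation. -/
theorem hasSum_sub_mul_sub_mul_pow {p x y : ℝ} (hp0 : 0 ≤ p) (hp1 : p ≤ 1) (h0 : 0 ≤ x)
    (h1 : x < 1) (c : ℕ) :
    HasSum (fun n : ℕ => (p ^ c - p ^ (c + 1 + n)) * (y - p ^ (c + 1 + n)) * x ^ (c + 1 + n))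
      (p ^ c * x ^ c * (x * (1 - p) *
        (y / ((1 - x) * (1 - p * x)) - p * p ^ c / ((1 - p * x) * (1 - p ^ 2 * x))))) := by
  have hpx : p * x < 1 := lt_of_le_of_lt (mul_le_of_le_one_left h0 hp1) h1
  have h := ((hasSum_sub_mul_pow hp0 hp1 h0 h1 c).mul_left y).sub
    (hasSum_sub_mul_pow hp0 hp1 (mul_nonneg hp0 h0) hpx c)
  have e : y * (p ^ c * x ^ c * (x * (1 - p) / ((1 - x) * (1 - p * x)))) -
      p ^ c * (p * x) ^ c * (p * x * (1 - p) / ((1 - p * x) * (1 - p * (p * x)))) =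
      p ^ c * x ^ c * (x * (1 - p) *
        (y / ((1 - x) * (1 - p * x)) - p * p ^ c / ((1 - p * x) * (1 - p ^ 2 * x)))) := by
    rw [mul_pow, ← mul_assoc p p x, ← pow_two]
    ring
  rw [e] at h
  refine h.congr_fun fun n => ?_
  rw [mul_pow]
  ring

/-- The case `y = p ^ c` of the preceding sum, where the two fractions do combine. -/
theorem hasSum_sub_sq_mul_pow {p x : ℝ} (hp0 : 0 ≤ p) (hp1 : p ≤ 1) (h0 : 0 ≤ x)
    (h1 : x < 1) (c : ℕ) :
    HasSum (fun n : ℕ => (p ^ c - p ^ (c + 1 + n)) ^ 2 * x ^ (c + 1 + n))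
      (p ^ (2 * c) * x ^ c * (x * (1 - p) ^ 2 * (1 + p * x) /
        ((1 - x) * (1 - p * x) * (1 - p ^ 2 * x)))) := by
  have hpx : p * x < 1 := lt_of_le_of_lt (mul_le_of_le_one_left h0 hp1) h1
  have hppx : p ^ 2 * x < 1 := lt_of_le_of_lt (mul_le_of_le_one_left h0 (pow_le_one₀ hp0 hp1)) h1
  have h := hasSum_sub_mul_sub_mul_pow (y := p ^ c) hp0 hp1 h0 h1 c
  have e : p ^ c * x ^ c * (x * (1 - p) *
        (p ^ c / ((1 - x) * (1 - p * x)) - p * p ^ c / ((1 - p * x) * (1 - p ^ 2 * x)))) =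
      p ^ (2 * c) * x ^ c * (x * (1 - p) ^ 2 * (1 + p * x) /
        ((1 - x) * (1 - p * x) * (1 - p ^ 2 * x))) := by
    have h2 : 1 - x ≠ 0 := by linarith
    have h3 : 1 - p * x ≠ 0 := by linarith
    have h4 : 1 - p ^ 2 * x ≠ 0 := by linarith
    have h5 : 1 / ((1 - x) * (1 - p * x)) - p / ((1 - p * x) * (1 - p ^ 2 * x)) =
        (1 - p) * (1 + p * x) / ((1 - x) * (1 - p * x) * (1 - p ^ 2 * x)) := by
      rw [div_sub_div _ _ (mul_ne_zero h2 h3) (mul_ne_zero h3 h4), div_eq_div_iff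
        (mul_ne_zero (mul_ne_zero h2 h3) (mul_ne_zero h3 h4)) (mul_ne_zero (mul_ne_zero h2 h3) h4)]
      ring
    have h6 : p ^ c / ((1 - x) * (1 - p * x)) - p * p ^ c / ((1 - p * x) * (1 - p ^ 2 * x)) =
        p ^ c * ((1 - p) * (1 + p * x) / ((1 - x) * (1 - p * x) * (1 - p ^ 2 * x))) := by
      rw [← h5]; ring
    rw [h6]
    ring
  rw [e] at h
  refine h.congr_fun fun n => ?_
  ring

/-- The values allowed for the variables `z_j = q ^ μ_j`. -/
def UnitPos {k : ℕ} (z : Fin k → ℝ) : Prop := ∀ i, 0 < z i ∧ z i ≤ 1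

theorem UnitPos.removeNth {k : ℕ} {z : Fin (k + 1) → ℝ} (hz : UnitPos z) (j : Fin (k + 1)) :
    UnitPos fun i => z (j.succAbove i) := fun _ => hz _

/-- The factor `(1 - q z) (1 - q ^ 2 z)`. -/
noncomputable def hookPair (q z : ℝ) : ℝ := (1 - q * z) * (1 - q ^ 2 * z)

theorem one_sub_pow_mul_pos {q z : ℝ} (hq0 : 0 < q) (hq1 : q < 1) (hz1 : z ≤ 1)
    {n : ℕ} (hn : n ≠ 0) : 0 < 1 - q ^ n * z := by
  have h1 : q ^ n < 1 := pow_lt_one₀ hq0.le hq1 hn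
  have h2 : q ^ n * z ≤ q ^ n * 1 := by gcongr
  linarith

theorem hookPair_pos {q z : ℝ} (hq0 : 0 < q) (hq1 : q < 1) (hz1 : z ≤ 1) :
    0 < hookPair q z := by
  have h1 := one_sub_pow_mul_pos hq0 hq1 hz1 (n := 1) (by norm_num)
  have h2 := one_sub_pow_mul_pos hq0 hq1 hz1 (n := 2) (by norm_num)
  rw [pow_one] at h1
  exact mul_pos h1 h2

/-- The sum over the chain below `x_1 < x_2`. -/
noncomputable def chainOne (q z : ℝ) : ℝ := q * z * (1 - q) / hookPair q z

/-- What remains of the sum over `b_1` after `(q ^ 3 z0 z1) ^ b_2` has been split off. The numerator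
factor `1 - q ^ 3 z0 z1` cancels against the geometric sum over `b_2`, which contributes the new
denominator `1 - q ^ 5 z0 z1`. -/
noncomputable def chainTwo (q z0 z1 : ℝ) : ℝ :=
  q * (1 - q) * (z1 - z0) * (1 - q ^ 3 * (z0 * z1)) / (hookPair q z0 * hookPair q z1)

/-- Both factors involving the product of all three variables cancel in the sum over `b_3`, which
therefore adds no denominator. -/
noncomputable def chainThree (q z0 z1 z2 : ℝ) : ℝ :=
  q ^ 4 * (1 - q) * (1 - q ^ 2) * ((z1 - z0) * (z2 - z0) * (z2 - z1)) *
    ((1 - q ^ 6 * (z0 * z1 * z2)) * (1 - q ^ 7 * (z0 * z1 * z2))) /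
    ((hookPair q z0 * hookPair q z1 * hookPair q z2) *
      ((1 - q ^ 5 * (z0 * z1)) * (1 - q ^ 5 * (z0 * z2)) * (1 - q ^ 5 * (z1 * z2))))

/-- The sum over `b_4` has the denominators `1 - X`, `1 - q X` and `1 - q ^ 2 X` with `X = q ^ 8 z0
z1 z2 z3`. The factors here cancel the first and the last; the middle one survives and is
responsible for the extra pole in `residue_five`. -/
noncomputable def chainFour (q z0 z1 z2 z3 : ℝ) : ℝ :=
  q ^ 10 * (1 - q) ^ 2 * (1 - q ^ 2) *
    ((z1 - z0) * (z2 - z0) * (z3 - z0) * (z2 - z1) * (z3 - z1) * (z3 - z2)) *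
    ((1 - q ^ 8 * (z0 * z1 * z2 * z3)) * (1 - q ^ 10 * (z0 * z1 * z2 * z3))) /
    ((hookPair q z0 * hookPair q z1 * hookPair q z2 * hookPair q z3) *
      ((1 - q ^ 5 * (z0 * z1)) * (1 - q ^ 5 * (z0 * z2)) * (1 - q ^ 5 * (z0 * z3)) *
        (1 - q ^ 5 * (z1 * z2)) * (1 - q ^ 5 * (z1 * z3)) * (1 - q ^ 5 * (z2 * z3))))

theorem chainOne_sub_chainOne {q z0 z1 : ℝ} (hq0 : 0 < q) (hq1 : q < 1) (h0 : 0 < z0 ∧ z0 ≤ 1)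
    (h1 : 0 < z1 ∧ z1 ≤ 1) : chainOne q z1 - chainOne q z0 = chainTwo q z0 z1 := by
  have e0 := (hookPair_pos hq0 hq1 h0.2).ne'
  have e1 := (hookPair_pos hq0 hq1 h1.2).ne'
  rw [chainOne, chainOne, chainTwo, div_sub_div _ _ e1 e0, div_eq_div_iff (mul_ne_zero e1 e0)
    (mul_ne_zero e0 e1)]
  simp only [hookPair]
  ring

/-- After `1 - q ^ 3 x y` is cancelled, the three terms over their common denominator are those of
`residue_three` with `c = q ^ 5`. -/
theorem chainThree_eq {q z0 z1 z2 : ℝ} (hq0 : 0 < q) (hq1 : q < 1) (h0 : 0 < z0 ∧ z0 ≤ 1)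
    (h1 : 0 < z1 ∧ z1 ≤ 1) (h2 : 0 < z2 ∧ z2 ≤ 1) (a : ℝ → ℝ → ℝ) (ha : ∀ x y, a x y = (q ^ 3 * (x * y)) * (1 - q ^ 2) /
      ((1 - q ^ 3 * (x * y)) * (1 - q ^ 2 * (q ^ 3 * (x * y)))) * chainTwo q x y) :
    a z1 z2 - a z0 z2 + a z0 z1 = chainThree q z0 z1 z2 := by
  have hp : ∀ x y : ℝ, (0 < x ∧ x ≤ 1) → (0 < y ∧ y ≤ 1) → 0 < x * y ∧ x * y ≤ 1 :=
    fun x y hx hy => ⟨mul_pos hx.1 hy.1, mul_le_one₀ hx.2 hy.1.le hy.2⟩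
  have e0 := (hookPair_pos hq0 hq1 h0.2).ne'
  have e1 := (hookPair_pos hq0 hq1 h1.2).ne'
  have e2 := (hookPair_pos hq0 hq1 h2.2).ne'
  have d : ∀ x y : ℝ, (0 < x ∧ x ≤ 1) → (0 < y ∧ y ≤ 1) → 1 - q ^ 5 * (x * y) ≠ 0 := fun x y hx hy =>
    (one_sub_pow_mul_pos hq0 hq1 (hp x y hx hy).2 (by norm_num)).ne'
  have ha' : ∀ x y, (0 < x ∧ x ≤ 1) → (0 < y ∧ y ≤ 1) → a x y =
      q ^ 4 * (1 - q) * (1 - q ^ 2) * (y - x) * (x * y) /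
        (hookPair q x * hookPair q y * (1 - q ^ 5 * (x * y))) := by
    intro x y hx hy
    have f1 := (one_sub_pow_mul_pos hq0 hq1 (hp x y hx hy).2 (n := 3)
      (by norm_num)).ne'
    rw [ha, chainTwo, div_mul_div_comm, ← mul_div_mul_right
      (q ^ 4 * (1 - q) * (1 - q ^ 2) * (y - x) * (x * y)) _ f1]
    congr 1 <;> ring
  have hr := residue_three (q ^ 5) q z0 z1 z2
  have d01 := d z0 z1 h0 h1
  have d02 := d z0 z2 h0 h2
  have d12 := d z1 z2 h1 h2
  rw [ha' _ _ h1 h2, ha' _ _ h0 h2, ha' _ _ h0 h1, chainThree]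
  have hh : ∀ x, (1 - q * x) * (1 - q ^ 2 * x) = hookPair q x := fun _ => rfl
  have hz6 : q * q ^ 5 = q ^ 6 := by ring
  have hz7 : q ^ 2 * q ^ 5 = q ^ 7 := by ring
  rw [hh, hh, hh, hz6, hz7] at hr
  -- The identity `hr` carries all the information needed about these factors; from here on they are
  -- independent nonzero letters.
  generalize hookPair q z0 = p0 at *
  generalize hookPair q z1 = p1 at *
  generalize hookPair q z2 = p2 at *
  generalize 1 - q ^ 5 * (z0 * z1) = c01 at *
  generalize 1 - q ^ 5 * (z0 * z2) = c02 at *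
  generalize 1 - q ^ 5 * (z1 * z2) = c12 at *
  rw [mul_assoc _ ((z1 - z0) * (z2 - z0) * (z2 - z1)) (_ * _), ← hr]
  field_simp

/-- This is `residue_four` with `c = q ^ 5` and the quadratic factor `(1 - q z) (1 - q ^ 2 z)`, so
`v = q ^ 3`; the products `c ^ 2` and `c v` are the exponents `10` and `8` of `chainFour`. -/
theorem chainFour_eq {q z0 z1 z2 z3 : ℝ} (hq0 : 0 < q) (hq1 : q < 1) (h0 : 0 < z0 ∧ z0 ≤ 1)
    (h1 : 0 < z1 ∧ z1 ≤ 1) (h2 : 0 < z2 ∧ z2 ≤ 1) (h3 : 0 < z3 ∧ z3 ≤ 1) (a : ℝ → ℝ → ℝ → ℝ)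
    (ha : ∀ x y w, a x y w = (q ^ 6 * (x * y * w)) * (1 - q) /
      ((1 - q ^ 6 * (x * y * w)) * (1 - q * (q ^ 6 * (x * y * w)))) * chainThree q x y w) :
    a z1 z2 z3 - a z0 z2 z3 + a z0 z1 z3 - a z0 z1 z2 = chainFour q z0 z1 z2 z3 := by
  have hp : ∀ x y : ℝ, (0 < x ∧ x ≤ 1) → (0 < y ∧ y ≤ 1) → 0 < x * y ∧ x * y ≤ 1 :=
    fun x y hx hy => ⟨mul_pos hx.1 hy.1, mul_le_one₀ hx.2 hy.1.le hy.2⟩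
  have e0 := (hookPair_pos hq0 hq1 h0.2).ne'
  have e1 := (hookPair_pos hq0 hq1 h1.2).ne'
  have e2 := (hookPair_pos hq0 hq1 h2.2).ne'
  have e3 := (hookPair_pos hq0 hq1 h3.2).ne'
  have d : ∀ x y : ℝ, (0 < x ∧ x ≤ 1) → (0 < y ∧ y ≤ 1) → 1 - q ^ 5 * (x * y) ≠ 0 := fun x y hx hy =>
    (one_sub_pow_mul_pos hq0 hq1 (hp x y hx hy).2 (by norm_num)).ne'
  have ha' : ∀ x y w, (0 < x ∧ x ≤ 1) → (0 < y ∧ y ≤ 1) → (0 < w ∧ w ≤ 1) → a x y w =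
      q ^ 10 * (1 - q) ^ 2 * (1 - q ^ 2) * ((y - x) * (w - x) * (w - y)) * (x * y * w) /
        (hookPair q x * hookPair q y * hookPair q w *
          ((1 - q ^ 5 * (x * y)) * (1 - q ^ 5 * (x * w)) * (1 - q ^ 5 * (y * w)))) := by
    intro x y w hx hy hw
    have hxyw := hp _ _ (hp x y hx hy) hw
    have f1 := (one_sub_pow_mul_pos hq0 hq1 hxyw.2 (n := 6) (by norm_num)).ne'
    have f2 := (one_sub_pow_mul_pos hq0 hq1 hxyw.2 (n := 7) (by norm_num)).ne'
    have f3 : 1 - q * (q ^ 6 * (x * y * w)) = 1 - q ^ 7 * (x * y * w) := by ring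
    rw [ha, chainThree, div_mul_div_comm, f3, ← mul_div_mul_right
      (q ^ 10 * (1 - q) ^ 2 * (1 - q ^ 2) * ((y - x) * (w - x) * (w - y)) * (x * y * w)) _
        (mul_ne_zero f1 f2)]
    congr 1 <;> ring
  have hr := residue_four (q ^ 5) (q + q ^ 2) (q ^ 3) z0 z1 z2 z3
  have d01 := d z0 z1 h0 h1
  have d02 := d z0 z2 h0 h2
  have d03 := d z0 z3 h0 h3
  have d12 := d z1 z2 h1 h2
  have d13 := d z1 z3 h1 h3
  have d23 := d z2 z3 h2 h3
  rw [ha' _ _ _ h1 h2 h3, ha' _ _ _ h0 h2 h3, ha' _ _ _ h0 h1 h3, ha' _ _ _ h0 h1 h2, chainFour]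
  have hh : ∀ x, 1 - (q + q ^ 2) * x + q ^ 3 * x ^ 2 = hookPair q x := fun _ => by
    rw [hookPair]; ring
  have hz6 : (q ^ 5) ^ 2 = q ^ 10 := by ring
  have hz7 : q ^ 5 * q ^ 3 = q ^ 8 := by ring
  rw [hh, hh, hh, hh, hz6, hz7, mul_comm (1 - q ^ 10 * (z0 * z1 * z2 * z3))] at hr
  generalize hookPair q z0 = p0 at *
  generalize hookPair q z1 = p1 at *
  generalize hookPair q z2 = p2 at *
  generalize hookPair q z3 = p3 at *
  generalize 1 - q ^ 5 * (z0 * z1) = c01 at *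
  generalize 1 - q ^ 5 * (z0 * z2) = c02 at *
  generalize 1 - q ^ 5 * (z0 * z3) = c03 at *
  generalize 1 - q ^ 5 * (z1 * z2) = c12 at *
  generalize 1 - q ^ 5 * (z1 * z3) = c13 at *
  generalize 1 - q ^ 5 * (z2 * z3) = c23 at *
  rw [mul_assoc _ ((z1 - z0) * (z2 - z0) * (z3 - z0) * (z2 - z1) * (z3 - z1) * (z3 - z2)) (_ * _),
    ← hr]
  field_simp

/-- The constant of proportionality of the sum over `b_1 > ⋯ > b_5 > b_6`. -/
noncomputable def chainFive (q z0 z1 z2 z3 z4 : ℝ) : ℝ :=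
  let Z := z0 * z1 * z2 * z3 * z4
  q ^ 28 * (1 - q) ^ 5 * (1 - q ^ 2) ^ 2 * Z ^ 2 *
    ((z1 - z0) * (z2 - z0) * (z3 - z0) * (z4 - z0) * (z2 - z1) * (z3 - z1) * (z4 - z1) *
      (z3 - z2) * (z4 - z2) * (z4 - z3)) *
    ((1 - q ^ 14 * Z * z0) * (1 - q ^ 14 * Z * z1) *
      (1 - q ^ 14 * Z * z2) * (1 - q ^ 14 * Z * z3) * (1 - q ^ 14 * Z * z4)) /
    ((hookPair q z0 * hookPair q z1 * hookPair q z2 * hookPair q z3 * hookPair q z4) *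
      ((1 - q ^ 5 * (z0 * z1)) * (1 - q ^ 5 * (z0 * z2)) * (1 - q ^ 5 * (z0 * z3)) *
        (1 - q ^ 5 * (z0 * z4)) * (1 - q ^ 5 * (z1 * z2)) * (1 - q ^ 5 * (z1 * z3)) *
        (1 - q ^ 5 * (z1 * z4)) * (1 - q ^ 5 * (z2 * z3)) * (1 - q ^ 5 * (z2 * z4)) *
        (1 - q ^ 5 * (z3 * z4))) *
      ((1 - q ^ 12 * Z) * (1 - q ^ 13 * Z)) *
      ((z0 - q ^ 9 * Z) * (z1 - q ^ 9 * Z) * (z2 - q ^ 9 * Z) * (z3 - q ^ 9 * Z) *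
        (z4 - q ^ 9 * Z)))

/-- The sum over `b_4` and `b_5` for one term of the Laplace expansion along the row of `b_5`. -/
noncomputable def chainFiveTerm (q W x0 x1 x2 x3 : ℝ) : ℝ :=
  q ^ 8 * (x0 * x1 * x2 * x3) * (1 - q) * chainFour q x0 x1 x2 x3 *
    (W * (1 - q) ^ 2 * (1 + q * W) / ((1 - W) * (1 - q * W) * (1 - q ^ 2 * W)) /
        ((1 - q ^ 8 * (x0 * x1 * x2 * x3)) * (1 - q * (q ^ 8 * (x0 * x1 * x2 * x3)))) -
      q * (q * W * (1 - q) ^ 2 * (1 + q * (q * W)) /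
          ((1 - q * W) * (1 - q * (q * W)) * (1 - q ^ 2 * (q * W)))) /
        ((1 - q * (q ^ 8 * (x0 * x1 * x2 * x3))) * (1 - q ^ 2 * (q ^ 8 * (x0 * x1 * x2 * x3)))))

/-- Writing `Z = t Y`, where `t` is the variable left out and `Y` the product of the others, turns
the uncancelled factor `1 - q ^ 9 Y` into `(t - q ^ 9 Z) / t`. Everything else becomes symmetric in
the five variables except a numerator linear in `t` and the factors of `residueTerm`. -/
theorem chainFiveTerm_eq {q Z t x0 x1 x2 x3 : ℝ} (hq0 : 0 < q) (hq1 : q < 1)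
    (ht : 0 < t ∧ t ≤ 1) (h0 : 0 < x0 ∧ x0 ≤ 1) (h1 : 0 < x1 ∧ x1 ≤ 1) (h2 : 0 < x2 ∧ x2 ≤ 1)
    (h3 : 0 < x3 ∧ x3 ≤ 1) (hZ : Z = t * (x0 * x1 * x2 * x3)) (n0 : t ≠ x0) (n1 : t ≠ x1)
    (n2 : t ≠ x2) (n3 : t ≠ x3) :
    chainFiveTerm q (q ^ 10 * Z) x0 x1 x2 x3 =
      q ^ 28 * (1 - q) ^ 5 * (1 - q ^ 2) ^ 2 * Z ^ 2 /
        ((1 - q ^ 10 * Z) * (1 - q ^ 11 * Z) * ((1 - q ^ 12 * Z) * (1 - q ^ 13 * Z))) *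
      ((x1 - x0) * (x2 - x0) * (x3 - x0) * (x2 - x1) * (x3 - x1) * (x3 - x2) *
        ((t - x0) * (t - x1) * (t - x2) * (t - x3))) /
      ((hookPair q t * hookPair q x0 * hookPair q x1 * hookPair q x2 * hookPair q x3) *
      ((1 - q ^ 5 * (t * x0)) * (1 - q ^ 5 * (t * x1)) * (1 - q ^ 5 * (t * x2)) *
        (1 - q ^ 5 * (t * x3)) * (1 - q ^ 5 * (x0 * x1)) * (1 - q ^ 5 * (x0 * x2)) *
        (1 - q ^ 5 * (x0 * x3)) * (1 - q ^ 5 * (x1 * x2)) * (1 - q ^ 5 * (x1 * x3)) *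
        (1 - q ^ 5 * (x2 * x3)))) * residueTerm q Z t x0 x1 x2 x3 := by
  have hp : ∀ x y : ℝ, (0 < x ∧ x ≤ 1) → (0 < y ∧ y ≤ 1) → 0 < x * y ∧ x * y ≤ 1 :=
    fun x y hx hy => ⟨mul_pos hx.1 hy.1, mul_le_one₀ hx.2 hy.1.le hy.2⟩
  have hY := hp _ _ (hp _ _ (hp _ _ h0 h1) h2) h3
  have hZ1 := hp _ _ ht hY
  rw [← hZ] at hZ1
  have d : ∀ x y : ℝ, (0 < x ∧ x ≤ 1) → (0 < y ∧ y ≤ 1) → 1 - q ^ 5 * (x * y) ≠ 0 := fun x y hx hy =>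
    (one_sub_pow_mul_pos hq0 hq1 (hp x y hx hy).2 (by norm_num)).ne'
  rw [chainFiveTerm, chainFour, residueTerm]
  obtain ⟨Y, hYdef⟩ : ∃ Y, Y = x0 * x1 * x2 * x3 := ⟨_, rfl⟩
  rw [← hYdef] at hY hZ ⊢
  have f8 := (one_sub_pow_mul_pos hq0 hq1 hY.2 (n := 8) (by norm_num)).ne'
  have f9 := (one_sub_pow_mul_pos hq0 hq1 hY.2 (n := 9) (by norm_num)).ne'
  have f10 := (one_sub_pow_mul_pos hq0 hq1 hY.2 (n := 10) (by norm_num)).ne'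
  have w0 := (one_sub_pow_mul_pos hq0 hq1 hZ1.2 (n := 10) (by norm_num)).ne'
  have w1 := (one_sub_pow_mul_pos hq0 hq1 hZ1.2 (n := 11) (by norm_num)).ne'
  have w2 := (one_sub_pow_mul_pos hq0 hq1 hZ1.2 (n := 12) (by norm_num)).ne'
  have w3 := (one_sub_pow_mul_pos hq0 hq1 hZ1.2 (n := 13) (by norm_num)).ne'
  have e0 : t - x0 ≠ 0 := sub_ne_zero.2 n0
  have e1 : t - x1 ≠ 0 := sub_ne_zero.2 n1
  have e2 : t - x2 ≠ 0 := sub_ne_zero.2 n2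
  have e3 : t - x3 ≠ 0 := sub_ne_zero.2 n3
  have t0 := d _ _ ht h0
  have t1 := d _ _ ht h1
  have t2 := d _ _ ht h2
  have t3 := d _ _ ht h3
  have htp : hookPair q t ≠ 0 := (hookPair_pos hq0 hq1 ht.2).ne'
  have hmain : q ^ 8 * Y * (1 - q) * ((1 - q ^ 8 * Y) * (1 - q ^ 10 * Y)) *
      (q ^ 10 * Z * (1 - q) ^ 2 * (1 + q * (q ^ 10 * Z)) /
        ((1 - q ^ 10 * Z) * (1 - q * (q ^ 10 * Z)) * (1 - q ^ 2 * (q ^ 10 * Z))) /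
        ((1 - q ^ 8 * Y) * (1 - q * (q ^ 8 * Y))) -
      q * (q * (q ^ 10 * Z) * (1 - q) ^ 2 * (1 + q * (q * (q ^ 10 * Z))) /
          ((1 - q * (q ^ 10 * Z)) * (1 - q * (q * (q ^ 10 * Z))) *
            (1 - q ^ 2 * (q * (q ^ 10 * Z))))) /
        ((1 - q * (q ^ 8 * Y)) * (1 - q ^ 2 * (q ^ 8 * Y)))) =
      q ^ 18 * (1 - q) ^ 3 * (1 - q ^ 2) * Z ^ 2 /
        ((1 - q ^ 10 * Z) * (1 - q ^ 11 * Z) * ((1 - q ^ 12 * Z) * (1 - q ^ 13 * Z))) *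
      (((1 + (q + q ^ 2) * (q ^ 10 * Z)) * t
      - q ^ 2 * (q ^ 10 * Z) * ((1 + q) + q ^ 2 * (q ^ 10 * Z)) * (q ^ 8 * Z)) /
        (t * (t - q ^ 9 * Z))) := by
    have g1 : 1 - q * (q ^ 10 * Z) = 1 - q ^ 11 * Z := by ring
    have g2 : 1 - q ^ 2 * (q ^ 10 * Z) = 1 - q ^ 12 * Z := by ring
    have g3 : 1 - q * (q * (q ^ 10 * Z)) = 1 - q ^ 12 * Z := by ring
    have g4 : 1 - q ^ 2 * (q * (q ^ 10 * Z)) = 1 - q ^ 13 * Z := by ring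
    have g5 : 1 - q * (q ^ 8 * Y) = 1 - q ^ 9 * Y := by ring
    have g6 : 1 - q ^ 2 * (q ^ 8 * Y) = 1 - q ^ 10 * Y := by ring
    have g7 : t - q ^ 9 * Z = t * (1 - q ^ 9 * Y) := by rw [hZ]; ring
    have htne := ht.1.ne'
    rw [g1, g2, g3, g4, g5, g6, g7]
    -- Every `Y` in the bracket meets a factor `t`, and `t Y = Z`; so the two fractions together
    -- have a numerator linear in `t`.
    have hnum : q ^ 8 * Y * (1 - q) * (q ^ 10 * Z * (1 - q) ^ 2) *
        ((1 + q * (q ^ 10 * Z)) * (1 - q ^ 13 * Z) * (1 - q ^ 10 * Y) -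
          q ^ 2 * (1 + q * (q * (q ^ 10 * Z))) * (1 - q ^ 10 * Z) * (1 - q ^ 8 * Y)) * (t * t) =
        q ^ 18 * (1 - q) ^ 3 * (1 - q ^ 2) * Z ^ 2 *
        ((1 + (q + q ^ 2) * (q ^ 10 * Z)) * t
      - q ^ 2 * (q ^ 10 * Z) * ((1 + q) + q ^ 2 * (q ^ 10 * Z)) * (q ^ 8 * Z)) := by
      rw [hZ]; ring
    generalize 1 - q ^ 10 * Z = a0 at *
    generalize 1 - q ^ 11 * Z = a1 at *
    generalize 1 - q ^ 12 * Z = a2 at *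
    generalize 1 - q ^ 13 * Z = a3 at *
    generalize 1 - q ^ 8 * Y = b8 at *
    generalize 1 - q ^ 9 * Y = b9 at *
    generalize 1 - q ^ 10 * Y = b10 at *
    rw [← mul_div_mul_comm, ← hnum]
    field_simp
  have hpt : (1 - q * t) * (1 - q ^ 2 * t) = hookPair q t := rfl
  rw [hpt]
  generalize (1 + (q + q ^ 2) * (q ^ 10 * Z)) * t
      - q ^ 2 * (q ^ 10 * Z) * ((1 + q) + q ^ 2 * (q ^ 10 * Z)) * (q ^ 8 * Z) = nn at *
  generalize t * (t - q ^ 9 * Z) = dd at *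
  generalize (q ^ 10 * Z * (1 - q) ^ 2 * (1 + q * (q ^ 10 * Z)) /
        ((1 - q ^ 10 * Z) * (1 - q * (q ^ 10 * Z)) * (1 - q ^ 2 * (q ^ 10 * Z))) /
        ((1 - q ^ 8 * Y) * (1 - q * (q ^ 8 * Y))) -
      q * (q * (q ^ 10 * Z) * (1 - q) ^ 2 * (1 + q * (q * (q ^ 10 * Z))) /
          ((1 - q * (q ^ 10 * Z)) * (1 - q * (q * (q ^ 10 * Z))) *
            (1 - q ^ 2 * (q * (q ^ 10 * Z))))) /
        ((1 - q * (q ^ 8 * Y)) * (1 - q ^ 2 * (q ^ 8 * Y)))) = br at *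
  generalize (1 - q ^ 10 * Z) * (1 - q ^ 11 * Z) * ((1 - q ^ 12 * Z) * (1 - q ^ 13 * Z)) = ww at *
  generalize (1 - q ^ 8 * Y) * (1 - q ^ 10 * Y) = ff at *
  generalize t - x0 = u0 at *
  generalize t - x1 = u1 at *
  generalize t - x2 = u2 at *
  generalize t - x3 = u3 at *
  generalize (x1 - x0) * (x2 - x0) * (x3 - x0) * (x2 - x1) * (x3 - x1) * (x3 - x2) = vd at *
  generalize 1 - q ^ 5 * (t * x0) = c0 at *
  generalize 1 - q ^ 5 * (t * x1) = c1 at *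
  generalize 1 - q ^ 5 * (t * x2) = c2 at *
  generalize 1 - q ^ 5 * (t * x3) = c3 at *
  generalize hookPair q t = ht' at *
  have step1 : ∀ D : ℝ, q ^ 8 * Y * (1 - q) * (q ^ 10 * (1 - q) ^ 2 * (1 - q ^ 2) * vd * ff / D) *
      br = q ^ 10 * (1 - q) ^ 2 * (1 - q ^ 2) * vd / D * (q ^ 8 * Y * (1 - q) * ff * br) := by
    intro D; ring
  rw [step1, hmain]
  generalize hookPair q x0 = p0
  generalize hookPair q x1 = p1
  generalize hookPair q x2 = p2
  generalize hookPair q x3 = p3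
  generalize 1 - q ^ 5 * (x0 * x1) = c01
  generalize 1 - q ^ 5 * (x0 * x2) = c02
  generalize 1 - q ^ 5 * (x0 * x3) = c03
  generalize 1 - q ^ 5 * (x1 * x2) = c12
  generalize 1 - q ^ 5 * (x1 * x3) = c13
  generalize 1 - q ^ 5 * (x2 * x3) = c23
  have hcan : c0 * c1 * c2 * c3 * ht' * (u0 * u1 * u2 * u3) ≠ 0 := by
    simp only [ne_eq, mul_eq_zero, not_or]
    exact ⟨⟨⟨⟨⟨t0, t1⟩, t2⟩, t3⟩, htp⟩, ⟨⟨e0, e1⟩, e2⟩, e3⟩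
  rw [div_mul_div_comm, div_mul_div_comm, div_mul_eq_mul_div, div_mul_eq_mul_div _ ww,
    div_mul_div_comm, div_div, ← mul_div_mul_right _ (p0 * p1 * p2 * p3 * _ * _) hcan]
  congr 1 <;> ring

/-- Summing the terms of the last Laplace expansion. -/
theorem sum_chainFiveTerm {q z0 z1 z2 z3 z4 : ℝ} (hq0 : 0 < q) (hq1 : q < 1)
    (h0 : 0 < z0) (h1 : z0 < z1) (h2 : z1 < z2) (h3 : z2 < z3) (h4 : z3 < z4) (h5 : z4 ≤ 1) :
    chainFiveTerm q (q ^ 10 * (z0 * z1 * z2 * z3 * z4)) z1 z2 z3 z4 -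
      chainFiveTerm q (q ^ 10 * (z0 * z1 * z2 * z3 * z4)) z0 z2 z3 z4 +
      chainFiveTerm q (q ^ 10 * (z0 * z1 * z2 * z3 * z4)) z0 z1 z3 z4 -
      chainFiveTerm q (q ^ 10 * (z0 * z1 * z2 * z3 * z4)) z0 z1 z2 z4 +
      chainFiveTerm q (q ^ 10 * (z0 * z1 * z2 * z3 * z4)) z0 z1 z2 z3 =
    chainFive q z0 z1 z2 z3 z4 := by
  have b0 : 0 < z0 ∧ z0 ≤ 1 := ⟨h0, by linarith⟩
  have b1 : 0 < z1 ∧ z1 ≤ 1 := ⟨by linarith, by linarith⟩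
  have b2 : 0 < z2 ∧ z2 ≤ 1 := ⟨by linarith, by linarith⟩
  have b3 : 0 < z3 ∧ z3 ≤ 1 := ⟨by linarith, by linarith⟩
  have b4 : 0 < z4 ∧ z4 ≤ 1 := ⟨by linarith, by linarith⟩
  have hr := residue_five hq0 hq1 rfl h0 h1 h2 h3 h4 h5
  have w0 : 1 - q ^ 10 * (z0 * z1 * z2 * z3 * z4) ≠ 0 := by
    refine (one_sub_pow_mul_pos hq0 hq1 ?_ (by norm_num)).ne'
    exact mul_le_one₀ (mul_le_one₀ (mul_le_one₀ (mul_le_one₀ b0.2 b1.1.le b1.2) b2.1.le b2.2)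
      b3.1.le b3.2) b4.1.le b4.2
  have w1 : 1 - q ^ 11 * (z0 * z1 * z2 * z3 * z4) ≠ 0 := by
    refine (one_sub_pow_mul_pos hq0 hq1 ?_ (by norm_num)).ne'
    exact mul_le_one₀ (mul_le_one₀ (mul_le_one₀ (mul_le_one₀ b0.2 b1.1.le b1.2) b2.1.le b2.2)
      b3.1.le b3.2) b4.1.le b4.2
  rw [chainFiveTerm_eq hq0 hq1 b0 b1 b2 b3 b4 (by ring) (by linarith) (by linarith) (by linarith)
      (by linarith),
    chainFiveTerm_eq hq0 hq1 b1 b0 b2 b3 b4 (by ring) (by linarith) (by linarith) (by linarith)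
      (by linarith),
    chainFiveTerm_eq hq0 hq1 b2 b0 b1 b3 b4 (by ring) (by linarith) (by linarith) (by linarith)
      (by linarith),
    chainFiveTerm_eq hq0 hq1 b3 b0 b1 b2 b4 (by ring) (by linarith) (by linarith) (by linarith)
      (by linarith),
    chainFiveTerm_eq hq0 hq1 b4 b0 b1 b2 b3 (by ring) (by linarith) (by linarith) (by linarith)
      (by linarith), chainFive]
  -- The products `z_i z_j` are put in increasing order so that the five denominators become
  -- literally equal.
  rw [mul_comm z1 z0, mul_comm z2 z0, mul_comm z2 z1, mul_comm z3 z0, mul_comm z3 z1,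
    mul_comm z3 z2, mul_comm z4 z0, mul_comm z4 z1, mul_comm z4 z2, mul_comm z4 z3]
  generalize residueTerm q _ z0 z1 z2 z3 z4 = r0 at *
  generalize residueTerm q _ z1 z0 z2 z3 z4 = r1 at *
  generalize residueTerm q _ z2 z0 z1 z3 z4 = r2 at *
  generalize residueTerm q _ z3 z0 z1 z2 z4 = r3 at *
  generalize residueTerm q _ z4 z0 z1 z2 z3 = r4 at *
  generalize z0 * z1 * z2 * z3 * z4 = Z at *
  generalize (1 - q ^ 14 * Z * z0) * (1 - q ^ 14 * Z * z1) *
      (1 - q ^ 14 * Z * z2) * (1 - q ^ 14 * Z * z3) * (1 - q ^ 14 * Z * z4) = nn at *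
  generalize (z0 - q ^ 9 * Z) * (z1 - q ^ 9 * Z) * (z2 - q ^ 9 * Z) * (z3 - q ^ 9 * Z) *
        (z4 - q ^ 9 * Z) = dd at *
  generalize hookPair q z0 = p0
  generalize hookPair q z1 = p1
  generalize hookPair q z2 = p2
  generalize hookPair q z3 = p3
  generalize hookPair q z4 = p4
  generalize 1 - q ^ 5 * (z0 * z1) = c01
  generalize 1 - q ^ 5 * (z0 * z2) = c02
  generalize 1 - q ^ 5 * (z0 * z3) = c03
  generalize 1 - q ^ 5 * (z0 * z4) = c04
  generalize 1 - q ^ 5 * (z1 * z2) = c12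
  generalize 1 - q ^ 5 * (z1 * z3) = c13
  generalize 1 - q ^ 5 * (z1 * z4) = c14
  generalize 1 - q ^ 5 * (z2 * z3) = c23
  generalize 1 - q ^ 5 * (z2 * z4) = c24
  generalize 1 - q ^ 5 * (z3 * z4) = c34
  generalize (1 - q ^ 12 * Z) * (1 - q ^ 13 * Z) = w23
  -- For `t = z_j` the product of the `t - x_i` has `4 - j` negative factors; their sign is the sign
  -- `(-1) ^ j` of the Laplace expansion, so all five terms end up with the same sign.
  rw [← neg_sub z1 z0, ← neg_sub z2 z0, ← neg_sub z2 z1, ← neg_sub z3 z0, ← neg_sub z3 z1,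
    ← neg_sub z3 z2, ← neg_sub z4 z0, ← neg_sub z4 z1, ← neg_sub z4 z2, ← neg_sub z4 z3]
  generalize z1 - z0 = d01
  generalize z2 - z0 = d02
  generalize z3 - z0 = d03
  generalize z4 - z0 = d04
  generalize z2 - z1 = d12
  generalize z3 - z1 = d13
  generalize z4 - z1 = d14
  generalize z3 - z2 = d23
  generalize z4 - z2 = d24
  generalize z4 - z3 = d34
  generalize q ^ 28 * (1 - q) ^ 5 * (1 - q ^ 2) ^ 2 * Z ^ 2 = κ
  generalize 1 - q ^ 10 * Z = w0' at *
  generalize 1 - q ^ 11 * Z = w1' at *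
  have hfin : κ / (w0' * w1' * w23) * (d01 * d02 * d03 * d04 * d12 * d13 * d14 * d23 * d24 * d34) /
      (p0 * p1 * p2 * p3 * p4 * (c01 * c02 * c03 * c04 * c12 * c13 * c14 * c23 * c24 * c34)) *
      (r0 + r1 + r2 + r3 + r4) = κ * (d01 * d02 * d03 * d04 * d12 * d13 * d14 * d23 * d24 * d34) *
        nn / (p0 * p1 * p2 * p3 * p4 * (c01 * c02 * c03 * c04 * c12 * c13 * c14 * c23 * c24 * c34) *
          w23 * dd) := by
    rw [hr, div_mul_eq_mul_div, div_mul_eq_mul_div κ, div_mul_div_comm, div_div, ← mul_div_mul_right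
      (κ * (d01 * d02 * d03 * d04 * d12 * d13 * d14 * d23 * d24 * d34) * nn) _ (mul_ne_zero w0 w1)]
    congr 1 <;> ring
  rw [← hfin]
  ring

/-! ### Summing out the diagonal values one after the other. -/

theorem HasSum.congr_right {f : ℕ → ℝ} {a b : ℝ} (h : HasSum f a) (hab : a = b) : HasSum f b :=
  hab ▸ h

/-- The summand after the summation over `b_1`. -/
noncomputable def stageOne (q : ℝ) (b : ℕ) (z : Fin 1 → ℝ) : ℝ :=
  q ^ b * (q * z 0) ^ b * chainOne q (z 0)

noncomputable def stageTwo (q : ℝ) (b : ℕ) (z : Fin 2 → ℝ) : ℝ :=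
  (q ^ 2) ^ b * (q ^ 3 * (z 0 * z 1)) ^ b * ((q ^ 3 * (z 0 * z 1)) * (1 - q ^ 2) /
    ((1 - q ^ 3 * (z 0 * z 1)) * (1 - q ^ 2 * (q ^ 3 * (z 0 * z 1)))) * chainTwo q (z 0) (z 1))

noncomputable def stageThree (q : ℝ) (b : ℕ) (z : Fin 3 → ℝ) : ℝ :=
  q ^ b * (q ^ 6 * (z 0 * z 1 * z 2)) ^ b * ((q ^ 6 * (z 0 * z 1 * z 2)) * (1 - q) /
      ((1 - q ^ 6 * (z 0 * z 1 * z 2)) * (1 - q * (q ^ 6 * (z 0 * z 1 * z 2)))) *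
        chainThree q (z 0) (z 1) (z 2))

/-- The parameter `y` will be `q ^ c`. The three-row diagram of the triple `(∅, 3, 4)` couples `b_4`
not only with `b_5` but also with `c`, hence the second factor in the sum over `b_4`. -/
noncomputable def stageFour (q y : ℝ) (b : ℕ) (z : Fin 4 → ℝ) : ℝ :=
  let X := q ^ 8 * (z 0 * z 1 * z 2 * z 3)
  q ^ b * X ^ b * (X * (1 - q) * (y / ((1 - X) * (1 - q * X)) -
    q * q ^ b / ((1 - q * X) * (1 - q ^ 2 * X)))) * chainFour q (z 0) (z 1) (z 2) (z 3)

theorem laplaceRow_two (b : ℕ) (φ : (Fin 1 → ℝ) → ℝ) (z : Fin 2 → ℝ) :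
    laplaceRow b φ z = z 0 ^ b * φ ![z 1] - z 1 ^ b * φ ![z 0] := by
  have h0 : (fun i => z (Fin.succAbove 0 i)) = ![z 1] := by
    funext i; fin_cases i; rfl
  have h1 : (fun i => z (Fin.succAbove 1 i)) = ![z 0] := by
    funext i; fin_cases i; rfl
  rw [laplaceRow, Fin.sum_univ_two, h0, h1]
  norm_num
  ring

theorem laplaceRow_three (b : ℕ) (φ : (Fin 2 → ℝ) → ℝ) (z : Fin 3 → ℝ) :
    laplaceRow b φ z = z 0 ^ b * φ ![z 1, z 2] - z 1 ^ b * φ ![z 0, z 2] + z 2 ^ b * φ ![z 0, z 1] := by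
  have h0 : (fun i => z (Fin.succAbove 0 i)) = ![z 1, z 2] := by
    funext i; fin_cases i <;> rfl
  have h1 : (fun i => z (Fin.succAbove 1 i)) = ![z 0, z 2] := by
    funext i; fin_cases i <;> rfl
  have h2 : (fun i => z (Fin.succAbove 2 i)) = ![z 0, z 1] := by
    funext i; fin_cases i <;> rfl
  rw [laplaceRow, Fin.sum_univ_three, h0, h1, h2]
  norm_num
  ring

theorem laplaceRow_four (b : ℕ) (φ : (Fin 3 → ℝ) → ℝ) (z : Fin 4 → ℝ) :
    laplaceRow b φ z = z 0 ^ b * φ ![z 1, z 2, z 3] - z 1 ^ b * φ ![z 0, z 2, z 3] + z 2 ^ b * φ ![z 0, z 1, z 3] - z 3 ^ b * φ ![z 0, z 1, z 2] := by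
  have h0 : (fun i => z (Fin.succAbove 0 i)) = ![z 1, z 2, z 3] := by
    funext i; fin_cases i <;> rfl
  have h1 : (fun i => z (Fin.succAbove 1 i)) = ![z 0, z 2, z 3] := by
    funext i; fin_cases i <;> rfl
  have h2 : (fun i => z (Fin.succAbove 2 i)) = ![z 0, z 1, z 3] := by
    funext i; fin_cases i <;> rfl
  have h3 : (fun i => z (Fin.succAbove 3 i)) = ![z 0, z 1, z 2] := by
    funext i; fin_cases i <;> rfl
  rw [laplaceRow, Fin.sum_univ_four, h0, h1, h2, h3]
  norm_num
  ring

theorem laplaceRow_five (b : ℕ) (φ : (Fin 4 → ℝ) → ℝ) (z : Fin 5 → ℝ) :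
    laplaceRow b φ z = z 0 ^ b * φ ![z 1, z 2, z 3, z 4] - z 1 ^ b * φ ![z 0, z 2, z 3, z 4] + z 2 ^ b * φ ![z 0, z 1, z 3, z 4] - z 3 ^ b * φ ![z 0, z 1, z 2, z 4] + z 4 ^ b * φ ![z 0, z 1, z 2, z 3] := by
  have h0 : (fun i => z (Fin.succAbove 0 i)) = ![z 1, z 2, z 3, z 4] := by
    funext i; fin_cases i <;> rfl
  have h1 : (fun i => z (Fin.succAbove 1 i)) = ![z 0, z 2, z 3, z 4] := by
    funext i; fin_cases i <;> rfl
  have h2 : (fun i => z (Fin.succAbove 2 i)) = ![z 0, z 1, z 3, z 4] := by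
    funext i; fin_cases i <;> rfl
  have h3 : (fun i => z (Fin.succAbove 3 i)) = ![z 0, z 1, z 2, z 4] := by
    funext i; fin_cases i <;> rfl
  have h4 : (fun i => z (Fin.succAbove 4 i)) = ![z 0, z 1, z 2, z 3] := by
    funext i; fin_cases i <;> rfl
  rw [laplaceRow, Fin.sum_univ_five, h0, h1, h2, h3, h4]
  norm_num
  ring


/-- Whichever variable is removed by the expansion, all powers with exponent `b` multiply to the
same symmetric expression. It factors out, and a signed sum of rational functions remains, which is
evaluated by the identity for `chainTwo`. The next two stages follow the same pattern. -/
theorem laplaceRow_stageOne {q : ℝ} (hq0 : 0 < q) (hq1 : q < 1) {z : Fin 2 → ℝ} (hz : UnitPos z)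
    (b : ℕ) : q ^ b * laplaceRow b (stageOne q b) z =
      (q ^ 3 * (z 0 * z 1)) ^ b * chainTwo q (z 0) (z 1) := by
  rw [← chainOne_sub_chainOne hq0 hq1 (hz 0) (hz 1), laplaceRow_two]
  simp only [stageOne, Matrix.cons_val_zero, mul_pow, ← pow_mul]
  ring

theorem laplaceRow_stageTwo {q : ℝ} (hq0 : 0 < q) (hq1 : q < 1) {z : Fin 3 → ℝ} (hz : UnitPos z)
    (b : ℕ) : q ^ b * laplaceRow b (stageTwo q b) z =
      (q ^ 6 * (z 0 * z 1 * z 2)) ^ b * chainThree q (z 0) (z 1) (z 2) := by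
  rw [← chainThree_eq hq0 hq1 (hz 0) (hz 1) (hz 2) _ fun _ _ => rfl, laplaceRow_three]
  simp only [stageTwo, Matrix.cons_val_zero, Matrix.cons_val_one, mul_pow _ _ b, ← pow_mul _ _ b]
  ring

theorem laplaceRow_stageThree {q : ℝ} (hq0 : 0 < q) (hq1 : q < 1) {z : Fin 4 → ℝ} (hz : UnitPos z)
    (b : ℕ) : q ^ b * laplaceRow b (stageThree q b) z =
      (q ^ 8 * (z 0 * z 1 * z 2 * z 3)) ^ b * chainFour q (z 0) (z 1) (z 2) (z 3) := by
  rw [← chainFour_eq hq0 hq1 (hz 0) (hz 1) (hz 2) (hz 3) _ fun _ _ _ => rfl, laplaceRow_four]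
  simp only [stageThree, Matrix.cons_val_zero, Matrix.cons_val_one, Matrix.cons_val_two,
    Matrix.tail_cons, Matrix.head_cons, mul_pow _ _ b, ← pow_mul _ _ b]
  ring

theorem hasSum_stageOne {q : ℝ} (hq0 : 0 < q) (hq1 : q < 1) {z : Fin 1 → ℝ} (hz : UnitPos z)
    (b : ℕ) : HasSum (fun n : ℕ => (q ^ b - q ^ (b + 1 + n)) * (q ^ (b + 1 + n) *
      laplaceRow (b + 1 + n) (fun _ => 1) z)) (stageOne q b z) := by
  have h := hasSum_sub_mul_pow hq0.le hq1.le (mul_pos hq0 (hz 0).1).le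
    (by nlinarith [(hz 0).1, (hz 0).2] : q * z 0 < 1) b
  have e : stageOne q b z = q ^ b * (q * z 0) ^ b * ((q * z 0) * (1 - q) /
      ((1 - q * z 0) * (1 - q * (q * z 0)))) := by
    rw [stageOne, chainOne, hookPair, ← mul_assoc q q, ← pow_two]
  rw [e]
  refine h.congr_fun fun n => ?_
  rw [laplaceRow, Fin.sum_univ_one, mul_pow]
  simp

theorem UnitPos.mul_apply {k : ℕ} {z : Fin k → ℝ} (hz : UnitPos z) {x : ℝ} (hx : 0 < x ∧ x ≤ 1)
    (i : Fin k) : 0 < x * z i ∧ x * z i ≤ 1 :=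
  ⟨mul_pos hx.1 (hz i).1, mul_le_one₀ hx.2 (hz i).1.le (hz i).2⟩

theorem pow_mul_lt_one {q x : ℝ} (hq0 : 0 < q) (hq1 : q < 1) (hx1 : x ≤ 1) {n : ℕ} (hn : n ≠ 0) :
    q ^ n * x < 1 := by
  linarith [one_sub_pow_mul_pos hq0 hq1 hx1 hn]

/-- The base `q ^ 2` comes from the triple `((1), 2, 2)`, whose diagram has two off-diagonal cells
in its first row. -/
theorem hasSum_stageTwo {q : ℝ} (hq0 : 0 < q) (hq1 : q < 1) {z : Fin 2 → ℝ} (hz : UnitPos z)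
    (b : ℕ) : HasSum (fun n : ℕ => ((q ^ 2) ^ b - (q ^ 2) ^ (b + 1 + n)) * (q ^ (b + 1 + n) *
      laplaceRow (b + 1 + n) (stageOne q (b + 1 + n)) z)) (stageTwo q b z) := by
  have hZ := hz.mul_apply (hz 0) 1
  have h := (hasSum_sub_mul_pow (sq_nonneg q) (pow_le_one₀ hq0.le hq1.le)
    (mul_pos (pow_pos hq0 3) hZ.1).le (pow_mul_lt_one hq0 hq1 hZ.2 (by norm_num)) b).mul_right
      (chainTwo q (z 0) (z 1))
  refine (h.congr_fun fun n => ?_).congr_right (mul_assoc _ _ _)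
  rw [laplaceRow_stageOne hq0 hq1 hz, mul_assoc]

theorem hasSum_stageThree {q : ℝ} (hq0 : 0 < q) (hq1 : q < 1) {z : Fin 3 → ℝ} (hz : UnitPos z)
    (b : ℕ) : HasSum (fun n : ℕ => (q ^ b - q ^ (b + 1 + n)) * (q ^ (b + 1 + n) *
      laplaceRow (b + 1 + n) (stageTwo q (b + 1 + n)) z)) (stageThree q b z) := by
  have hZ := hz.mul_apply (hz.mul_apply (hz 0) 1) 2
  have h := (hasSum_sub_mul_pow hq0.le hq1.le
    (mul_pos (pow_pos hq0 6) hZ.1).le (pow_mul_lt_one hq0 hq1 hZ.2 (by norm_num)) b).mul_right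
      (chainThree q (z 0) (z 1) (z 2))
  refine (h.congr_fun fun n => ?_).congr_right (mul_assoc _ _ _)
  rw [laplaceRow_stageTwo hq0 hq1 hz]
  ring

theorem hasSum_stageFour {q : ℝ} (hq0 : 0 < q) (hq1 : q < 1) {z : Fin 4 → ℝ} (hz : UnitPos z)
    (y : ℝ) (b : ℕ) : HasSum (fun n : ℕ => (q ^ b - q ^ (b + 1 + n)) * (y - q ^ (b + 1 + n)) *
      (q ^ (b + 1 + n) * laplaceRow (b + 1 + n) (stageThree q (b + 1 + n)) z))
      (stageFour q y b z) := by
  have hZ := hz.mul_apply (hz.mul_apply (hz.mul_apply (hz 0) 1) 2) 3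
  have h := (hasSum_sub_mul_sub_mul_pow (y := y) hq0.le hq1.le
    (mul_pos (pow_pos hq0 8) hZ.1).le (pow_mul_lt_one hq0 hq1 hZ.2 (by norm_num)) b).mul_right
      (chainFour q (z 0) (z 1) (z 2) (z 3))
  refine (h.congr_fun fun n => ?_).congr_right (by rw [stageFour])
  rw [laplaceRow_stageThree hq0 hq1 hz]
  ring

/-- The two fractions of `stageFour` depend on the exponent through `W ^ b_5` and `(q W) ^ b_5`, so
two sums of the same type are subtracted. The square is the product of the factors `q ^ c - q ^ b_5`
supplied by `(∅, 3, 4)` and `(∅, 2, 5)`. -/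
theorem hasSum_stageFive_term {q : ℝ} (hq0 : 0 < q) (hq1 : q < 1) {z : Fin 4 → ℝ} (hz : UnitPos z)
    {t : ℝ} (ht : 0 < t ∧ t ≤ 1) (c : ℕ) :
    HasSum (fun n : ℕ => (q ^ c - q ^ (c + 1 + n)) ^ 2 * (q ^ (c + 1 + n) *
      (t ^ (c + 1 + n) * stageFour q (q ^ c) (c + 1 + n) z)))
      ((q ^ c) ^ 3 * (q ^ 10 * (t * (z 0 * z 1 * z 2 * z 3))) ^ c *
        chainFiveTerm q (q ^ 10 * (t * (z 0 * z 1 * z 2 * z 3))) (z 0) (z 1) (z 2) (z 3)) := by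
  have hY := hz.mul_apply (hz.mul_apply (hz.mul_apply (hz 0) 1) 2) 3
  have hZ0 : 0 < t * (z 0 * z 1 * z 2 * z 3) := mul_pos ht.1 hY.1
  have hZ1 : t * (z 0 * z 1 * z 2 * z 3) ≤ 1 := mul_le_one₀ ht.2 hY.1.le hY.2
  obtain ⟨Y, hYd⟩ : ∃ Y, Y = z 0 * z 1 * z 2 * z 3 := ⟨_, rfl⟩
  obtain ⟨W, hW⟩ : ∃ W, W = q ^ 10 * (t * (z 0 * z 1 * z 2 * z 3)) := ⟨_, rfl⟩
  have hW0 : 0 ≤ W := by rw [hW]; positivity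
  have hW1 : W < 1 := hW ▸ pow_mul_lt_one hq0 hq1 hZ1 (by norm_num)
  have hqW : q * W < 1 := lt_of_le_of_lt (mul_le_of_le_one_left hW0 hq1.le) hW1
  obtain ⟨F, hF⟩ : ∃ F, F = chainFour q (z 0) (z 1) (z 2) (z 3) := ⟨_, rfl⟩
  have h1 := (hasSum_sub_sq_mul_pow hq0.le hq1.le hW0 hW1 c).mul_left
    (q ^ c * (q ^ 8 * Y * (1 - q) / ((1 - q ^ 8 * Y) * (1 - q * (q ^ 8 * Y))) * F))
  have h2 := (hasSum_sub_sq_mul_pow hq0.le hq1.le (mul_nonneg hq0.le hW0) hqW c).mul_left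
    (q ^ 8 * Y * (1 - q) * q / ((1 - q * (q ^ 8 * Y)) * (1 - q ^ 2 * (q ^ 8 * Y))) * F)
  have h := h1.sub h2
  rw [← hW]
  refine (h.congr_fun fun n => ?_).congr_right ?_
  · rw [stageFour, ← hYd, ← hF]
    have hWb : W ^ (c + 1 + n) = q ^ (c + 1 + n) * (t ^ (c + 1 + n) *
        (q ^ (c + 1 + n) * (q ^ 8 * Y) ^ (c + 1 + n))) := by
      rw [hW, ← hYd, ← mul_pow, ← mul_pow, ← mul_pow]
      congr 1
      ring
    have hWb' : (q * W) ^ (c + 1 + n) = q ^ (c + 1 + n) * W ^ (c + 1 + n) := mul_pow _ _ _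
    rw [hWb', hWb]
    ring
  · rw [chainFiveTerm, ← hYd, ← hF, mul_pow q W c]
    ring

theorem hasSum_stageFive {q : ℝ} (hq0 : 0 < q) (hq1 : q < 1) {z : Fin 5 → ℝ} (hz : UnitPos z)
    (hmono : StrictMono z) (c : ℕ) :
    HasSum (fun n : ℕ => (q ^ c - q ^ (c + 1 + n)) ^ 2 * (q ^ (c + 1 + n) *
      laplaceRow (c + 1 + n) (stageFour q (q ^ c) (c + 1 + n)) z))
      ((q ^ c) ^ 3 * (q ^ 10 * (z 0 * z 1 * z 2 * z 3 * z 4)) ^ c *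
        chainFive q (z 0) (z 1) (z 2) (z 3) (z 4)) := by
  have hlt : ∀ i j : Fin 5, i < j → z i < z j := fun i j h => hmono h
  have key : ∀ (w : Fin 4 → ℝ) (t : ℝ), UnitPos w → (0 < t ∧ t ≤ 1) →
      t * (w 0 * w 1 * w 2 * w 3) = z 0 * z 1 * z 2 * z 3 * z 4 →
      HasSum (fun n : ℕ => (q ^ c - q ^ (c + 1 + n)) ^ 2 * (q ^ (c + 1 + n) *
      (t ^ (c + 1 + n) * stageFour q (q ^ c) (c + 1 + n) w)))
      ((q ^ c) ^ 3 * (q ^ 10 * (z 0 * z 1 * z 2 * z 3 * z 4)) ^ c *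
        chainFiveTerm q (q ^ 10 * (z 0 * z 1 * z 2 * z 3 * z 4)) (w 0) (w 1) (w 2) (w 3)) := by
    intro w t hw ht he
    have := hasSum_stageFive_term hq0 hq1 hw ht c
    rwa [he] at this
  have hu : ∀ i j k l : Fin 5, UnitPos ![z i, z j, z k, z l] := by
    intro i j k l m
    fin_cases m
    exacts [hz i, hz j, hz k, hz l]
  have k0 := key ![z 1, z 2, z 3, z 4] (z 0) (hu _ _ _ _) (hz 0) (by simp; ring)
  have k1 := key ![z 0, z 2, z 3, z 4] (z 1) (hu _ _ _ _) (hz 1) (by simp; ring)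
  have k2 := key ![z 0, z 1, z 3, z 4] (z 2) (hu _ _ _ _) (hz 2) (by simp; ring)
  have k3 := key ![z 0, z 1, z 2, z 4] (z 3) (hu _ _ _ _) (hz 3) (by simp; ring)
  have k4 := key ![z 0, z 1, z 2, z 3] (z 4) (hu _ _ _ _) (hz 4) (by simp; ring)
  have h := (((k0.sub k1).add k2).sub k3).add k4
  rw [← sum_chainFiveTerm hq0 hq1 (hz 0).1 (hlt 0 1 (by decide)) (hlt 1 2 (by decide))
    (hlt 2 3 (by decide)) (hlt 3 4 (by decide)) (hz 4).2]
  refine (h.congr_fun fun n => ?_).congr_right ?_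
  · rw [laplaceRow_five]
    ring
  · simp only [Matrix.cons_val_zero, Matrix.cons_val_one, Matrix.cons_val_two,
      Matrix.tail_cons, Matrix.head_cons, Matrix.cons_val]
    ring

/-! ### Fillings of a shifted diagram with prescribed diagonal. -/

theorem hasSum_pi_prod {n : ℕ} (g : Fin n → ℕ → ℝ) (a : Fin n → ℝ) (hg0 : ∀ r t, 0 ≤ g r t)
    (hg : ∀ r, HasSum (g r) (a r)) :
    HasSum (fun v : Fin n → ℕ => ∏ r, g r (v r)) (∏ r, a r) := by
  induction n with
  | zero =>
    simp
  | succ n ih =>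
    have h := ih (fun r => g r.succ) (fun r => a r.succ) (fun r => hg0 _) fun r => hg _
    have hn : ∀ v : Fin n → ℕ, 0 ≤ ∏ r : Fin n, g r.succ (v r) :=
      fun v => Finset.prod_nonneg fun r _ => hg0 _ _
    have hs : Summable (fun p : ℕ × (Fin n → ℕ) => g 0 p.1 * ∏ r : Fin n, g r.succ (p.2 r)) :=
      Summable.mul_of_nonneg (f := g 0) (g := fun v : Fin n → ℕ => ∏ r : Fin n, g r.succ (v r))
        (hg 0).summable h.summable (hg0 0) hn
    have h2 : HasSum (fun p : ℕ × (Fin n → ℕ) => g 0 p.1 * ∏ r : Fin n, g r.succ (p.2 r))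
        (a 0 * ∏ r : Fin n, a r.succ) :=
      HasSum.mul (f := g 0) (g := fun v : Fin n → ℕ => ∏ r : Fin n, g r.succ (v r)) (hg 0) h hs
    rw [Fin.prod_univ_succ, ← (Fin.consEquiv fun _ : Fin (n + 1) => ℕ).hasSum_iff]
    refine h2.congr_fun fun v => ?_
    simp [Fin.prod_univ_succ, Fin.consEquiv]

/-- Row `r` involves only the variable `v r`, so by the Leibniz formula the sum over all `v` can be
taken in each row separately. Nonnegativity of the entries makes the products summable. -/
theorem hasSum_pi_det {n : ℕ} (g : Fin n → Fin n → ℕ → ℝ) (a : Fin n → Fin n → ℝ)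
    (hg0 : ∀ r j t, 0 ≤ g r j t) (hg : ∀ r j, HasSum (g r j) (a r j)) :
    HasSum (fun v : Fin n → ℕ => Matrix.det (Matrix.of fun r j => g r j (v r)))
      (Matrix.det (Matrix.of a)) := by
  rw [← Matrix.det_transpose, Matrix.det_apply']
  have h : ∀ v : Fin n → ℕ, Matrix.det (Matrix.of fun r j => g r j (v r)) =
      ∑ σ : Equiv.Perm (Fin n), (Equiv.Perm.sign σ : ℝ) * ∏ r, g r (σ r) (v r) := by
    intro v
    rw [← Matrix.det_transpose, Matrix.det_apply']
    simp
  refine HasSum.congr_fun (hasSum_sum fun σ _ => HasSum.mul_left _ ?_) h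
  simpa using hasSum_pi_prod (fun r => g r (σ r)) (fun r => a r (σ r)) (fun r => hg0 _ _)
    fun r => hg _ _

/-- Row operations do not change a determinant. Reversing the order of the rows turns subtraction of
the following row into addition of the preceding one. -/
theorem det_sub_next {n : ℕ} {A B : Matrix (Fin (n + 1)) (Fin (n + 1)) ℝ}
    (hlast : ∀ j, A (Fin.last n) j = B (Fin.last n) j)
    (h : ∀ (i : Fin n) j, A i.castSucc j = B i.castSucc j - B i.succ j) : A.det = B.det := by
  rw [← Matrix.det_submatrix_equiv_self Fin.revPerm B, ← Matrix.det_submatrix_equiv_self Fin.revPerm A]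
  symm
  refine Matrix.det_eq_of_forall_row_eq_smul_add_pred (fun _ => 1) ?_ ?_
  · intro j
    simp [hlast]
  · intro i j
    simp [Fin.rev_succ, Fin.rev_castSucc, h]


theorem tsum_ofReal_of_hasSum {ι : Type*} {f : ι → ℝ} {a : ℝ} (h0 : ∀ i, 0 ≤ f i)
    (h : HasSum f a) : ∑' i, ENNReal.ofReal (f i) = ENNReal.ofReal a := by
  rw [← ENNReal.ofReal_tsum_of_nonneg h0 h.summable, h.tsum_eq]

theorem hasSum_ite_le {z : ℝ} (h0 : 0 ≤ z) (h1 : z < 1) (c : ℕ) :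
    HasSum (fun t => if c ≤ t then z ^ t else 0) (z ^ c / (1 - z)) := by
  have h := (hasSum_geometric_of_lt_one h0 h1).mul_left (z ^ c)
  rw [← div_eq_mul_inv] at h
  have hinj : Function.Injective fun n : ℕ => c + n := add_right_injective c
  rw [← hinj.hasSum_iff]
  · refine h.congr_fun fun n => ?_
    simp [pow_add]
  · intro t ht
    rw [if_neg]
    intro hct
    exact ht ⟨t - c, by simp only; omega⟩

theorem hasSum_ite_le_lt {z : ℝ} (h0 : 0 ≤ z) (h1 : z < 1) {c d : ℕ} (hcd : c ≤ d) :
    HasSum (fun t => if c ≤ t ∧ t < d then z ^ t else 0) (z ^ c / (1 - z) - z ^ d / (1 - z)) := by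
  refine ((hasSum_ite_le h0 h1 c).sub (hasSum_ite_le h0 h1 d)).congr_fun fun t => ?_
  by_cases h2 : d ≤ t
  · rw [if_neg (by omega), if_pos (by omega), if_pos h2, sub_self]
  · rw [if_neg h2, sub_zero]
    refine if_congr ?_ rfl rfl
    omega

/-- `B` is the diagonal and `f r k` the `k`-th off-diagonal entry of row `r` of a filling of the
shifted diagram with `μ r` off-diagonal cells in row `r`; row `r` is shifted by `r`, so that the
entries increase strictly down the columns. -/
structure IsFilling {n : ℕ} (μ B : Fin n → ℕ) (f : Fin n → ℕ → ℕ) : Prop where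
  zero : ∀ r k, μ r ≤ k → f r k = 0
  diag_le : ∀ r, 0 < μ r → B r ≤ f r 0
  lt_diag : ∀ r r' : Fin n, (r' : ℕ) = r + 1 → 0 < μ r → f r 0 < B r'
  le_succ : ∀ r k, k + 1 < μ r → f r k ≤ f r (k + 1)
  lt_next : ∀ (r r' : Fin n) k, (r' : ℕ) = r + 1 → k + 1 < μ r → k < μ r' → f r (k + 1) < f r' k

/-- The generating function of the fillings with a given diagonal. -/
noncomputable def fillingSum (q : ℝ) {n : ℕ} (μ B : Fin n → ℕ) : ENNReal :=
  ∑' f : {f // IsFilling μ B f}, ENNReal.ofReal q ^ ∑ r, ∑ k ∈ Finset.range (μ r), f.1 r k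

/-- `(1 - q) ⋯ (1 - q ^ m)`. -/
noncomputable def qPoch (q : ℝ) (m : ℕ) : ℝ := ∏ k ∈ Finset.range m, (1 - q ^ (k + 1))

theorem qPoch_pos {q : ℝ} (hq0 : 0 < q) (hq1 : q < 1) (m : ℕ) : 0 < qPoch q m :=
  Finset.prod_pos fun k _ => by
    have : q ^ (k + 1) < 1 := pow_lt_one₀ hq0.le hq1 (by omega)
    linarith

/-- The alternant `det (q ^ (μ_j B_r))`. -/
noncomputable def alternant (q : ℝ) {n : ℕ} (μ B : Fin n → ℕ) : ℝ :=
  Matrix.det (Matrix.of fun r j => (q ^ μ j) ^ B r)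

theorem sigma_subtype_ext {α β : Type*} {S : α → Prop} {T : α → β → Prop}
    {p p' : (v : {v // S v}) × {f // T v.1 f}} (h1 : p.1.1 = p'.1.1) (h2 : p.2.1 = p'.2.1) :
    p = p' := by
  obtain ⟨⟨v, hv⟩, ⟨f, hf⟩⟩ := p
  obtain ⟨⟨v', hv'⟩, ⟨f', hf'⟩⟩ := p'
  dsimp at h1 h2
  subst h1 h2
  rfl

/-- Splitting off the cells next to the diagonal when every row has such a cell. -/
def fillingEquivOfPos {n : ℕ} {μ B : Fin n → ℕ} (hμ : ∀ r, 0 < μ r) :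
    {f // IsFilling μ B f} ≃ (v : {v : Fin n → ℕ // ∀ r, B r ≤ v r ∧
      ∀ r' : Fin n, (r' : ℕ) = r + 1 → v r < B r'}) × {f // IsFilling (fun r => μ r - 1) v.1 f} where
  toFun f := ⟨⟨fun r => f.1 r 0, fun r => ⟨f.2.diag_le r (hμ r),
      fun r' h => f.2.lt_diag r r' h (hμ r)⟩⟩, ⟨fun r k => f.1 r (k + 1),
    { zero := fun r k h => f.2.zero r _ (by omega)
      diag_le := fun r h => f.2.le_succ r 0 (by omega)
      lt_diag := fun r r' h1 h2 => f.2.lt_next r r' 0 h1 (by omega) (hμ r')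
      le_succ := fun r k h => f.2.le_succ r (k + 1) (by omega)
      lt_next := fun r r' k h1 h2 h3 => f.2.lt_next r r' (k + 1) h1 (by omega) (by omega) }⟩⟩
  invFun p := ⟨fun r k => Nat.casesOn k (p.1.1 r) (p.2.1 r),
    { zero := fun r k h => by
        have := hμ r
        cases k with
        | zero => omega
        | succ k => exact p.2.2.zero r k (by omega)
      diag_le := fun r _ => (p.1.2 r).1
      lt_diag := fun r r' h _ => (p.1.2 r).2 r' h
      le_succ := fun r k h => by
        cases k with
        | zero => exact p.2.2.diag_le r (by omega)
        | succ k => exact p.2.2.le_succ r k (by omega)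
      lt_next := fun r r' k h1 h2 h3 => by
        cases k with
        | zero => exact p.2.2.lt_diag r r' h1 (by omega)
        | succ k => exact p.2.2.lt_next r r' k h1 (by omega) (by omega) }⟩
  left_inv f := by
    apply Subtype.ext
    funext r k
    cases k <;> rfl
  right_inv p := rfl

/-- Splitting off the cells next to the diagonal when the last row has no such cell. -/
def fillingEquivOfLast {n : ℕ} {μ B : Fin (n + 1) → ℕ} (hμ : ∀ r : Fin n, 0 < μ r.castSucc)
    (hl : μ (Fin.last n) = 0) :
    {f // IsFilling μ B f} ≃ (v : {v : Fin n → ℕ // ∀ r, B r.castSucc ≤ v r ∧ v r < B r.succ}) ×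
      {f // IsFilling (fun r : Fin n => μ r.castSucc - 1) v.1 f} where
  toFun f := ⟨⟨fun r => f.1 r.castSucc 0, fun r => ⟨f.2.diag_le _ (hμ r),
      f.2.lt_diag _ _ (by simp) (hμ r)⟩⟩, ⟨fun r k => f.1 r.castSucc (k + 1),
    { zero := fun r k h => f.2.zero _ _ (by omega)
      diag_le := fun r h => f.2.le_succ _ 0 (by omega)
      lt_diag := fun r r' h1 h2 => f.2.lt_next r.castSucc r'.castSucc 0 h1 (by omega) (hμ r')
      le_succ := fun r k h => f.2.le_succ _ (k + 1) (by omega)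
      lt_next := fun r r' k h1 h2 h3 => f.2.lt_next r.castSucc r'.castSucc (k + 1) h1 (by omega)
        (by omega) }⟩⟩
  invFun p := ⟨fun r k => Fin.lastCases (motive := fun _ => ℕ) 0
      (fun r => Nat.casesOn k (p.1.1 r) (p.2.1 r)) r,
    { zero := fun r k h => by
        induction r using Fin.lastCases with
        | last => simp
        | cast r =>
          have := hμ r
          simp only [Fin.lastCases_castSucc]
          cases k with
          | zero => omega
          | succ k => exact p.2.2.zero r k (by omega)
      diag_le := fun r h => by
        induction r using Fin.lastCases with
        | last => omega
        | cast r => simpa using (p.1.2 r).1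
      lt_diag := fun r r' h h0 => by
        induction r using Fin.lastCases with
        | last => omega
        | cast r =>
          have : r' = r.succ := Fin.ext (by simpa using h)
          subst this
          simpa using (p.1.2 r).2
      le_succ := fun r k h => by
        induction r using Fin.lastCases with
        | last => omega
        | cast r =>
          simp only [Fin.lastCases_castSucc]
          cases k with
          | zero => exact p.2.2.diag_le r (by omega)
          | succ k => exact p.2.2.le_succ r k (by omega)
      lt_next := fun r r' k h1 h2 h3 => by
        induction r' using Fin.lastCases with
        | last => omega
        | cast r' =>
          induction r using Fin.lastCases with
          | last => omega
          | cast r =>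
            simp only [Fin.lastCases_castSucc]
            cases k with
            | zero => exact p.2.2.lt_diag r r' h1 (by omega)
            | succ k => exact p.2.2.lt_next r r' k h1 (by omega) (by omega) }⟩
  left_inv f := by
    apply Subtype.ext
    funext r k
    induction r using Fin.lastCases with
    | last => simpa using (f.2.zero (Fin.last n) k (by omega)).symm
    | cast r =>
      simp only [Fin.lastCases_castSucc]
      cases k <;> rfl
  right_inv p := by
    apply sigma_subtype_ext
    · funext r
      simp
    · funext r k
      simp

theorem qPoch_pred (q : ℝ) {m : ℕ} (hm : 0 < m) : qPoch q m = qPoch q (m - 1) * (1 - q ^ m) := by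
  obtain ⟨m, rfl⟩ : ∃ k, m = k + 1 := ⟨m - 1, by omega⟩
  rw [qPoch, Finset.prod_range_succ]
  rfl

theorem sum_range_of_pos {μ : ℕ} (hμ : 0 < μ) (f : ℕ → ℕ) :
    ∑ k ∈ Finset.range μ, f k = f 0 + ∑ k ∈ Finset.range (μ - 1), f (k + 1) := by
  obtain ⟨m, rfl⟩ : ∃ k, μ = k + 1 := ⟨μ - 1, by omega⟩
  rw [Finset.sum_range_succ', add_comm]
  rfl

/-- Multiplying row `r` of the alternant of `v` by `q ^ v_r` raises the exponents `μ_j - 1` to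
`μ_j`. The condition on `v` is moved into the entries: a forbidden value makes a whole row vanish.
The summation can then be done row by row inside the determinant. The nonnegativity that comes with
it is needed to pass between real and extended nonnegative sums, and is handed on in the induction.
-/
theorem tsum_mul_fillingSum {q : ℝ} (hq0 : 0 < q) (hq1 : q < 1) {n : ℕ} (μ : Fin n → ℕ)
    (hμ : ∀ r, 0 < μ r) (good : Fin n → ℕ → Prop) [∀ r t, Decidable (good r t)]
    (a : Fin n → Fin n → ℝ)
    (ha : ∀ r j, HasSum (fun t => if good r t then (q ^ μ j) ^ t else 0) (a r j))
    (ih : ∀ v : Fin n → ℕ, (∀ r, good r (v r)) →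
      0 ≤ alternant q (fun r => μ r - 1) v ∧ fillingSum q (fun r => μ r - 1) v =
        ENNReal.ofReal ((∏ r, (qPoch q (μ r - 1))⁻¹) * alternant q (fun r => μ r - 1) v)) :
    0 ≤ (Matrix.of a).det ∧ ∑' v : {v : Fin n → ℕ // ∀ r, good r (v r)},
      ENNReal.ofReal q ^ (∑ r, v.1 r) * fillingSum q (fun r => μ r - 1) v.1 =
        ENNReal.ofReal ((∏ r, (qPoch q (μ r - 1))⁻¹) * (Matrix.of a).det) := by
  classical
  have hdet := hasSum_pi_det (fun r j t => if good r t then (q ^ μ j) ^ t else 0) a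
    (fun r j t => by split_ifs <;> positivity) ha
  have hpos : 0 < ∏ r, (qPoch q (μ r - 1))⁻¹ :=
    Finset.prod_pos fun r _ => inv_pos.2 (qPoch_pos hq0 hq1 _)
  have hgood : ∀ v : Fin n → ℕ, (∀ r, good r (v r)) →
      Matrix.det (Matrix.of fun r j => if good r (v r) then (q ^ μ j) ^ v r else 0) =
        q ^ (∑ r, v r) * alternant q (fun r => μ r - 1) v := by
    intro v hv
    rw [alternant, ← Finset.prod_pow_eq_pow_sum, ← Matrix.det_mul_column]
    congr 1
    ext r j
    obtain ⟨m, hm⟩ : ∃ k, μ j = k + 1 := ⟨μ j - 1, by have := hμ j; omega⟩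
    simp [hv r, hm, pow_succ, mul_pow, mul_comm]
  have hbad : ∀ v : Fin n → ℕ, ¬ (∀ r, good r (v r)) →
      Matrix.det (Matrix.of fun r j => if good r (v r) then (q ^ μ j) ^ v r else 0) = 0 := by
    intro v hv
    push Not at hv
    obtain ⟨r, hr⟩ := hv
    exact Matrix.det_eq_zero_of_row_eq_zero r fun j => by simp [hr]
  have h0 : ∀ v : Fin n → ℕ, 0 ≤
      Matrix.det (Matrix.of fun r j => if good r (v r) then (q ^ μ j) ^ v r else 0) := by
    intro v
    by_cases hv : ∀ r, good r (v r)
    · rw [hgood v hv]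
      exact mul_nonneg (by positivity) (ih v hv).1
    · rw [hbad v hv]
  refine ⟨hdet.nonneg h0, ?_⟩
  rw [← tsum_ofReal_of_hasSum (fun v => mul_nonneg hpos.le (h0 v)) (hdet.mul_left _)]
  rw [← tsum_subtype_eq_of_support_subset (s := {v : Fin n → ℕ | ∀ r, good r (v r)})]
  · refine tsum_congr fun v => ?_
    rw [hgood v.1 v.2, (ih v.1 v.2).2, ← ENNReal.ofReal_pow hq0.le,
      ← ENNReal.ofReal_mul (by positivity)]
    congr 1
    ring
  · intro v hv
    by_contra hv'
    exact hv (by simp only [hbad v hv', mul_zero, ENNReal.ofReal_zero])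

theorem fillingSum_fin_zero (q : ℝ) (μ B : Fin 0 → ℕ) : 0 ≤ alternant q μ B ∧
    fillingSum q μ B = ENNReal.ofReal ((∏ r, (qPoch q (μ r))⁻¹) * alternant q μ B) := by
  have h : IsFilling μ B (fun r => r.elim0) :=
    ⟨fun r => r.elim0, fun r => r.elim0, fun r => r.elim0, fun r => r.elim0, fun r => r.elim0⟩
  have : Unique {f // IsFilling μ B f} :=
    { default := ⟨_, h⟩
      uniq := fun f => Subtype.ext (Subsingleton.elim _ _) }
  constructor
  · simp [alternant]
  · simp [fillingSum, alternant, tsum_fintype]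

/-- The cells next to the diagonal satisfy `B_r ≤ v_r < B_{r+1}`, with no upper bound in the last
row. The geometric sums give differences of consecutive rows of the matrix `F` and its unchanged
last row, so `det_sub_next` leads back to the alternant of `B`, with one new factor `(1 - q ^
μ_j)⁻¹` for each column. -/
theorem fillingSum_eq_of_pos {q : ℝ} (hq0 : 0 < q) (hq1 : q < 1) {n : ℕ} {μ B : Fin (n + 1) → ℕ}
    (hμ : ∀ r, 0 < μ r) (hB : StrictMono B)
    (ih : ∀ v : Fin (n + 1) → ℕ, StrictMono v →
      0 ≤ alternant q (fun r => μ r - 1) v ∧ fillingSum q (fun r => μ r - 1) v =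
        ENNReal.ofReal ((∏ r, (qPoch q (μ r - 1))⁻¹) * alternant q (fun r => μ r - 1) v)) :
    0 ≤ alternant q μ B ∧
      fillingSum q μ B = ENNReal.ofReal ((∏ r, (qPoch q (μ r))⁻¹) * alternant q μ B) := by
  classical
  have hz : ∀ j, 0 < 1 - q ^ μ j := fun j => by
    have := pow_lt_one₀ hq0.le hq1 (hμ j).ne'
    linarith
  let F : Fin (n + 1) → Fin (n + 1) → ℝ := fun r j => (q ^ μ j) ^ B r / (1 - q ^ μ j)
  let a : Fin (n + 1) → Fin (n + 1) → ℝ := fun r j =>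
    Fin.lastCases (motive := fun _ => ℝ) (F (Fin.last n) j)
      (fun r => F r.castSucc j - F r.succ j) r
  have hdet : (Matrix.of a).det = (∏ j, (1 - q ^ μ j)⁻¹) * alternant q μ B := by
    rw [det_sub_next (A := Matrix.of a) (B := Matrix.of F) (fun j => by simp [a])
      (fun i j => by simp [a]), alternant, ← Matrix.det_mul_row]
    congr 1
    ext r j
    simp [F, div_eq_mul_inv, mul_comm]
  obtain ⟨h1, h2⟩ := tsum_mul_fillingSum hq0 hq1 μ hμ
    (fun r t => B r ≤ t ∧ ∀ r' : Fin (n + 1), (r' : ℕ) = r + 1 → t < B r') a (by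
      intro r j
      have hq0' : 0 ≤ q ^ μ j := by positivity
      have hq1' : q ^ μ j < 1 := by linarith [hz j]
      induction r using Fin.lastCases with
      | last =>
        simp only [a, F, Fin.lastCases_last]
        refine (hasSum_ite_le hq0' hq1' _).congr_fun fun t => if_congr ?_ rfl rfl
        refine and_iff_left fun r' h => ?_
        have := r'.isLt
        simp at h
        omega
      | cast r =>
        simp only [a, F, Fin.lastCases_castSucc]
        refine (hasSum_ite_le_lt hq0' hq1' (hB (Fin.castSucc_lt_succ (i := r))).le).congr_fun
          fun t => if_congr (and_congr_right' ⟨fun h => h _ (by simp), fun h r' h' => ?_⟩) rfl rfl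
        have : r' = r.succ := Fin.ext (by simpa using h')
        rwa [this]) (by
      intro v hv
      refine ih v (Fin.strictMono_iff_lt_succ.2 fun i => ?_)
      exact ((hv i.castSucc).2 i.succ (by simp)).trans_le (hv i.succ).1)
  have hpos : 0 < ∏ j, (1 - q ^ μ j)⁻¹ := Finset.prod_pos fun j _ => inv_pos.2 (hz j)
  rw [hdet] at h1 h2
  refine ⟨nonneg_of_mul_nonneg_right h1 hpos, ?_⟩
  have h3 : (∏ r, (qPoch q (μ r))⁻¹) * alternant q μ B =
      (∏ r, (qPoch q (μ r - 1))⁻¹) * ((∏ j, (1 - q ^ μ j)⁻¹) * alternant q μ B) := by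
    rw [← mul_assoc, ← Finset.prod_mul_distrib]
    congr 1
    refine Finset.prod_congr rfl fun r _ => ?_
    rw [qPoch_pred q (hμ r), mul_inv]
  rw [h3, ← h2, fillingSum, ← (fillingEquivOfPos hμ).symm.tsum_eq, ENNReal.tsum_sigma']
  refine tsum_congr fun v => ?_
  rw [fillingSum, ← ENNReal.tsum_mul_left]
  refine tsum_congr fun f => ?_
  rw [← pow_add, ← Finset.sum_add_distrib]
  congr 1
  refine Finset.sum_congr rfl fun r _ => ?_
  rw [sum_range_of_pos (hμ r)]
  rfl

/-- If the last row has no off-diagonal cell, the last column of the alternant consists of ones.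
Subtracting from each row the next one turns that column into `(0, ..., 0, 1)`, and expansion along
it leaves the smaller determinant of differences produced by the interlacing cells. -/
theorem fillingSum_eq_of_last {q : ℝ} (hq0 : 0 < q) (hq1 : q < 1) {n : ℕ}
    {μ B : Fin (n + 1) → ℕ} (hμ : ∀ r : Fin n, 0 < μ r.castSucc) (hl : μ (Fin.last n) = 0)
    (hB : StrictMono B)
    (ih : ∀ v : Fin n → ℕ, StrictMono v →
      0 ≤ alternant q (fun r : Fin n => μ r.castSucc - 1) v ∧
        fillingSum q (fun r : Fin n => μ r.castSucc - 1) v =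
        ENNReal.ofReal ((∏ r : Fin n, (qPoch q (μ r.castSucc - 1))⁻¹) *
          alternant q (fun r : Fin n => μ r.castSucc - 1) v)) :
    0 ≤ alternant q μ B ∧
      fillingSum q μ B = ENNReal.ofReal ((∏ r, (qPoch q (μ r))⁻¹) * alternant q μ B) := by
  classical
  have hz : ∀ j : Fin n, 0 < 1 - q ^ μ j.castSucc := fun j => by
    have := pow_lt_one₀ hq0.le hq1 (hμ j).ne'
    linarith
  let F : Fin (n + 1) → Fin n → ℝ := fun r j =>
    (q ^ μ j.castSucc) ^ B r / (1 - q ^ μ j.castSucc)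
  let a : Fin n → Fin n → ℝ := fun r j => F r.castSucc j - F r.succ j
  let C : Fin (n + 1) → Fin (n + 1) → ℝ := fun r j => (q ^ μ j) ^ B r
  let A : Fin (n + 1) → Fin (n + 1) → ℝ := fun r j =>
    Fin.lastCases (motive := fun _ => ℝ) (C (Fin.last n) j)
      (fun r => C r.castSucc j - C r.succ j) r
  have hdet : (Matrix.of a).det = (∏ j : Fin n, (1 - q ^ μ j.castSucc)⁻¹) * alternant q μ B := by
    have h1 : alternant q μ B = (Matrix.of A).det :=
      (det_sub_next (A := Matrix.of A) (B := Matrix.of C) (fun j => by simp [A])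
        (fun i j => by simp [A])).symm
    rw [h1, Matrix.det_succ_column _ (Fin.last n), Fin.sum_univ_castSucc, Finset.sum_eq_zero,
      zero_add]
    · have h2 : Matrix.of A (Fin.last n) (Fin.last n) = 1 := by simp [A, C, hl]
      rw [h2, ← two_mul, pow_mul, neg_one_sq, one_pow, one_mul, one_mul, ← Matrix.det_mul_row]
      congr 1
      ext r j
      simp only [Matrix.of_apply, Matrix.submatrix_apply, Fin.succAbove_last, a, A, F, C,
        Fin.lastCases_castSucc]
      ring
    · intro i _
      simp [A, C, hl]
  obtain ⟨h1, h2⟩ := tsum_mul_fillingSum hq0 hq1 (fun r : Fin n => μ r.castSucc) hμ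
    (fun r t => B r.castSucc ≤ t ∧ t < B r.succ) a (by
      intro r j
      have hq0' : 0 ≤ q ^ μ j.castSucc := by positivity
      have hq1' : q ^ μ j.castSucc < 1 := by linarith [hz j]
      exact hasSum_ite_le_lt hq0' hq1' (hB (Fin.castSucc_lt_succ (i := r))).le) (by
      intro v hv
      refine ih v ?_
      cases n with
      | zero => exact fun i => i.elim0
      | succ n =>
        refine Fin.strictMono_iff_lt_succ.2 fun i => ?_
        exact (hv i.castSucc).2.trans_le (by simpa using (hv i.succ).1))
  have hpos : 0 < ∏ j : Fin n, (1 - q ^ μ j.castSucc)⁻¹ :=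
    Finset.prod_pos fun j _ => inv_pos.2 (hz j)
  rw [hdet] at h1 h2
  refine ⟨nonneg_of_mul_nonneg_right h1 hpos, ?_⟩
  have h3 : (∏ r, (qPoch q (μ r))⁻¹) * alternant q μ B =
      (∏ r : Fin n, (qPoch q (μ r.castSucc - 1))⁻¹) *
        ((∏ j : Fin n, (1 - q ^ μ j.castSucc)⁻¹) * alternant q μ B) := by
    rw [← mul_assoc, ← Finset.prod_mul_distrib, Fin.prod_univ_castSucc, hl]
    have h4 : (qPoch q 0)⁻¹ = 1 := by simp [qPoch]
    rw [h4, mul_one]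
    congr 1
    refine Finset.prod_congr rfl fun r _ => ?_
    rw [qPoch_pred q (hμ r), mul_inv]
  rw [h3, ← h2, fillingSum, ← (fillingEquivOfLast hμ hl).symm.tsum_eq, ENNReal.tsum_sigma']
  refine tsum_congr fun v => ?_
  rw [fillingSum, ← ENNReal.tsum_mul_left]
  refine tsum_congr fun f => ?_
  rw [← pow_add, ← Finset.sum_add_distrib, Fin.sum_univ_castSucc, hl, Finset.range_zero,
    Finset.sum_empty, add_zero]
  congr 1
  refine Finset.sum_congr rfl fun r _ => ?_
  rw [sum_range_of_pos (hμ r)]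
  simp [fillingEquivOfLast]

/-- Induction on a bound for the row lengths: removing the cells next to the diagonal lowers every
positive length by one and keeps the lengths strictly decreasing. A row of length zero can only be
the last one and is dropped, so the number of rows has to vary in the induction. -/
theorem fillingSum_eq_aux {q : ℝ} (hq0 : 0 < q) (hq1 : q < 1) (N : ℕ) :
    ∀ {n : ℕ} (μ B : Fin n → ℕ), StrictAnti μ → StrictMono B → (∀ r, μ r < N) →
      0 ≤ alternant q μ B ∧
      fillingSum q μ B = ENNReal.ofReal ((∏ r, (qPoch q (μ r))⁻¹) * alternant q μ B) := by
  induction N with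
  | zero =>
    intro n μ B _ _ hN
    cases n with
    | zero => exact fillingSum_fin_zero q μ B
    | succ n => exact absurd (hN 0) (by omega)
  | succ N ih =>
    intro n μ B hμ hB hN
    cases n with
    | zero => exact fillingSum_fin_zero q μ B
    | succ n =>
      have hc : ∀ r : Fin n, 0 < μ r.castSucc := fun r =>
        (Nat.zero_le _).trans_lt (hμ (Fin.castSucc_lt_last r))
      rcases Nat.eq_zero_or_pos (μ (Fin.last n)) with hl | hl
      · refine fillingSum_eq_of_last hq0 hq1 hc hl hB fun v hv => ih _ v ?_ hv fun r => ?_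
        · intro i j hij
          have h1 := hμ (Fin.castSucc_lt_castSucc_iff.2 hij)
          have h2 := hc j
          simp only
          omega
        · have h1 := hN r.castSucc
          have h2 := hc r
          omega
      · have hp : ∀ r, 0 < μ r := Fin.lastCases hl hc
        refine fillingSum_eq_of_pos hq0 hq1 hp hB fun v hv => ih _ v ?_ hv fun r => ?_
        · intro i j hij
          have h1 := hμ hij
          have h2 := hp j
          simp only
          omega
        · have h1 := hN r
          have h2 := hp r
          omega

/-- The generating function of the fillings of a shifted diagram with a given diagonal. -/
theorem fillingSum_eq {q : ℝ} (hq0 : 0 < q) (hq1 : q < 1) {n : ℕ} {μ B : Fin n → ℕ}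
    (hμ : StrictAnti μ) (hB : StrictMono B) : 0 ≤ alternant q μ B ∧
      fillingSum q μ B = ENNReal.ofReal ((∏ r, (qPoch q (μ r))⁻¹) * alternant q μ B) :=
  fillingSum_eq_aux hq0 hq1 (∑ r, μ r + 1) μ B hμ hB fun r =>
    Nat.lt_succ_of_le (Finset.single_le_sum (f := μ) (fun _ _ => Nat.zero_le _)
      (Finset.mem_univ r))

/-! ### Sums over weakly decreasing sequences. -/

theorem ENNReal.tsum_pi_prod {n : ℕ} {S : Fin n → Type} (g : ∀ i, S i → ENNReal) :
    ∑' f : ∀ i, S i, ∏ i, g i (f i) = ∏ i, ∑' s, g i s := by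
  induction n with
  | zero => simp [tsum_fintype]
  | succ n ih =>
    rw [Fin.prod_univ_succ, ← ih fun i => g i.succ, ← (Fin.consEquiv S).tsum_eq,
      ENNReal.tsum_prod', ← ENNReal.tsum_mul_right]
    refine tsum_congr fun s => ?_
    rw [← ENNReal.tsum_mul_left]
    refine tsum_congr fun f => ?_
    simp [Fin.prod_univ_succ, Fin.consEquiv]

/-- Prepending an entry to a weakly decreasing sequence. -/
def antitoneConsEquiv (m : ℕ) : {s : Fin (m + 2) → ℕ // Antitone s} ≃
    {s : Fin (m + 1) → ℕ // Antitone s} × ℕ where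
  toFun s := ⟨⟨fun i => s.1 i.succ, fun i j h => s.2 (Fin.succ_le_succ_iff.2 h)⟩, s.1 0 - s.1 1⟩
  invFun p := ⟨Fin.cons (p.1.1 0 + p.2) p.1.1, by
    rw [Fin.antitone_iff_succ_le]
    intro i
    cases i using Fin.cases with
    | zero => simp
    | succ i =>
      rw [← Fin.succ_castSucc, Fin.cons_succ, Fin.cons_succ]
      exact p.1.2 (Fin.castSucc_lt_succ (i := i)).le⟩
  left_inv s := by
    apply Subtype.ext
    funext i
    cases i using Fin.cases with
    | zero =>
      have h := s.2 (Fin.zero_le (1 : Fin (m + 2)))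
      simp only [Fin.cons_zero, Fin.succ_zero_eq_one]
      omega
    | succ i => simp
  right_inv p := by
    obtain ⟨⟨s, hs⟩, d⟩ := p
    ext
    · simp
    · simp only [Fin.cons_zero, show (1 : Fin (m + 2)) = Fin.succ 0 from rfl, Fin.cons_succ]
      omega

theorem tsum_antitone_succ {m : ℕ} (g : (Fin (m + 2) → ℕ) → ENNReal) :
    ∑' s : {s : Fin (m + 2) → ℕ // Antitone s}, g s.1 =
      ∑' s : {s : Fin (m + 1) → ℕ // Antitone s}, ∑' d : ℕ, g (Fin.cons (s.1 0 + d) s.1) := by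
  rw [← (antitoneConsEquiv m).symm.tsum_eq, ENNReal.tsum_prod']
  rfl

theorem tsum_antitone_one (g : (Fin 1 → ℕ) → ENNReal) :
    ∑' s : {s : Fin 1 → ℕ // Antitone s}, g s.1 = ∑' c : ℕ, g fun _ => c := by
  let e : ℕ ≃ {s : Fin 1 → ℕ // Antitone s} :=
    { toFun := fun c => ⟨fun _ => c, fun _ _ _ => le_rfl⟩
      invFun := fun s => s.1 0
      left_inv := fun c => rfl
      right_inv := fun s => by
        apply Subtype.ext
        funext i
        rw [Subsingleton.elim i 0] }
  rw [← e.tsum_eq]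
  rfl

/-- Consecutive differences are free. Summing over the excess of the first entry gives `(1 - Q ^
E)⁻¹` and leaves weight `E + 1` on the next entry. -/
theorem tsum_antitone_geometric (Q : ENNReal) (m E : ℕ) :
    ∑' s : {s : Fin (m + 1) → ℕ // Antitone s}, Q ^ (E * s.1 0 + ∑ i : Fin m, s.1 i.succ) =
      ∏ i ∈ Finset.range (m + 1), (1 - Q ^ (E + i))⁻¹ := by
  induction m generalizing E with
  | zero =>
    rw [tsum_antitone_one fun s => Q ^ (E * s 0 + ∑ i : Fin 0, s i.succ)]
    simp [pow_mul, ENNReal.tsum_geometric]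
  | succ m ih =>
    rw [tsum_antitone_succ fun s => Q ^ (E * s 0 + ∑ i : Fin (m + 1), s i.succ),
      Finset.prod_range_succ', add_zero, ← ENNReal.tsum_geometric]
    have h := ih (E + 1)
    simp only [add_assoc, add_comm 1] at h ⊢
    rw [← h, ← ENNReal.tsum_mul_right]
    refine tsum_congr fun s => ?_
    rw [← ENNReal.tsum_mul_left]
    refine tsum_congr fun d => ?_
    rw [← pow_mul, ← pow_add, Fin.sum_univ_succ]
    simp only [Fin.cons_zero, Fin.cons_succ]
    ring_nf

/-- Extending a weakly decreasing sequence downwards. -/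
theorem tsum_below_geometric (Q : ENNReal) (m E : ℕ) :
    ∑' c : ℕ, Q ^ (E * c) * ∑' t : {t : Fin m → ℕ // Antitone t ∧ ∀ j, t j ≤ c}, Q ^ ∑ j, t.1 j =
      ∏ i ∈ Finset.range (m + 1), (1 - Q ^ (E + i))⁻¹ := by
  rw [← tsum_antitone_geometric]
  let e : ((c : ℕ) × {t : Fin m → ℕ // Antitone t ∧ ∀ j, t j ≤ c}) ≃
      {s : Fin (m + 1) → ℕ // Antitone s} :=
    { toFun := fun p => ⟨Fin.cons p.1 p.2.1, by
        intro i j hij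
        cases j using Fin.cases with
        | zero => rw [Fin.le_zero_iff.1 hij]
        | succ j =>
          cases i using Fin.cases with
          | zero => simpa using p.2.2.2 j
          | succ i => simpa using p.2.2.1 (Fin.succ_le_succ_iff.1 hij)⟩
      invFun := fun s => ⟨s.1 0, fun j => s.1 j.succ,
        fun i j h => s.2 (Fin.succ_le_succ_iff.2 h), fun j => s.2 (Fin.zero_le _)⟩
      left_inv := fun p => rfl
      right_inv := fun s => by
        apply Subtype.ext
        funext i
        cases i using Fin.cases <;> simp }
  rw [← e.tsum_eq, ENNReal.tsum_sigma']
  refine tsum_congr fun c => ?_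
  rw [← ENNReal.tsum_mul_left]
  refine tsum_congr fun t => ?_
  rw [pow_add]
  rfl

/-! ### Decomposition of a `P`-partition into its diagonal and independent fillings. -/

theorem Par.add_addStaircase {n : ℕ} (lam : Par n) (r : Fin n) :
    (r : ℕ) + lam.addStaircase r = lam.part r + n := by
  have := r.isLt
  unfold Par.addStaircase
  omega

theorem Par.part_antitone {n : ℕ} (lam : Par n) : Antitone lam.part := lam.2

theorem Par.addStaircase_pos {n : ℕ} (lam : Par n) (r : Fin n) : 0 < lam.addStaircase r := by
  have := r.isLt
  unfold Par.addStaircase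
  omega

theorem Par.addStaircase_strictAnti {n : ℕ} (lam : Par n) : StrictAnti lam.addStaircase := by
  intro i j h
  have h1 := lam.add_addStaircase i
  have h2 := lam.add_addStaircase j
  have h3 := lam.part_antitone h.le
  have : (i : ℕ) < j := h
  omega

namespace DiagPoset

variable {n m : ℕ} {X : List (Attachment n)}

theorem le_of_gen {x y : DiagPoset n m X} (h : Gen x y) : x ≤ y := Relation.ReflTransGen.single h

theorem antitone_iff_gen {σ : DiagPoset n m X → ℕ} :
    Antitone σ ↔ ∀ x y, Gen x y → σ y ≤ σ x := by
  refine ⟨fun h x y hxy => h (le_of_gen hxy), fun h x y hxy => ?_⟩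
  have hxy' : Relation.ReflTransGen Gen x y := hxy
  induction hxy' with
  | refl => exact le_rfl
  | tail hxz hzy ih => exact (h _ _ hzy).trans (ih hxz)

/-- The number of off-diagonal cells of row `r` of the `t`-th diagram. -/
def offDiag (X : List (Attachment n)) (t : Fin X.length) (r : Fin (X.get t).len) : ℕ :=
  (X.get t).lam.addStaircase r - 1

/-- The shifted diagonal of the `t`-th diagram. -/
def shiftedDiag (X : List (Attachment n)) (a : Fin n → ℕ) (t : Fin X.length)
    (r : Fin (X.get t).len) : ℕ :=
  a (diagIndex t r) + r

/-- The fillings of the `t`-th diagram with a given diagonal. -/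
abbrev Filling (X : List (Attachment n)) (a : Fin n → ℕ) (t : Fin X.length) : Type :=
  {f : Fin (X.get t).len → ℕ → ℕ // IsFilling (offDiag X t) (shiftedDiag X a t) f}

theorem offDiag_strictAnti (t : Fin X.length) : StrictAnti (offDiag X t) := by
  intro i j h
  have h1 := (X.get t).lam.addStaircase_strictAnti h
  have h2 := (X.get t).lam.addStaircase_pos j
  unfold offDiag
  omega

theorem diagIndex_strictAnti (t : Fin X.length) : StrictAnti (diagIndex t) := by
  intro i j h
  have h1 : (i : ℕ) < j := h
  have := j.isLt
  simp only [diagIndex, Fin.lt_def]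
  omega

theorem shiftedDiag_strictMono {a : Fin n → ℕ} (ha : Antitone a) (t : Fin X.length) :
    StrictMono (shiftedDiag X a t) := by
  intro i j h
  have h1 : (i : ℕ) < j := h
  have h2 := ha (diagIndex_strictAnti t h).le
  unfold shiftedDiag
  omega

/-- The map with given values on the chain, the top chain and the diagrams. -/
def glue (a : Fin n → ℕ) (b : Fin m → ℕ) (f : ∀ t : Fin X.length, Fin (X.get t).len → ℕ → ℕ) :
    DiagPoset n m X → ℕ
  | diag i => a i
  | top j => b j
  | cell t r j => f t r j - r

theorem glue_place (a : Fin n → ℕ) (b : Fin m → ℕ)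
    (f : ∀ t : Fin X.length, Fin (X.get t).len → ℕ → ℕ) (t : Fin X.length)
    (c : ShiftedCell (X.get t).lam) : glue a b f (place t c) =
      if (c.pos : ℕ) = 0 then a (diagIndex t c.row) else f t c.row (c.pos - 1) - c.row := by
  unfold place
  split_ifs <;> rfl

theorem le_filling {a : Fin n → ℕ} {t : Fin X.length} (f : Filling X a t)
    (r : Fin (X.get t).len) (k : ℕ) (hk : k < offDiag X t r) : a (diagIndex t r) + r ≤ f.1 r k := by
  induction k with
  | zero => exact f.2.diag_le r hk
  | succ k ih => exact (ih (by omega)).trans (f.2.le_succ r k hk)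

theorem filling_row_mono {a : Fin n → ℕ} {t : Fin X.length} (f : Filling X a t)
    (r : Fin (X.get t).len) {k l : ℕ} (hkl : k ≤ l) (hl : l < offDiag X t r) :
    f.1 r k ≤ f.1 r l := by
  induction l, hkl using Nat.le_induction with
  | base => exact le_rfl
  | succ l hkl ih => exact (ih (by omega)).trans (f.2.le_succ r l hl)

/-- The local inequalities of a filling imply all the others: a cell is compared with one further
down by descending a row at a time within its column, and then along the final row. The induction is
on the number of rows descended. -/
theorem filling_below {a : Fin n → ℕ} (ha : Antitone a) {t : Fin X.length} (f : Filling X a t)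
    (d : ℕ) : ∀ (r r' : Fin (X.get t).len) (c c' : ℕ), (r' : ℕ) = r + d →
      c < (X.get t).lam.addStaircase r → c' < (X.get t).lam.addStaircase r' →
      (r : ℕ) + c ≤ r' + c' →
      (if c = 0 then a (diagIndex t r) else f.1 r (c - 1) - r) ≤
        if c' = 0 then a (diagIndex t r') else f.1 r' (c' - 1) - r' := by
  induction d with
  | zero =>
    intro r r' c c' hr hc hc' hle
    obtain rfl : r' = r := Fin.ext hr
    by_cases h' : c' = 0
    · rw [if_pos (by omega), if_pos h']
    · rw [if_neg h']
      by_cases h : c = 0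
      · rw [if_pos h]
        have := le_filling f r' (c' - 1) (by unfold offDiag; omega)
        omega
      · rw [if_neg h]
        have := filling_row_mono f r' (k := c - 1) (l := c' - 1) (by omega)
          (by unfold offDiag; omega)
        omega
  | succ d ih =>
    intro r r' c c' hr hc hc' hle
    have hr' := r'.isLt
    let s : Fin (X.get t).len := ⟨r + 1, by omega⟩
    have hs : (s : ℕ) = r + 1 := rfl
    have h1 := (X.get t).lam.add_addStaircase s
    have h2 := (X.get t).lam.add_addStaircase r'
    have h3 := (X.get t).lam.part_antitone (show s ≤ r' from by rw [Fin.le_def]; omega)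
    -- The intermediate cell is the one directly below. For `c = 0` the truncated subtraction makes
    -- it the next diagonal cell instead, and the comparison is that of `a` at two diagonal entries.
    refine le_trans ?_ (ih s r' (c - 1) c' (by omega) (by omega) hc' (by omega))
    have hrs : a (diagIndex t r) ≤ a (diagIndex t s) :=
      ha (diagIndex_strictAnti t (show r < s from by rw [Fin.lt_def]; omega)).le
    by_cases h : c = 0
    · rwa [if_pos h, if_pos (by omega)]
    · rw [if_neg h]
      by_cases h' : c - 1 = 0
      · rw [if_pos h', h']
        have := f.2.lt_diag r s hs (by unfold offDiag; omega)
        unfold shiftedDiag at this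
        omega
      · rw [if_neg h']
        have := f.2.lt_next r s (c - 1 - 1) hs (by unfold offDiag; omega)
          (by unfold offDiag; omega)
        rw [show c - 1 - 1 + 1 = c - 1 by omega] at this
        omega

theorem antitone_glue {a : Fin n → ℕ} (ha : Antitone a) {b : Fin m → ℕ} (hb : Antitone b)
    (hba : ∀ i j, b j ≤ a i) (f : ∀ t : Fin X.length, Filling X a t) :
    Antitone (glue a b fun t => (f t).1) := by
  rw [antitone_iff_gen]
  intro x y h
  cases h with
  | diag h => exact ha h
  | attach i j => exact hba i j
  | top h => exact hb h
  | @cell t c d h =>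
    rw [glue_place, glue_place]
    obtain ⟨h1, h2⟩ := h
    exact filling_below ha (f t) (c.row - d.row) d.row c.row d.pos c.pos
      (by have : (d.row : ℕ) ≤ c.row := h1; omega) d.pos.isLt c.pos.isLt h2

theorem isFilling_of_antitone {σ : DiagPoset n m X → ℕ} (hσ : Antitone σ) (t : Fin X.length) :
    IsFilling (offDiag X t) (shiftedDiag X (fun i => σ (diag i)) t)
      fun r k => if h : k < offDiag X t r then σ (cell t r ⟨k, h⟩) + r else 0 := by
  have key : ∀ c d : ShiftedCell (X.get t).lam, c.Below d → σ (place t d) ≤ σ (place t c) :=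
    fun c d h => hσ (le_of_gen (Gen.cell t h))
  have hcell : ∀ (r : Fin (X.get t).len) (k : ℕ) (h : k < offDiag X t r),
      ∃ c : ShiftedCell (X.get t).lam, (c.row : ℕ) = r ∧ (c.pos : ℕ) = k + 1 ∧
        place (m := m) t c = cell t r ⟨k, h⟩ := by
    intro r k h
    refine ⟨⟨r, ⟨k + 1, by unfold offDiag at h; omega⟩⟩, rfl, rfl, ?_⟩
    simp [place]
  have hdiag : ∀ r : Fin (X.get t).len, ∃ c : ShiftedCell (X.get t).lam, (c.row : ℕ) = r ∧
      (c.pos : ℕ) = 0 ∧ place (m := m) t c = diag (diagIndex t r) :=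
    fun r => ⟨⟨r, ⟨0, Par.addStaircase_pos _ _⟩⟩, rfl, rfl, by simp [place]⟩
  constructor
  · intro r k h
    rw [dif_neg (by omega)]
  · intro r h
    rw [dif_pos h]
    obtain ⟨c, hc1, hc2, hc3⟩ := hcell r 0 h
    obtain ⟨d, hd1, hd2, hd3⟩ := hdiag r
    have := key c d ⟨by rw [Fin.le_def]; omega, by omega⟩
    rw [hc3, hd3] at this
    simp only [shiftedDiag]
    omega
  · intro r s hrs h
    rw [dif_pos h]
    obtain ⟨c, hc1, hc2, hc3⟩ := hcell r 0 h
    obtain ⟨d, hd1, hd2, hd3⟩ := hdiag s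
    have := key d c ⟨by rw [Fin.le_def]; omega, by omega⟩
    rw [hc3, hd3] at this
    simp only [shiftedDiag]
    omega
  · intro r k h
    rw [dif_pos h, dif_pos (by omega)]
    obtain ⟨c, hc1, hc2, hc3⟩ := hcell r k (by omega)
    obtain ⟨d, hd1, hd2, hd3⟩ := hcell r (k + 1) h
    have := key d c ⟨by rw [Fin.le_def]; omega, by omega⟩
    rw [hc3, hd3] at this
    omega
  · intro r s k hrs h h'
    rw [dif_pos h, dif_pos h']
    obtain ⟨c, hc1, hc2, hc3⟩ := hcell r (k + 1) h
    obtain ⟨d, hd1, hd2, hd3⟩ := hcell s k h'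
    have := key d c ⟨by rw [Fin.le_def]; omega, by omega⟩
    rw [hc3, hd3] at this
    omega

/-- A `P`-partition consists of its values on the chain, on the top chain and on the diagrams. -/
def partitionEquiv : {σ : DiagPoset n m X → ℕ // Antitone σ} ≃
    (a : {a : Fin n → ℕ // Antitone a}) ×
      ({b : Fin m → ℕ // Antitone b ∧ ∀ i j, b j ≤ a.1 i} × ∀ t : Fin X.length, Filling X a.1 t) where
  toFun σ := ⟨⟨fun i => σ.1 (diag i), fun _ _ h => σ.2 (le_of_gen (Gen.diag h))⟩,
    ⟨fun j => σ.1 (top j), fun _ _ h => σ.2 (le_of_gen (Gen.top h)),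
      fun i j => σ.2 (le_of_gen (Gen.attach i j))⟩,
    fun t => ⟨_, isFilling_of_antitone σ.2 t⟩⟩
  invFun p := ⟨_, antitone_glue p.1.2 p.2.1.2.1 p.2.1.2.2 p.2.2⟩
  left_inv σ := by
    apply Subtype.ext
    funext x
    cases x with
    | diag i => rfl
    | top j => rfl
    | cell t r j =>
      have h : (j : ℕ) < offDiag X t r := j.isLt
      simp only [glue]
      rw [dif_pos h]
      exact Nat.add_sub_cancel _ _
  right_inv p := by
    obtain ⟨⟨a, ha⟩, ⟨b, hb, hba⟩, f⟩ := p
    refine Sigma.ext rfl (heq_of_eq (Prod.ext rfl ?_))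
    funext t
    apply Subtype.ext
    funext r k
    by_cases h : k < offDiag X t r
    · have := le_filling (f t) r k h
      simp only [h, dif_pos, glue]
      omega
    · simp only [h, dif_neg, not_false_eq_true]
      exact ((f t).2.zero r k (by omega)).symm

theorem sum_eq (σ : DiagPoset n m X → ℕ) : ∑ x, σ x = ∑ i, σ (diag i) + ∑ j, σ (top j) +
    ∑ t : Fin X.length, ∑ r, ∑ j : Fin (offDiag X t r), σ (cell t r j) := by
  rw [← (equivSum n m X).symm.sum_comp, Fintype.sum_sum_type, Fintype.sum_sum_type,
    Fintype.sum_sigma]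
  simp only [Fintype.sum_sigma]
  rfl

/-- Given the values on the chain, the top chain and the diagrams are filled independently, hence
the product. The power of `q` on the left compensates for the row index `r` that is added to every
off-diagonal entry of row `r`. -/
theorem tsum_partition {q : ℝ} :
    (∑' σ : {σ : DiagPoset n m X → ℕ // Antitone σ}, ENNReal.ofReal q ^ ∑ x, σ.1 x) *
      ENNReal.ofReal q ^ (∑ t : Fin X.length, ∑ r : Fin (X.get t).len, (r : ℕ) * offDiag X t r) =
    ∑' a : {a : Fin n → ℕ // Antitone a}, ENNReal.ofReal q ^ (∑ i, a.1 i) *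
      (∑' b : {b : Fin m → ℕ // Antitone b ∧ ∀ i j, b j ≤ a.1 i}, ENNReal.ofReal q ^ ∑ j, b.1 j) *
      ∏ t, fillingSum q (offDiag X t) (shiftedDiag X a.1 t) := by
  rw [← ENNReal.tsum_mul_right, ← partitionEquiv.symm.tsum_eq, ENNReal.tsum_sigma']
  refine tsum_congr fun a => ?_
  rw [ENNReal.tsum_prod', mul_assoc, ← ENNReal.tsum_mul_right, ← ENNReal.tsum_mul_left]
  refine tsum_congr fun b => ?_
  simp only [fillingSum]
  rw [← ENNReal.tsum_pi_prod (S := Filling X a.1) (fun t (f : Filling X a.1 t) =>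
    ENNReal.ofReal q ^ ∑ r, ∑ k ∈ Finset.range (offDiag X t r), f.1 r k),
    ← ENNReal.tsum_mul_left, ← ENNReal.tsum_mul_left]
  refine tsum_congr fun f => ?_
  rw [Finset.prod_pow_eq_pow_sum, ← pow_add, ← pow_add, ← pow_add]
  congr 1
  rw [sum_eq]
  change ∑ i, a.1 i + ∑ j, b.1 j + _ + _ = _
  rw [add_assoc, ← Finset.sum_add_distrib, add_assoc]
  congr 2
  refine Finset.sum_congr rfl fun t _ => ?_
  rw [← Finset.sum_add_distrib]
  refine Finset.sum_congr rfl fun r _ => ?_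
  rw [Finset.sum_range]
  have h : (r : ℕ) * offDiag X t r = ∑ _j : Fin (offDiag X t r), (r : ℕ) := by
    simp [mul_comm]
  rw [h, ← Finset.sum_add_distrib]
  refine Finset.sum_congr rfl fun j _ => ?_
  have := le_filling (f t) r j j.isLt
  change (f t).1 r j - r + r = _
  omega

end DiagPoset

/-! ### The five-fold sum of determinants. -/

theorem tsum_ofReal_mul_of_hasSum {f : ℕ → ℝ} {x a : ℝ} (hx : 0 ≤ x) (h0 : ∀ n, 0 ≤ f n)
    (h : HasSum f a) : ∑' n, ENNReal.ofReal (x * f n) = ENNReal.ofReal (x * a) :=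
  tsum_ofReal_of_hasSum (fun n => mul_nonneg hx (h0 n)) (h.mul_left x)

theorem laplaceRow_const_mul {k : ℕ} (b : ℕ) (x : ℝ) (φ : (Fin k → ℝ) → ℝ) (z : Fin (k + 1) → ℝ) :
    laplaceRow b (fun w => x * φ w) z = x * laplaceRow b φ z := by
  rw [laplaceRow, laplaceRow, Finset.mul_sum]
  exact Finset.sum_congr rfl fun j _ => by ring

theorem det_eq_laplaceRow {k : ℕ} (B : Fin (k + 1) → ℕ) (z : Fin (k + 1) → ℝ) :
    Matrix.det (Matrix.of fun r j => z j ^ B r) =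
      laplaceRow (B 0) (fun w => Matrix.det (Matrix.of fun r j => w j ^ B r.succ)) z := by
  rw [Matrix.det_succ_row_zero, laplaceRow]
  rfl

/-- The determinant of the `z_j ^ b_r`, expanded along its rows. -/
noncomputable def powerDet (b5 b4 b3 b2 b1 : ℕ) : (Fin 5 → ℝ) → ℝ :=
  laplaceRow b5 (laplaceRow b4 (laplaceRow b3 (laplaceRow b2 (laplaceRow b1 fun _ => 1))))

theorem powerDet_eq_det (b5 b4 b3 b2 b1 : ℕ) (z : Fin 5 → ℝ) :
    powerDet b5 b4 b3 b2 b1 z = Matrix.det (Matrix.of fun r j => z j ^ ![b5, b4, b3, b2, b1] r) := by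
  rw [det_eq_laplaceRow, powerDet]
  congr 1
  funext z
  rw [det_eq_laplaceRow]
  congr 1
  funext z
  rw [det_eq_laplaceRow]
  congr 1
  funext z
  rw [det_eq_laplaceRow]
  congr 1
  funext z
  rw [det_eq_laplaceRow]
  congr 1
  funext z
  simp

/-- Lets a summation over an inner exponent be performed underneath an outer Laplace expansion: the
outer row does not involve the summation variable, and deleting a variable preserves `UnitPos`. -/
theorem hasSum_mul_mul_laplaceRow {k : ℕ} (b : ℕ) {u v : ℕ → ℝ} {φ : ℕ → (Fin k → ℝ) → ℝ}
    {ψ : (Fin k → ℝ) → ℝ}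
    (h : ∀ z, UnitPos z → HasSum (fun n => u n * (v n * φ n z)) (ψ z))
    (z : Fin (k + 1) → ℝ) (hz : UnitPos z) :
    HasSum (fun n => u n * (v n * laplaceRow b (φ n) z)) (laplaceRow b ψ z) := by
  refine (hasSum_laplaceRow b (φ := fun n z => u n * v n * φ n z) (ψ := ψ) (z := z)
    fun j => (h _ (hz.removeNth j)).congr_fun fun n => by ring).congr_fun fun n => ?_
  rw [laplaceRow_const_mul, mul_assoc]

theorem mul_mul_mul_regroup (x u v l : ℝ) : x * (u * (v * l)) = x * (u * v) * l := by ring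

/-- The real summations run from `b_1` outwards. Nonnegativity runs with them: each inner value is a
sum of nonnegative terms, the start being the determinants themselves. This is what allows every
stage to be transferred to extended nonnegative reals. -/
theorem tsum_stages {q : ℝ} (hq0 : 0 < q) (hq1 : q < 1) {z : Fin 5 → ℝ} (hz : UnitPos z)
    (hmono : StrictMono z)
    (hdet : ∀ b5 b4 b3 b2 b1 : ℕ, b5 < b4 → b4 < b3 → b3 < b2 → b2 < b1 →
      0 ≤ powerDet b5 b4 b3 b2 b1 z) (c : ℕ) (F : ℕ → ℕ → ℕ → ℕ → ℕ → ℝ)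
    (hF : ∀ b5 b4 b3 b2 b1, F b5 b4 b3 b2 b1 =
      ((q ^ c - q ^ b5) ^ 2 * q ^ b5) * ((q ^ b5 - q ^ b4) * (q ^ c - q ^ b4) * q ^ b4) *
      ((q ^ b4 - q ^ b3) * q ^ b3) * (((q ^ 2) ^ b3 - (q ^ 2) ^ b2) * q ^ b2) *
      ((q ^ b2 - q ^ b1) * (q ^ b1 * powerDet b5 b4 b3 b2 b1 z))) :
    ∑' n5 : ℕ, ∑' n4 : ℕ, ∑' n3 : ℕ, ∑' n2 : ℕ, ∑' n1 : ℕ,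
      ENNReal.ofReal (F (c + 1 + n5) (c + 1 + n5 + 1 + n4) (c + 1 + n5 + 1 + n4 + 1 + n3)
        (c + 1 + n5 + 1 + n4 + 1 + n3 + 1 + n2) (c + 1 + n5 + 1 + n4 + 1 + n3 + 1 + n2 + 1 + n1)) =
    ENNReal.ofReal ((q ^ c) ^ 3 * (q ^ 10 * (z 0 * z 1 * z 2 * z 3 * z 4)) ^ c *
        chainFive q (z 0) (z 1) (z 2) (z 3) (z 4)) := by
  have hsub : ∀ {x : ℝ} {b b' : ℕ}, 0 < x → x ≤ 1 → b < b' → 0 ≤ x ^ b - x ^ b' :=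
    fun h0 h1 h => sub_nonneg.2 (pow_le_pow_of_le_one h0.le h1 h.le)
  have hq2 : q ^ 2 ≤ 1 := pow_le_one₀ hq0.le hq1.le
  have hq20 : 0 < q ^ 2 := pow_pos hq0 2
  have h1 : ∀ b5 b4 b3 b2 : ℕ, HasSum (fun n => (q ^ b2 - q ^ (b2 + 1 + n)) * (q ^ (b2 + 1 + n) *
      powerDet b5 b4 b3 b2 (b2 + 1 + n) z))
      (laplaceRow b5 (laplaceRow b4 (laplaceRow b3 (laplaceRow b2 (stageOne q b2)))) z) :=
    fun b5 b4 b3 b2 => hasSum_mul_mul_laplaceRow b5 (hasSum_mul_mul_laplaceRow b4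
      (hasSum_mul_mul_laplaceRow b3 (hasSum_mul_mul_laplaceRow b2
        fun z hz => hasSum_stageOne hq0 hq1 hz b2))) z hz
  have p1 : ∀ b5 b4 b3 b2 : ℕ, b5 < b4 → b4 < b3 → b3 < b2 → ∀ n,
      0 ≤ (q ^ b2 - q ^ (b2 + 1 + n)) * (q ^ (b2 + 1 + n) *
      powerDet b5 b4 b3 b2 (b2 + 1 + n) z) := fun b5 b4 b3 b2 h5 h4 h3 n =>
    mul_nonneg (hsub hq0 hq1.le (by omega)) (mul_nonneg (pow_pos hq0 _).le
      (hdet _ _ _ _ _ h5 h4 h3 (by omega)))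
  have h2 : ∀ b5 b4 b3 : ℕ, HasSum (fun n => ((q ^ 2) ^ b3 - (q ^ 2) ^ (b3 + 1 + n)) *
      (q ^ (b3 + 1 + n) * laplaceRow b5 (laplaceRow b4 (laplaceRow b3 (laplaceRow (b3 + 1 + n)
        (stageOne q (b3 + 1 + n))))) z))
      (laplaceRow b5 (laplaceRow b4 (laplaceRow b3 (stageTwo q b3))) z) :=
    fun b5 b4 b3 => hasSum_mul_mul_laplaceRow b5 (hasSum_mul_mul_laplaceRow b4
      (hasSum_mul_mul_laplaceRow b3 fun z hz => hasSum_stageTwo hq0 hq1 hz b3)) z hz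
  have p2 : ∀ b5 b4 b3 : ℕ, b5 < b4 → b4 < b3 → ∀ n,
      0 ≤ ((q ^ 2) ^ b3 - (q ^ 2) ^ (b3 + 1 + n)) *
      (q ^ (b3 + 1 + n) * laplaceRow b5 (laplaceRow b4 (laplaceRow b3 (laplaceRow (b3 + 1 + n)
        (stageOne q (b3 + 1 + n))))) z) := fun b5 b4 b3 h5 h4 n =>
    mul_nonneg (hsub hq20 hq2 (by omega)) (mul_nonneg (pow_pos hq0 _).le
      ((h1 _ _ _ _).nonneg (p1 _ _ _ _ h5 h4 (by omega))))
  have h3 : ∀ b5 b4 : ℕ, HasSum (fun n => (q ^ b4 - q ^ (b4 + 1 + n)) *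
      (q ^ (b4 + 1 + n) * laplaceRow b5 (laplaceRow b4 (laplaceRow (b4 + 1 + n)
        (stageTwo q (b4 + 1 + n)))) z))
      (laplaceRow b5 (laplaceRow b4 (stageThree q b4)) z) :=
    fun b5 b4 => hasSum_mul_mul_laplaceRow b5 (hasSum_mul_mul_laplaceRow b4
      fun z hz => hasSum_stageThree hq0 hq1 hz b4) z hz
  have p3 : ∀ b5 b4 : ℕ, b5 < b4 → ∀ n, 0 ≤ (q ^ b4 - q ^ (b4 + 1 + n)) *
      (q ^ (b4 + 1 + n) * laplaceRow b5 (laplaceRow b4 (laplaceRow (b4 + 1 + n)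
        (stageTwo q (b4 + 1 + n)))) z) := fun b5 b4 h5 n =>
    mul_nonneg (hsub hq0 hq1.le (by omega)) (mul_nonneg (pow_pos hq0 _).le
      ((h2 _ _ _).nonneg (p2 _ _ _ h5 (by omega))))
  have h4 : ∀ b5 : ℕ, HasSum (fun n => (q ^ b5 - q ^ (b5 + 1 + n)) * (q ^ c - q ^ (b5 + 1 + n)) *
      (q ^ (b5 + 1 + n) * laplaceRow b5 (laplaceRow (b5 + 1 + n)
        (stageThree q (b5 + 1 + n))) z))
      (laplaceRow b5 (stageFour q (q ^ c) b5) z) :=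
    fun b5 => hasSum_mul_mul_laplaceRow b5
      (fun z hz => hasSum_stageFour hq0 hq1 hz (q ^ c) b5) z hz
  have p4 : ∀ b5 : ℕ, c < b5 → ∀ n,
      0 ≤ (q ^ b5 - q ^ (b5 + 1 + n)) * (q ^ c - q ^ (b5 + 1 + n)) *
      (q ^ (b5 + 1 + n) * laplaceRow b5 (laplaceRow (b5 + 1 + n)
        (stageThree q (b5 + 1 + n))) z) := fun b5 hc n =>
    mul_nonneg (mul_nonneg (hsub hq0 hq1.le (by omega)) (hsub hq0 hq1.le (by omega)))
      (mul_nonneg (pow_pos hq0 _).le ((h3 _ _).nonneg (p3 _ _ (by omega))))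
  have h5 := hasSum_stageFive hq0 hq1 hz hmono c
  have p5 : ∀ n, 0 ≤ (q ^ c - q ^ (c + 1 + n)) ^ 2 * (q ^ (c + 1 + n) *
      laplaceRow (c + 1 + n) (stageFour q (q ^ c) (c + 1 + n)) z) := fun n =>
    mul_nonneg (sq_nonneg _) (mul_nonneg (pow_pos hq0 _).le
      ((h4 _).nonneg (p4 _ (by omega))))
  have x5 : ∀ b5 : ℕ, 0 ≤ (q ^ c - q ^ b5) ^ 2 * q ^ b5 := fun b5 => by positivity
  have x4 : ∀ b5 b4 : ℕ, c < b5 → b5 < b4 →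
      0 ≤ (q ^ b5 - q ^ b4) * (q ^ c - q ^ b4) * q ^ b4 := fun b5 b4 i j =>
    mul_nonneg (mul_nonneg (hsub hq0 hq1.le (by omega)) (hsub hq0 hq1.le (by omega)))
      (pow_pos hq0 _).le
  have x3 : ∀ b4 b3 : ℕ, b4 < b3 → 0 ≤ (q ^ b4 - q ^ b3) * q ^ b3 := fun b4 b3 i =>
    mul_nonneg (hsub hq0 hq1.le i) (pow_pos hq0 _).le
  have x2 : ∀ b3 b2 : ℕ, b3 < b2 → 0 ≤ ((q ^ 2) ^ b3 - (q ^ 2) ^ b2) * q ^ b2 := fun b3 b2 i =>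
    mul_nonneg (hsub hq20 hq2 i) (pow_pos hq0 _).le
  simp only [hF]
  -- The closed form is unfolded from the outermost sum inwards; the factors already collected stay
  -- in front as a nonnegative constant.
  rw [← tsum_ofReal_of_hasSum p5 h5]
  refine tsum_congr fun n5 => ?_
  generalize hb5 : c + 1 + n5 = b5
  rw [← mul_assoc, ← tsum_ofReal_mul_of_hasSum (x5 b5) (p4 b5 (by omega)) (h4 b5)]
  refine tsum_congr fun n4 => ?_
  generalize hb4 : b5 + 1 + n4 = b4
  have x54 := mul_nonneg (x5 b5) (x4 b5 b4 (by omega) (by omega))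
  rw [mul_mul_mul_regroup,
    ← tsum_ofReal_mul_of_hasSum x54 (p3 b5 b4 (by omega)) (h3 b5 b4)]
  refine tsum_congr fun n3 => ?_
  generalize hb3 : b4 + 1 + n3 = b3
  have x53 := mul_nonneg x54 (x3 b4 b3 (by omega))
  rw [mul_mul_mul_regroup,
    ← tsum_ofReal_mul_of_hasSum x53 (p2 b5 b4 b3 (by omega) (by omega)) (h2 b5 b4 b3)]
  refine tsum_congr fun n2 => ?_
  generalize hb2 : b3 + 1 + n2 = b2
  have x52 := mul_nonneg x53 (x2 b3 b2 (by omega))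
  rw [mul_mul_mul_regroup,
    ← tsum_ofReal_mul_of_hasSum x52 (p1 b5 b4 b3 b2 (by omega) (by omega) (by omega))
      (h1 b5 b4 b3 b2)]

open DiagPoset in
theorem tsum_partition_eq_tsum_cons {m : ℕ} {X : List (Attachment 6)} {q : ℝ} :
    (∑' σ : {σ : DiagPoset 6 m X → ℕ // Antitone σ}, ENNReal.ofReal q ^ ∑ x, σ.1 x) *
      ENNReal.ofReal q ^ (∑ t : Fin X.length, ∑ r : Fin (X.get t).len, (r : ℕ) * offDiag X t r) =
    ∑' a : {a : Fin 6 → ℕ // Antitone a}, ENNReal.ofReal q ^ (∑ i, a.1 i) *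
      (∑' b : {b : Fin m → ℕ // Antitone b ∧ ∀ j, b j ≤ a.1 5}, ENNReal.ofReal q ^ ∑ j, b.1 j) *
      ∏ t, fillingSum q (offDiag X t) (shiftedDiag X a.1 t) := by
  rw [tsum_partition]
  refine tsum_congr fun a => ?_
  congr 2
  have h : ∀ b : Fin m → ℕ, (Antitone b ∧ ∀ i j, b j ≤ a.1 i) ↔ (Antitone b ∧ ∀ j, b j ≤ a.1 5) :=
    fun b => and_congr_right' ⟨fun h j => h 5 j, fun h i j => (h j).trans (a.2 (Fin.le_last i))⟩
  rw [← (Equiv.subtypeEquivRight h).tsum_eq]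
  rfl

/-- The smallest value `c` is outermost and the successive increments are free, which matches the
order of the five summations. -/
theorem tsum_antitone_six (g : (Fin 6 → ℕ) → ENNReal) :
    ∑' a : {a : Fin 6 → ℕ // Antitone a}, g a.1 =
      ∑' c : ℕ, ∑' n5 : ℕ, ∑' n4 : ℕ, ∑' n3 : ℕ, ∑' n2 : ℕ, ∑' n1 : ℕ,
        g ![c + n5 + n4 + n3 + n2 + n1, c + n5 + n4 + n3 + n2, c + n5 + n4 + n3, c + n5 + n4,
          c + n5, c] := by
  rw [tsum_antitone_succ g, tsum_antitone_succ (m := 3) fun s => ∑' n1, g (Fin.cons (s 0 + n1) s),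
    tsum_antitone_succ (m := 2) fun s => ∑' n2, ∑' n1, (fun s => g (Fin.cons (s 0 + n1) s))
      (Fin.cons (s 0 + n2) s),
    tsum_antitone_succ (m := 1) fun s => ∑' n3, ∑' n2, ∑' n1,
      (fun s => (fun s => g (Fin.cons (s 0 + n1) s)) (Fin.cons (s 0 + n2) s))
        (Fin.cons (s 0 + n3) s),
    tsum_antitone_succ (m := 0) fun s => ∑' n4, ∑' n3, ∑' n2, ∑' n1,
      (fun s => (fun s => (fun s => g (Fin.cons (s 0 + n1) s)) (Fin.cons (s 0 + n2) s))
        (Fin.cons (s 0 + n3) s)) (Fin.cons (s 0 + n4) s),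
    tsum_antitone_one fun s => ∑' n5, ∑' n4, ∑' n3, ∑' n2, ∑' n1,
      (fun s => (fun s => (fun s => (fun s => g (Fin.cons (s 0 + n1) s)) (Fin.cons (s 0 + n2) s))
        (Fin.cons (s 0 + n3) s)) (Fin.cons (s 0 + n4) s)) (Fin.cons (s 0 + n5) s)]
  refine tsum_congr fun c => tsum_congr fun n5 => tsum_congr fun n4 => tsum_congr fun n3 =>
    tsum_congr fun n2 => tsum_congr fun n1 => congrArg g ?_
  funext i
  fin_cases i <;> rfl

/-! ### Closed form of the generating function of a tagged swivel. -/

namespace TaggedSwivel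

/-- The number of off-diagonal cells in row `r` of the large diagram. -/
def arm (lam : Par 5) (r : Fin 5) : ℕ := lam.addStaircase r - 1

theorem arm_strictAnti (lam : Par 5) : StrictAnti (arm lam) := by
  intro i j h
  have h1 := lam.addStaircase_strictAnti h
  have h2 := lam.addStaircase_pos j
  unfold arm
  omega

/-- The powers `q ^ M_r`. -/
noncomputable def armPow (q : ℝ) (lam : Par 5) (r : Fin 5) : ℝ := q ^ arm lam r

theorem unitPos_armPow {q : ℝ} (hq0 : 0 < q) (hq1 : q < 1) (lam : Par 5) :
    UnitPos (armPow q lam) :=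
  fun _ => ⟨pow_pos hq0 _, pow_le_one₀ hq0.le hq1.le⟩

theorem armPow_strictMono {q : ℝ} (hq0 : 0 < q) (hq1 : q < 1) (lam : Par 5) :
    StrictMono (armPow q lam) :=
  fun _ _ h => pow_lt_pow_right_of_lt_one₀ hq0 hq1 (arm_strictAnti lam h)

theorem alternant_arm (q : ℝ) (lam : Par 5) (b5 b4 b3 b2 b1 : ℕ) :
    alternant q (arm lam) ![b5, b4, b3, b2, b1] = powerDet b5 b4 b3 b2 b1 (armPow q lam) := by
  rw [powerDet_eq_det]
  rfl

/-- The sign is not obtained from a direct study of the determinant, but from the nonnegativity of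
the alternant established along with the count of fillings. -/
theorem powerDet_arm_nonneg {q : ℝ} (hq0 : 0 < q) (hq1 : q < 1) (lam : Par 5)
    (b5 b4 b3 b2 b1 : ℕ) (h4 : b5 < b4) (h3 : b4 < b3) (h2 : b3 < b2) (h1 : b2 < b1) :
    0 ≤ powerDet b5 b4 b3 b2 b1 (armPow q lam) := by
  rw [← alternant_arm]
  refine (fillingSum_eq hq0 hq1 (arm_strictAnti lam) ?_).1
  rw [Fin.strictMono_iff_lt_succ]
  intro i
  fin_cases i <;> assumption

theorem powerDet_succ (b5 b4 b3 b2 b1 : ℕ) (z : Fin 5 → ℝ) :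
    powerDet (b5 + 1) (b4 + 1) (b3 + 1) (b2 + 1) (b1 + 1) z =
      z 0 * z 1 * z 2 * z 3 * z 4 * powerDet b5 b4 b3 b2 b1 z := by
  rw [powerDet_eq_det, powerDet_eq_det, ← Fin.prod_univ_five, ← Matrix.det_mul_row]
  congr 1
  ext r j
  fin_cases r <;> simp [pow_succ, mul_comm]

/-- The product of the normalising factors of the fillings of the six diagrams. -/
noncomputable def normalizer (q : ℝ) (lam : Par 5) : ℝ :=
  (∏ r, qPoch q (arm lam r)) * ((1 - q) ^ 6 * (1 - q ^ 2) ^ 2)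

/-- The value of `fillingSum`. -/
noncomputable def fillingValue (q : ℝ) {n : ℕ} (μ B : Fin n → ℕ) : ℝ :=
  (∏ r, (qPoch q (μ r))⁻¹) * alternant q μ B

theorem qPoch_zero (q : ℝ) : qPoch q 0 = 1 := by simp [qPoch]

theorem qPoch_one (q : ℝ) : qPoch q 1 = 1 - q := by simp [qPoch]

theorem qPoch_two (q : ℝ) : qPoch q 2 = (1 - q) * (1 - q ^ 2) := by
  simp [qPoch, Finset.prod_range_succ]

theorem fillingValue_two (q : ℝ) (x b c : ℕ) :
    fillingValue q ![x, 0] ![b, c] = (qPoch q x)⁻¹ * ((q ^ x) ^ b - (q ^ x) ^ c) := by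
  simp [fillingValue, alternant, Matrix.det_fin_two, qPoch_zero]

theorem fillingValue_three (q : ℝ) (b c d : ℕ) :
    fillingValue q ![2, 1, 0] ![b, c, d] = (qPoch q 2)⁻¹ * (qPoch q 1)⁻¹ *
      ((q ^ b - q ^ c) * (q ^ b - q ^ d) * (q ^ c - q ^ d)) := by
  simp [fillingValue, alternant, Matrix.det_fin_three, Fin.prod_univ_three, qPoch_zero,
    pow_right_comm q 2]
  ring

open DiagPoset in
-- The large diagram contributes the `5 × 5` determinant, the four two-row diagrams one difference
-- each, and `(∅, 3, 4)` a Vandermonde product of three differences.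
theorem prod_fillingSum {q : ℝ} (hq0 : 0 < q) (hq1 : q < 1) (lam : Par 5) {a : Fin 6 → ℕ}
    (ha : Antitone a) :
    ∏ t, fillingSum q (offDiag (taggedSwivelData lam) t) (shiftedDiag (taggedSwivelData lam) a t) =
      ENNReal.ofReal ((normalizer q lam)⁻¹ *
        (powerDet (a 4) (a 3 + 1) (a 2 + 2) (a 1 + 3) (a 0 + 4) (armPow q lam) *
          (q ^ a 1 - q ^ (a 0 + 1)) * ((q ^ 2) ^ a 2 - (q ^ 2) ^ (a 1 + 1)) *
          (q ^ a 3 - q ^ (a 2 + 1)) *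
          ((q ^ a 5 - q ^ (a 4 + 1)) * (q ^ a 5 - q ^ (a 3 + 2)) *
            (q ^ (a 4 + 1) - q ^ (a 3 + 2))) *
          (q ^ a 5 - q ^ (a 4 + 1)))) := by
  have key : ∀ t : Fin (taggedSwivelData lam).length,
      0 ≤ fillingValue q (offDiag (taggedSwivelData lam) t)
          (shiftedDiag (taggedSwivelData lam) a t) ∧
      fillingSum q (offDiag (taggedSwivelData lam) t) (shiftedDiag (taggedSwivelData lam) a t) =
      ENNReal.ofReal (fillingValue q (offDiag (taggedSwivelData lam) t)
          (shiftedDiag (taggedSwivelData lam) a t)) := by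
    intro t
    have h := fillingSum_eq hq0 hq1 (offDiag_strictAnti t) (shiftedDiag_strictMono ha t)
    exact ⟨mul_nonneg (Finset.prod_nonneg fun r _ => inv_nonneg.2 (qPoch_pos hq0 hq1 _).le) h.1,
      h.2⟩
  rw [Finset.prod_congr rfl fun t _ => (key t).2, ← ENNReal.ofReal_prod_of_nonneg
    fun t _ => (key t).1]
  congr 1
  change ∏ t : Fin 6, _ = _
  have e0 : fillingValue q (offDiag (taggedSwivelData lam) (0 : Fin 6))
        (shiftedDiag (taggedSwivelData lam) a (0 : Fin 6)) =
      fillingValue q (arm lam) ![a 4, a 3 + 1, a 2 + 2, a 1 + 3, a 0 + 4] :=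
    congrArg₂ (fillingValue q) (by funext r; fin_cases r <;> rfl) (by funext r; fin_cases r <;> rfl)
  have e1 : fillingValue q (offDiag (taggedSwivelData lam) (1 : Fin 6))
        (shiftedDiag (taggedSwivelData lam) a (1 : Fin 6)) =
      fillingValue q ![1, 0] ![a 1, a 0 + 1] :=
    congrArg₂ (fillingValue q) (by funext r; fin_cases r <;> rfl) (by funext r; fin_cases r <;> rfl)
  have e2 : fillingValue q (offDiag (taggedSwivelData lam) (2 : Fin 6))
        (shiftedDiag (taggedSwivelData lam) a (2 : Fin 6)) =
      fillingValue q ![2, 0] ![a 2, a 1 + 1] :=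
    congrArg₂ (fillingValue q) (by funext r; fin_cases r <;> rfl) (by funext r; fin_cases r <;> rfl)
  have e3 : fillingValue q (offDiag (taggedSwivelData lam) (3 : Fin 6))
        (shiftedDiag (taggedSwivelData lam) a (3 : Fin 6)) =
      fillingValue q ![1, 0] ![a 3, a 2 + 1] :=
    congrArg₂ (fillingValue q) (by funext r; fin_cases r <;> rfl) (by funext r; fin_cases r <;> rfl)
  have e4 : fillingValue q (offDiag (taggedSwivelData lam) (4 : Fin 6))
        (shiftedDiag (taggedSwivelData lam) a (4 : Fin 6)) =
      fillingValue q ![2, 1, 0] ![a 5, a 4 + 1, a 3 + 2] :=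
    congrArg₂ (fillingValue q) (by funext r; fin_cases r <;> rfl) (by funext r; fin_cases r <;> rfl)
  have e5 : fillingValue q (offDiag (taggedSwivelData lam) (5 : Fin 6))
        (shiftedDiag (taggedSwivelData lam) a (5 : Fin 6)) =
      fillingValue q ![1, 0] ![a 5, a 4 + 1] :=
    congrArg₂ (fillingValue q) (by funext r; fin_cases r <;> rfl) (by funext r; fin_cases r <;> rfl)
  rw [Fin.prod_univ_six]
  refine (congrArg₂ (· * ·) (congrArg₂ (· * ·) (congrArg₂ (· * ·) (congrArg₂ (· * ·)
    (congrArg₂ (· * ·) e0 e1) e2) e3) e4) e5).trans ?_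
  simp only [fillingValue_two, fillingValue_three]
  rw [fillingValue, alternant_arm, Finset.prod_inv_distrib, normalizer, qPoch_one, qPoch_two]
  have h1 : 1 - q ≠ 0 := by linarith
  have h2 : 1 - q ^ 2 ≠ 0 := by
    have := pow_lt_one₀ hq0.le hq1 two_ne_zero
    linarith
  have h3 : ∏ r, qPoch q (arm lam r) ≠ 0 :=
    Finset.prod_ne_zero_iff.2 fun r _ => (qPoch_pos hq0 hq1 _).ne'
  simp only [pow_one, mul_inv]
  field_simp

open DiagPoset in
-- The final `1` comes from the middle row of the diagram of `(∅, 3, 4)`; the second rows of the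
-- two-row diagrams have no off-diagonal cells.
theorem weight_eq (lam : Par 5) : ∑ t : Fin (taggedSwivelData lam).length,
    ∑ r : Fin ((taggedSwivelData lam).get t).len, (r : ℕ) * offDiag (taggedSwivelData lam) t r =
      arm lam 1 + 2 * arm lam 2 + 3 * arm lam 3 + 4 * arm lam 4 + 1 := by
  change ∑ t : Fin 6, _ = _
  rw [Fin.sum_univ_six]
  have e0 : ∑ r : Fin 5, (r : ℕ) * offDiag (taggedSwivelData lam) (0 : Fin 6) r =
      arm lam 1 + 2 * arm lam 2 + 3 * arm lam 3 + 4 * arm lam 4 := by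
    rw [Fin.sum_univ_five]
    change 0 * _ + 1 * arm lam 1 + 2 * arm lam 2 + 3 * arm lam 3 + 4 * arm lam 4 = _
    ring
  refine (congrArg₂ (· + ·) (congrArg₂ (· + ·) (congrArg₂ (· + ·) (congrArg₂ (· + ·)
    (congrArg₂ (· + ·) e0 (?_ : _ = 0)) (?_ : _ = 0)) (?_ : _ = 0)) (?_ : _ = 1)) (?_ : _ = 0)).trans ?_
  · rfl
  · rfl
  · rfl
  · rfl
  · rfl
  · rfl

/-- The generating function as it comes out of the summation. -/
noncomputable def rawValue (q : ℝ) (lam : Par 5) : ℝ :=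
  (normalizer q lam)⁻¹ * chainFive q (armPow q lam 0) (armPow q lam 1) (armPow q lam 2)
    (armPow q lam 3) (armPow q lam 4) /
    (q ^ 28 * q ^ (∑ r, arm lam r) *
      q ^ (arm lam 1 + 2 * arm lam 2 + 3 * arm lam 3 + 4 * arm lam 4))

theorem tsum_partition_eq {q : ℝ} (hq0 : 0 < q) (hq1 : q < 1) (lam : Par 5) (m : ℕ) :
    ∑' σ : {σ : DiagPoset 6 m (taggedSwivelData lam) → ℕ // Antitone σ},
      ENNReal.ofReal q ^ ∑ x, σ.1 x =
    ENNReal.ofReal (rawValue q lam) *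
      ∏ i ∈ Finset.range (m + 1), (1 - ENNReal.ofReal q ^ (∑ r, arm lam r + 14 + i))⁻¹ := by
  have hz := unitPos_armPow hq0 hq1 lam
  set z := armPow q lam with hzdef
  set S := ∑ r, arm lam r with hS
  have hZ : z 0 * z 1 * z 2 * z 3 * z 4 = q ^ S := by
    rw [hS, ← Finset.prod_pow_eq_pow_sum, Fin.prod_univ_five]
    rfl
  have hN : 0 < normalizer q lam := by
    have h2 : q ^ 2 < 1 := pow_lt_one₀ hq0.le hq1 two_ne_zero
    have h3 : 0 < 1 - q := by linarith
    have h4 : 0 < 1 - q ^ 2 := by linarith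
    have h5 : 0 < ∏ r, qPoch q (arm lam r) := Finset.prod_pos fun r _ => qPoch_pos hq0 hq1 _
    rw [normalizer]
    positivity
  let F : ℕ → ℕ → ℕ → ℕ → ℕ → ℕ → ℝ := fun c b5 b4 b3 b2 b1 =>
      ((q ^ c - q ^ b5) ^ 2 * q ^ b5) * ((q ^ b5 - q ^ b4) * (q ^ c - q ^ b4) * q ^ b4) *
      ((q ^ b4 - q ^ b3) * q ^ b3) * (((q ^ 2) ^ b3 - (q ^ 2) ^ b2) * q ^ b2) *
      ((q ^ b2 - q ^ b1) * (q ^ b1 * powerDet b5 b4 b3 b2 b1 z))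
  let T : ℕ → ENNReal := fun c =>
    ∑' b : {b : Fin m → ℕ // Antitone b ∧ ∀ j, b j ≤ c}, ENNReal.ofReal q ^ ∑ j, b.1 j
  have h := tsum_partition_eq_tsum_cons (m := m) (X := taggedSwivelData lam) (q := q)
  rw [weight_eq] at h
  -- The diagonal values are replaced by `b_5 = a_4 + 1, ..., b_1 = a_0 + 5`. The shifts contribute
  -- `1 + 2 + 3 + 4 + 5 = 15` to the exponent of `q` through the values themselves and `4 + 6 + 2 =
  -- 12` through the differences between `b_1, b_2`, between `b_2, b_3` and between `b_3, b_4`.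
  -- Raising all exponents of the determinant by one contributes `q ^ S`.
  have hterm : ∀ a : {a : Fin 6 → ℕ // Antitone a},
      (ENNReal.ofReal q ^ (∑ i, a.1 i) * T (a.1 5) *
      ∏ t, fillingSum q (DiagPoset.offDiag (taggedSwivelData lam) t)
        (DiagPoset.shiftedDiag (taggedSwivelData lam) a.1 t)) * ENNReal.ofReal (q ^ 27 * q ^ S) =
      ENNReal.ofReal ((normalizer q lam)⁻¹) * (ENNReal.ofReal q ^ a.1 5 * T (a.1 5) *
        ENNReal.ofReal (F (a.1 5) (a.1 4 + 1) (a.1 3 + 2) (a.1 2 + 3) (a.1 1 + 4) (a.1 0 + 5))) := by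
    intro a
    have e : ∀ x w y p v u s : ENNReal, x * y * p = v * (u * s) →
        x * w * y * p = v * (u * w * s) := by
      intro x w y p v u s h
      rw [mul_right_comm x w y, mul_right_comm _ w p, h]
      ring
    rw [prod_fillingSum hq0 hq1 lam a.2, ← ENNReal.ofReal_pow hq0.le, ← ENNReal.ofReal_pow hq0.le]
    refine e _ _ _ _ _ _ _ ?_
    rw [← ENNReal.ofReal_mul (by positivity), ← ENNReal.ofReal_mul' (by positivity),
      ← ENNReal.ofReal_mul (by positivity), ← ENNReal.ofReal_mul (by positivity)]
    congr 1
    simp only [F]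
    rw [powerDet_succ, hZ, Fin.sum_univ_six]
    simp only [pow_add]
    ring
  have hsum : ∀ c : ℕ, ∑' n5 : ℕ, ∑' n4 : ℕ, ∑' n3 : ℕ, ∑' n2 : ℕ, ∑' n1 : ℕ,
      ENNReal.ofReal (F c (c + n5 + 1) (c + n5 + n4 + 2) (c + n5 + n4 + n3 + 3)
        (c + n5 + n4 + n3 + n2 + 4) (c + n5 + n4 + n3 + n2 + n1 + 5)) =
      ENNReal.ofReal (chainFive q (z 0) (z 1) (z 2) (z 3) (z 4)) *
        ENNReal.ofReal q ^ ((S + 13) * c) := by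
    intro c
    rw [← ENNReal.ofReal_pow hq0.le, ← ENNReal.ofReal_mul' (by positivity)]
    have h1 := tsum_stages hq0 hq1 hz (armPow_strictMono hq0 hq1 lam)
      (powerDet_arm_nonneg hq0 hq1 lam) c (F c) fun _ _ _ _ _ => rfl
    rw [hZ] at h1
    have h2 : (q ^ c) ^ 3 * (q ^ 10 * q ^ S) ^ c * chainFive q (z 0) (z 1) (z 2) (z 3) (z 4) =
      chainFive q (z 0) (z 1) (z 2) (z 3) (z 4) * q ^ ((S + 13) * c) := by
      rw [← pow_mul, ← pow_add, ← pow_mul, ← pow_add, mul_comm]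
      congr 2
      ring
    rw [← h2, ← h1]
    refine tsum_congr fun n5 => tsum_congr fun n4 => tsum_congr fun n3 =>
      tsum_congr fun n2 => tsum_congr fun n1 => ?_
    congr 2 <;> omega
  have hmain : (∑' σ : {σ : DiagPoset 6 m (taggedSwivelData lam) → ℕ // Antitone σ},
      ENNReal.ofReal q ^ ∑ x, σ.1 x) *
      (ENNReal.ofReal q ^ (arm lam 1 + 2 * arm lam 2 + 3 * arm lam 3 + 4 * arm lam 4 + 1) *
        ENNReal.ofReal (q ^ 27 * q ^ S)) =
      ENNReal.ofReal ((normalizer q lam)⁻¹ * chainFive q (z 0) (z 1) (z 2) (z 3) (z 4)) *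
        ∏ i ∈ Finset.range (m + 1), (1 - ENNReal.ofReal q ^ (S + 14 + i))⁻¹ := by
    rw [← mul_assoc, h, ← ENNReal.tsum_mul_right, tsum_congr hterm, ENNReal.tsum_mul_left,
      tsum_antitone_six fun a => ENNReal.ofReal q ^ a 5 * T (a 5) *
        ENNReal.ofReal (F (a 5) (a 4 + 1) (a 3 + 2) (a 2 + 3) (a 1 + 4) (a 0 + 5)),
      ENNReal.ofReal_mul (inv_nonneg.2 hN.le), mul_assoc, ← tsum_below_geometric]
    congr 1
    rw [← ENNReal.tsum_mul_left]
    refine tsum_congr fun c => ?_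
    refine Eq.trans (b := ENNReal.ofReal q ^ c * T c *
      (∑' n5 : ℕ, ∑' n4 : ℕ, ∑' n3 : ℕ, ∑' n2 : ℕ, ∑' n1 : ℕ,
      ENNReal.ofReal (F c (c + n5 + 1) (c + n5 + n4 + 2) (c + n5 + n4 + n3 + 3)
        (c + n5 + n4 + n3 + n2 + 4) (c + n5 + n4 + n3 + n2 + n1 + 5)))) ?_ ?_
    · simp only [← ENNReal.tsum_mul_left]
      rfl
    · rw [hsum]
      -- The five summations give `(q ^ c) ^ 3 (q ^ (10 + S)) ^ c`; the value `c` on `x_6` itself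
      -- contributes one more `q ^ c`.
      have e : (S + 14) * c = c + (S + 13) * c := by ring
      rw [e, pow_add]
      ring
  have hpos : 0 < q ^ (arm lam 1 + 2 * arm lam 2 + 3 * arm lam 3 + 4 * arm lam 4 + 1) *
      (q ^ 27 * q ^ S) := by positivity
  rw [← ENNReal.ofReal_pow hq0.le, ← ENNReal.ofReal_mul (by positivity)] at hmain
  have hne : ENNReal.ofReal (q ^ (arm lam 1 + 2 * arm lam 2 + 3 * arm lam 3 + 4 * arm lam 4 + 1) *
      (q ^ 27 * q ^ S)) ≠ 0 := by simpa using hpos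
  rw [mul_comm, ← ENNReal.eq_div_iff hne ENNReal.ofReal_ne_top, ENNReal.mul_div_right_comm,
    ← ENNReal.ofReal_div_of_pos hpos] at hmain
  rw [hmain, rawValue]
  congr 3
  rw [← hS]
  ring

end TaggedSwivel

/-! ### From real values of `q` to formal power series. -/

/-- The power series `F` converges absolutely at `q`, with value `v`. -/
structure PowerSeries.HasValue (F : PowerSeries ℚ) (q v : ℝ) : Prop where
  summable : Summable fun n => ‖((PowerSeries.coeff n F : ℚ) : ℝ) * q ^ n‖
  hasSum : HasSum (fun n => ((PowerSeries.coeff n F : ℚ) : ℝ) * q ^ n) v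

namespace PowerSeries

theorem HasValue.mul {F G : PowerSeries ℚ} {q v w : ℝ} (hF : F.HasValue q v)
    (hG : G.HasValue q w) : (F * G).HasValue q (v * w) := by
  have e : ∀ n, ∑ kl ∈ Finset.HasAntidiagonal.antidiagonal n, (((coeff kl.1 F : ℚ) : ℝ) * q ^ kl.1) *
      (((coeff kl.2 G : ℚ) : ℝ) * q ^ kl.2) = ((coeff n (F * G) : ℚ) : ℝ) * q ^ n := by
    intro n
    rw [coeff_mul]
    push_cast
    rw [Finset.sum_mul]
    refine Finset.sum_congr rfl fun kl hkl => ?_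
    rw [← Finset.HasAntidiagonal.mem_antidiagonal.1 hkl, pow_add]
    ring
  have h1 := summable_norm_sum_mul_antidiagonal_of_summable_norm hF.summable hG.summable
  have h2 := tsum_mul_tsum_eq_tsum_sum_antidiagonal_of_summable_norm hF.summable hG.summable
  simp only [e] at h1 h2
  refine ⟨h1, ?_⟩
  rw [hF.hasSum.tsum_eq, hG.hasSum.tsum_eq] at h2
  rw [h2]
  exact h1.of_norm.hasSum

theorem hasValue_one (q : ℝ) : (1 : PowerSeries ℚ).HasValue q 1 := by
  have h : ∀ n, n ∉ ({0} : Finset ℕ) → ((coeff n (1 : PowerSeries ℚ) : ℚ) : ℝ) * q ^ n = 0 := by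
    intro n hn
    rw [coeff_one, if_neg (by simpa using hn)]
    simp
  refine ⟨summable_of_ne_finset_zero (s := {0}) fun n hn => by rw [h n hn, norm_zero], ?_⟩
  have := hasSum_sum_of_ne_finset_zero (s := {0}) (L := SummationFilter.unconditional ℕ) h
  simpa using this

theorem hasValue_one_sub_X_pow (q : ℝ) {k : ℕ} (hk : 0 < k) :
    (1 - X ^ k : PowerSeries ℚ).HasValue q (1 - q ^ k) := by
  have h : ∀ n, n ∉ ({0, k} : Finset ℕ) →
      ((coeff n (1 - X ^ k : PowerSeries ℚ) : ℚ) : ℝ) * q ^ n = 0 := by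
    intro n hn
    simp only [Finset.mem_insert, Finset.mem_singleton, not_or] at hn
    rw [map_sub, coeff_one, coeff_X_pow, if_neg hn.1, if_neg hn.2]
    simp
  refine ⟨summable_of_ne_finset_zero (s := {0, k}) fun n hn => by rw [h n hn, norm_zero], ?_⟩
  have := hasSum_sum_of_ne_finset_zero (s := {0, k}) (L := SummationFilter.unconditional ℕ) h
  rw [Finset.sum_pair hk.ne] at this
  simpa [coeff_one, coeff_X_pow, hk.ne, hk.ne', sub_eq_add_neg] using this

theorem HasValue.prod {ι : Type*} (s : Finset ι) {F : ι → PowerSeries ℚ} {q : ℝ} {v : ι → ℝ}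
    (h : ∀ i, (F i).HasValue q (v i)) : (∏ i ∈ s, F i).HasValue q (∏ i ∈ s, v i) := by
  classical
  induction s using Finset.induction_on with
  | empty => exact hasValue_one q
  | insert i s hi ih =>
    rw [Finset.prod_insert hi, Finset.prod_insert hi]
    exact (h i).mul ih

end PowerSeries

/-- For `q ≤ 1/2` the tail after the constant term is at most `2 q K`, where `K` is the absolute sum
at `1/2`; since `q` can be arbitrarily small, the constant term vanishes. Dividing by `q` shifts the
coefficients, which gives the induction. -/
theorem eq_zero_of_hasSum_pow (n : ℕ) : ∀ c : ℕ → ℝ,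
    Summable (fun n => ‖c n * (1 / 2 : ℝ) ^ n‖) →
    (∀ q : ℝ, 0 < q → q < 1 → HasSum (fun n => c n * q ^ n) 0) → c n = 0 := by
  have zero : ∀ c : ℕ → ℝ, Summable (fun n => ‖c n * (1 / 2 : ℝ) ^ n‖) →
      (∀ q : ℝ, 0 < q → q < 1 → HasSum (fun n => c n * q ^ n) 0) → c 0 = 0 := by
    intro c hs hc
    set K := ∑' n, ‖c n * (1 / 2 : ℝ) ^ n‖ with hK
    have hK0 : 0 ≤ K := tsum_nonneg fun n => norm_nonneg _
    have key : ∀ q : ℝ, 0 < q → q ≤ 1 / 2 → |c 0| ≤ 2 * q * K := by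
      intro q hq0 hq1
      have h1 := (hasSum_nat_add_iff' 1).2 (hc q hq0 (by linarith))
      have h2 : Summable fun n => ‖c (n + 1) * (1 / 2 : ℝ) ^ (n + 1)‖ :=
        (summable_nat_add_iff 1).2 hs
      have h3 : ∑' n, ‖c (n + 1) * (1 / 2 : ℝ) ^ (n + 1)‖ ≤ K := by
        rw [hK, hs.tsum_eq_zero_add]
        linarith [norm_nonneg (c 0 * (1 / 2 : ℝ) ^ 0)]
      have h4 := tsum_of_norm_bounded (h2.hasSum.mul_left (2 * q))
        (f := fun n => c (n + 1) * q ^ (n + 1)) fun n => by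
          rw [norm_mul, norm_mul, mul_left_comm, norm_pow, norm_pow, Real.norm_of_nonneg hq0.le,
            Real.norm_of_nonneg (by norm_num : (0 : ℝ) ≤ 1 / 2)]
          refine mul_le_mul_of_nonneg_left ?_ (norm_nonneg _)
          have := pow_le_pow_left₀ hq0.le hq1 n
          rw [pow_succ, pow_succ]
          nlinarith
      rw [h1.tsum_eq] at h4
      simp only [Finset.range_one, Finset.sum_singleton, pow_zero, mul_one, zero_sub, norm_neg,
        Real.norm_eq_abs] at h4
      exact h4.trans (mul_le_mul_of_nonneg_left h3 (by linarith))
    by_contra h0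
    have h0' : 0 < |c 0| := abs_pos.2 h0
    have h1 : 0 < 2 * K + 2 * |c 0| := by linarith
    -- This `q` is at most `1/4` and small enough to make `2 q K` less than `|c 0|`; the summand `2
    -- |c 0|` in its denominator also covers `K = 0`.
    have h2 := key (|c 0| / (2 * (2 * K + 2 * |c 0|))) (by positivity) (by
      rw [div_le_div_iff₀ (by positivity) (by norm_num)]
      linarith)
    have h3 : 2 * (|c 0| / (2 * (2 * K + 2 * |c 0|))) * K = |c 0| * (K / (2 * K + 2 * |c 0|)) := by
      field_simp
    rw [h3] at h2
    have h4 : K / (2 * K + 2 * |c 0|) < 1 := by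
      rw [div_lt_one h1]
      linarith
    nlinarith
  induction n with
  | zero => exact zero
  | succ n ih =>
    intro c hs hc
    have h0 := zero c hs hc
    refine ih (fun n => c (n + 1)) ?_ fun q hq0 hq1 => ?_
    · have h2 : Summable fun n => ‖c (n + 1) * (1 / 2 : ℝ) ^ (n + 1)‖ :=
        (summable_nat_add_iff 1).2 hs
      refine (h2.mul_left 2).congr fun n => ?_
      rw [pow_succ, ← mul_assoc, norm_mul]
      norm_num
      ring
    · have h1 := ((hasSum_nat_add_iff' 1).2 (hc q hq0 hq1)).mul_left q⁻¹
      simp only [Finset.range_one, Finset.sum_singleton, h0, zero_mul, sub_zero, mul_zero] at h1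
      refine h1.congr_fun fun n => ?_
      rw [pow_succ]
      field_simp

theorem PowerSeries.eq_one_of_hasValue {F : PowerSeries ℚ}
    (h : ∀ q : ℝ, 0 < q → q < 1 → F.HasValue q 1) : F = 1 := by
  ext n
  have key := eq_zero_of_hasSum_pow n
    (fun n => ((PowerSeries.coeff n F : ℚ) : ℝ) - ((PowerSeries.coeff n (1 : PowerSeries ℚ) : ℚ) : ℝ))
    ?_ fun q hq0 hq1 => ?_
  · exact_mod_cast sub_eq_zero.1 key
  · refine Summable.of_nonneg_of_le (fun n => norm_nonneg _) (fun n => ?_)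
      ((h (1 / 2) (by norm_num) (by norm_num)).summable.add (PowerSeries.hasValue_one (1 / 2)).summable)
    rw [sub_mul]
    exact norm_sub_le _ _
  · have := (h q hq0 hq1).hasSum.sub (PowerSeries.hasValue_one q).hasSum
    rw [sub_self] at this
    exact this.congr_fun fun n => sub_mul _ _ _

theorem finite_antitone_sum_eq (P : Type) [PartialOrder P] [Fintype P] (N : ℕ) :
    Finite {σ : P → ℕ // Antitone σ ∧ ∑ x, σ x = N} := by
  classical
  refine Set.Finite.subset (Set.finite_Icc (0 : P → ℕ) (fun _ : P => N))
    fun σ hσ => ⟨fun _ => Nat.zero_le _, fun x => ?_⟩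
  rw [← hσ.2]
  exact Finset.single_le_sum (f := σ) (fun _ _ => Nat.zero_le _) (Finset.mem_univ x)

theorem tsum_antitone_eq (P : Type) [PartialOrder P] [Fintype P] (Q : ENNReal) :
    ∑' σ : {σ : P → ℕ // Antitone σ}, Q ^ ∑ x, σ.1 x =
      ∑' N : ℕ, (Nat.card {σ : P → ℕ // Antitone σ ∧ ∑ x, σ x = N} : ENNReal) * Q ^ N := by
  let e : ((N : ℕ) × {σ : P → ℕ // Antitone σ ∧ ∑ x, σ x = N}) ≃ {σ : P → ℕ // Antitone σ} :=
    { toFun := fun p => ⟨p.2.1, p.2.2.1⟩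
      invFun := fun σ => ⟨∑ x, σ.1 x, ⟨σ.1, σ.2, rfl⟩⟩
      left_inv := by
        rintro ⟨N, σ, h1, rfl⟩
        rfl
      right_inv := fun σ => rfl }
  rw [← e.tsum_eq, ENNReal.tsum_sigma']
  refine tsum_congr fun N => ?_
  have := finite_antitone_sum_eq P N
  have := Fintype.ofFinite {σ : P → ℕ // Antitone σ ∧ ∑ x, σ x = N}
  have h : ∀ σ : {σ : P → ℕ // Antitone σ ∧ ∑ x, σ x = N},
      Q ^ (∑ x, (e ⟨N, σ⟩).1 x) = Q ^ N := fun σ => congrArg (Q ^ ·) σ.2.2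
  rw [tsum_congr h, tsum_fintype, Finset.sum_const, nsmul_eq_mul, Nat.card_eq_fintype_card]
  rfl

theorem hasValue_pPartitionGF (P : Type) [PartialOrder P] [Fintype P] {q v : ℝ} (hq0 : 0 < q)
    (hv : 0 ≤ v) (h : ∑' σ : {σ : P → ℕ // Antitone σ}, ENNReal.ofReal q ^ ∑ x, σ.1 x =
      ENNReal.ofReal v) : (pPartitionGF P).HasValue q v := by
  rw [tsum_antitone_eq] at h
  have hs := ENNReal.hasSum_toReal (h ▸ ENNReal.ofReal_ne_top)
  have h2 : HasSum (fun n => ((PowerSeries.coeff n (pPartitionGF P) : ℚ) : ℝ) * q ^ n) v := by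
    rw [← ENNReal.tsum_toReal_eq, h, ENNReal.toReal_ofReal hv] at hs
    · refine hs.congr_fun fun n => ?_
      rw [pPartitionGF, PowerSeries.coeff_mk, ENNReal.toReal_mul, ENNReal.toReal_pow,
        ENNReal.toReal_ofReal hq0.le]
      simp
    · intro n
      exact ENNReal.mul_ne_top (ENNReal.natCast_ne_top _) (ENNReal.pow_ne_top ENNReal.ofReal_ne_top)
  refine ⟨h2.summable.congr fun n => ?_, h2⟩
  rw [Real.norm_of_nonneg]
  rw [pPartitionGF, PowerSeries.coeff_mk]
  positivity

/-- Multiplying by the polynomial `∏ (1 - X ^ h)` avoids evaluating infinite products of inverses: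
the product has the value `1` at every `q`, hence is the series `1`. -/
theorem pPartitionGF_eq_prod (P : Type) [PartialOrder P] [Fintype P] {h : P → ℕ}
    (hh : ∀ u, 0 < h u) (H : ∀ q : ℝ, 0 < q → q < 1 →
      ∑' σ : {σ : P → ℕ // Antitone σ}, ENNReal.ofReal q ^ ∑ x, σ.1 x =
        ENNReal.ofReal (∏ u, (1 - q ^ h u)⁻¹)) :
    pPartitionGF P = ∏ u, (1 - (PowerSeries.X : PowerSeries ℚ) ^ h u)⁻¹ := by
  have key : pPartitionGF P * ∏ u, (1 - (PowerSeries.X : PowerSeries ℚ) ^ h u) = 1 := by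
    refine PowerSeries.eq_one_of_hasValue fun q hq0 hq1 => ?_
    have hpos : ∀ u, 0 < 1 - q ^ h u := fun u => by
      have := pow_lt_one₀ hq0.le hq1 (hh u).ne'
      linarith
    have h1 := hasValue_pPartitionGF P hq0
      (Finset.prod_nonneg fun u _ => inv_nonneg.2 (hpos u).le) (H q hq0 hq1)
    have h2 := h1.mul (PowerSeries.HasValue.prod Finset.univ fun u =>
      PowerSeries.hasValue_one_sub_X_pow q (hh u))
    rw [← Finset.prod_mul_distrib, Finset.prod_eq_one fun u _ => inv_mul_cancel₀ (hpos u).ne'] at h2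
    exact h2
  have h3 : (∏ u, (1 - (PowerSeries.X : PowerSeries ℚ) ^ h u)) *
      ∏ u, (1 - (PowerSeries.X : PowerSeries ℚ) ^ h u)⁻¹ = 1 := by
    rw [← Finset.prod_mul_distrib]
    refine Finset.prod_eq_one fun u _ => PowerSeries.mul_inv_cancel _ ?_
    simp [(hh u).ne']
  calc pPartitionGF P = pPartitionGF P * ((∏ u, (1 - (PowerSeries.X : PowerSeries ℚ) ^ h u)) *
      ∏ u, (1 - (PowerSeries.X : PowerSeries ℚ) ^ h u)⁻¹) := by rw [h3, mul_one]
    _ = _ := by rw [← mul_assoc, key, one_mul]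

/-! ### Double-tailed diamonds inside a poset. -/

namespace DoubleTailedDiamond

variable {k : ℕ}

/-- The maximal element. -/
def summit (hk : 3 ≤ k) : DoubleTailedDiamond k := neck ⟨k - 3, by omega⟩

theorem rank_summit (hk : 3 ≤ k) : (summit hk).rank = 2 * k - 4 := by
  simp only [summit, rank]
  omega

theorem eq_summit_iff (hk : 3 ≤ k) {a : DoubleTailedDiamond k} :
    a = summit hk ↔ ¬ a.rank < 2 * k - 4 := by
  constructor
  · rintro rfl
    rw [rank_summit]
    omega
  · intro h
    cases a with
    | tail i => have := i.isLt; simp only [rank] at h; omega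
    | left => simp only [rank] at h; omega
    | right => simp only [rank] at h; omega
    | neck i =>
      have := i.isLt
      simp only [rank] at h
      simp only [summit, neck.injEq, Fin.ext_iff]
      omega

theorem le_summit (hk : 3 ≤ k) (a : DoubleTailedDiamond k) : a ≤ summit hk := by
  by_cases h : a.rank < 2 * k - 4
  · exact Or.inr (by rw [rank_summit]; exact h)
  · exact Or.inl ((eq_summit_iff hk).2 h)

theorem isMax_iff (hk : 3 ≤ k) {a : DoubleTailedDiamond k} : ¬ IsMax a ↔ a.rank < 2 * k - 4 := by
  constructor
  · intro h
    by_contra h'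
    refine h fun b _ => ?_
    rw [(eq_summit_iff hk).2 h']
    exact le_summit hk b
  · intro h hm
    have := hm (le_summit hk a)
    have := rank_le_of_le this
    rw [rank_summit] at this
    omega

theorem lt_iff_rank {a b : DoubleTailedDiamond k} : a < b ↔ a.rank < b.rank := by
  constructor
  · intro h
    rcases h.le with h' | h'
    · exact absurd h' h.ne
    · exact h'
  · intro h
    refine lt_of_le_of_ne (Or.inr h) ?_
    rintro rfl
    omega

end DoubleTailedDiamond

open DoubleTailedDiamond

/-- `f` parametrises the `d_k^-`-convex set `I`; its value at the maximal element is arbitrary. -/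
structure IsDMinusEmbedding {P : Type} [PartialOrder P] (k : ℕ) (I : Set P)
    (f : DoubleTailedDiamond k → P) : Prop where
  le_iff : ∀ a b, a.rank < 2 * k - 4 → b.rank < 2 * k - 4 → (f a ≤ f b ↔ a ≤ b)
  mem_iff : ∀ x, x ∈ I ↔ ∃ a, a.rank < 2 * k - 4 ∧ f a = x
  ordConnected : I.OrdConnected

section

variable {P : Type} [PartialOrder P] {k : ℕ}

theorem IsDMinusConvex.exists_embedding (hk : 3 ≤ k) {I : Set P} (h : IsDMinusConvex k I) :
    ∃ f, IsDMinusEmbedding k I f := by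
  classical
  obtain ⟨hc, ⟨e⟩⟩ := h
  have hbot : (tail ⟨0, by omega⟩ : DoubleTailedDiamond k).rank < 2 * k - 4 := by
    simp only [rank]
    omega
  refine ⟨fun a => if h : a.rank < 2 * k - 4 then e.symm ⟨a, (isMax_iff hk).2 h⟩
    else e.symm ⟨_, (isMax_iff hk).2 hbot⟩, fun a b ha hb => ?_, fun x => ?_, hc⟩
  · simp only [ha, hb, dif_pos]
    rw [Subtype.coe_le_coe, e.symm.le_iff_le]
    rfl
  · constructor
    · intro hx
      refine ⟨(e ⟨x, hx⟩).1, (isMax_iff hk).1 (e ⟨x, hx⟩).2, ?_⟩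
      rw [dif_pos ((isMax_iff hk).1 (e ⟨x, hx⟩).2)]
      simp
    · rintro ⟨a, ha, rfl⟩
      rw [dif_pos ha]
      exact (e.symm _).2

/-- A `d_k`-interval without its top is a convex set of the kind treated here, so every restriction
on such convex sets also restricts intervals. -/
theorem dInterval_embedding (hk : 3 ≤ k) {w z : P} (e : Set.Icc w z ≃o DoubleTailedDiamond k) :
    IsDMinusEmbedding k (Set.Icc w z \ {z}) (fun a => (e.symm a : P)) ∧
      (e.symm (summit hk) : P) = z := by
  have hle : ∀ a b, (e.symm a : P) ≤ e.symm b ↔ a ≤ b := fun a b => by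
    rw [Subtype.coe_le_coe, e.symm.le_iff_le]
  have hz : (e.symm (summit hk) : P) = z := by
    refine le_antisymm (e.symm (summit hk)).2.2 ?_
    by_cases hwz : w ≤ z
    · have := (hle (e ⟨z, hwz, le_rfl⟩) (summit hk)).2 (le_summit hk _)
      simpa using this
    · exact absurd ((e.symm (summit hk)).2.1.trans (e.symm (summit hk)).2.2) hwz
  refine ⟨⟨fun a b _ _ => hle a b, fun x => ?_, ?_⟩, hz⟩
  · constructor
    · rintro ⟨hx, hxz⟩
      refine ⟨e ⟨x, hx⟩, ?_, by simp⟩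
      by_contra h
      rw [← eq_summit_iff hk] at h
      apply hxz
      rw [Set.mem_singleton_iff, ← hz, ← h]
      simp
    · rintro ⟨a, ha, rfl⟩
      refine ⟨(e.symm a).2, fun h => ?_⟩
      have h2 : a = summit hk := e.symm.injective (Subtype.ext (h.trans hz.symm))
      exact (eq_summit_iff hk).1 h2 ha
  · refine ⟨fun x hx y hy a ha => ⟨⟨hx.1.1.trans ha.1, ha.2.trans hy.1.2⟩, ?_⟩⟩
    rintro rfl
    exact hy.2 (le_antisymm hy.1.2 ha.2)

namespace IsDMinusEmbedding

variable {I : Set P} {f : DoubleTailedDiamond k → P}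

theorem lt_iff (h : IsDMinusEmbedding k I f) {a b : DoubleTailedDiamond k}
    (ha : a.rank < 2 * k - 4) (hb : b.rank < 2 * k - 4) : f a < f b ↔ a.rank < b.rank := by
  rw [← lt_iff_rank, lt_iff_le_not_ge, lt_iff_le_not_ge, h.le_iff a b ha hb, h.le_iff b a hb ha]

theorem injOn (h : IsDMinusEmbedding k I f) {a b : DoubleTailedDiamond k}
    (ha : a.rank < 2 * k - 4) (hb : b.rank < 2 * k - 4) (hab : f a = f b) : a = b :=
  le_antisymm ((h.le_iff a b ha hb).1 hab.le) ((h.le_iff b a hb ha).1 hab.ge)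

theorem mem (h : IsDMinusEmbedding k I f) {a : DoubleTailedDiamond k}
    (ha : a.rank < 2 * k - 4) : f a ∈ I := (h.mem_iff _).2 ⟨a, ha, rfl⟩

/-- By convexity, any element strictly between two elements of `I` belongs to `I`, where there is no
rank strictly between two consecutive ones. -/
theorem covBy (h : IsDMinusEmbedding k I f) {a b : DoubleTailedDiamond k}
    (hb : b.rank < 2 * k - 4) (hab : b.rank = a.rank + 1) : f a ⋖ f b := by
  refine ⟨(h.lt_iff (by omega) hb).2 (by omega), fun x hx hx' => ?_⟩
  have hx2 : x ∈ I := h.ordConnected.out (h.mem (by omega)) (h.mem hb) ⟨hx.le, hx'.le⟩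
  obtain ⟨c, hc, rfl⟩ := (h.mem_iff x).1 hx2
  rw [h.lt_iff (by omega) hc] at hx
  rw [h.lt_iff hc hb] at hx'
  omega

theorem isDInterval (h : IsDMinusEmbedding k I f) (hk : 3 ≤ k) {w z : P}
    (hI : insert z I = Set.Icc w z) (hz : z ∉ I) : IsDInterval k w z := by
  classical
  let g : DoubleTailedDiamond k → P := fun a => if a.rank < 2 * k - 4 then f a else z
  have hIz : ∀ x ∈ I, x ≤ z := fun x hx => by
    have : x ∈ Set.Icc w z := hI ▸ Set.mem_insert_of_mem z hx
    exact this.2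
  have hg : ∀ a b, g a ≤ g b ↔ a ≤ b := by
    intro a b
    by_cases ha : a.rank < 2 * k - 4 <;> by_cases hb : b.rank < 2 * k - 4
    · simp only [g, ha, hb, if_true]
      exact h.le_iff a b ha hb
    · simp only [g, ha, hb, if_true, if_false]
      exact iff_of_true (hIz _ (h.mem ha)) ((eq_summit_iff hk).2 hb ▸ le_summit hk a)
    · simp only [g, ha, hb, if_true, if_false]
      refine iff_of_false (fun h' => hz ?_) fun h' => ?_
      · rw [le_antisymm h' (hIz _ (h.mem hb))]
        exact h.mem hb
      · have := rank_le_of_le h'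
        omega
    · simp only [g, ha, hb, if_false]
      exact iff_of_true le_rfl
        (by rw [(eq_summit_iff hk).2 ha, (eq_summit_iff hk).2 hb])
  have hmem : ∀ a, g a ∈ Set.Icc w z := by
    intro a
    rw [← hI]
    by_cases ha : a.rank < 2 * k - 4
    · simp only [g, ha, if_true]
      exact Set.mem_insert_of_mem z (h.mem ha)
    · simp only [g, ha, if_false]
      exact Set.mem_insert z I
  have hbij : Function.Bijective fun a => (⟨g a, hmem a⟩ : Set.Icc w z) := by
    refine ⟨fun a b hab => ?_, fun y => ?_⟩
    · have : g a = g b := congrArg Subtype.val hab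
      exact le_antisymm ((hg _ _).1 this.le) ((hg _ _).1 this.ge)
    · obtain ⟨y, hy⟩ := y
      have hy' := hy
      rw [← hI] at hy'
      rcases hy' with rfl | hy'
      · refine ⟨summit hk, Subtype.ext ?_⟩
        simp [g, rank_summit]
      · obtain ⟨a, ha, rfl⟩ := (h.mem_iff y).1 hy'
        refine ⟨a, Subtype.ext ?_⟩
        simp [g, ha]
  exact ⟨OrderIso.symm { Equiv.ofBijective _ hbij with map_rel_iff' := fun {a b} => hg a b }⟩

end IsDMinusEmbedding

/-- Any two upper covers of an element are covered by a common element, and there are at most two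
of them. -/
def CoversClose (P : Type) [PartialOrder P] : Prop :=
  ∀ w x y : P, w ⋖ x → w ⋖ y → x ≠ y → (∃ z, x ⋖ z ∧ y ⋖ z) ∧ ∀ v, w ⋖ v → v = x ∨ v = y

namespace IsDMinusEmbedding

variable {I : Set P} {f : DoubleTailedDiamond k → P}

theorem eq_of_covBy_mem (h : IsDMinusEmbedding k I f) {i : ℕ} (hi : i + 1 < k - 2) {u : P}
    (hu : f (tail ⟨i, by omega⟩) ⋖ u) (huI : u ∈ I) : u = f (tail ⟨i + 1, hi⟩) := by
  have hcov : f (tail ⟨i, by omega⟩) ⋖ f (tail ⟨i + 1, hi⟩) :=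
    h.covBy (by simp only [rank]; omega) (by simp only [rank])
  obtain ⟨a, ha, rfl⟩ := (h.mem_iff u).1 huI
  have h1 := (h.lt_iff (by simp only [rank]; omega) ha).1 hu.lt
  have h2 : tail ⟨i + 1, hi⟩ ≤ a := by
    rcases Nat.lt_or_ge (i + 1) a.rank with h3 | h3
    · exact Or.inr h3
    · left
      cases a with
      | tail j =>
        simp only [rank] at h1 h3
        simp only [tail.injEq, Fin.ext_iff]
        omega
      | left => simp only [rank] at h1 h3; omega
      | right => simp only [rank] at h1 h3; omega
      | neck j => simp only [rank] at h1 h3; omega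
  have h3 := (h.le_iff _ _ (by simp only [rank]; omega) ha).2 h2
  exact (hu.eq_or_eq hcov.le h3 |>.resolve_left hcov.ne').symm

theorem left_ne_right (h : IsDMinusEmbedding k I f) (hk : 3 ≤ k) : f left ≠ f right := fun h' => by
  have := h.injOn (a := left) (b := right) (by simp only [rank]; omega)
    (by simp only [rank]; omega) h'
  cases this

/-- Descending induction along the tail. A second upper cover `u` of a tail element would have a
common upper cover with the next tail element. That common cover belongs to `I`, being a side or, by
induction, the tail element after the next; so `u` belongs to `I` by convexity, and the next tail
element is the only upper cover inside `I`. -/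
theorem tail_covBy (h : IsDMinusEmbedding k I f) (hP : CoversClose P) (d : ℕ) :
    ∀ (i : ℕ) (hi : i + 1 < k - 2), i + 2 + d = k - 2 → ∀ u, f (tail ⟨i, by omega⟩) ⋖ u →
      u = f (tail ⟨i + 1, hi⟩) := by
  induction d with
  | zero =>
    intro i hi hd u hu
    by_contra hne
    have hcov : f (tail ⟨i, by omega⟩) ⋖ f (tail ⟨i + 1, hi⟩) :=
      h.covBy (by simp only [rank]; omega) (by simp only [rank])
    obtain ⟨⟨j, hj1, hj2⟩, -⟩ := hP _ _ _ hcov hu (Ne.symm hne)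
    have hl : f (tail ⟨i + 1, hi⟩) ⋖ f left :=
      h.covBy (by simp only [rank]; omega) (by simp only [rank]; omega)
    have hr : f (tail ⟨i + 1, hi⟩) ⋖ f right :=
      h.covBy (by simp only [rank]; omega) (by simp only [rank]; omega)
    have hjI : j ∈ I := by
      rcases (hP _ _ _ hl hr (h.left_ne_right (by omega))).2 j hj1 with rfl | rfl
      · exact h.mem (by simp only [rank]; omega)
      · exact h.mem (by simp only [rank]; omega)
    exact hne (h.eq_of_covBy_mem hi hu (h.ordConnected.out (h.mem (a := tail ⟨i, by omega⟩)
      (by simp only [rank]; omega)) hjI ⟨hu.le, hj2.le⟩))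
  | succ d ih =>
    intro i hi hd u hu
    by_contra hne
    have hcov : f (tail ⟨i, by omega⟩) ⋖ f (tail ⟨i + 1, hi⟩) :=
      h.covBy (by simp only [rank]; omega) (by simp only [rank])
    obtain ⟨⟨j, hj1, hj2⟩, -⟩ := hP _ _ _ hcov hu (Ne.symm hne)
    have hjI : j ∈ I := by
      rw [ih (i + 1) (by omega) (by omega) j hj1]
      exact h.mem (by simp only [rank]; omega)
    exact hne (h.eq_of_covBy_mem hi hu (h.ordConnected.out (h.mem (a := tail ⟨i, by omega⟩)
      (by simp only [rank]; omega)) hjI ⟨hu.le, hj2.le⟩))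

/-- Every tail element below the last one has a unique upper cover. -/
theorem eq_of_tail_covBy (h : IsDMinusEmbedding k I f) (hP : CoversClose P) {i : ℕ}
    (hi : i + 1 < k - 2) {u : P} (hu : f (tail ⟨i, by omega⟩) ⋖ u) : u = f (tail ⟨i + 1, hi⟩) :=
  h.tail_covBy hP (k - 2 - (i + 2)) i hi (by omega) u hu

end IsDMinusEmbedding

end

/-! ### The tagged swivel as a subset of the plane. -/

/-- The set of the coordinates of the elements of a tagged swivel; row `i` of the large diagram is
`u = 2 i`, `i ≤ v ≤ L_i`, and the chain above it is `u = v ≤ 0`. -/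
inductive InSwivel (L1 L2 L3 L4 L5 u v : ℤ) : Prop
  | row1 (hu : u = 2) (h : 1 ≤ v) (h' : v ≤ L1)
  | row2 (hu : u = 4) (h : 2 ≤ v) (h' : v ≤ L2)
  | row3 (hu : u = 6) (h : 3 ≤ v) (h' : v ≤ L3)
  | row4 (hu : u = 8) (h : 4 ≤ v) (h' : v ≤ L4)
  | row5 (hu : u = 10) (h : 5 ≤ v) (h' : v ≤ L5)
  | chain (hu : u = v) (h : 1 - L1 ≤ u) (h' : u ≤ 0)
  | p9 (hu : u = 9) (hv : v = 4)
  | p7 (hu : u = 7) (hv : v = 3)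
  | p12 (hu : u = 12) (hv : v = 3)
  | p5 (hu : u = 5) (hv : v = 2)
  | p31 (hu : u = 3) (hv : v = 1)
  | p30 (hu : u = 3) (hv : v = 0)
  | p1 (hu : u = 1) (hv : v = 0)
  | p0 (hu : u = 0) (hv : v = 1)

/-- The covering relation of a tagged swivel in coordinates: `(u', v')` covers `(u, v)`. -/
inductive UpSwivel (u v u' v' : ℤ) : Prop
  | left (hu : u = 4 ∨ u = 6 ∨ u = 8 ∨ u = 10) (hv : u < 2 * v) (hu' : u' = u) (hv' : v' = v - 1)
  | up (hu : u = 4 ∨ u = 6 ∨ u = 8 ∨ u = 10) (hv : u ≤ 2 * v) (hu' : u' = u - 2) (hv' : v' = v)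
  | diag (hu : u = 4 ∨ u = 6 ∨ u = 8 ∨ u = 10) (hv : u = 2 * v) (hu' : u' = u - 1)
      (hv' : v' = v - 1)
  | left1 (hu : u = 2) (hv : 2 ≤ v) (hu' : u' = 2) (hv' : v' = v - 1)
  | diag1 (hu : u = 2) (hv : v = 1) (hu' : u' = 1) (hv' : v' = 0)
  | diag1' (hu : u = 2) (hv : v = 1) (hu' : u' = 0) (hv' : v' = 1)
  | chain (hu : u = v) (hv : u ≤ 0) (hu' : u' = u - 1) (hv' : v' = v - 1)
  | p9 (hu : u = 9) (hv : v = 4) (hu' : u' = 8) (hv' : v' = 4)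
  | p7 (hu : u = 7) (hv : v = 3) (hu' : u' = 6) (hv' : v' = 3)
  | p12 (hu : u = 12) (hv : v = 3) (hu' : u' = 7) (hv' : v' = 3)
  | p5 (hu : u = 5) (hv : v = 2) (hu' : u' = 4) (hv' : v' = 2)
  | p31 (hu : u = 3) (hv : v = 1) (hu' : u' = 3) (hv' : v' = 0)
  | p31' (hu : u = 3) (hv : v = 1) (hu' : u' = 2) (hv' : v' = 1)
  | p30 (hu : u = 3) (hv : v = 0) (hu' : u' = 1) (hv' : v' = 0)
  | p1 (hu : u = 1) (hv : v = 0) (hu' : u' = 0) (hv' : v' = 0)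
  | p0 (hu : u = 0) (hv : v = 1) (hu' : u' = 0) (hv' : v' = 0)

/-- Coordinates on a poset that identify it with a tagged swivel. -/
structure SwivelCoord (P : Type) [PartialOrder P] (L1 L2 L3 L4 L5 : ℤ) (U V : P → ℤ) : Prop where
  le_iff : ∀ x y, x ≤ y ↔ U y ≤ U x ∧ V y ≤ V x
  mem : ∀ x, InSwivel L1 L2 L3 L4 L5 (U x) (V x)
  exists_mem : ∀ u v, InSwivel L1 L2 L3 L4 L5 u v → ∃ x, U x = u ∧ V x = v
  five_le : 5 ≤ L5
  le5 : L5 ≤ L4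
  le4 : L4 ≤ L3
  le3 : L3 ≤ L2
  le2 : L2 ≤ L1

/-- The steps generate the coordinate order: whenever one point lies strictly below another, some
step leads upwards and stays below the target. In rows two to five it goes left, or to the
odd-numbered point at the diagonal, if the target is further left, and up otherwise. This is used
both to identify the covering relation and to prove that the coordinate order is the order of the
poset. -/
theorem exists_upSwivel {L1 L2 L3 L4 L5 : ℤ} (h5 : 5 ≤ L5) (h4 : L5 ≤ L4) (h3 : L4 ≤ L3)
    (h2 : L3 ≤ L2) (h1 : L2 ≤ L1) {u v a b : ℤ} (h : InSwivel L1 L2 L3 L4 L5 u v)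
    (hab : InSwivel L1 L2 L3 L4 L5 a b) (hu : a ≤ u) (hv : b ≤ v) (hne : ¬ (a = u ∧ b = v)) :
    ∃ u' v', UpSwivel u v u' v' ∧ InSwivel L1 L2 L3 L4 L5 u' v' ∧ a ≤ u' ∧ b ≤ v' := by
  have leftCase : ∀ s : ℤ, u = 2 * s → s < v → (s = 2 ∨ s = 3 ∨ s = 4 ∨ s = 5) → b < v →
      InSwivel L1 L2 L3 L4 L5 u (v - 1) →
      ∃ u' v', UpSwivel u v u' v' ∧ InSwivel L1 L2 L3 L4 L5 u' v' ∧ a ≤ u' ∧ b ≤ v' :=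
    fun s h1 h2 h3 h4 h5 => ⟨u, v - 1, .left (by omega) (by omega) rfl rfl, h5, hu, by omega⟩
  have upCase : ∀ s : ℤ, u = 2 * s → s ≤ v → (s = 2 ∨ s = 3 ∨ s = 4 ∨ s = 5) → ¬ b < v →
      InSwivel L1 L2 L3 L4 L5 (u - 2) v →
      ∃ u' v', UpSwivel u v u' v' ∧ InSwivel L1 L2 L3 L4 L5 u' v' ∧ a ≤ u' ∧ b ≤ v' :=
    fun s h1 h2 h3 h4 h5 => ⟨u - 2, v, .up (by omega) (by omega) rfl rfl, h5,
      by cases hab <;> omega, hv⟩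
  have diagCase : ∀ s : ℤ, u = 2 * s → s = v → (s = 2 ∨ s = 3 ∨ s = 4 ∨ s = 5) → b < v →
      InSwivel L1 L2 L3 L4 L5 (u - 1) (v - 1) →
      ∃ u' v', UpSwivel u v u' v' ∧ InSwivel L1 L2 L3 L4 L5 u' v' ∧ a ≤ u' ∧ b ≤ v' :=
    fun s h1 h2 h3 h4 h5 => ⟨u - 1, v - 1, .diag (by omega) (by omega) rfl rfl, h5,
      by cases hab <;> omega, by omega⟩
  cases h with
  | row1 h6 h7 h8 =>
    by_cases hv1 : v = 1
    · by_cases hb : b < 1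
      · exact ⟨1, 0, .diag1 h6 hv1 rfl rfl, .p1 rfl rfl, by cases hab <;> omega, by omega⟩
      · exact ⟨0, 1, .diag1' h6 hv1 rfl rfl, .p0 rfl rfl, by cases hab <;> omega, by omega⟩
    · exact ⟨2, v - 1, .left1 h6 (by omega) rfl rfl, .row1 rfl (by omega) (by omega), by omega,
        by cases hab <;> omega⟩
  | row2 h6 h7 h8 =>
    by_cases hb : b < v
    · by_cases hv1 : v = 2
      · exact diagCase 2 h6 hv1.symm (by omega) hb (.p31 (by omega) (by omega))
      · exact leftCase 2 h6 (by omega) (by omega) hb (.row2 (by omega) (by omega) (by omega))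
    · exact upCase 2 h6 h7 (by omega) hb (.row1 (by omega) (by omega) (by omega))
  | row3 h6 h7 h8 =>
    by_cases hb : b < v
    · by_cases hv1 : v = 3
      · exact diagCase 3 h6 hv1.symm (by omega) hb (.p5 (by omega) (by omega))
      · exact leftCase 3 h6 (by omega) (by omega) hb (.row3 (by omega) (by omega) (by omega))
    · exact upCase 3 h6 h7 (by omega) hb (.row2 (by omega) (by omega) (by omega))
  | row4 h6 h7 h8 =>
    by_cases hb : b < v
    · by_cases hv1 : v = 4
      · exact diagCase 4 h6 hv1.symm (by omega) hb (.p7 (by omega) (by omega))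
      · exact leftCase 4 h6 (by omega) (by omega) hb (.row4 (by omega) (by omega) (by omega))
    · exact upCase 4 h6 h7 (by omega) hb (.row3 (by omega) (by omega) (by omega))
  | row5 h6 h7 h8 =>
    by_cases hb : b < v
    · by_cases hv1 : v = 5
      · exact diagCase 5 h6 hv1.symm (by omega) hb (.p9 (by omega) (by omega))
      · exact leftCase 5 h6 (by omega) (by omega) hb (.row5 (by omega) (by omega) (by omega))
    · exact upCase 5 h6 h7 (by omega) hb (.row4 (by omega) (by omega) (by omega))
  | chain h6 h7 h8 =>
    exact ⟨u - 1, v - 1, .chain h6 h8 rfl rfl, .chain (by omega) (by cases hab <;> omega)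
      (by omega), by cases hab <;> omega, by cases hab <;> omega⟩
  | p9 h6 h7 =>
    exact ⟨8, 4, .p9 h6 h7 rfl rfl, .row4 rfl (by omega) (by omega), by cases hab <;> omega,
      by omega⟩
  | p7 h6 h7 =>
    exact ⟨6, 3, .p7 h6 h7 rfl rfl, .row3 rfl (by omega) (by omega), by cases hab <;> omega,
      by omega⟩
  | p12 h6 h7 =>
    exact ⟨7, 3, .p12 h6 h7 rfl rfl, .p7 rfl rfl, by cases hab <;> omega, by omega⟩
  | p5 h6 h7 =>
    exact ⟨4, 2, .p5 h6 h7 rfl rfl, .row2 rfl (by omega) (by omega), by cases hab <;> omega,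
      by omega⟩
  | p31 h6 h7 =>
    by_cases hb : b < 1
    · exact ⟨3, 0, .p31 h6 h7 rfl rfl, .p30 rfl rfl, by omega, by omega⟩
    · exact ⟨2, 1, .p31' h6 h7 rfl rfl, .row1 rfl (by omega) (by omega), by cases hab <;> omega,
        by omega⟩
  | p30 h6 h7 =>
    exact ⟨1, 0, .p30 h6 h7 rfl rfl, .p1 rfl rfl, by cases hab <;> omega, by omega⟩
  | p1 h6 h7 =>
    exact ⟨0, 0, .p1 h6 h7 rfl rfl, .chain rfl (by omega) (by omega), by cases hab <;> omega,
      by omega⟩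
  | p0 h6 h7 =>
    exact ⟨0, 0, .p0 h6 h7 rfl rfl, .chain rfl (by omega) (by omega), by omega,
      by cases hab <;> omega⟩

theorem UpSwivel.between {L1 L2 L3 L4 L5 u v u' v' a b : ℤ} (h : UpSwivel u v u' v')
    (hab : InSwivel L1 L2 L3 L4 L5 a b) (h1 : u' ≤ a) (h2 : a ≤ u) (h3 : v' ≤ b) (h4 : b ≤ v) :
    (a = u ∧ b = v) ∨ (a = u' ∧ b = v') := by
  cases h <;> cases hab <;> omega

theorem UpSwivel.le {u v u' v' : ℤ} (h : UpSwivel u v u' v') :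
    u' ≤ u ∧ v' ≤ v ∧ ¬ (u' = u ∧ v' = v) := by
  cases h <;> omega

namespace SwivelCoord

variable {P : Type} [PartialOrder P] {L1 L2 L3 L4 L5 : ℤ} {U V : P → ℤ}

theorem ext (h : SwivelCoord P L1 L2 L3 L4 L5 U V) {x y : P} (hu : U x = U y) (hv : V x = V y) :
    x = y :=
  le_antisymm ((h.le_iff x y).2 ⟨hu.ge, hv.ge⟩) ((h.le_iff y x).2 ⟨hu.le, hv.le⟩)

theorem lt_iff (h : SwivelCoord P L1 L2 L3 L4 L5 U V) {x y : P} :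
    x < y ↔ U y ≤ U x ∧ V y ≤ V x ∧ ¬ (U y = U x ∧ V y = V x) := by
  rw [lt_iff_le_not_ge, h.le_iff, h.le_iff]
  omega

theorem covBy_iff (h : SwivelCoord P L1 L2 L3 L4 L5 U V) {x y : P} :
    x ⋖ y ↔ UpSwivel (U x) (V x) (U y) (V y) := by
  constructor
  · intro hxy
    have h1 := h.lt_iff.1 hxy.lt
    obtain ⟨u', v', h2, h3, h4, h5⟩ := exists_upSwivel h.five_le h.le5 h.le4 h.le3 h.le2
      (h.mem x) (h.mem y) h1.1 h1.2.1 h1.2.2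
    obtain ⟨z, rfl, rfl⟩ := h.exists_mem u' v' h3
    have hz := h2.le
    rcases hxy.eq_or_eq ((h.le_iff x z).2 ⟨hz.1, hz.2.1⟩) ((h.le_iff z y).2 ⟨h4, h5⟩) with
      rfl | rfl
    · exact absurd ⟨rfl, rfl⟩ hz.2.2
    · exact h2
  · intro hxy
    refine ⟨h.lt_iff.2 hxy.le, fun z hz1 hz2 => ?_⟩
    have h1 := h.lt_iff.1 hz1
    have h2 := h.lt_iff.1 hz2
    have := hxy.between (h.mem z) h2.1 h1.1 h2.2.1 h1.2.1
    omega

end SwivelCoord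

/-! ### Squares and longer intervals. -/

/-- The diamonds of a tagged swivel: bottom `(u, v)`, sides `(ux, vx)` and `(uy, vy)`, top
`(uz, vz)`. -/
inductive DiamondSwivel (u v ux vx uy vy uz vz : ℤ) : Prop
  | row (hu : u = 4 ∨ u = 6 ∨ u = 8 ∨ u = 10) (hv : u < 2 * v) (hux : ux = u) (hvx : vx = v - 1)
      (huy : uy = u - 2) (hvy : vy = v) (huz : uz = u - 2) (hvz : vz = v - 1)
  | diag (hu : u = 4 ∨ u = 6 ∨ u = 8 ∨ u = 10) (hv : u = 2 * v) (hux : ux = u - 1)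
      (hvx : vx = v - 1) (huy : uy = u - 2) (hvy : vy = v) (huz : uz = u - 2) (hvz : vz = v - 1)
  | diag1 (hu : u = 2) (hv : v = 1) (hux : ux = 1) (hvx : vx = 0) (huy : uy = 0) (hvy : vy = 1)
      (huz : uz = 0) (hvz : vz = 0)
  | p31 (hu : u = 3) (hv : v = 1) (hux : ux = 3) (hvx : vx = 0) (huy : uy = 2) (hvy : vy = 1)
      (huz : uz = 1) (hvz : vz = 0)

/-- The longer intervals: bottom `(u, v)`, sides `(ux, vx)` and `(uy, vy)`, top `(uz, vz)`, and the
element `(ut, vt)` below the top. -/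
inductive LongSwivel (k u v ux vx uy vy ut vt uz vz : ℤ) : Prop
  | p9 (hk : k = 4) (hu : u = 9) (hv : v = 4) (hux : ux = 7) (hvx : vx = 3) (huy : uy = 6)
      (hvy : vy = 4) (hut : ut = 6) (hvt : vt = 3) (huz : uz = 5) (hvz : vz = 2)
  | p7 (hk : k = 4) (hu : u = 7) (hv : v = 3) (hux : ux = 5) (hvx : vx = 2) (huy : uy = 4)
      (hvy : vy = 3) (hut : ut = 4) (hvt : vt = 2) (huz : uz = 3) (hvz : vz = 1)
  | p5 (hk : k = 4) (hu : u = 5) (hv : v = 2) (hux : ux = 3) (hvx : vx = 1) (huy : uy = 2)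
      (hvy : vy = 2) (hut : ut = 2) (hvt : vt = 1) (huz : uz = 0) (hvz : vz = 1)
  | p12 (hk : k = 5) (hu : u = 12) (hv : v = 3) (hux : ux = 5) (hvx : vx = 2) (huy : uy = 4)
      (hvy : vy = 3) (hut : ut = 3) (hvt : vt = 1) (huz : uz = 3) (hvz : vz = 0)
  | row (hk : 4 ≤ k) (hu : u = 2) (hv : v = k - 2) (hux : ux = 1) (hvx : vx = 0) (huy : uy = 0)
      (hvy : vy = 1) (hut : ut = 4 - k) (hvt : vt = 4 - k) (huz : uz = 3 - k) (hvz : vz = 3 - k)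

namespace InSwivel

variable {L1 L2 L3 L4 L5 u v : ℤ}

theorem up_mem (h : InSwivel L1 L2 L3 L4 L5 u v) (hu : u = 4 ∨ u = 6 ∨ u = 8 ∨ u = 10)
    (h4 : L5 ≤ L4) (h3 : L4 ≤ L3) (h2 : L3 ≤ L2) (h1 : L2 ≤ L1) :
    InSwivel L1 L2 L3 L4 L5 (u - 2) v := by
  cases h with
  | row2 => exact .row1 (by omega) (by omega) (by omega)
  | row3 => exact .row2 (by omega) (by omega) (by omega)
  | row4 => exact .row3 (by omega) (by omega) (by omega)
  | row5 => exact .row4 (by omega) (by omega) (by omega)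
  | _ => omega

theorem left_mem (h : InSwivel L1 L2 L3 L4 L5 u v) (hu : u = 4 ∨ u = 6 ∨ u = 8 ∨ u = 10)
    (hv : u < 2 * v) : InSwivel L1 L2 L3 L4 L5 u (v - 1) := by
  cases h with
  | row2 => exact .row2 (by omega) (by omega) (by omega)
  | row3 => exact .row3 (by omega) (by omega) (by omega)
  | row4 => exact .row4 (by omega) (by omega) (by omega)
  | row5 => exact .row5 (by omega) (by omega) (by omega)
  | _ => omega

theorem diag_mem (hu : u = 4 ∨ u = 6 ∨ u = 8 ∨ u = 10) (hv : u = 2 * v) :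
    InSwivel L1 L2 L3 L4 L5 (u - 1) (v - 1) := by
  rcases hu with h | h | h | h
  · exact .p31 (by omega) (by omega)
  · exact .p5 (by omega) (by omega)
  · exact .p7 (by omega) (by omega)
  · exact .p9 (by omega) (by omega)

end InSwivel

namespace UpSwivel

theorem diamond {u v ux vx uy vy : ℤ} (hx : UpSwivel u v ux vx) (hy : UpSwivel u v uy vy)
    (hne : ¬ (ux = uy ∧ vx = vy)) : ∃ uz vz, DiamondSwivel u v ux vx uy vy uz vz ∨
      DiamondSwivel u v uy vy ux vx uz vz := by
  have key : ∀ {ux vx uy vy : ℤ}, UpSwivel u v ux vx → UpSwivel u v uy vy →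
      vx < vy → ∃ uz vz, DiamondSwivel u v ux vx uy vy uz vz := by
    intro ux vx uy vy hx hy hlt
    cases hx with
    | left h1 h2 h3 h4 =>
      exact ⟨_, _, .row h1 h2 h3 h4 (by cases hy <;> omega) (by cases hy <;> omega) rfl rfl⟩
    | diag h1 h2 h3 h4 =>
      exact ⟨_, _, .diag h1 h2 h3 h4 (by cases hy <;> omega) (by cases hy <;> omega) rfl rfl⟩
    | diag1 h1 h2 h3 h4 =>
      exact ⟨_, _, .diag1 h1 h2 h3 h4 (by cases hy <;> omega) (by cases hy <;> omega) rfl rfl⟩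
    | p31 h1 h2 h3 h4 =>
      exact ⟨_, _, .p31 h1 h2 h3 h4 (by cases hy <;> omega) (by cases hy <;> omega) rfl rfl⟩
    | _ => exfalso; cases hy <;> omega
  rcases lt_trichotomy vx vy with h | h | h
  · obtain ⟨uz, vz, h⟩ := key hx hy h
    exact ⟨uz, vz, Or.inl h⟩
  · exfalso
    cases hx <;> cases hy <;> omega
  · obtain ⟨uz, vz, h⟩ := key hy hx h
    exact ⟨uz, vz, Or.inr h⟩

end UpSwivel

namespace DiamondSwivel

variable {u v ux vx uy vy uz vz : ℤ}

theorem mem {L1 L2 L3 L4 L5 : ℤ} (h : DiamondSwivel u v ux vx uy vy uz vz) (h5 : 5 ≤ L5)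
    (h4 : L5 ≤ L4) (h3 : L4 ≤ L3) (h2 : L3 ≤ L2) (h1 : L2 ≤ L1)
    (hw : InSwivel L1 L2 L3 L4 L5 u v) : InSwivel L1 L2 L3 L4 L5 uz vz := by
  cases h with
  | diag1 => exact .chain (by omega) (by omega) (by omega)
  | p31 => exact .p1 (by omega) (by omega)
  | row =>
    cases hw with
    | row2 => exact .row1 (by omega) (by omega) (by omega)
    | row3 => exact .row2 (by omega) (by omega) (by omega)
    | row4 => exact .row3 (by omega) (by omega) (by omega)
    | row5 => exact .row4 (by omega) (by omega) (by omega)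
    | _ => omega
  | diag =>
    cases hw with
    | row2 => exact .row1 (by omega) (by omega) (by omega)
    | row3 => exact .row2 (by omega) (by omega) (by omega)
    | row4 => exact .row3 (by omega) (by omega) (by omega)
    | row5 => exact .row4 (by omega) (by omega) (by omega)
    | _ => omega

theorem up_left (h : DiamondSwivel u v ux vx uy vy uz vz) : UpSwivel ux vx uz vz := by
  cases h with
  | row hu => exact .up (by omega) (by omega) (by omega) (by omega)
  | diag hu =>
    rcases hu with h | h | h | h
    · exact .p31' (by omega) (by omega) (by omega) (by omega)
    · exact .p5 (by omega) (by omega) (by omega) (by omega)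
    · exact .p7 (by omega) (by omega) (by omega) (by omega)
    · exact .p9 (by omega) (by omega) (by omega) (by omega)
  | diag1 => exact .p1 (by omega) (by omega) (by omega) (by omega)
  | p31 => exact .p30 (by omega) (by omega) (by omega) (by omega)

theorem up_right (h : DiamondSwivel u v ux vx uy vy uz vz) : UpSwivel uy vy uz vz := by
  cases h with
  | row hu =>
    rcases hu with h | h | h | h
    · exact .left1 (by omega) (by omega) (by omega) (by omega)
    all_goals exact .left (by omega) (by omega) (by omega) (by omega)
  | diag hu =>
    rcases hu with h | h | h | h
    · exact .left1 (by omega) (by omega) (by omega) (by omega)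
    all_goals exact .left (by omega) (by omega) (by omega) (by omega)
  | diag1 => exact .p0 (by omega) (by omega) (by omega) (by omega)
  | p31 => exact .diag1 (by omega) (by omega) (by omega) (by omega)

theorem up_eq (h : DiamondSwivel u v ux vx uy vy uz vz) {a b : ℤ} (hab : UpSwivel u v a b) :
    (a = ux ∧ b = vx) ∨ (a = uy ∧ b = vy) := by
  cases h <;> cases hab <;> omega

theorem eq_of_up (h : DiamondSwivel u v ux vx uy vy uz vz) {a b : ℤ} (hx : UpSwivel ux vx a b)
    (hy : UpSwivel uy vy a b) : a = uz ∧ b = vz := by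
  have := hy.le
  cases h <;> cases hx <;> omega

theorem eq_of_down (h : DiamondSwivel u v ux vx uy vy uz vz) {a b : ℤ} (hx : UpSwivel a b ux vx)
    (hy : UpSwivel a b uy vy) : a = u ∧ b = v := by
  have := hy.le
  cases h <;> cases hx <;> omega

theorem lower_eq (h : DiamondSwivel u v ux vx uy vy uz vz) {a b : ℤ} (hab : UpSwivel a b uz vz) :
    (a = ux ∧ b = vx) ∨ (a = uy ∧ b = vy) := by
  cases h <;> cases hab <;> omega

theorem between {L1 L2 L3 L4 L5 : ℤ} (h : DiamondSwivel u v ux vx uy vy uz vz) {a b : ℤ}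
    (hab : InSwivel L1 L2 L3 L4 L5 a b) (h1 : uz ≤ a) (h2 : a ≤ u) (h3 : vz ≤ b) (h4 : b ≤ v) :
    (a = u ∧ b = v) ∨ (a = ux ∧ b = vx) ∨ (a = uy ∧ b = vy) ∨ (a = uz ∧ b = vz) := by
  cases h <;> cases hab <;> omega

end DiamondSwivel

namespace LongSwivel

variable {k u v ux vx uy vy ut vt uz vz : ℤ}

theorem mem {L1 L2 L3 L4 L5 : ℤ} (h : LongSwivel k u v ux vx uy vy ut vt uz vz)
    (hw : InSwivel L1 L2 L3 L4 L5 u v) : InSwivel L1 L2 L3 L4 L5 uz vz := by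
  cases h with
  | p9 => exact .p5 (by omega) (by omega)
  | p7 => exact .p31 (by omega) (by omega)
  | p5 => exact .p0 (by omega) (by omega)
  | p12 => exact .p30 (by omega) (by omega)
  | row => exact .chain (by omega) (by cases hw <;> omega) (by omega)

theorem up (h : LongSwivel k u v ux vx uy vy ut vt uz vz) : UpSwivel ut vt uz vz := by
  cases h with
  | p9 => exact .diag (by omega) (by omega) (by omega) (by omega)
  | p7 => exact .diag (by omega) (by omega) (by omega) (by omega)
  | p5 => exact .diag1' (by omega) (by omega) (by omega) (by omega)
  | p12 => exact .p31 (by omega) (by omega) (by omega) (by omega)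
  | row => exact .chain (by omega) (by omega) (by omega) (by omega)

theorem between {L1 L2 L3 L4 L5 : ℤ} (h : LongSwivel k u v ux vx uy vy ut vt uz vz) {a b : ℤ}
    (hab : InSwivel L1 L2 L3 L4 L5 a b) (h1 : uz ≤ a) (h2 : a ≤ u) (h3 : vz ≤ b) (h4 : b ≤ v) :
    (a = uz ∧ b = vz) ∨ (ut ≤ a ∧ vt ≤ b) := by
  cases h <;> cases hab <;> omega

theorem lower_eq (h : LongSwivel k u v ux vx uy vy ut vt uz vz) {a b : ℤ}
    (hab : UpSwivel a b uz vz) : a = ut ∧ b = vt := by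
  cases h <;> cases hab <;> omega

/-- The element below the top determines the bottom of a long interval of given `k`; this is the
third axiom of `d`-completeness for `k ≥ 4`. -/
theorem bottom_eq (h : LongSwivel k u v ux vx uy vy ut vt uz vz) {a b ax bx ay by' az bz : ℤ}
    (h' : LongSwivel k a b ax bx ay by' ut vt az bz) : a = u ∧ b = v := by
  cases h <;> cases h' <;> omega

/-- The element `t` below the expected top may have a second upper cover. An interval ending there
would contain a further point that is not below `t`, and such a point is exhibited; on the top chain
there is no second cover at all. -/
theorem exists_of_up_ne (h : LongSwivel k u v ux vx uy vy ut vt uz vz) {a b : ℤ}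
    (hab : UpSwivel ut vt a b) (hne : ¬ (a = uz ∧ b = vz)) {L1 L2 L3 L4 L5 : ℤ} (h5 : 5 ≤ L5)
    (h4 : L5 ≤ L4) (h3 : L4 ≤ L3) (h2 : L3 ≤ L2) (h1 : L2 ≤ L1) :
    ∃ c d, InSwivel L1 L2 L3 L4 L5 c d ∧ a ≤ c ∧ c ≤ u ∧ b ≤ d ∧ d ≤ v ∧
      ¬ (ut ≤ c ∧ vt ≤ d) ∧ ¬ (c = a ∧ d = b) := by
  cases h with
  | p9 => exact ⟨4, 4, .row2 rfl (by omega) (by omega), by cases hab <;> omega⟩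
  | p7 => exact ⟨2, 3, .row1 rfl (by omega) (by omega), by cases hab <;> omega⟩
  | p5 => exact ⟨3, 0, .p30 rfl rfl, by cases hab <;> omega⟩
  | p12 => exact ⟨2, 2, .row1 rfl (by omega) (by omega), by cases hab <;> omega⟩
  | row => exact ⟨2, 2, .row1 rfl (by omega) (by omega), by cases hab <;> omega⟩

end LongSwivel

namespace SwivelCoord

variable {P : Type} [PartialOrder P] {L1 L2 L3 L4 L5 : ℤ} {U V : P → ℤ}

theorem exists_diamond (h : SwivelCoord P L1 L2 L3 L4 L5 U V) {w x y : P} (hx : w ⋖ x) (hy : w ⋖ y)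
    (hne : x ≠ y) : ∃ z, DiamondSwivel (U w) (V w) (U x) (V x) (U y) (V y) (U z) (V z) ∨
      DiamondSwivel (U w) (V w) (U y) (V y) (U x) (V x) (U z) (V z) := by
  obtain ⟨uz, vz, hd⟩ := (h.covBy_iff.1 hx).diamond (h.covBy_iff.1 hy)
    fun hxy => hne (h.ext hxy.1 hxy.2)
  have hmem : InSwivel L1 L2 L3 L4 L5 uz vz := by
    rcases hd with hd | hd
    · exact hd.mem h.five_le h.le5 h.le4 h.le3 h.le2 (h.mem w)
    · exact hd.mem h.five_le h.le5 h.le4 h.le3 h.le2 (h.mem w)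
  obtain ⟨z, rfl, rfl⟩ := h.exists_mem _ _ hmem
  exact ⟨z, hd⟩

theorem coversClose (h : SwivelCoord P L1 L2 L3 L4 L5 U V) : CoversClose P := by
  intro w x y hx hy hne
  obtain ⟨z, hd | hd⟩ := h.exists_diamond hx hy hne
  · refine ⟨⟨z, h.covBy_iff.2 hd.up_left, h.covBy_iff.2 hd.up_right⟩, fun v hv => ?_⟩
    exact (hd.up_eq (h.covBy_iff.1 hv)).imp (fun e => h.ext e.1 e.2) fun e => h.ext e.1 e.2
  · refine ⟨⟨z, h.covBy_iff.2 hd.up_right, h.covBy_iff.2 hd.up_left⟩, fun v hv => ?_⟩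
    exact (hd.up_eq (h.covBy_iff.1 hv)).symm.imp (fun e => h.ext e.1 e.2) fun e => h.ext e.1 e.2

variable {k : ℕ} {I : Set P} {f : DoubleTailedDiamond k → P}

theorem tail_up (h : SwivelCoord P L1 L2 L3 L4 L5 U V) (hf : IsDMinusEmbedding k I f) {i : ℕ}
    (hi : i + 1 < k - 2) {a b : ℤ}
    (hup : UpSwivel (U (f (tail ⟨i, by omega⟩))) (V (f (tail ⟨i, by omega⟩))) a b)
    (hab : InSwivel L1 L2 L3 L4 L5 a b) :
    U (f (tail ⟨i + 1, hi⟩)) = a ∧ V (f (tail ⟨i + 1, hi⟩)) = b := by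
  obtain ⟨u, rfl, rfl⟩ := h.exists_mem a b hab
  rw [hf.eq_of_tail_covBy h.coversClose hi (h.covBy_iff.2 hup)]
  exact ⟨rfl, rfl⟩

/-- The middle part of a `d_k^-`-convex set is a diamond. -/
theorem exists_sides (h : SwivelCoord P L1 L2 L3 L4 L5 U V) (hk : 3 ≤ k)
    (hf : IsDMinusEmbedding k I f) : ∃ l r z : P,
      ((l = f left ∧ r = f right) ∨ (l = f right ∧ r = f left)) ∧
      DiamondSwivel (U (f (tail ⟨k - 3, by omega⟩))) (V (f (tail ⟨k - 3, by omega⟩)))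
        (U l) (V l) (U r) (V r) (U z) (V z) ∧
      ∀ z', f left ⋖ z' → f right ⋖ z' → z' = z := by
  have hl : f (tail ⟨k - 3, by omega⟩) ⋖ f left :=
    hf.covBy (by simp only [rank]; omega) (by simp only [rank]; omega)
  have hr : f (tail ⟨k - 3, by omega⟩) ⋖ f right :=
    hf.covBy (by simp only [rank]; omega) (by simp only [rank]; omega)
  obtain ⟨z, hd | hd⟩ := h.exists_diamond hl hr (hf.left_ne_right hk)
  · refine ⟨f left, f right, z, Or.inl ⟨rfl, rfl⟩, hd, fun z' h1 h2 => ?_⟩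
    have := hd.eq_of_up (h.covBy_iff.1 h1) (h.covBy_iff.1 h2)
    exact h.ext this.1 this.2
  · refine ⟨f right, f left, z, Or.inr ⟨rfl, rfl⟩, hd, fun z' h1 h2 => ?_⟩
    have := hd.eq_of_up (h.covBy_iff.1 h2) (h.covBy_iff.1 h1)
    exact h.ext this.1 this.2

/-- For `k ≥ 4` the bottom is a tail element below the last one, hence has a single upper cover.
This excludes all points with two upward steps. The points on the chain and `(3, 0)`, `(1, 0)`, `(0,
1)` are excluded because no square starts above them. What is left is the first row and the four
points `(9, 4)`, `(7, 3)`, `(5, 2)` and `(12, 3)`. -/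
theorem exists_long (h : SwivelCoord P L1 L2 L3 L4 L5 U V) (hk : 4 ≤ k)
    (hf : IsDMinusEmbedding k I f) : ∃ l r z : P,
      ((l = f left ∧ r = f right) ∨ (l = f right ∧ r = f left)) ∧
      LongSwivel k (U (f (tail ⟨0, by omega⟩))) (V (f (tail ⟨0, by omega⟩)))
        (U l) (V l) (U r) (V r) (U (f (neck ⟨k - 4, by omega⟩))) (V (f (neck ⟨k - 4, by omega⟩)))
        (U z) (V z) := by
  have h5 := h.five_le
  have h4 := h.le5
  have h3 := h.le4
  have h2 := h.le3
  have h1 := h.le2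
  obtain ⟨l, r, z0, hlr, hd, hz0⟩ := h.exists_sides (by omega) hf
  have hn0 : f (neck ⟨0, by omega⟩) = z0 := hz0 _
    (hf.covBy (by simp only [rank]; omega) (by simp only [rank]; omega))
    (hf.covBy (by simp only [rank]; omega) (by simp only [rank]; omega))
  have hneck : ∀ i (hi : i + 1 < k - 3), f (neck ⟨i, by omega⟩) ⋖ f (neck ⟨i + 1, by omega⟩) :=
    fun i hi => hf.covBy (by simp only [rank]; omega) (by simp only [rank]; omega)
  have htail : ∀ i (hi : i + 1 < k - 2), f (tail ⟨i, by omega⟩) ⋖ f (tail ⟨i + 1, hi⟩) :=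
    fun i hi => hf.covBy (by simp only [rank]; omega) (by simp only [rank])
  have hw := h.mem (f (tail ⟨0, by omega⟩))
  have hwt : f (tail ⟨0, by omega⟩) ≤ f (tail ⟨k - 3, by omega⟩) := by
    rw [hf.le_iff _ _ (by simp only [rank]; omega) (by simp only [rank]; omega)]
    rcases Nat.eq_zero_or_pos (k - 3) with h0 | h0
    · omega
    · exact Or.inr h0
  have hwt' := (h.le_iff _ _).1 hwt
  have hup := h.covBy_iff.1 (htail 0 (by omega))
  have huniq : ∀ {a b : ℤ}, UpSwivel (U (f (tail ⟨0, by omega⟩))) (V (f (tail ⟨0, by omega⟩))) a b →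
      InSwivel L1 L2 L3 L4 L5 a b → U (f (tail ⟨0 + 1, by omega⟩)) = a ∧
        V (f (tail ⟨0 + 1, by omega⟩)) = b := fun h1 h2 => h.tail_up hf (by omega) h1 h2
  suffices hs : ∃ uz vz, LongSwivel k (U (f (tail ⟨0, by omega⟩))) (V (f (tail ⟨0, by omega⟩)))
        (U l) (V l) (U r) (V r) (U (f (neck ⟨k - 4, by omega⟩))) (V (f (neck ⟨k - 4, by omega⟩)))
        uz vz by
    obtain ⟨uz, vz, hs⟩ := hs
    obtain ⟨z, rfl, rfl⟩ := h.exists_mem uz vz (hs.mem hw)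
    exact ⟨l, r, z, hlr, hs⟩
  have hlast : ∀ i (hi : i < k - 2), i + 3 = k → tail ⟨k - 3, by omega⟩ =
      (tail ⟨i, hi⟩ : DoubleTailedDiamond k) := fun i hi hik => by
    simp only [tail.injEq, Fin.mk.injEq]
    omega
  have hneck_last : ∀ i (hi : i < k - 2), i + 4 = k → neck ⟨k - 4, by omega⟩ =
      (neck ⟨i, hi⟩ : DoubleTailedDiamond k) := fun i hi hik => by
    simp only [neck.injEq, Fin.mk.injEq]
    omega
  -- the case of a long interval with `k = 4`
  have four : ∀ {u v ux vx uy vy : ℤ}, U (f (tail ⟨0 + 1, by omega⟩)) = u →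
      V (f (tail ⟨0 + 1, by omega⟩)) = v →
      UpSwivel u v ux vx → InSwivel L1 L2 L3 L4 L5 ux vx →
      UpSwivel u v uy vy → InSwivel L1 L2 L3 L4 L5 uy vy → ¬ (ux = uy ∧ vx = vy) →
      k = 4 := by
    intro u v ux vx uy vy hu hv hx hx' hy hy' hne
    by_contra hk4
    subst hu hv
    have e1 := h.tail_up hf (i := 0 + 1) (by omega) hx hx'
    have e2 := h.tail_up hf (i := 0 + 1) (by omega) hy hy'
    exact hne ⟨e1.1.symm.trans e2.1, e1.2.symm.trans e2.2⟩
  cases hup with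
  | left h6 h7 h8 h9 =>
    have := huniq (.up h6 h7.le rfl rfl) (hw.up_mem h6 h4 h3 h2 h1)
    omega
  | up h6 h7 h8 h9 =>
    rcases h7.lt_or_eq with h7 | h7
    · have := huniq (.left h6 h7 rfl rfl) (hw.left_mem h6 h7)
      omega
    · have := huniq (.diag h6 h7 rfl rfl) (.diag_mem h6 h7)
      omega
  | diag h6 h7 h8 h9 =>
    have := huniq (.up h6 h7.le rfl rfl) (hw.up_mem h6 h4 h3 h2 h1)
    omega
  | left1 h6 h7 h8 h9 =>
    -- The tail runs to the left along the first row. It cannot pass `(2, 1)`, because that point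
    -- has two upper covers and must be the last tail element.
    have ht : ∀ i (hi : i < k - 2), U (f (tail ⟨i, hi⟩)) = 2 ∧
        V (f (tail ⟨i, hi⟩)) = V (f (tail ⟨0, by omega⟩)) - i := by
      intro i
      induction i with
      | zero => exact fun hi => ⟨h6, by simp⟩
      | succ i ih =>
        intro hi
        obtain ⟨i1, i2⟩ := ih (by omega)
        have hi1 := h.covBy_iff.1 (htail i hi)
        cases hi1 with
        | left1 j1 j2 j3 j4 => push_cast; omega
        | diag1 j1 j2 j3 j4 =>
          have := h.tail_up hf hi (.diag1' j1 j2 rfl rfl) (.p0 rfl rfl)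
          omega
        | diag1' j1 j2 j3 j4 =>
          have := h.tail_up hf hi (.diag1 j1 j2 rfl rfl) (.p1 rfl rfl)
          omega
        | _ => omega
    have ht3 := ht (k - 3) (by omega)
    have hn : ∀ i (hi : i < k - 3), U (f (neck ⟨i, by omega⟩)) = -i ∧
        V (f (neck ⟨i, by omega⟩)) = -i := by
      intro i
      induction i with
      | zero =>
        intro hi
        rw [hn0]
        cases hd <;> omega
      | succ i ih =>
        intro hi
        obtain ⟨i1, i2⟩ := ih (by omega)
        have hi1 := h.covBy_iff.1 (hneck i hi)
        push_cast
        cases hi1 <;> omega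
    have hn4 := hn (k - 4) (by omega)
    rw [Nat.cast_sub (by omega)] at ht3 hn4
    refine ⟨3 - k, 3 - k, .row (by omega) h6 ?_ ?_ ?_ ?_ ?_ ?_ ?_ rfl rfl⟩ <;> cases hd <;> omega
  | diag1 h6 h7 h8 h9 =>
    have := huniq (.diag1' h6 h7 rfl rfl) (.p0 rfl rfl)
    omega
  | diag1' h6 h7 h8 h9 =>
    have := huniq (.diag1 h6 h7 rfl rfl) (.p1 rfl rfl)
    omega
  | chain h6 h7 h8 h9 => exfalso; cases hd <;> omega
  | p9 h6 h7 h8 h9 =>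
    have hk4 : k = 4 := four h8 h9 (.diag (by omega) (by omega) rfl rfl)
      (.diag_mem (by omega) (by omega)) (.up (by omega) (by omega) rfl rfl)
      (.row3 (by omega) (by omega) (by omega)) (by omega)
    rw [hlast (0 + 1) (by omega) (by omega)] at hd
    rw [hneck_last 0 (by omega) (by omega), hn0]
    refine ⟨5, 2, .p9 (by omega) h6 h7 ?_ ?_ ?_ ?_ ?_ ?_ rfl rfl⟩ <;> cases hd <;> omega
  | p7 h6 h7 h8 h9 =>
    have hk4 : k = 4 := four h8 h9 (.diag (by omega) (by omega) rfl rfl)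
      (.diag_mem (by omega) (by omega)) (.up (by omega) (by omega) rfl rfl)
      (.row2 (by omega) (by omega) (by omega)) (by omega)
    rw [hlast (0 + 1) (by omega) (by omega)] at hd
    rw [hneck_last 0 (by omega) (by omega), hn0]
    refine ⟨3, 1, .p7 (by omega) h6 h7 ?_ ?_ ?_ ?_ ?_ ?_ rfl rfl⟩ <;> cases hd <;> omega
  | p12 h6 h7 h8 h9 =>
    have hk5 : k ≠ 4 := by
      intro hk4
      rw [hlast (0 + 1) (by omega) (by omega)] at hd
      cases hd <;> omega
    have h10 := h.tail_up hf (i := 0 + 1) (a := 6) (b := 3) (by omega) (.p7 h8 h9 rfl rfl)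
      (.row3 rfl (by omega) (by omega))
    -- The point `(6, 3)` already has two upper covers, so the tail ends there.
    have hk5' : k = 5 := by
      by_contra hk6
      have e1 := h.tail_up hf (i := 0 + 1 + 1) (by omega)
        (.diag (by omega) (by omega) rfl rfl) (.diag_mem (by omega) (by omega))
      have e2 := h.tail_up hf (i := 0 + 1 + 1) (by omega)
        (.up (by omega) (by omega) rfl rfl) (.row2 (by omega) (by omega) (by omega))
      omega
    rw [hlast (0 + 1 + 1) (by omega) (by omega)] at hd
    rw [hneck_last (0 + 1) (by omega) (by omega)]
    have hz1 : U z0 = 4 ∧ V z0 = 2 := by cases hd <;> omega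
    have hn1 := h.covBy_iff.1 (hneck 0 (by omega))
    rw [hn0] at hn1
    -- From `(4, 2)` the neck could also go to `(2, 2)`. Then `(2, 3)` would lie in the convex set,
    -- although it is incomparable with `(4, 2)`, whereas a neck element is comparable with
    -- everything.
    have hn2 : U (f (neck ⟨0 + 1, by omega⟩)) = 3 ∧ V (f (neck ⟨0 + 1, by omega⟩)) = 1 := by
      by_contra hcon
      have hn3 : U (f (neck ⟨0 + 1, by omega⟩)) = 2 ∧ V (f (neck ⟨0 + 1, by omega⟩)) = 2 := by
        cases hn1 <;> omega
      obtain ⟨x, hx1, hx2⟩ := h.exists_mem 2 3 (.row1 rfl (by omega) (by omega))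
      have hxI : x ∈ I := hf.ordConnected.out (hf.mem (a := tail ⟨0, by omega⟩)
        (by simp only [rank]; omega)) (hf.mem (a := neck ⟨0 + 1, by omega⟩)
        (by simp only [rank]; omega)) ⟨(h.le_iff _ _).2 (by omega), (h.le_iff _ _).2 (by omega)⟩
      obtain ⟨a, ha, rfl⟩ := (hf.mem_iff x).1 hxI
      have hcmp : f a ≤ f (neck ⟨0, by omega⟩) ∨ f (neck ⟨0, by omega⟩) ≤ f a := by
        rw [hf.le_iff _ _ ha (by simp only [rank]; omega),
          hf.le_iff _ _ (by simp only [rank]; omega) ha]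
        rcases lt_trichotomy a.rank (neck ⟨0, by omega⟩ : DoubleTailedDiamond k).rank with e | e | e
        · exact Or.inl (Or.inr e)
        · left
          left
          cases a with
          | neck i =>
            simp only [rank] at e
            simp only [neck.injEq, Fin.ext_iff]
            omega
          | tail i => have := i.isLt; simp only [rank] at e; omega
          | left => simp only [rank] at e; omega
          | right => simp only [rank] at e; omega
        · exact Or.inr (Or.inr e)
      rw [h.le_iff, h.le_iff, hn0] at hcmp
      omega
    refine ⟨3, 0, .p12 (by omega) h6 h7 ?_ ?_ ?_ ?_ hn2.1 hn2.2 rfl rfl⟩ <;> cases hd <;> omega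
  | p5 h6 h7 h8 h9 =>
    have hk4 : k = 4 := four h8 h9 (.diag (by omega) (by omega) rfl rfl)
      (.diag_mem (by omega) (by omega)) (.up (by omega) (by omega) rfl rfl)
      (.row1 (by omega) (by omega) (by omega)) (by omega)
    rw [hlast (0 + 1) (by omega) (by omega)] at hd
    rw [hneck_last 0 (by omega) (by omega), hn0]
    refine ⟨0, 1, .p5 (by omega) h6 h7 ?_ ?_ ?_ ?_ ?_ ?_ rfl rfl⟩ <;> cases hd <;> omega
  | p31 h6 h7 h8 h9 =>
    have := huniq (.p31' h6 h7 rfl rfl) (.row1 rfl (by omega) (by omega))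
    omega
  | p31' h6 h7 h8 h9 =>
    have := huniq (.p31 h6 h7 rfl rfl) (.p30 rfl rfl)
    omega
  | p30 h6 h7 h8 h9 => exfalso; cases hd <;> omega
  | p1 h6 h7 h8 h9 => exfalso; cases hd <;> omega
  | p0 h6 h7 h8 h9 => exfalso; cases hd <;> omega

end SwivelCoord

/-! ### `d`-completeness. -/

namespace IsDMinusEmbedding

variable {P : Type} [PartialOrder P] {k : ℕ} {I : Set P} {f : DoubleTailedDiamond k → P}

theorem bot_le (h : IsDMinusEmbedding k I f) (hk : 3 ≤ k) {x : P} (hx : x ∈ I) :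
    f (tail ⟨0, by omega⟩) ≤ x := by
  obtain ⟨a, ha, rfl⟩ := (h.mem_iff x).1 hx
  rw [h.le_iff _ _ (by simp only [rank]; omega) ha]
  rcases Nat.eq_zero_or_pos a.rank with h0 | h0
  · left
    cases a with
    | tail i =>
      simp only [rank] at h0
      simp only [tail.injEq, Fin.ext_iff]
      exact h0.symm
    | left => simp only [rank] at h0; omega
    | right => simp only [rank] at h0; omega
    | neck i => simp only [rank] at h0; omega
  · exact Or.inr h0

theorem bot_mem (h : IsDMinusEmbedding k I f) (hk : 3 ≤ k) : f (tail ⟨0, by omega⟩) ∈ I :=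
  h.mem (by simp only [rank]; omega)

theorem minimal_iff (h : IsDMinusEmbedding k I f) (hk : 3 ≤ k) {x : P} :
    Minimal (· ∈ I) x ↔ x = f (tail ⟨0, by omega⟩) := by
  constructor
  · intro hx
    exact le_antisymm (hx.2 (h.bot_mem hk) (h.bot_le hk hx.1)) (h.bot_le hk hx.1)
  · rintro rfl
    exact ⟨h.bot_mem hk, fun y hy _ => h.bot_le hk hy⟩

theorem le_top (h : IsDMinusEmbedding k I f) (hk : 4 ≤ k) {x : P} (hx : x ∈ I) :
    x ≤ f (neck ⟨k - 4, by omega⟩) := by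
  obtain ⟨a, ha, rfl⟩ := (h.mem_iff x).1 hx
  rw [h.le_iff _ _ ha (by simp only [rank]; omega)]
  rcases Nat.lt_or_ge a.rank (2 * k - 5) with h0 | h0
  · right
    have : (neck ⟨k - 4, by omega⟩ : DoubleTailedDiamond k).rank = k - 1 + (k - 4) := rfl
    omega
  · left
    cases a with
    | tail i => have := i.isLt; simp only [rank] at h0; omega
    | left => simp only [rank] at h0; omega
    | right => simp only [rank] at h0; omega
    | neck i =>
      simp only [rank] at h0 ha
      simp only [neck.injEq, Fin.ext_iff]
      omega

theorem top_mem (h : IsDMinusEmbedding k I f) (hk : 4 ≤ k) : f (neck ⟨k - 4, by omega⟩) ∈ I :=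
  h.mem (by simp only [rank]; omega)

theorem eq_Icc (h : IsDMinusEmbedding k I f) (hk : 4 ≤ k) :
    I = Set.Icc (f (tail ⟨0, by omega⟩)) (f (neck ⟨k - 4, by omega⟩)) := by
  ext x
  exact ⟨fun hx => ⟨h.bot_le (by omega) hx, h.le_top hk hx⟩,
    fun hx => h.ordConnected.out (h.bot_mem (by omega)) (h.top_mem hk) hx⟩

theorem mem_iff_three {I : Set P} {f : DoubleTailedDiamond 3 → P} (h : IsDMinusEmbedding 3 I f)
    {x : P} : x ∈ I ↔ x = f (tail ⟨0, by omega⟩) ∨ x = f left ∨ x = f right := by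
  rw [h.mem_iff]
  constructor
  · rintro ⟨a, ha, rfl⟩
    cases a with
    | tail i =>
      left
      congr 2
      have := i.isLt
      exact Fin.ext (by simp only; omega)
    | left => exact Or.inr (Or.inl rfl)
    | right => exact Or.inr (Or.inr rfl)
    | neck i => simp only [rank] at ha; omega
  · rintro (rfl | rfl | rfl)
    · exact ⟨_, by simp only [rank]; omega, rfl⟩
    · exact ⟨_, by simp only [rank]; omega, rfl⟩
    · exact ⟨_, by simp only [rank]; omega, rfl⟩

end IsDMinusEmbedding

theorem dInterval_bot {P : Type} [PartialOrder P] {k : ℕ} (hk : 3 ≤ k) {w z : P}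
    (e : Set.Icc w z ≃o DoubleTailedDiamond k) : (e.symm (tail ⟨0, by omega⟩) : P) = w := by
  obtain ⟨hf, hz⟩ := dInterval_embedding hk e
  have h1 := (hf.bot_mem hk).1.1
  have hz' : (e.symm (tail ⟨0, by omega⟩) : P) ≠ z := (hf.bot_mem hk).2
  refine le_antisymm (hf.bot_le hk ⟨⟨le_rfl, (e.symm _).2.1.trans (e.symm (summit hk)).2.2⟩, ?_⟩) h1
  rintro rfl
  exact hz' (le_antisymm (e.symm _).2.2 h1)

theorem dInterval_covBy {P : Type} [PartialOrder P] {k : ℕ} (hk : 3 ≤ k) {w z : P}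
    (e : Set.Icc w z ≃o DoubleTailedDiamond k) {a : DoubleTailedDiamond k}
    (ha : a.rank = 2 * k - 5) : (e.symm a : P) ⋖ z := by
  obtain ⟨hf, hz⟩ := dInterval_embedding hk e
  have ha' : (e.symm a : P) ∈ Set.Icc w z \ {z} := hf.mem (by omega)
  refine ⟨lt_of_le_of_ne ha'.1.2 ha'.2, fun x hx hx' => ?_⟩
  obtain ⟨b, hb, rfl⟩ := (hf.mem_iff x).1 ⟨⟨ha'.1.1.trans hx.le, hx'.le⟩, hx'.ne⟩
  have := (hf.lt_iff (by omega) hb).1 hx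
  omega

namespace SwivelCoord

variable {P : Type} [PartialOrder P] {L1 L2 L3 L4 L5 : ℤ} {U V : P → ℤ}

/-- The intervals of a tagged swivel that are double-tailed diamonds. -/
theorem dInterval_cases (h : SwivelCoord P L1 L2 L3 L4 L5 U V) {k : ℕ} (hk : 3 ≤ k) {w z : P}
    (e : Set.Icc w z ≃o DoubleTailedDiamond k) : ∃ l r : P,
      ((l = e.symm left ∧ r = e.symm right) ∨ (l = e.symm right ∧ r = e.symm left)) ∧
      ((k = 3 ∧ DiamondSwivel (U w) (V w) (U l) (V l) (U r) (V r) (U z) (V z)) ∨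
        (4 ≤ k ∧ ∃ t, t ⋖ z ∧ t ∈ Set.Icc w z ∧ LongSwivel k (U w) (V w) (U l) (V l) (U r) (V r)
          (U t) (V t) (U z) (V z))) := by
  obtain ⟨hf, hz⟩ := dInterval_embedding hk e
  have hw := dInterval_bot hk e
  rcases hk.eq_or_lt with rfl | hk4
  · obtain ⟨l, r, z0, hlr, hd, hz0⟩ := h.exists_sides le_rfl hf
    have hzz := hz0 z (dInterval_covBy le_rfl e rfl) (dInterval_covBy le_rfl e rfl)
    subst hzz
    exact ⟨l, r, hlr, Or.inl ⟨rfl, hw ▸ hd⟩⟩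
  · obtain ⟨l, r, z0, hlr, hd⟩ := h.exists_long hk4 hf
    have hcov := dInterval_covBy hk e (a := neck ⟨k - 4, by omega⟩) (by simp only [rank]; omega)
    refine ⟨l, r, hlr, Or.inr ⟨hk4, _, hcov, (e.symm _).2, ?_⟩⟩
    rw [hw] at hd
    by_cases hzz : U z = U z0 ∧ V z = V z0
    · rw [hzz.1, hzz.2]
      exact hd
    · exfalso
      obtain ⟨c, d, hcd, h1, h2, h3, h4, h5, h6⟩ :=
        hd.exists_of_up_ne (h.covBy_iff.1 hcov) hzz h.five_le h.le5 h.le4 h.le3 h.le2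
      obtain ⟨x, rfl, rfl⟩ := h.exists_mem c d hcd
      -- The extra point would lie in the interval without its top, hence below the maximal element
      -- of that set.
      have := hf.le_top hk4 (x := x) ⟨⟨(h.le_iff _ _).2 ⟨h2, h4⟩, (h.le_iff _ _).2 ⟨h1, h3⟩⟩, by
        rintro rfl
        exact h6 ⟨rfl, rfl⟩⟩
      exact h5 ((h.le_iff _ _).1 this)

/-- Everything is read off the list of squares and long intervals. The completing element is the top
of the listed interval; inspecting the steps into that top shows that it covers nothing else. The
bottom is determined by the two sides of a square, or by the maximal element of the convex set if `k
≥ 4`. -/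
theorem isDComplete (h : SwivelCoord P L1 L2 L3 L4 L5 U V) : IsDComplete P := by
  constructor
  · intro k hk I hI
    obtain ⟨f, hf⟩ := hI.exists_embedding hk
    rcases hk.eq_or_lt with rfl | hk4
    · obtain ⟨l, r, z, hlr, hd, -⟩ := h.exists_sides le_rfl hf
      have hmem : ∀ x, x ∈ I ↔ x = f (tail ⟨0, by omega⟩) ∨ x = l ∨ x = r := by
        intro x
        rw [hf.mem_iff_three]
        rcases hlr with ⟨rfl, rfl⟩ | ⟨rfl, rfl⟩
        · rfl
        · rw [or_comm (a := x = f left)]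
      have hl : l ⋖ z := h.covBy_iff.2 hd.up_left
      have hr : r ⋖ z := h.covBy_iff.2 hd.up_right
      have hwl : f (tail ⟨0, by omega⟩) < l := lt_of_le_of_ne
        (hf.bot_le le_rfl ((hmem l).2 (Or.inr (Or.inl rfl)))) (by
          rcases hlr with ⟨rfl, -⟩ | ⟨rfl, -⟩
          all_goals
            intro h'
            have := hf.injOn (by simp only [rank]; omega) (by simp only [rank]; omega) h'
            cases this)
      have hwr : f (tail ⟨0, by omega⟩) ≤ r :=
        hf.bot_le le_rfl ((hmem r).2 (Or.inr (Or.inr rfl)))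
      have hzI : z ∉ I := by
        intro hz
        rcases (hmem z).1 hz with e | e | e
        · exact absurd (hwl.trans hl.lt) (by rw [e]; exact lt_irrefl _)
        · exact hl.ne e.symm
        · exact hr.ne e.symm
      have hIcc : insert z I = Set.Icc (f (tail ⟨0, by omega⟩)) z := by
        ext x
        constructor
        · rintro (rfl | hx)
          · exact ⟨hwl.le.trans hl.le, le_rfl⟩
          · rcases (hmem x).1 hx with rfl | rfl | rfl
            · exact ⟨le_rfl, hwl.le.trans hl.le⟩
            · exact ⟨hwl.le, hl.le⟩
            · exact ⟨hwr, hr.le⟩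
        · rintro ⟨hx1, hx2⟩
          have h1 := (h.le_iff _ _).1 hx1
          have h2 := (h.le_iff _ _).1 hx2
          rcases hd.between (h.mem x) h2.1 h1.1 h2.2 h1.2 with e | e | e | e
          · exact Or.inr ((hmem x).2 (Or.inl (h.ext e.1 e.2)))
          · exact Or.inr ((hmem x).2 (Or.inr (Or.inl (h.ext e.1 e.2))))
          · exact Or.inr ((hmem x).2 (Or.inr (Or.inr (h.ext e.1 e.2))))
          · exact Or.inl (h.ext e.1 e.2)
      refine ⟨z, fun a ha => ?_, _, hIcc, hf.isDInterval le_rfl hIcc hzI⟩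
      rcases (hmem a).1 ha.1 with rfl | rfl | rfl
      · exact absurd (ha.2 ((hmem l).2 (Or.inr (Or.inl rfl))) hwl.le) (not_le_of_gt hwl)
      · exact hl
      · exact hr
    · obtain ⟨l, r, z, -, hd⟩ := h.exists_long hk4 hf
      have hcov : f (neck ⟨k - 4, by omega⟩) ⋖ z := h.covBy_iff.2 hd.up
      have hI' := hf.eq_Icc hk4
      have hbt := hf.bot_le hk (hf.top_mem hk4)
      have hzI : z ∉ I := fun hz => not_le_of_gt hcov.lt (hf.le_top hk4 hz)
      have hIcc : insert z I = Set.Icc (f (tail ⟨0, by omega⟩)) z := by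
        ext x
        constructor
        · rintro (rfl | hx)
          · exact ⟨hbt.trans hcov.le, le_rfl⟩
          · exact ⟨hf.bot_le hk hx, (hf.le_top hk4 hx).trans hcov.le⟩
        · rintro ⟨hx1, hx2⟩
          have h1 := (h.le_iff _ _).1 hx1
          have h2 := (h.le_iff _ _).1 hx2
          rcases hd.between (h.mem x) h2.1 h1.1 h2.2 h1.2 with e | e
          · exact Or.inl (h.ext e.1 e.2)
          · refine Or.inr ?_
            rw [hI']
            exact ⟨hx1, (h.le_iff _ _).2 e⟩
      refine ⟨z, fun a ha => ?_, _, hIcc, hf.isDInterval hk hIcc hzI⟩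
      rw [le_antisymm (hf.le_top hk4 ha.1) (ha.2 (hf.top_mem hk4) (hf.le_top hk4 ha.1))]
      exact hcov
  · rintro k hk w z ⟨e⟩ y hy
    obtain ⟨l, r, hlr, ⟨rfl, hd⟩ | ⟨hk4, t, ht, htI, hd⟩⟩ := h.dInterval_cases hk e
    · have hlI : l ∈ Set.Icc w z := by
        rcases hlr with ⟨rfl, -⟩ | ⟨rfl, -⟩ <;> exact (e.symm _).2
      have hrI : r ∈ Set.Icc w z := by
        rcases hlr with ⟨-, rfl⟩ | ⟨-, rfl⟩ <;> exact (e.symm _).2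
      rcases hd.lower_eq (h.covBy_iff.1 hy) with e | e
      · rwa [h.ext e.1 e.2]
      · rwa [h.ext e.1 e.2]
    · have := hd.lower_eq (h.covBy_iff.1 hy)
      rwa [h.ext this.1 this.2]
  · intro k hk I J hI hJ hIJ
    obtain ⟨f, hf⟩ := hI.exists_embedding hk
    obtain ⟨g, hg⟩ := hJ.exists_embedding hk
    have hIJ' : ∀ x, (x ∈ I ∧ x ≠ f (tail ⟨0, by omega⟩)) ↔
        (x ∈ J ∧ x ≠ g (tail ⟨0, by omega⟩)) := by
      intro x
      have := Set.ext_iff.1 hIJ x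
      simp only [Set.mem_ofPred_eq, hf.minimal_iff hk, hg.minimal_iff hk] at this
      exact this
    -- Each set has exactly one minimal element and the rest coincide, so it is enough to identify
    -- the two bottoms.
    suffices hw : f (tail ⟨0, by omega⟩) = g (tail ⟨0, by omega⟩) by
      ext x
      by_cases hx : x = f (tail ⟨0, by omega⟩)
      · exact iff_of_true (hx ▸ hf.bot_mem hk) (hx.trans hw ▸ hg.bot_mem hk)
      · have := hIJ' x
        rw [← hw] at this
        exact ⟨fun h1 => (this.1 ⟨h1, hx⟩).1, fun h1 => (this.2 ⟨h1, hx⟩).1⟩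
    rcases hk.eq_or_lt with rfl | hk4
    · obtain ⟨l, r, z, hlr, hd, -⟩ := h.exists_sides le_rfl hf
      have hside : ∀ a : DoubleTailedDiamond 3, a = left ∨ a = right → g (tail ⟨0, by omega⟩) ⋖ f a := by
        intro a ha
        have har : a.rank = 1 := by rcases ha with rfl | rfl <;> rfl
        obtain ⟨h1, h2⟩ := (hIJ' (f a)).1 ⟨hf.mem (by omega), fun h' => by
          have := hf.injOn (by omega) (by simp only [rank]; omega) h'
          rw [this] at har
          simp only [rank] at har
          omega⟩
        rcases hg.mem_iff_three.1 h1 with e | e | e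
        · exact absurd e h2
        · rw [e]
          exact hg.covBy (by simp only [rank]; omega) (by simp only [rank])
        · rw [e]
          exact hg.covBy (by simp only [rank]; omega) (by simp only [rank])
      have hll := hside left (Or.inl rfl)
      have hrr := hside right (Or.inr rfl)
      have : U (g (tail ⟨0, by omega⟩)) = U (f (tail ⟨0, by omega⟩)) ∧
          V (g (tail ⟨0, by omega⟩)) = V (f (tail ⟨0, by omega⟩)) := by
        rcases hlr with ⟨rfl, rfl⟩ | ⟨rfl, rfl⟩
        · exact hd.eq_of_down (h.covBy_iff.1 hll) (h.covBy_iff.1 hrr)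
        · exact hd.eq_of_down (h.covBy_iff.1 hrr) (h.covBy_iff.1 hll)
      exact h.ext this.1.symm this.2.symm
    · obtain ⟨l, r, z, -, hd⟩ := h.exists_long hk4 hf
      obtain ⟨l', r', z', -, hd'⟩ := h.exists_long hk4 hg
      have hne : ∀ {I : Set P} {f : DoubleTailedDiamond k → P}, IsDMinusEmbedding k I f →
          f (neck ⟨k - 4, by omega⟩) ≠ f (tail ⟨0, by omega⟩) := fun hf h' => by
        have := hf.injOn (by simp only [rank]; omega) (by simp only [rank]; omega) h'
        cases this
      have htop : f (neck ⟨k - 4, by omega⟩) = g (neck ⟨k - 4, by omega⟩) := le_antisymm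
        (hg.le_top hk4 ((hIJ' _).1 ⟨hf.top_mem hk4, hne hf⟩).1)
        (hf.le_top hk4 ((hIJ' _).2 ⟨hg.top_mem hk4, hne hg⟩).1)
      rw [← htop] at hd'
      have := hd.bottom_eq hd'
      exact h.ext this.1.symm this.2.symm

end SwivelCoord

/-! ### Elements that lie in necks. -/

section

variable {P : Type} [PartialOrder P] {L1 L2 L3 L4 L5 : ℤ} {U V : P → ℤ}

namespace SwivelCoord

/-- Reduces the construction of a double-tailed diamond to arithmetic: lists `F`, `G` of coordinates
with the right comparisons that exhaust the rectangle between bottom and top already determine the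
order isomorphism. -/
theorem inNeck_of_coord (h : SwivelCoord P L1 L2 L3 L4 L5 U V) {k : ℕ} (hk : 3 ≤ k)
    (F G : DoubleTailedDiamond k → ℤ) (hmem : ∀ a, InSwivel L1 L2 L3 L4 L5 (F a) (G a))
    (hmono : ∀ a b, a.rank < b.rank → F b ≤ F a ∧ G b ≤ G a ∧ ¬ (F a ≤ F b ∧ G a ≤ G b))
    (hsides : ¬ (F left ≤ F right ∧ G left ≤ G right) ∧ ¬ (F right ≤ F left ∧ G right ≤ G left))
    (hsurj : ∀ u v, InSwivel L1 L2 L3 L4 L5 u v → F (summit hk) ≤ u → G (summit hk) ≤ v →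
      u ≤ F (tail ⟨0, by omega⟩) → v ≤ G (tail ⟨0, by omega⟩) → ∃ a, F a = u ∧ G a = v)
    {z : P} (hu : U z = F (summit hk)) (hv : V z = G (summit hk)) : InNeck z := by
  have hle : ∀ a b, F b ≤ F a ∧ G b ≤ G a ↔ a ≤ b := by
    intro a b
    constructor
    · intro hab
      rcases lt_trichotomy a.rank b.rank with h1 | h1 | h1
      · exact Or.inr h1
      · cases a with
        | tail i =>
          cases b with
          | tail j => left; simp only [rank] at h1; simp only [tail.injEq, Fin.ext_iff]; exact h1
          | left => have := i.isLt; simp only [rank] at h1; omega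
          | right => have := i.isLt; simp only [rank] at h1; omega
          | neck j => have := i.isLt; simp only [rank] at h1; omega
        | left =>
          cases b with
          | tail j => have := j.isLt; simp only [rank] at h1; omega
          | left => exact le_rfl
          | right => exact absurd hab hsides.2
          | neck j => simp only [rank] at h1; omega
        | right =>
          cases b with
          | tail j => have := j.isLt; simp only [rank] at h1; omega
          | left => exact absurd hab hsides.1
          | right => exact le_rfl
          | neck j => simp only [rank] at h1; omega
        | neck i =>
          cases b with
          | tail j => have := j.isLt; simp only [rank] at h1; omega
          | left => simp only [rank] at h1; omega
          | right => simp only [rank] at h1; omega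
          | neck j =>
            left; simp only [rank] at h1; simp only [neck.injEq, Fin.ext_iff]; omega
      · exact absurd hab (hmono b a h1).2.2
    · rintro (rfl | hab)
      · exact ⟨le_rfl, le_rfl⟩
      · exact ⟨(hmono a b hab).1, (hmono a b hab).2.1⟩
  choose g hgU hgV using fun a => h.exists_mem _ _ (hmem a)
  have hg : ∀ a b, g a ≤ g b ↔ a ≤ b := fun a b => by
    rw [h.le_iff, hgU, hgU, hgV, hgV, hle]
  obtain rfl : z = g (summit hk) := h.ext (by rw [hgU, hu]) (by rw [hgV, hv])
  have hbot : ∀ a, (tail ⟨0, by omega⟩ : DoubleTailedDiamond k) ≤ a := fun a => by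
    rcases Nat.eq_zero_or_pos a.rank with h0 | h0
    · left
      cases a with
      | tail i => simp only [rank] at h0; simp only [tail.injEq, Fin.ext_iff]; exact h0.symm
      | left => simp only [rank] at h0; omega
      | right => simp only [rank] at h0; omega
      | neck i => simp only [rank] at h0; omega
    · exact Or.inr (by simpa only [rank] using h0)
  have hbij : Function.Bijective fun a =>
      (⟨g a, (hg _ _).2 (hbot a), (hg _ _).2 (le_summit hk a)⟩ :
        Set.Icc (g (tail ⟨0, by omega⟩)) (g (summit hk))) := by
    refine ⟨fun a b hab => ?_, fun y => ?_⟩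
    · have : g a = g b := congrArg Subtype.val hab
      exact le_antisymm ((hg _ _).1 this.le) ((hg _ _).1 this.ge)
    · obtain ⟨y, hy1, hy2⟩ := y
      rw [h.le_iff, hgU, hgV] at hy1 hy2
      obtain ⟨a, ha1, ha2⟩ := hsurj _ _ (h.mem y) hy2.1 hy2.2 hy1.1 hy1.2
      exact ⟨a, Subtype.ext (h.ext (by rw [hgU, ha1]) (by rw [hgV, ha2]))⟩
  let e : DoubleTailedDiamond k ≃o Set.Icc (g (tail ⟨0, by omega⟩)) (g (summit hk)) :=
    { Equiv.ofBijective _ hbij with map_rel_iff' := fun {a b} => hg a b }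
  exact ⟨k, hk, _, _, e.symm, ⟨k - 3, by omega⟩, rfl⟩

theorem inNeck_of_diamond (h : SwivelCoord P L1 L2 L3 L4 L5 U V) {z : P}
    {u v ux vx uy vy : ℤ} (hd : DiamondSwivel u v ux vx uy vy (U z) (V z))
    (hw : InSwivel L1 L2 L3 L4 L5 u v) (hx : InSwivel L1 L2 L3 L4 L5 ux vx)
    (hy : InSwivel L1 L2 L3 L4 L5 uy vy) : InNeck z := by
  refine h.inNeck_of_coord (k := 3) le_rfl
    (fun a => match a with | tail _ => u | left => ux | right => uy | neck _ => U z)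
    (fun a => match a with | tail _ => v | left => vx | right => vy | neck _ => V z)
    (fun a => ?_) (fun a b hab => ?_) ?_ ?_ rfl rfl
  · cases a
    exacts [hw, hx, hy, h.mem z]
  · cases a <;> cases b <;> simp only [rank] at hab ⊢ <;> cases hd <;> omega
  · cases hd <;> dsimp only <;> omega
  · intro a b hab h1 h2 h3 h4
    simp only [summit] at h1 h2
    rcases hd.between hab h1 h3 h2 h4 with h5 | h5 | h5 | h5
    · exact ⟨tail ⟨0, by omega⟩, h5.1.symm, h5.2.symm⟩
    · exact ⟨left, h5.1.symm, h5.2.symm⟩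
    · exact ⟨right, h5.1.symm, h5.2.symm⟩
    · exact ⟨neck ⟨0, by omega⟩, h5.1.symm, h5.2.symm⟩

theorem inNeck_five (h : SwivelCoord P L1 L2 L3 L4 L5 U V) {z : P} (hu : U z = 5) (hv : V z = 2) :
    InNeck z := by
  refine h.inNeck_of_coord (k := 4) (by omega)
    (fun a => match a with | tail i => 9 - i | left => 7 | right => 6 | neck i => 6 - i)
    (fun a => match a with | tail _ => 4 | left => 3 | right => 4 | neck i => 3 - i)
    (fun a => ?_) (fun a b hab => ?_) ?_ (fun u v hm h1 h2 h3 h4 => ?_) hu hv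
  · have := h.le4
    have := h.le5
    have := h.five_le
    rcases a with ⟨_ | _ | i, hi⟩ | _ | _ | ⟨_ | _ | i, hi⟩
    · exact .p9 rfl rfl
    · exact .row4 rfl (by norm_num) (by dsimp only; omega)
    · omega
    · exact .p7 rfl rfl
    · exact .row3 rfl (by norm_num) (by dsimp only; omega)
    · exact .row3 rfl (by norm_num) (by dsimp only; push_cast; omega)
    · exact .p5 rfl rfl
    · omega
  · cases a <;> cases b <;> simp only [rank] at hab ⊢ <;> omega
  · dsimp only
    omega
  · have key : (u = 9 ∧ v = 4) ∨ (u = 8 ∧ v = 4) ∨ (u = 7 ∧ v = 3) ∨ (u = 6 ∧ v = 4) ∨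
        (u = 6 ∧ v = 3) ∨ (u = 5 ∧ v = 2) := by
      simp only [summit] at h1 h2 h3 h4
      cases hm <;> omega
    rcases key with ⟨rfl, rfl⟩ | ⟨rfl, rfl⟩ | ⟨rfl, rfl⟩ | ⟨rfl, rfl⟩ | ⟨rfl, rfl⟩ | ⟨rfl, rfl⟩
    exacts [⟨tail 0, rfl, rfl⟩, ⟨tail 1, rfl, rfl⟩, ⟨left, rfl, rfl⟩, ⟨right, rfl, rfl⟩,
      ⟨neck 0, rfl, rfl⟩, ⟨neck 1, rfl, rfl⟩]

theorem inNeck_three_one (h : SwivelCoord P L1 L2 L3 L4 L5 U V) {z : P} (hu : U z = 3)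
    (hv : V z = 1) : InNeck z := by
  refine h.inNeck_of_coord (k := 4) (by omega)
    (fun a => match a with | tail i => 7 - i | left => 5 | right => 4 | neck i => 4 - i)
    (fun a => match a with | tail _ => 3 | left => 2 | right => 3 | neck i => 2 - i)
    (fun a => ?_) (fun a b hab => ?_) ?_ (fun u v hm h1 h2 h3 h4 => ?_) hu hv
  · have := h.le3
    have := h.le4
    have := h.le5
    have := h.five_le
    rcases a with ⟨_ | _ | i, hi⟩ | _ | _ | ⟨_ | _ | i, hi⟩
    · exact .p7 rfl rfl
    · exact .row3 rfl (by norm_num) (by dsimp only; omega)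
    · omega
    · exact .p5 rfl rfl
    · exact .row2 rfl (by norm_num) (by dsimp only; omega)
    · exact .row2 rfl (by norm_num) (by dsimp only; push_cast; omega)
    · exact .p31 rfl rfl
    · omega
  · cases a <;> cases b <;> simp only [rank] at hab ⊢ <;> omega
  · dsimp only
    omega
  · have key : (u = 7 ∧ v = 3) ∨ (u = 6 ∧ v = 3) ∨ (u = 5 ∧ v = 2) ∨ (u = 4 ∧ v = 3) ∨
        (u = 4 ∧ v = 2) ∨ (u = 3 ∧ v = 1) := by
      simp only [summit] at h1 h2 h3 h4
      cases hm <;> omega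
    rcases key with ⟨rfl, rfl⟩ | ⟨rfl, rfl⟩ | ⟨rfl, rfl⟩ | ⟨rfl, rfl⟩ | ⟨rfl, rfl⟩ | ⟨rfl, rfl⟩
    exacts [⟨tail 0, rfl, rfl⟩, ⟨tail 1, rfl, rfl⟩, ⟨left, rfl, rfl⟩, ⟨right, rfl, rfl⟩,
      ⟨neck 0, rfl, rfl⟩, ⟨neck 1, rfl, rfl⟩]

theorem inNeck_zero_one (h : SwivelCoord P L1 L2 L3 L4 L5 U V) {z : P} (hu : U z = 0)
    (hv : V z = 1) : InNeck z := by
  refine h.inNeck_of_coord (k := 4) (by omega)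
    (fun a => match a with | tail i => 5 - i | left => 3 | right => 2 | neck i => 2 - 2 * i)
    (fun a => match a with | tail _ => 2 | left => 1 | right => 2 | neck _ => 1)
    (fun a => ?_) (fun a b hab => ?_) ?_ (fun u v hm h1 h2 h3 h4 => ?_) hu hv
  · have := h.le2
    have := h.le3
    have := h.le4
    have := h.le5
    have := h.five_le
    rcases a with ⟨_ | _ | i, hi⟩ | _ | _ | ⟨_ | _ | i, hi⟩
    · exact .p5 rfl rfl
    · exact .row2 rfl (by norm_num) (by dsimp only; omega)
    · omega
    · exact .p31 rfl rfl
    · exact .row1 rfl (by norm_num) (by dsimp only; omega)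
    · exact .row1 rfl (by norm_num) (by dsimp only; omega)
    · exact .p0 rfl rfl
    · omega
  · cases a <;> cases b <;> simp only [rank] at hab ⊢ <;> omega
  · dsimp only
    omega
  · have key : (u = 5 ∧ v = 2) ∨ (u = 4 ∧ v = 2) ∨ (u = 3 ∧ v = 1) ∨ (u = 2 ∧ v = 2) ∨
        (u = 2 ∧ v = 1) ∨ (u = 0 ∧ v = 1) := by
      simp only [summit] at h1 h2 h3 h4
      cases hm <;> omega
    rcases key with ⟨rfl, rfl⟩ | ⟨rfl, rfl⟩ | ⟨rfl, rfl⟩ | ⟨rfl, rfl⟩ | ⟨rfl, rfl⟩ | ⟨rfl, rfl⟩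
    exacts [⟨tail 0, rfl, rfl⟩, ⟨tail 1, rfl, rfl⟩, ⟨left, rfl, rfl⟩, ⟨right, rfl, rfl⟩,
      ⟨neck 0, rfl, rfl⟩, ⟨neck 1, rfl, rfl⟩]

theorem inNeck_three_zero (h : SwivelCoord P L1 L2 L3 L4 L5 U V) {z : P} (hu : U z = 3)
    (hv : V z = 0) : InNeck z := by
  refine h.inNeck_of_coord (k := 5) (by omega)
    (fun a => match a with
      | tail i => if (i : ℕ) = 0 then 12 else 8 - i
      | left => 5
      | right => 4
      | neck i => if (i : ℕ) = 0 then 4 else 3)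
    (fun a => match a with | tail _ => 3 | left => 2 | right => 3 | neck i => 2 - i)
    (fun a => ?_) (fun a b hab => ?_) ?_ (fun u v hm h1 h2 h3 h4 => ?_) hu hv
  · have := h.le3
    have := h.le4
    have := h.le5
    have := h.five_le
    rcases a with ⟨_ | _ | _ | i, hi⟩ | _ | _ | ⟨_ | _ | _ | i, hi⟩
    · exact .p12 rfl rfl
    · exact .p7 rfl rfl
    · exact .row3 rfl (by norm_num) (by dsimp only; omega)
    · omega
    · exact .p5 rfl rfl
    · exact .row2 rfl (by norm_num) (by dsimp only; omega)
    · exact .row2 rfl (by norm_num) (by dsimp only; push_cast; omega)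
    · exact .p31 rfl rfl
    · exact .p30 rfl rfl
    · omega
  · cases a <;> cases b <;> simp only [rank] at hab ⊢ <;> try split_ifs
    all_goals omega
  · dsimp only
    omega
  · have key : (u = 12 ∧ v = 3) ∨ (u = 7 ∧ v = 3) ∨ (u = 6 ∧ v = 3) ∨ (u = 5 ∧ v = 2) ∨
        (u = 4 ∧ v = 3) ∨ (u = 4 ∧ v = 2) ∨ (u = 3 ∧ v = 1) ∨ (u = 3 ∧ v = 0) := by
      simp only [summit] at h1 h2 h3 h4
      cases hm <;> simp_all <;> omega
    rcases key with ⟨rfl, rfl⟩ | ⟨rfl, rfl⟩ | ⟨rfl, rfl⟩ | ⟨rfl, rfl⟩ | ⟨rfl, rfl⟩ | ⟨rfl, rfl⟩ |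
      ⟨rfl, rfl⟩ | ⟨rfl, rfl⟩
    exacts [⟨tail 0, rfl, rfl⟩, ⟨tail 1, rfl, rfl⟩, ⟨tail 2, rfl, rfl⟩, ⟨left, rfl, rfl⟩,
      ⟨right, rfl, rfl⟩, ⟨neck 0, rfl, rfl⟩, ⟨neck 1, rfl, rfl⟩, ⟨neck 2, rfl, rfl⟩]

/-- The diamond with top `(v, v)` has its bottom at `(2, 1 - v)` in the first row, so `k = 3 - v`.
The top chain is just short enough for column `1 - v` to exist in that row. -/
theorem inNeck_chain (h : SwivelCoord P L1 L2 L3 L4 L5 U V) {z : P} (hu : U z = V z)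
    (hv : V z < 0) : InNeck z := by
  have hL := h.mem z
  have hz : 1 - L1 ≤ V z := by cases hL <;> omega
  obtain ⟨k, hk⟩ : ∃ k : ℕ, (k : ℤ) = 3 - V z := ⟨(3 - V z).toNat, by omega⟩
  refine h.inNeck_of_coord (k := k) (by omega)
    (fun a => match a with | tail _ => 2 | left => 1 | right => 0 | neck i => - i)
    (fun a => match a with | tail i => k - 2 - i | left => 0 | right => 1 | neck i => - i)
    (fun a => ?_) (fun a b hab => ?_) ?_ (fun u v hm h1 h2 h3 h4 => ?_) ?_ ?_
  · cases a with
    | tail i => have := i.isLt; exact .row1 rfl (by dsimp only; omega) (by dsimp only; omega)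
    | left => exact .p1 rfl rfl
    | right => exact .p0 rfl rfl
    | neck i => have := i.isLt; exact .chain rfl (by dsimp only; omega) (by dsimp only; omega)
  · cases a <;> cases b <;> simp only [rank] at hab ⊢ <;> omega
  · dsimp only
    omega
  · simp only [summit] at h1 h2 h3 h4
    cases hm with
    | row1 hu' h5 h6 =>
      exact ⟨tail ⟨(k - 2 - v).toNat, by omega⟩, hu'.symm, by dsimp only; omega⟩
    | p1 h5 h6 => exact ⟨left, h5.symm, h6.symm⟩
    | p0 h5 h6 => exact ⟨right, h5.symm, h6.symm⟩
    | chain h5 h6 h7 =>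
      exact ⟨neck ⟨(-v).toNat, by omega⟩, by dsimp only; omega, by dsimp only; omega⟩
    | _ => exfalso; omega
  · simp only [summit]
    omega
  · simp only [summit]
    omega

end SwivelCoord

end

/-! ### The hook length formula. -/

/-- The contribution `[v ≤ L]` of a row of length `L` to the hook lengths in column `v`. -/
def columnStep (v L : ℤ) : ℤ := if v ≤ L then 1 else 0

theorem columnStep_of_le {v L : ℤ} (h : v ≤ L) : columnStep v L = 1 := if_pos h

theorem columnStep_bound (v L : ℤ) : 0 ≤ columnStep v L ∧ columnStep v L ≤ 1 := by
  unfold columnStep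
  split_ifs <;> omega

/-- The hook lengths of a tagged swivel in the rows of the large diagram. -/
def hookRow (L1 L2 L3 L4 L5 u v : ℤ) : ℤ :=
  if u = 2 then
    if 5 ≤ v then L1 - v + 1 + (columnStep v L2 + columnStep v L3 + columnStep v L4 +
      columnStep v L5)
    else if v = 4 then L1 + 1 else if v = 3 then L1 + L5 - 1 else if v = 2 then L1 + L4
    else L1 + L3 + 1
  else if u = 4 then
    if 5 ≤ v then L2 - v + 1 + (columnStep v L3 + columnStep v L4 + columnStep v L5)
    else if v = 4 then L2 else if v = 3 then L2 + L5 - 2 else L2 + L4 - 1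
  else if u = 6 then
    if 5 ≤ v then L3 - v + 1 + (columnStep v L4 + columnStep v L5)
    else if v = 4 then L3 - 1 else L3 + L5 - 3
  else if u = 8 then
    if 5 ≤ v then L4 - v + 1 + columnStep v L5 else L4 - 2
  else L5 - v + 1

/-- The hook lengths of a tagged swivel in coordinates. -/
def hookSwivel (L1 L2 L3 L4 L5 u v : ℤ) : ℤ :=
  if u = 12 then 1
  else if u = 9 then L5 - 3
  else if u = 7 then L4 + L5 - 4
  else if u = 5 then L3 + L4 - 2
  else if u = 3 then if v = 1 then L2 + L3 else L2 + L3 + L4 + L5 - 5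
  else if u = 1 then L1 + L3 + L4 + L5 - 4
  else if u = 0 ∧ v = 1 then L1 + L2 + 2
  -- The long interval from `(2, 1 - v)` to `(v, v)` has sides `(1, 0)` and `(0, 1)`; the constant
  -- is the sum of their hook lengths.
  else if u ≤ 0 then 2 * L1 + L2 + L3 + L4 + L5 - 2 - hookRow L1 L2 L3 L4 L5 2 (1 - v)
  else hookRow L1 L2 L3 L4 L5 u v

section

variable {L1 L2 L3 L4 L5 : ℤ}

theorem hookRow_two_le (h5 : 5 ≤ L5) (h4 : L5 ≤ L4) (h3 : L4 ≤ L3) (v : ℤ) :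
    hookRow L1 L2 L3 L4 L5 2 v ≤ L1 + L3 + 1 := by
  have b2 := columnStep_bound v L2
  have b3 := columnStep_bound v L3
  have b4 := columnStep_bound v L4
  have b5 := columnStep_bound v L5
  unfold hookRow
  rw [if_pos rfl]
  split_ifs <;> omega

theorem hookRow_pos (h5 : 5 ≤ L5) (h4 : L5 ≤ L4) (h3 : L4 ≤ L3) (h2 : L3 ≤ L2) (h1 : L2 ≤ L1)
    {u v : ℤ} (hv : (u = 2 ∧ v ≤ L1) ∨ (u = 4 ∧ v ≤ L2) ∨ (u = 6 ∧ v ≤ L3) ∨ (u = 8 ∧ v ≤ L4) ∨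
      (u = 10 ∧ v ≤ L5)) : 0 < hookRow L1 L2 L3 L4 L5 u v := by
  have b2 := columnStep_bound v L2
  have b3 := columnStep_bound v L3
  have b4 := columnStep_bound v L4
  have b5 := columnStep_bound v L5
  unfold hookRow
  split_ifs <;> omega

theorem hookSwivel_pos (h5 : 5 ≤ L5) (h4 : L5 ≤ L4) (h3 : L4 ≤ L3) (h2 : L3 ≤ L2) (h1 : L2 ≤ L1)
    {u v : ℤ} (h : InSwivel L1 L2 L3 L4 L5 u v) : 0 < hookSwivel L1 L2 L3 L4 L5 u v := by
  have hr : (u = 2 ∧ v ≤ L1) ∨ (u = 4 ∧ v ≤ L2) ∨ (u = 6 ∧ v ≤ L3) ∨ (u = 8 ∧ v ≤ L4) ∨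
      (u = 10 ∧ v ≤ L5) → 0 < hookRow L1 L2 L3 L4 L5 u v := hookRow_pos h5 h4 h3 h2 h1
  have hc := hookRow_two_le (L1 := L1) (L2 := L2) h5 h4 h3 (1 - v)
  unfold hookSwivel
  split_ifs
  all_goals first | omega | exact hr (by cases h <;> omega)

/-- Right of column `5` the two squares' columns both meet the lower row of the square, whose
contribution is therefore `1` in both; all other contributions cancel in pairs. At column `5` all
contributions are `1`, and the remaining squares are finitely many linear identities. -/
theorem hookSwivel_diamond (h5 : 5 ≤ L5) (h4 : L5 ≤ L4) (h3 : L4 ≤ L3) (h2 : L3 ≤ L2)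
    {u v ux vx uy vy uz vz : ℤ} (h : InSwivel L1 L2 L3 L4 L5 u v)
    (hd : DiamondSwivel u v ux vx uy vy uz vz) :
    hookSwivel L1 L2 L3 L4 L5 uz vz + hookSwivel L1 L2 L3 L4 L5 u v =
      hookSwivel L1 L2 L3 L4 L5 ux vx + hookSwivel L1 L2 L3 L4 L5 uy vy := by
  have s2 := columnStep_of_le (h5.trans (h4.trans (h3.trans h2)))
  have s3 := columnStep_of_le (h5.trans (h4.trans h3))
  have s4 := columnStep_of_le (h5.trans h4)
  have s5 := columnStep_of_le h5
  cases hd with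
  | row hu hv hux hvx huy hvy huz hvz =>
    subst ux vx uy vy uz vz
    rcases lt_trichotomy v 5 with hv5 | rfl | hv5
    · have hv1 : v = 3 ∨ v = 4 := by omega
      rcases hu with rfl | rfl | rfl | rfl <;> rcases hv1 with rfl | rfl <;>
        first | (exfalso; omega) | (norm_num [hookSwivel, hookRow]; omega)
    · rcases hu with rfl | rfl | rfl | rfl <;>
        first | (exfalso; omega) | (norm_num [hookSwivel, hookRow, s2, s3, s4, s5]; omega)
    · have e1 : 5 ≤ v - 1 := by omega
      have e2 : 5 ≤ v := by omega
      rcases hu with rfl | rfl | rfl | rfl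
      · have i1 : v ≤ L2 := by cases h <;> omega
        have i2 := columnStep_of_le i1
        have i3 : columnStep (v - 1) L2 = 1 := columnStep_of_le (by omega)
        norm_num [hookSwivel, hookRow, e1, e2, i2, i3]
        omega
      · have i1 : v ≤ L3 := by cases h <;> omega
        have i2 := columnStep_of_le i1
        have i3 : columnStep (v - 1) L3 = 1 := columnStep_of_le (by omega)
        norm_num [hookSwivel, hookRow, e1, e2, i2, i3]
        omega
      · have i1 : v ≤ L4 := by cases h <;> omega
        have i2 := columnStep_of_le i1
        have i3 : columnStep (v - 1) L4 = 1 := columnStep_of_le (by omega)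
        norm_num [hookSwivel, hookRow, e1, e2, i2, i3]
        omega
      · have i1 : v ≤ L5 := by cases h <;> omega
        have i2 := columnStep_of_le i1
        have i3 : columnStep (v - 1) L5 = 1 := columnStep_of_le (by omega)
        norm_num [hookSwivel, hookRow, e1, e2, i2, i3]
        omega
  | diag hu hv hux hvx huy hvy huz hvz =>
    subst ux vx uy vy uz vz
    rcases hu with rfl | rfl | rfl | rfl
    · obtain rfl : v = 2 := by omega
      norm_num [hookSwivel, hookRow]
      omega
    · obtain rfl : v = 3 := by omega
      norm_num [hookSwivel, hookRow]
      omega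
    · obtain rfl : v = 4 := by omega
      norm_num [hookSwivel, hookRow]
      omega
    · obtain rfl : v = 5 := by omega
      norm_num [hookSwivel, hookRow, s5]
      omega
  | diag1 hu hv hux hvx huy hvy huz hvz =>
    subst_vars
    norm_num [hookSwivel, hookRow]
    omega
  | p31 hu hv hux hvx huy hvy huz hvz =>
    subst_vars
    norm_num [hookSwivel, hookRow]
    omega

/-- Along the chain this holds by the choice of the formula; the four exceptional intervals are
linear identities in the row lengths. -/
theorem hookSwivel_long {k u v ux vx uy vy ut vt uz vz : ℤ}
    (hd : LongSwivel k u v ux vx uy vy ut vt uz vz) :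
    hookSwivel L1 L2 L3 L4 L5 uz vz + hookSwivel L1 L2 L3 L4 L5 u v =
      hookSwivel L1 L2 L3 L4 L5 ux vx + hookSwivel L1 L2 L3 L4 L5 uy vy := by
  cases hd with
  | row hk hu hv hux hvx huy hvy hut hvt huz hvz =>
    have e1 : hookSwivel L1 L2 L3 L4 L5 uz vz = 2 * L1 + L2 + L3 + L4 + L5 - 2 -
        hookRow L1 L2 L3 L4 L5 2 (1 - vz) := by
      unfold hookSwivel
      rw [if_neg (by omega), if_neg (by omega), if_neg (by omega), if_neg (by omega),
        if_neg (by omega), if_neg (by omega), if_neg (by omega), if_pos (by omega)]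
    have e2 : hookSwivel L1 L2 L3 L4 L5 u v = hookRow L1 L2 L3 L4 L5 2 (1 - vz) := by
      rw [show 1 - vz = v by omega, hu]
      simp [hookSwivel]
    have e3 : hookSwivel L1 L2 L3 L4 L5 ux vx = L1 + L3 + L4 + L5 - 4 := by
      rw [hux, hvx]
      simp [hookSwivel]
    have e4 : hookSwivel L1 L2 L3 L4 L5 uy vy = L1 + L2 + 2 := by
      rw [huy, hvy]
      simp [hookSwivel]
    omega
  | _ =>
    subst_vars
    norm_num [hookSwivel, hookRow]
    try omega

end

/-- The hook lengths of a tagged swivel. -/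
def hookLength {P : Type} (L1 L2 L3 L4 L5 : ℤ) (U V : P → ℤ) (x : P) : ℕ :=
  (hookSwivel L1 L2 L3 L4 L5 (U x) (V x)).toNat

namespace SwivelCoord

variable {P : Type} [PartialOrder P] {L1 L2 L3 L4 L5 : ℤ} {U V : P → ℤ}

theorem hookLength_eq (h : SwivelCoord P L1 L2 L3 L4 L5 U V) (x : P) :
    (hookLength L1 L2 L3 L4 L5 U V x : ℤ) = hookSwivel L1 L2 L3 L4 L5 (U x) (V x) :=
  Int.toNat_of_nonneg (hookSwivel_pos h.five_le h.le5 h.le4 h.le3 h.le2 (h.mem x)).le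

theorem hookLength_pos (h : SwivelCoord P L1 L2 L3 L4 L5 U V) (x : P) :
    0 < hookLength L1 L2 L3 L4 L5 U V x := by
  have := hookSwivel_pos h.five_le h.le5 h.le4 h.le3 h.le2 (h.mem x)
  rw [← h.hookLength_eq] at this
  omega

theorem hookLength_add (h : SwivelCoord P L1 L2 L3 L4 L5 U V) {k : ℕ} (hk : 3 ≤ k) {w z : P}
    (e : Set.Icc w z ≃o DoubleTailedDiamond k) :
    hookLength L1 L2 L3 L4 L5 U V z + hookLength L1 L2 L3 L4 L5 U V w =
      hookLength L1 L2 L3 L4 L5 U V (e.symm .left : P) +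
        hookLength L1 L2 L3 L4 L5 U V (e.symm .right : P) := by
  obtain ⟨l, r, hlr, hd⟩ := h.dInterval_cases hk e
  have key : hookLength L1 L2 L3 L4 L5 U V z + hookLength L1 L2 L3 L4 L5 U V w =
      hookLength L1 L2 L3 L4 L5 U V l + hookLength L1 L2 L3 L4 L5 U V r := by
    zify
    simp only [h.hookLength_eq]
    rcases hd with ⟨-, hd⟩ | ⟨-, t, -, -, hd⟩
    · exact hookSwivel_diamond h.five_le h.le5 h.le4 h.le3 (h.mem w) hd
    · exact hookSwivel_long hd
  rcases hlr with ⟨rfl, rfl⟩ | ⟨rfl, rfl⟩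
  · exact key
  · rw [key, add_comm]

/-- Counting the elements below `z`: those in the rows of the large diagram, from column `aᵢ` on,
and those in `E`. -/
theorem card_Iic (h : SwivelCoord P L1 L2 L3 L4 L5 U V) {z : P} (a1 a2 a3 a4 a5 : ℤ)
    (E : Finset (ℤ × ℤ)) (hE : ∀ p ∈ E, p.1 = 7 ∨ p.1 = 9 ∨ p.1 = 12)
    (hz : ∀ u v, (InSwivel L1 L2 L3 L4 L5 u v ∧ U z ≤ u ∧ V z ≤ v) ↔
      (u = 2 ∧ a1 ≤ v ∧ v ≤ L1) ∨ (u = 4 ∧ a2 ≤ v ∧ v ≤ L2) ∨ (u = 6 ∧ a3 ≤ v ∧ v ≤ L3) ∨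
      (u = 8 ∧ a4 ≤ v ∧ v ≤ L4) ∨ (u = 10 ∧ a5 ≤ v ∧ v ≤ L5) ∨ (u, v) ∈ E) :
    Nat.card (Set.Iic z) = (L1 + 1 - a1).toNat + (L2 + 1 - a2).toNat + (L3 + 1 - a3).toNat +
      (L4 + 1 - a4).toNat + (L5 + 1 - a5).toNat + E.card := by
  classical
  let row : ℤ → ℤ → ℤ → Finset (ℤ × ℤ) := fun u a L => {u} ×ˢ Finset.Icc a L
  have hrow : ∀ u a L (p : ℤ × ℤ), p ∈ row u a L ↔ p.1 = u ∧ a ≤ p.2 ∧ p.2 ≤ L := by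
    intro u a L p
    simp only [row, Finset.mem_product, Finset.mem_singleton, Finset.mem_Icc]
  have hcard : ∀ u a L, (row u a L).card = (L + 1 - a).toNat := by
    intro u a L
    simp [row]
  let S := row 2 a1 L1 ∪ row 4 a2 L2 ∪ row 6 a3 L3 ∪ row 8 a4 L4 ∪ row 10 a5 L5 ∪ E
  have hS : S.card = (L1 + 1 - a1).toNat + (L2 + 1 - a2).toNat + (L3 + 1 - a3).toNat +
      (L4 + 1 - a4).toNat + (L5 + 1 - a5).toNat + E.card := by
    simp only [S]
    rw [Finset.card_union_of_disjoint, Finset.card_union_of_disjoint,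
      Finset.card_union_of_disjoint, Finset.card_union_of_disjoint,
      Finset.card_union_of_disjoint, hcard, hcard, hcard, hcard, hcard]
    all_goals
      rw [Finset.disjoint_left]
      intro p hp hp'
      simp only [Finset.mem_union, hrow] at hp hp'
      first | omega | (have := hE p hp'; omega)
  have himage : (fun x => (U x, V x)) '' Set.Iic z = (S : Set (ℤ × ℤ)) := by
    ext p
    have hp : p ∈ S ↔ InSwivel L1 L2 L3 L4 L5 p.1 p.2 ∧ U z ≤ p.1 ∧ V z ≤ p.2 := by
      rw [hz]
      simp only [S, Finset.mem_union, hrow, or_assoc]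
    rw [Finset.mem_coe, hp]
    constructor
    · rintro ⟨x, hx, rfl⟩
      exact ⟨h.mem x, (h.le_iff x z).1 hx⟩
    · rintro ⟨h1, h2⟩
      obtain ⟨x, hxu, hxv⟩ := h.exists_mem _ _ h1
      exact ⟨x, (h.le_iff x z).2 (hxu ▸ hxv ▸ h2), Prod.ext hxu hxv⟩
  rw [← hS, Nat.card_coe_set_eq, ← Set.ncard_image_of_injective (f := fun x => (U x, V x)),
    himage, Set.ncard_coe_finset]
  intro x y hxy
  exact h.ext (congrArg Prod.fst hxy) (congrArg Prod.snd hxy)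

theorem card_Iic_row (h : SwivelCoord P L1 L2 L3 L4 L5 U V) {z : P} (hv : 5 ≤ V z)
    {a1 a2 a3 a4 a5 : ℤ} (h1 : (U z ≤ 2 ∧ a1 = V z) ∨ (2 < U z ∧ a1 = L1 + 1))
    (h2 : (U z ≤ 4 ∧ a2 = V z) ∨ (4 < U z ∧ a2 = L2 + 1))
    (h3 : (U z ≤ 6 ∧ a3 = V z) ∨ (6 < U z ∧ a3 = L3 + 1))
    (h4 : (U z ≤ 8 ∧ a4 = V z) ∨ (8 < U z ∧ a4 = L4 + 1))
    (h5 : (U z ≤ 10 ∧ a5 = V z) ∨ (10 < U z ∧ a5 = L5 + 1)) :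
    Nat.card (Set.Iic z) = (L1 + 1 - a1).toNat + (L2 + 1 - a2).toNat + (L3 + 1 - a3).toNat +
      (L4 + 1 - a4).toNat + (L5 + 1 - a5).toNat := by
  refine h.card_Iic a1 a2 a3 a4 a5 ∅ (by simp) fun u v => ⟨?_, ?_⟩
  · rintro ⟨hm, h6, h7⟩
    cases hm <;> omega
  · rintro (h6 | h6 | h6 | h6 | h6 | h6)
    · exact ⟨.row1 h6.1 (by omega) h6.2.2, by omega, by omega⟩
    · exact ⟨.row2 h6.1 (by omega) h6.2.2, by omega, by omega⟩
    · exact ⟨.row3 h6.1 (by omega) h6.2.2, by omega, by omega⟩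
    · exact ⟨.row4 h6.1 (by omega) h6.2.2, by omega, by omega⟩
    · exact ⟨.row5 h6.1 (by omega) h6.2.2, by omega, by omega⟩
    · simp at h6

theorem inNeck_of_bottom (h : SwivelCoord P L1 L2 L3 L4 L5 U V) {z : P}
    {u v ux vx uy vy : ℤ} (hd : DiamondSwivel u v ux vx uy vy (U z) (V z))
    (hw : InSwivel L1 L2 L3 L4 L5 u v) : InNeck z := by
  have h2 := h.le2
  have h3 := h.le3
  have h4 := h.le4
  have h5 := h.le5
  have h6 := h.five_le
  refine h.inNeck_of_diamond hd hw ?_ ?_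
  · cases hd with
    | row hu hv hux hvx => exact hux ▸ hvx ▸ hw.left_mem hu hv
    | diag hu hv hux hvx => exact hux ▸ hvx ▸ InSwivel.diag_mem hu hv
    | diag1 hu hv hux hvx => exact .p1 hux hvx
    | p31 hu hv hux hvx => exact .p30 hux hvx
  · cases hd with
    | row hu hv hux hvx huy hvy => exact huy ▸ hvy ▸ hw.up_mem hu h5 h4 h3 h2
    | diag hu hv hux hvx huy hvy => exact huy ▸ hvy ▸ hw.up_mem hu h5 h4 h3 h2
    | diag1 hu hv hux hvx huy hvy => exact .p0 huy hvy
    | p31 hu hv hux hvx huy hvy => exact .row1 huy (by omega) (by omega)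

/-- An element of row `i` above an element of row `i + 1` is in a neck. -/
theorem inNeck_of_row (h : SwivelCoord P L1 L2 L3 L4 L5 U V) {z : P}
    (hu : U z = 2 ∨ U z = 4 ∨ U z = 6 ∨ U z = 8) (hv : U z ≤ 2 * V z)
    (hw : InSwivel L1 L2 L3 L4 L5 (U z + 2) (V z + 1)) : InNeck z := by
  rcases hv.lt_or_eq with h1 | h1
  · exact h.inNeck_of_bottom
      (.row (by omega) (by omega) rfl rfl rfl rfl (by omega) (by omega)) hw
  · exact h.inNeck_of_bottom
      (.diag (by omega) (by omega) rfl rfl rfl rfl (by omega) (by omega)) hw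

/-- A cell of row `i` that has a cell diagonally below it in row `i + 1` is the top of a square.
Otherwise its column is at least `L_{i+1}`, so each lower row has at most one cell below it, and
counting gives the formula. Apart from the last row, the only other elements to be counted are `(9,
4)`, `(7, 3)` and `(12, 3)`. -/
theorem inNeck_or_card (h : SwivelCoord P L1 L2 L3 L4 L5 U V) (z : P) :
    InNeck z ∨ hookSwivel L1 L2 L3 L4 L5 (U z) (V z) = Nat.card (Set.Iic z) := by
  have h2 := h.le2
  have h3 := h.le3
  have h4 := h.le4
  have h5 := h.le5
  have h6 := h.five_le
  -- For a row ending at or before column `v`, the number of its cells from column `v` on is zero or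
  -- one, which is exactly `columnStep`.
  have hstep : ∀ v L, L ≤ v → columnStep v L = (L + 1 - v).toNat := by
    intro v L h8
    unfold columnStep
    split_ifs <;> omega
  cases h.mem z with
  | row1 hu hv hv' =>
    by_cases hL : V z + 1 ≤ L2
    · exact Or.inl (h.inNeck_of_row (by omega) (by omega)
        (.row2 (by omega) (by omega) (by omega)))
    · right
      rw [h.card_Iic_row (a1 := V z) (a2 := V z) (a3 := V z) (a4 := V z) (a5 := V z) (by omega)
        (by omega) (by omega) (by omega) (by omega) (by omega), hu]
      have e1 : 5 ≤ V z := by omega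
      norm_num [hookSwivel, hookRow, e1]
      rw [hstep _ L2 (by omega), hstep _ L3 (by omega), hstep _ L4 (by omega),
        hstep _ L5 (by omega)]
      omega
  | row2 hu hv hv' =>
    by_cases hL : V z + 1 ≤ L3
    · exact Or.inl (h.inNeck_of_row (by omega) (by omega)
        (.row3 (by omega) (by omega) (by omega)))
    · right
      rw [h.card_Iic_row (a1 := L1 + 1) (a2 := V z) (a3 := V z) (a4 := V z) (a5 := V z) (by omega)
        (by omega) (by omega) (by omega) (by omega) (by omega), hu]
      have e1 : 5 ≤ V z := by omega
      norm_num [hookSwivel, hookRow, e1]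
      rw [hstep _ L3 (by omega), hstep _ L4 (by omega), hstep _ L5 (by omega)]
      omega
  | row3 hu hv hv' =>
    by_cases hL : V z + 1 ≤ L4
    · exact Or.inl (h.inNeck_of_row (by omega) (by omega)
        (.row4 (by omega) (by omega) (by omega)))
    · right
      rw [h.card_Iic_row (a1 := L1 + 1) (a2 := L2 + 1) (a3 := V z) (a4 := V z) (a5 := V z)
        (by omega) (by omega) (by omega) (by omega) (by omega) (by omega), hu]
      have e1 : 5 ≤ V z := by omega
      norm_num [hookSwivel, hookRow, e1]
      rw [hstep _ L4 (by omega), hstep _ L5 (by omega)]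
      omega
  | row4 hu hv hv' =>
    by_cases hL : V z + 1 ≤ L5
    · exact Or.inl (h.inNeck_of_row (by omega) (by omega)
        (.row5 (by omega) (by omega) (by omega)))
    · right
      rw [h.card_Iic_row (a1 := L1 + 1) (a2 := L2 + 1) (a3 := L3 + 1) (a4 := V z) (a5 := V z)
        (by omega) (by omega) (by omega) (by omega) (by omega) (by omega), hu]
      have e1 : 5 ≤ V z := by omega
      norm_num [hookSwivel, hookRow, e1]
      rw [hstep _ L5 (by omega)]
      omega
  | row5 hu hv hv' =>
    right
    rw [h.card_Iic_row (a1 := L1 + 1) (a2 := L2 + 1) (a3 := L3 + 1) (a4 := L4 + 1) (a5 := V z)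
      (by omega) (by omega) (by omega) (by omega) (by omega) (by omega), hu]
    norm_num [hookSwivel, hookRow]
    omega
  | chain hu hv hv' =>
    left
    by_cases hz : V z = 0
    · exact h.inNeck_of_bottom (.diag1 rfl rfl rfl rfl rfl rfl (by omega) hz)
        (.row1 rfl (by omega) (by omega))
    · exact h.inNeck_chain hu (by omega)
  | p9 hu hv =>
    right
    rw [h.card_Iic (L1 + 1) (L2 + 1) (L3 + 1) (L4 + 1) 5 {(9, 4)} (by simp) fun u v => ?_, hu]
    · norm_num [hookSwivel]
      omega
    · rw [Finset.mem_singleton, Prod.mk.injEq, hu, hv]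
      constructor
      · rintro ⟨hm, h7, h8⟩
        cases hm <;> omega
      · intro h7
        rcases (by omega : (u = 10 ∧ 5 ≤ v ∧ v ≤ L5) ∨ (u = 9 ∧ v = 4)) with h8 | h8
        · exact ⟨.row5 h8.1 h8.2.1 h8.2.2, by omega, by omega⟩
        · exact ⟨.p9 h8.1 h8.2, by omega, by omega⟩
  | p7 hu hv =>
    right
    rw [h.card_Iic (L1 + 1) (L2 + 1) (L3 + 1) 4 5 {(7, 3), (9, 4), (12, 3)} (by simp)
      fun u v => ?_, hu]
    · norm_num [hookSwivel]
      omega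
    · simp only [Finset.mem_insert, Finset.mem_singleton, Prod.mk.injEq, hu, hv]
      constructor
      · rintro ⟨hm, h7, h8⟩
        cases hm <;> omega
      · intro h7
        rcases (by omega : (u = 8 ∧ 4 ≤ v ∧ v ≤ L4) ∨ (u = 10 ∧ 5 ≤ v ∧ v ≤ L5) ∨
          (u = 7 ∧ v = 3) ∨ (u = 9 ∧ v = 4) ∨ (u = 12 ∧ v = 3)) with h8 | h8 | h8 | h8 | h8
        · exact ⟨.row4 h8.1 h8.2.1 h8.2.2, by omega, by omega⟩
        · exact ⟨.row5 h8.1 h8.2.1 h8.2.2, by omega, by omega⟩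
        · exact ⟨.p7 h8.1 h8.2, by omega, by omega⟩
        · exact ⟨.p9 h8.1 h8.2, by omega, by omega⟩
        · exact ⟨.p12 h8.1 h8.2, by omega, by omega⟩
  | p12 hu hv =>
    right
    rw [h.card_Iic (L1 + 1) (L2 + 1) (L3 + 1) (L4 + 1) (L5 + 1) {(12, 3)} (by simp)
      fun u v => ?_, hu]
    · norm_num [hookSwivel]
    · rw [Finset.mem_singleton, Prod.mk.injEq, hu, hv]
      constructor
      · rintro ⟨hm, h7, h8⟩
        cases hm <;> omega
      · intro h7
        exact ⟨.p12 (by omega) (by omega), by omega, by omega⟩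
  | p5 hu hv => exact Or.inl (h.inNeck_five hu hv)
  | p31 hu hv => exact Or.inl (h.inNeck_three_one hu hv)
  | p30 hu hv => exact Or.inl (h.inNeck_three_zero hu hv)
  | p1 hu hv =>
    exact Or.inl (h.inNeck_of_bottom (.p31 rfl rfl rfl rfl rfl rfl hu hv) (.p31 rfl rfl))
  | p0 hu hv => exact Or.inl (h.inNeck_zero_one hu hv)

theorem isHookLength (h : SwivelCoord P L1 L2 L3 L4 L5 U V) :
    IsHookLength (hookLength L1 L2 L3 L4 L5 U V) where
  of_not_inNeck z hz := by
    have := (h.inNeck_or_card z).resolve_left hz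
    rw [← h.hookLength_eq] at this
    exact_mod_cast this
  add_eq _ hk _ _ e := h.hookLength_add hk e

end SwivelCoord

/-! ### Coordinates on the tagged swivel. -/

namespace TaggedSwivel

open DiagPoset

/-- The first coordinate of the cell in row `r` and position `p` of the `t`-th diagram. -/
def placeU (t r p : ℕ) : ℤ :=
  if t = 0 then 2 * (r + 1)
  else if p = 0 then
    if t = 1 then 8 + 2 * r else if t = 2 then 6 + 2 * r else if t = 3 then 4 + 2 * r else 2 * r
  else if t = 1 then 9
  else if t = 2 then if p = 1 then 7 else 12
  else if t = 3 then 5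
  else if t = 4 then if r = 0 ∧ p = 1 then 1 else 3
  else 0

/-- The second coordinate of the cell in row `r` and position `p` of the `t`-th diagram. -/
def placeV (t r p : ℕ) : ℤ :=
  if t = 0 then r + 1 + p
  else if p = 0 then
    if t = 1 then 4 + r else if t = 2 then 3 + r else if t = 3 then 2 + r else r
  else if t = 1 then 4
  else if t = 2 then 3
  else if t = 3 then 2
  else if t = 4 then r
  else 1

variable {lam : Par 5}

/-- The first coordinate of an element. -/
def coordU : TaggedSwivel lam → ℤ
  | diag i => 10 - 2 * i
  | top j => -1 - j
  | cell t r j => placeU t r (j + 1)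

/-- The second coordinate of an element. -/
def coordV : TaggedSwivel lam → ℤ
  | diag i => 5 - i
  | top j => -1 - j
  | cell t r j => placeV t r (j + 1)

/-- The elements one by one. -/
theorem elements {motive : TaggedSwivel lam → Prop} (hdiag : ∀ i : Fin 6, motive (.diag i))
    (htop : ∀ j, motive (.top j))
    (hrow : ∀ (r : Fin 5) (j : Fin (arm lam r)), motive (.cell (0 : Fin 6) r j))
    (h1 : motive (.cell (1 : Fin 6) (0 : Fin 2) (0 : Fin 1)))
    (h2 : motive (.cell (2 : Fin 6) (0 : Fin 2) (0 : Fin 2)))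
    (h2' : motive (.cell (2 : Fin 6) (0 : Fin 2) (1 : Fin 2)))
    (h3 : motive (.cell (3 : Fin 6) (0 : Fin 2) (0 : Fin 1)))
    (h4 : motive (.cell (4 : Fin 6) (0 : Fin 3) (0 : Fin 2)))
    (h4' : motive (.cell (4 : Fin 6) (0 : Fin 3) (1 : Fin 2)))
    (h4'' : motive (.cell (4 : Fin 6) (1 : Fin 3) (0 : Fin 1)))
    (h5 : motive (.cell (5 : Fin 6) (0 : Fin 2) (0 : Fin 1))) : ∀ x, motive x
  | .diag i => hdiag i
  | .top j => htop j
  | .cell ⟨0, _⟩ r j => hrow r j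
  | .cell ⟨1, _⟩ ⟨0, _⟩ ⟨0, _⟩ => h1
  | .cell ⟨1, _⟩ ⟨0, _⟩ ⟨j + 1, hj⟩ => absurd (show j + 1 < 1 from hj) (by omega)
  | .cell ⟨1, _⟩ ⟨1, _⟩ ⟨j, hj⟩ => absurd (show j < 0 from hj) (by omega)
  | .cell ⟨1, _⟩ ⟨r + 2, hr⟩ _ => absurd (show r + 2 < 2 from hr) (by omega)
  | .cell ⟨2, _⟩ ⟨0, _⟩ ⟨0, _⟩ => h2
  | .cell ⟨2, _⟩ ⟨0, _⟩ ⟨1, _⟩ => h2'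
  | .cell ⟨2, _⟩ ⟨0, _⟩ ⟨j + 2, hj⟩ => absurd (show j + 2 < 2 from hj) (by omega)
  | .cell ⟨2, _⟩ ⟨1, _⟩ ⟨j, hj⟩ => absurd (show j < 0 from hj) (by omega)
  | .cell ⟨2, _⟩ ⟨r + 2, hr⟩ _ => absurd (show r + 2 < 2 from hr) (by omega)
  | .cell ⟨3, _⟩ ⟨0, _⟩ ⟨0, _⟩ => h3
  | .cell ⟨3, _⟩ ⟨0, _⟩ ⟨j + 1, hj⟩ => absurd (show j + 1 < 1 from hj) (by omega)
  | .cell ⟨3, _⟩ ⟨1, _⟩ ⟨j, hj⟩ => absurd (show j < 0 from hj) (by omega)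
  | .cell ⟨3, _⟩ ⟨r + 2, hr⟩ _ => absurd (show r + 2 < 2 from hr) (by omega)
  | .cell ⟨4, _⟩ ⟨0, _⟩ ⟨0, _⟩ => h4
  | .cell ⟨4, _⟩ ⟨0, _⟩ ⟨1, _⟩ => h4'
  | .cell ⟨4, _⟩ ⟨0, _⟩ ⟨j + 2, hj⟩ => absurd (show j + 2 < 2 from hj) (by omega)
  | .cell ⟨4, _⟩ ⟨1, _⟩ ⟨0, _⟩ => h4''
  | .cell ⟨4, _⟩ ⟨1, _⟩ ⟨j + 1, hj⟩ => absurd (show j + 1 < 1 from hj) (by omega)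
  | .cell ⟨4, _⟩ ⟨2, _⟩ ⟨j, hj⟩ => absurd (show j < 0 from hj) (by omega)
  | .cell ⟨4, _⟩ ⟨r + 3, hr⟩ _ => absurd (show r + 3 < 3 from hr) (by omega)
  | .cell ⟨5, _⟩ ⟨0, _⟩ ⟨0, _⟩ => h5
  | .cell ⟨5, _⟩ ⟨0, _⟩ ⟨j + 1, hj⟩ => absurd (show j + 1 < 1 from hj) (by omega)
  | .cell ⟨5, _⟩ ⟨1, _⟩ ⟨j, hj⟩ => absurd (show j < 0 from hj) (by omega)
  | .cell ⟨5, _⟩ ⟨r + 2, hr⟩ _ => absurd (show r + 2 < 2 from hr) (by omega)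
  | .cell ⟨t + 6, ht⟩ _ _ => absurd (show t + 6 < 6 from ht) (by omega)

/-- The length of row `r` of the large diagram, counted from its first column. -/
def rowEnd (lam : Par 5) (r : Fin 5) : ℕ := lam.part r + 5

theorem rowEnd_antitone (lam : Par 5) : Antitone (rowEnd lam) :=
  fun _ _ h => Nat.add_le_add_right (lam.part_antitone h) 5

theorem arm_add (lam : Par 5) (r : Fin 5) : arm lam r + (r + 1) = rowEnd lam r := by
  have h1 := lam.add_addStaircase r
  have h2 := lam.addStaircase_pos r
  unfold arm rowEnd
  omega

theorem coord_diagIndex (t : Fin (taggedSwivelData lam).length)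
    (r : Fin ((taggedSwivelData lam).get t).len) :
    (10 - 2 * (diagIndex t r : ℕ) : ℤ) = placeU t r 0 ∧
      (5 - (diagIndex t r : ℕ) : ℤ) = placeV t r 0 := by
  match t, r with
  | ⟨0, _⟩, r =>
    have h : (r : ℕ) < 5 := r.isLt
    change (10 - 2 * ((1 - 1 + (5 - 1 - (r : ℕ)) : ℕ) : ℤ)) = 2 * (r + 1) ∧
      (5 - ((1 - 1 + (5 - 1 - (r : ℕ)) : ℕ) : ℤ)) = r + 1 + (0 : ℕ)
    omega
  | ⟨1, _⟩, r =>
    have h : (r : ℕ) < 2 := r.isLt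
    change (10 - 2 * ((1 - 1 + (2 - 1 - (r : ℕ)) : ℕ) : ℤ)) = 8 + 2 * r ∧
      (5 - ((1 - 1 + (2 - 1 - (r : ℕ)) : ℕ) : ℤ)) = 4 + r
    omega
  | ⟨2, _⟩, r =>
    have h : (r : ℕ) < 2 := r.isLt
    change (10 - 2 * ((2 - 1 + (2 - 1 - (r : ℕ)) : ℕ) : ℤ)) = 6 + 2 * r ∧
      (5 - ((2 - 1 + (2 - 1 - (r : ℕ)) : ℕ) : ℤ)) = 3 + r
    omega
  | ⟨3, _⟩, r =>
    have h : (r : ℕ) < 2 := r.isLt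
    change (10 - 2 * ((3 - 1 + (2 - 1 - (r : ℕ)) : ℕ) : ℤ)) = 4 + 2 * r ∧
      (5 - ((3 - 1 + (2 - 1 - (r : ℕ)) : ℕ) : ℤ)) = 2 + r
    omega
  | ⟨4, _⟩, r =>
    have h : (r : ℕ) < 3 := r.isLt
    change (10 - 2 * ((4 - 1 + (3 - 1 - (r : ℕ)) : ℕ) : ℤ)) = 2 * r ∧
      (5 - ((4 - 1 + (3 - 1 - (r : ℕ)) : ℕ) : ℤ)) = r
    omega
  | ⟨5, _⟩, r =>
    have h : (r : ℕ) < 2 := r.isLt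
    change (10 - 2 * ((5 - 1 + (2 - 1 - (r : ℕ)) : ℕ) : ℤ)) = 2 * r ∧
      (5 - ((5 - 1 + (2 - 1 - (r : ℕ)) : ℕ) : ℤ)) = r
    omega
  | ⟨t + 6, ht⟩, _ => exact absurd (show t + 6 < 6 from ht) (by omega)

theorem coord_place (t : Fin (taggedSwivelData lam).length)
    (c : ShiftedCell ((taggedSwivelData lam).get t).lam) :
    coordU (lam := lam) (place t c) = placeU t c.row c.pos ∧
      coordV (lam := lam) (place t c) = placeV t c.row c.pos := by
  unfold place
  split
  · rename_i h
    rw [h]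
    exact coord_diagIndex t c.row
  · rename_i h
    have : (c.pos : ℕ) - 1 + 1 = c.pos := by omega
    change placeU t c.row ((c.pos : ℕ) - 1 + 1) = _ ∧ placeV t c.row ((c.pos : ℕ) - 1 + 1) = _
    rw [this]
    exact ⟨rfl, rfl⟩

theorem place_mono {t r p r' p' : ℕ} (h1 : r' ≤ r) (h2 : r' + p' ≤ r + p)
    (hr : t = 0 ∨ (t = 1 ∧ r + p < 2) ∨ (t = 2 ∧ (r = 0 ∧ p < 3 ∨ r = 1 ∧ p = 0)) ∨
      (t = 3 ∧ r + p < 2) ∨ (t = 4 ∧ r + p < 3) ∨ (t = 5 ∧ r + p < 2)) :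
    placeU t r' p' ≤ placeU t r p ∧ placeV t r' p' ≤ placeV t r p := by
  unfold placeU placeV
  rcases hr with rfl | ⟨rfl, hr⟩ | ⟨rfl, hr⟩ | ⟨rfl, hr⟩ | ⟨rfl, hr⟩ | ⟨rfl, hr⟩
  all_goals norm_num
  all_goals try split_ifs
  all_goals omega

theorem cell_bound (t : Fin (taggedSwivelData lam).length)
    (c : ShiftedCell ((taggedSwivelData lam).get t).lam) :
    (t : ℕ) = 0 ∨ ((t : ℕ) = 1 ∧ (c.row : ℕ) + c.pos < 2) ∨
      ((t : ℕ) = 2 ∧ ((c.row : ℕ) = 0 ∧ (c.pos : ℕ) < 3 ∨ (c.row : ℕ) = 1 ∧ (c.pos : ℕ) = 0)) ∨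
      ((t : ℕ) = 3 ∧ (c.row : ℕ) + c.pos < 2) ∨ ((t : ℕ) = 4 ∧ (c.row : ℕ) + c.pos < 3) ∨
      ((t : ℕ) = 5 ∧ (c.row : ℕ) + c.pos < 2) := by
  match t, c with
  | ⟨0, _⟩, _ => exact Or.inl rfl
  | ⟨1, _⟩, ⟨r, p⟩ =>
    refine Or.inr (Or.inl ⟨rfl, ?_⟩)
    match r, p with
    | ⟨0, _⟩, ⟨p, hp⟩ => have : p < 2 := hp; dsimp only; omega
    | ⟨1, _⟩, ⟨p, hp⟩ => have : p < 1 := hp; dsimp only; omega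
    | ⟨r + 2, hr⟩, _ => exact absurd (show r + 2 < 2 from hr) (by omega)
  | ⟨2, _⟩, ⟨r, p⟩ =>
    refine Or.inr (Or.inr (Or.inl ⟨rfl, ?_⟩))
    match r, p with
    | ⟨0, _⟩, ⟨p, hp⟩ => exact Or.inl ⟨rfl, hp⟩
    | ⟨1, _⟩, ⟨p, hp⟩ => have : p < 1 := hp; exact Or.inr ⟨rfl, by dsimp only; omega⟩
    | ⟨r + 2, hr⟩, _ => exact absurd (show r + 2 < 2 from hr) (by omega)
  | ⟨3, _⟩, ⟨r, p⟩ =>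
    refine Or.inr (Or.inr (Or.inr (Or.inl ⟨rfl, ?_⟩)))
    match r, p with
    | ⟨0, _⟩, ⟨p, hp⟩ => have : p < 2 := hp; dsimp only; omega
    | ⟨1, _⟩, ⟨p, hp⟩ => have : p < 1 := hp; dsimp only; omega
    | ⟨r + 2, hr⟩, _ => exact absurd (show r + 2 < 2 from hr) (by omega)
  | ⟨4, _⟩, ⟨r, p⟩ =>
    refine Or.inr (Or.inr (Or.inr (Or.inr (Or.inl ⟨rfl, ?_⟩))))
    match r, p with
    | ⟨0, _⟩, ⟨p, hp⟩ => have : p < 3 := hp; dsimp only; omega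
    | ⟨1, _⟩, ⟨p, hp⟩ => have : p < 2 := hp; dsimp only; omega
    | ⟨2, _⟩, ⟨p, hp⟩ => have : p < 1 := hp; dsimp only; omega
    | ⟨r + 3, hr⟩, _ => exact absurd (show r + 3 < 3 from hr) (by omega)
  | ⟨5, _⟩, ⟨r, p⟩ =>
    refine Or.inr (Or.inr (Or.inr (Or.inr (Or.inr ⟨rfl, ?_⟩))))
    match r, p with
    | ⟨0, _⟩, ⟨p, hp⟩ => have : p < 2 := hp; dsimp only; omega
    | ⟨1, _⟩, ⟨p, hp⟩ => have : p < 1 := hp; dsimp only; omega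
    | ⟨r + 2, hr⟩, _ => exact absurd (show r + 2 < 2 from hr) (by omega)
  | ⟨t + 6, ht⟩, _ => exact absurd (show t + 6 < 6 from ht) (by omega)

theorem coord_gen {x y : TaggedSwivel lam} (h : Gen x y) :
    coordU y ≤ coordU x ∧ coordV y ≤ coordV x := by
  cases h with
  | @diag i j h =>
    have : (i : ℕ) ≤ j := h
    simp only [coordU, coordV]
    omega
  | @cell t a b h =>
    rw [(coord_place t a).1, (coord_place t a).2, (coord_place t b).1, (coord_place t b).2]
    exact place_mono h.1 h.2 (cell_bound t a)
  | attach i j =>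
    have := i.isLt
    simp only [coordU, coordV]
    omega
  | @top i j h =>
    have : (i : ℕ) ≤ j := h
    simp only [coordU, coordV]
    omega

theorem coord_le {x y : TaggedSwivel lam} (h : x ≤ y) :
    coordU y ≤ coordU x ∧ coordV y ≤ coordV x := by
  have h' : Relation.ReflTransGen Gen x y := h
  induction h' with
  | refl => exact ⟨le_rfl, le_rfl⟩
  | tail hxz hzy ih =>
    have h1 := ih hxz
    have h2 := coord_gen hzy
    omega

theorem coord_mem (x : TaggedSwivel lam) : InSwivel (rowEnd lam 0) (rowEnd lam 1) (rowEnd lam 2)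
    (rowEnd lam 3) (rowEnd lam 4) (coordU x) (coordV x) := by
  have h4 : 5 ≤ rowEnd lam 4 := Nat.le_add_left 5 _
  have h3 : rowEnd lam 4 ≤ rowEnd lam 3 := rowEnd_antitone lam (by decide)
  have h2 : rowEnd lam 3 ≤ rowEnd lam 2 := rowEnd_antitone lam (by decide)
  have h1 : rowEnd lam 2 ≤ rowEnd lam 1 := rowEnd_antitone lam (by decide)
  have h0 : rowEnd lam 1 ≤ rowEnd lam 0 := rowEnd_antitone lam (by decide)
  induction x using elements with
  | hdiag i =>
    fin_cases i
    · exact .row5 rfl (le_refl (5 : ℤ)) (by change (5 : ℤ) ≤ _; omega)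
    · exact .row4 rfl (le_refl (4 : ℤ)) (by change (4 : ℤ) ≤ _; omega)
    · exact .row3 rfl (le_refl (3 : ℤ)) (by change (3 : ℤ) ≤ _; omega)
    · exact .row2 rfl (le_refl (2 : ℤ)) (by change (2 : ℤ) ≤ _; omega)
    · exact .row1 rfl (le_refl (1 : ℤ)) (by change (1 : ℤ) ≤ _; omega)
    · exact .chain rfl (by change _ ≤ (0 : ℤ); omega) (le_refl (0 : ℤ))
  | htop j =>
    have := j.isLt
    have h : rowEnd lam 0 = lam.part 0 + 5 := rfl
    exact .chain rfl (by simp only [coordU]; omega) (by simp only [coordU]; omega)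
  | hrow r j =>
    have hj := j.isLt
    have ha := arm_add lam r
    have hu : coordU (.cell (0 : Fin 6) r j : TaggedSwivel lam) = 2 * ((r : ℕ) + 1) := rfl
    have hv : coordV (.cell (0 : Fin 6) r j : TaggedSwivel lam) =
      (r : ℕ) + 1 + ((j : ℕ) + 1 : ℕ) := rfl
    rw [hu, hv]
    fin_cases r
    · exact .row1 rfl (by dsimp only at *; omega) (by dsimp at *; omega)
    · exact .row2 rfl (by dsimp only at *; omega) (by dsimp at *; omega)
    · exact .row3 rfl (by dsimp only at *; omega) (by dsimp at *; omega)
    · exact .row4 rfl (by dsimp only at *; omega) (by dsimp at *; omega)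
    · exact .row5 rfl (by dsimp only at *; omega) (by dsimp at *; omega)
  | h1 => exact .p9 rfl rfl
  | h2 => exact .p7 rfl rfl
  | h2' => exact .p12 rfl rfl
  | h3 => exact .p5 rfl rfl
  | h4 => exact .p1 rfl rfl
  | h4' => exact .p30 rfl rfl
  | h4'' => exact .p31 rfl rfl
  | h5 => exact .p0 rfl rfl

end TaggedSwivel

namespace TaggedSwivel

open DiagPoset

variable {lam : Par 5}

/-- The element with given coordinates. -/
inductive IsAt (lam : Par 5) (u v : ℤ) : TaggedSwivel lam → Prop
  | diag (i : Fin 6) (hu : u = 10 - 2 * (i : ℕ)) (hv : v = 5 - (i : ℕ)) : IsAt lam u v (.diag i)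
  | top (j : Fin (lam.part 0 + 4)) (hu : u = -1 - (j : ℕ)) (hv : v = -1 - (j : ℕ)) :
    IsAt lam u v (.top j)
  | row (r : Fin 5) (j : Fin (arm lam r)) (hu : u = 2 * ((r : ℕ) + 1))
      (hv : v = (r : ℕ) + 1 + ((j : ℕ) + 1 : ℕ)) : IsAt lam u v (.cell (0 : Fin 6) r j)
  | one (hu : u = 9) (hv : v = 4) : IsAt lam u v (.cell (1 : Fin 6) (0 : Fin 2) (0 : Fin 1))
  | two (hu : u = 7) (hv : v = 3) : IsAt lam u v (.cell (2 : Fin 6) (0 : Fin 2) (0 : Fin 2))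
  | two_one (hu : u = 12) (hv : v = 3) : IsAt lam u v (.cell (2 : Fin 6) (0 : Fin 2) (1 : Fin 2))
  | three (hu : u = 5) (hv : v = 2) : IsAt lam u v (.cell (3 : Fin 6) (0 : Fin 2) (0 : Fin 1))
  | four (hu : u = 1) (hv : v = 0) : IsAt lam u v (.cell (4 : Fin 6) (0 : Fin 3) (0 : Fin 2))
  | four_one (hu : u = 3) (hv : v = 0) : IsAt lam u v (.cell (4 : Fin 6) (0 : Fin 3) (1 : Fin 2))
  | four_row (hu : u = 3) (hv : v = 1) : IsAt lam u v (.cell (4 : Fin 6) (1 : Fin 3) (0 : Fin 1))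
  | five (hu : u = 0) (hv : v = 1) : IsAt lam u v (.cell (5 : Fin 6) (0 : Fin 2) (0 : Fin 1))

theorem isAt_coord (x : TaggedSwivel lam) : IsAt lam (coordU x) (coordV x) x := by
  induction x using elements with
  | hdiag i => exact .diag i rfl rfl
  | htop j => exact .top j rfl rfl
  | hrow r j => exact .row r j rfl rfl
  | h1 => exact .one rfl rfl
  | h2 => exact .two rfl rfl
  | h2' => exact .two_one rfl rfl
  | h3 => exact .three rfl rfl
  | h4 => exact .four rfl rfl
  | h4' => exact .four_one rfl rfl
  | h4'' => exact .four_row rfl rfl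
  | h5 => exact .five rfl rfl

theorem IsAt.unique {u v : ℤ} : ∀ {x y : TaggedSwivel lam}, IsAt lam u v x → IsAt lam u v y →
    x = y := by
  intro x y hx hy
  cases hx with
  | row r j hu hv =>
    cases hy with
    | row r' j' hu' hv' =>
      obtain rfl : r = r' := Fin.ext (by omega)
      obtain rfl : j = j' := Fin.ext (by omega)
      rfl
    | _ => exfalso; omega
  | diag i hu hv =>
    cases hy with
    | diag i' hu' hv' =>
      obtain rfl : i = i' := Fin.ext (by omega)
      rfl
    | _ => exfalso; omega
  | top i hu hv =>
    cases hy with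
    | top i' hu' hv' =>
      obtain rfl : i = i' := Fin.ext (by omega)
      rfl
    | _ => exfalso; omega
  | _ => cases hy <;> first | rfl | (exfalso; omega)

theorem IsAt.coord {u v : ℤ} {x : TaggedSwivel lam} (h : IsAt lam u v x) :
    coordU x = u ∧ coordV x = v := by
  cases h with
  | _ => subst_vars; exact ⟨rfl, rfl⟩

theorem isAt_place (t : Fin (taggedSwivelData lam).length)
    (c : ShiftedCell ((taggedSwivelData lam).get t).lam) :
    IsAt lam (placeU t c.row c.pos) (placeV t c.row c.pos) (place t c) := by
  rw [← (coord_place t c).1, ← (coord_place t c).2]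
  exact isAt_coord _

theorem exists_isAt {u v : ℤ} (h : InSwivel (rowEnd lam 0) (rowEnd lam 1) (rowEnd lam 2)
    (rowEnd lam 3) (rowEnd lam 4) u v) : ∃ x, IsAt lam u v x := by
  have hrow : ∀ (r : Fin 5), u = 2 * ((r : ℕ) + 1) → (r : ℕ) + 1 ≤ v → v ≤ rowEnd lam r →
      ∃ x, IsAt lam u v x := by
    intro r h1 h2 h3
    have hr := r.isLt
    have ha := arm_add lam r
    by_cases h4 : v = (r : ℕ) + 1
    · exact ⟨_, .diag ⟨4 - r, by omega⟩ (by dsimp only; omega) (by dsimp only; omega)⟩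
    · exact ⟨_, .row r ⟨(v - ((r : ℕ) + 2)).toNat, by omega⟩ h1 (by dsimp only; omega)⟩
  cases h with
  | row1 h1 h2 h3 => exact hrow 0 h1 h2 h3
  | row2 h1 h2 h3 => exact hrow 1 h1 h2 h3
  | row3 h1 h2 h3 => exact hrow 2 h1 h2 h3
  | row4 h1 h2 h3 => exact hrow 3 h1 h2 h3
  | row5 h1 h2 h3 => exact hrow 4 h1 h2 h3
  | chain h1 h2 h3 =>
    by_cases h4 : u = 0
    · exact ⟨_, .diag 5 h4 (by change v = 5 - 5; omega)⟩
    · have h : rowEnd lam 0 = lam.part 0 + 5 := rfl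
      exact ⟨_, .top ⟨(-1 - u).toNat, by omega⟩ (by dsimp only; omega) (by dsimp only; omega)⟩
  | p9 h1 h2 => exact ⟨_, .one h1 h2⟩
  | p7 h1 h2 => exact ⟨_, .two h1 h2⟩
  | p12 h1 h2 => exact ⟨_, .two_one h1 h2⟩
  | p5 h1 h2 => exact ⟨_, .three h1 h2⟩
  | p31 h1 h2 => exact ⟨_, .four_row h1 h2⟩
  | p30 h1 h2 => exact ⟨_, .four_one h1 h2⟩
  | p1 h1 h2 => exact ⟨_, .four h1 h2⟩
  | p0 h1 h2 => exact ⟨_, .five h1 h2⟩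

/-- Elements are specified by coordinates only, because a diagonal element is a cell of several
diagrams at once and any of these may be the one in which the comparison takes place. -/
theorem le_of_below (t : Fin (taggedSwivelData lam).length)
    (a b : ShiftedCell ((taggedSwivelData lam).get t).lam) (h : a.Below b) {u v u' v' : ℤ}
    {x y : TaggedSwivel lam} (hx : IsAt lam u v x) (hy : IsAt lam u' v' y)
    (hu : u = placeU t a.row a.pos) (hv : v = placeV t a.row a.pos)
    (hu' : u' = placeU t b.row b.pos) (hv' : v' = placeV t b.row b.pos) : x ≤ y := by
  subst hu hv hu' hv'
  rw [hx.unique (isAt_place t a), hy.unique (isAt_place t b)]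
  exact le_of_gen (.cell t h)

theorem le_of_row {u v u' v' : ℤ} {x y : TaggedSwivel lam} (hx : IsAt lam u v x)
    (hy : IsAt lam u' v' y) (r s : Fin 5) (hu : u = 2 * ((r : ℕ) + 1))
    (hu' : u' = 2 * ((s : ℕ) + 1)) (hsr : s ≤ r) (hvv : v' ≤ v) (hr : (r : ℕ) + 1 ≤ v)
    (hs : (s : ℕ) + 1 ≤ v') (hv : v ≤ rowEnd lam r) (hv' : v' ≤ rowEnd lam s) : x ≤ y := by
  have hr' := lam.add_addStaircase r
  have hs' := lam.add_addStaircase s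
  have hsr' : (s : ℕ) ≤ r := hsr
  unfold rowEnd at hv hv'
  refine le_of_below (0 : Fin 6) ⟨r, ⟨(v - ((r : ℕ) + 1)).toNat, ?_⟩⟩
    ⟨s, ⟨(v' - ((s : ℕ) + 1)).toNat, ?_⟩⟩ ⟨hsr, ?_⟩ hx hy hu ?_ hu' ?_
  · change _ < lam.addStaircase r
    omega
  · change _ < lam.addStaircase s
    omega
  · dsimp only
    omega
  · change v = (r : ℕ) + 1 + ((v - ((r : ℕ) + 1)).toNat : ℤ)
    omega
  · change v' = (s : ℕ) + 1 + ((v' - ((s : ℕ) + 1)).toNat : ℤ)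
    omega

/-- Each step stays inside a single piece of the poset, either one of the six diagrams or the chain,
where it is an instance of a generating relation. -/
theorem le_of_upSwivel {u v u' v' : ℤ} {x y : TaggedSwivel lam} (h : UpSwivel u v u' v')
    (hx : IsAt lam u v x) (hy : IsAt lam u' v' y)
    (hin : InSwivel (rowEnd lam 0) (rowEnd lam 1) (rowEnd lam 2) (rowEnd lam 3) (rowEnd lam 4) u v)
    (hin' : InSwivel (rowEnd lam 0) (rowEnd lam 1) (rowEnd lam 2) (rowEnd lam 3) (rowEnd lam 4)
      u' v') : x ≤ y := by
  have hrow : ∀ (r s : Fin 5), u = 2 * ((r : ℕ) + 1) → u' = 2 * ((s : ℕ) + 1) → s ≤ r → v' ≤ v →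
      (r : ℕ) + 1 ≤ v → (s : ℕ) + 1 ≤ v' → v ≤ rowEnd lam r → v' ≤ rowEnd lam s → x ≤ y :=
    le_of_row hx hy
  cases h with
  | left hu hv hu' hv' =>
    rcases hu with hu | hu | hu | hu
    · exact hrow 1 1 hu (by rw [hu', hu]; rfl) le_rfl (by omega)
        (by change (1 : ℤ) + 1 ≤ v; omega) (by change (1 : ℤ) + 1 ≤ v'; omega)
        (by cases hin <;> omega) (by cases hin' <;> omega)
    · exact hrow 2 2 hu (by rw [hu', hu]; rfl) le_rfl (by omega)
        (by change (2 : ℤ) + 1 ≤ v; omega) (by change (2 : ℤ) + 1 ≤ v'; omega)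
        (by cases hin <;> omega) (by cases hin' <;> omega)
    · exact hrow 3 3 hu (by rw [hu', hu]; rfl) le_rfl (by omega)
        (by change (3 : ℤ) + 1 ≤ v; omega) (by change (3 : ℤ) + 1 ≤ v'; omega)
        (by cases hin <;> omega) (by cases hin' <;> omega)
    · exact hrow 4 4 hu (by rw [hu', hu]; rfl) le_rfl (by omega)
        (by change (4 : ℤ) + 1 ≤ v; omega) (by change (4 : ℤ) + 1 ≤ v'; omega)
        (by cases hin <;> omega) (by cases hin' <;> omega)
  | up hu hv hu' hv' =>
    rcases hu with hu | hu | hu | hu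
    · exact hrow 1 0 hu (by rw [hu', hu]; rfl) (by decide) (by omega)
        (by change (1 : ℤ) + 1 ≤ v; omega) (by change (0 : ℤ) + 1 ≤ v'; omega)
        (by cases hin <;> omega) (by cases hin' <;> omega)
    · exact hrow 2 1 hu (by rw [hu', hu]; rfl) (by decide) (by omega)
        (by change (2 : ℤ) + 1 ≤ v; omega) (by change (1 : ℤ) + 1 ≤ v'; omega)
        (by cases hin <;> omega) (by cases hin' <;> omega)
    · exact hrow 3 2 hu (by rw [hu', hu]; rfl) (by decide) (by omega)
        (by change (3 : ℤ) + 1 ≤ v; omega) (by change (2 : ℤ) + 1 ≤ v'; omega)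
        (by cases hin <;> omega) (by cases hin' <;> omega)
    · exact hrow 4 3 hu (by rw [hu', hu]; rfl) (by decide) (by omega)
        (by change (4 : ℤ) + 1 ≤ v; omega) (by change (3 : ℤ) + 1 ≤ v'; omega)
        (by cases hin <;> omega) (by cases hin' <;> omega)
  | diag hu hv hu' hv' =>
    rcases hu with hu | hu | hu | hu
    · exact le_of_below (4 : Fin 6) ⟨(2 : Fin 3), (0 : Fin 1)⟩ ⟨(1 : Fin 3), (1 : Fin 2)⟩
        ⟨(by decide : (1 : Fin 3) ≤ 2), (by decide : 1 + 1 ≤ 2 + 0)⟩ hx hy hu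
        (by change v = 2; omega) (by change u' = 3; omega) (by change v' = 1; omega)
    · exact le_of_below (3 : Fin 6) ⟨(1 : Fin 2), (0 : Fin 1)⟩ ⟨(0 : Fin 2), (1 : Fin 2)⟩
        ⟨(by decide : (0 : Fin 2) ≤ 1), (by decide : 0 + 1 ≤ 1 + 0)⟩ hx hy hu
        (by change v = 3; omega) (by change u' = 5; omega) (by change v' = 2; omega)
    · exact le_of_below (2 : Fin 6) ⟨(1 : Fin 2), (0 : Fin 1)⟩ ⟨(0 : Fin 2), (1 : Fin 3)⟩
        ⟨(by decide : (0 : Fin 2) ≤ 1), (by decide : 0 + 1 ≤ 1 + 0)⟩ hx hy hu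
        (by change v = 4; omega) (by change u' = 7; omega) (by change v' = 3; omega)
    · exact le_of_below (1 : Fin 6) ⟨(1 : Fin 2), (0 : Fin 1)⟩ ⟨(0 : Fin 2), (1 : Fin 2)⟩
        ⟨(by decide : (0 : Fin 2) ≤ 1), (by decide : 0 + 1 ≤ 1 + 0)⟩ hx hy hu
        (by change v = 5; omega) (by change u' = 9; omega) (by change v' = 4; omega)
  | left1 hu hv hu' hv' =>
    exact hrow 0 0 hu hu' le_rfl (by omega)
      (by change (0 : ℤ) + 1 ≤ v; omega) (by change (0 : ℤ) + 1 ≤ v'; omega)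
      (by cases hin <;> omega) (by cases hin' <;> omega)
  | diag1 hu hv hu' hv' =>
    exact le_of_below (4 : Fin 6) ⟨(1 : Fin 3), (0 : Fin 2)⟩ ⟨(0 : Fin 3), (1 : Fin 3)⟩
      ⟨(by decide : (0 : Fin 3) ≤ 1), (by decide : 0 + 1 ≤ 1 + 0)⟩ hx hy hu hv hu' hv'
  | diag1' hu hv hu' hv' =>
    exact le_of_below (5 : Fin 6) ⟨(1 : Fin 2), (0 : Fin 1)⟩ ⟨(0 : Fin 2), (1 : Fin 2)⟩
      ⟨(by decide : (0 : Fin 2) ≤ 1), (by decide : 0 + 1 ≤ 1 + 0)⟩ hx hy hu hv hu' hv'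
  | chain hu hv hu' hv' =>
    have h0 : rowEnd lam 0 = lam.part 0 + 5 := rfl
    have hu1 : 1 - (rowEnd lam 0 : ℤ) ≤ u' := by cases hin' <;> omega
    rw [hy.unique (.top ⟨(-1 - u').toNat, by omega⟩ (by dsimp only; omega) (by dsimp only; omega))]
    by_cases h : u = 0
    · rw [hx.unique (.diag 5 h (by change v = 5 - 5; omega))]
      exact le_of_gen (.attach _ _)
    · rw [hx.unique (.top ⟨(-1 - u).toNat, by omega⟩ (by dsimp only; omega)
        (by dsimp only; omega))]
      refine le_of_gen (.top ?_)
      rw [Fin.mk_le_mk]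
      omega
  | p9 hu hv hu' hv' =>
    exact le_of_below (1 : Fin 6) ⟨(0 : Fin 2), (1 : Fin 2)⟩ ⟨(0 : Fin 2), (0 : Fin 2)⟩
      ⟨le_rfl, (by decide : 0 + 0 ≤ 0 + 1)⟩ hx hy hu hv hu' hv'
  | p7 hu hv hu' hv' =>
    exact le_of_below (2 : Fin 6) ⟨(0 : Fin 2), (1 : Fin 3)⟩ ⟨(0 : Fin 2), (0 : Fin 3)⟩
      ⟨le_rfl, (by decide : 0 + 0 ≤ 0 + 1)⟩ hx hy hu hv hu' hv'
  | p12 hu hv hu' hv' =>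
    exact le_of_below (2 : Fin 6) ⟨(0 : Fin 2), (2 : Fin 3)⟩ ⟨(0 : Fin 2), (1 : Fin 3)⟩
      ⟨le_rfl, (by decide : 0 + 1 ≤ 0 + 2)⟩ hx hy hu hv hu' hv'
  | p5 hu hv hu' hv' =>
    exact le_of_below (3 : Fin 6) ⟨(0 : Fin 2), (1 : Fin 2)⟩ ⟨(0 : Fin 2), (0 : Fin 2)⟩
      ⟨le_rfl, (by decide : 0 + 0 ≤ 0 + 1)⟩ hx hy hu hv hu' hv'
  | p31 hu hv hu' hv' =>
    exact le_of_below (4 : Fin 6) ⟨(1 : Fin 3), (1 : Fin 2)⟩ ⟨(0 : Fin 3), (2 : Fin 3)⟩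
      ⟨(by decide : (0 : Fin 3) ≤ 1), (by decide : 0 + 2 ≤ 1 + 1)⟩ hx hy hu hv hu' hv'
  | p31' hu hv hu' hv' =>
    exact le_of_below (4 : Fin 6) ⟨(1 : Fin 3), (1 : Fin 2)⟩ ⟨(1 : Fin 3), (0 : Fin 2)⟩
      ⟨le_rfl, (by decide : 1 + 0 ≤ 1 + 1)⟩ hx hy hu hv hu' hv'
  | p30 hu hv hu' hv' =>
    exact le_of_below (4 : Fin 6) ⟨(0 : Fin 3), (2 : Fin 3)⟩ ⟨(0 : Fin 3), (1 : Fin 3)⟩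
      ⟨le_rfl, (by decide : 0 + 1 ≤ 0 + 2)⟩ hx hy hu hv hu' hv'
  | p1 hu hv hu' hv' =>
    exact le_of_below (4 : Fin 6) ⟨(0 : Fin 3), (1 : Fin 3)⟩ ⟨(0 : Fin 3), (0 : Fin 3)⟩
      ⟨le_rfl, (by decide : 0 + 0 ≤ 0 + 1)⟩ hx hy hu hv hu' hv'
  | p0 hu hv hu' hv' =>
    exact le_of_below (5 : Fin 6) ⟨(0 : Fin 2), (1 : Fin 2)⟩ ⟨(0 : Fin 2), (0 : Fin 2)⟩
      ⟨le_rfl, (by decide : 0 + 0 ≤ 0 + 1)⟩ hx hy hu hv hu' hv'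

/-- The generating relations are monotone in the coordinates. Conversely, a coordinate inequality is
realised by climbing along steps that stay below the target. -/
theorem swivelCoord (lam : Par 5) : SwivelCoord (TaggedSwivel lam) (rowEnd lam 0) (rowEnd lam 1)
    (rowEnd lam 2) (rowEnd lam 3) (rowEnd lam 4) coordU coordV := by
  have h4 : (5 : ℤ) ≤ rowEnd lam 4 := Int.ofNat_le.2 (Nat.le_add_left 5 _)
  have h3 : (rowEnd lam 4 : ℤ) ≤ rowEnd lam 3 := Int.ofNat_le.2 (rowEnd_antitone lam (by decide))
  have h2 : (rowEnd lam 3 : ℤ) ≤ rowEnd lam 2 := Int.ofNat_le.2 (rowEnd_antitone lam (by decide))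
  have h1 : (rowEnd lam 2 : ℤ) ≤ rowEnd lam 1 := Int.ofNat_le.2 (rowEnd_antitone lam (by decide))
  have h0 : (rowEnd lam 1 : ℤ) ≤ rowEnd lam 0 := Int.ofNat_le.2 (rowEnd_antitone lam (by decide))
  refine ⟨fun x y => ⟨coord_le, ?_⟩, coord_mem, fun u v h => ?_, h4, h3, h2, h1, h0⟩
  -- The climb terminates because every step strictly lowers the sum of the two coordinates.
  · obtain ⟨n, hn⟩ : ∃ n : ℕ, (coordU x - coordU y) + (coordV x - coordV y) < n :=
      ⟨((coordU x - coordU y) + (coordV x - coordV y)).toNat + 1, by omega⟩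
    induction n generalizing x with
    | zero => intro h; omega
    | succ n ih =>
      intro h
      by_cases hxy : coordU y = coordU x ∧ coordV y = coordV x
      · have hy := isAt_coord y
        rw [hxy.1, hxy.2] at hy
        exact ((isAt_coord x).unique hy).le
      · obtain ⟨u, v, hup, hin, hu, hv⟩ :=
          exists_upSwivel h4 h3 h2 h1 h0 (coord_mem x) (coord_mem y) h.1 h.2 hxy
        obtain ⟨z, hz⟩ := exists_isAt hin
        have hle := hup.le
        refine (le_of_upSwivel hup (isAt_coord x) hz (coord_mem x) hin).trans (ih z ?_ ?_) <;>
          rw [hz.coord.1, hz.coord.2]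
        · push_cast at hn
          omega
        · exact ⟨hu, hv⟩
  · obtain ⟨x, hx⟩ := exists_isAt h
    exact ⟨x, hx.coord⟩

end TaggedSwivel

/-! ### Products over hook lengths. -/

section

variable {M : Type*} [CommMonoid M]

/-- Adding a leg to the hook lengths of a row. -/
theorem prod_leg (f : ℕ → M) {N n l : ℕ} (hl : l ≤ N) (g : ℕ → ℕ)
    (hg : ∀ c < l, g c = N - c + n) :
    (∏ c ∈ Finset.range N, f (g c + if c < l then 1 else 0)) * f (N - l + n + 1) =
      (∏ c ∈ Finset.range N, f (g c)) * f (N + n + 1) := by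
  induction l with
  | zero => simp
  | succ l ih =>
    rw [← ih (by omega) fun c hc => hg c (by omega)]
    have hmem : l ∈ Finset.range N := Finset.mem_range.2 (by omega)
    -- Extending the leg by one changes only column `l`, whose hook length exchanges `N - l + n` for
    -- `N - l + n + 1`.
    rw [← Finset.mul_prod_erase _ _ hmem, ← Finset.mul_prod_erase _ _ hmem]
    have h1 : ∏ c ∈ (Finset.range N).erase l, f (g c + if c < l + 1 then 1 else 0) =
        ∏ c ∈ (Finset.range N).erase l, f (g c + if c < l then 1 else 0) := by
      refine Finset.prod_congr rfl fun c hc => ?_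
      have := Finset.ne_of_mem_erase hc
      congr 2
      exact if_congr (by omega) rfl rfl
    rw [h1, if_pos (Nat.lt_succ_self l), if_neg (lt_irrefl l), hg l (Nat.lt_succ_self l),
      show N - (l + 1) + n + 1 = N - l + n + 0 by omega, mul_right_comm, mul_comm (f _),
      mul_right_comm]

theorem prod_legs_zero (f : ℕ → M) (N : ℕ) :
    ∏ c ∈ Finset.range N, f (N - c) = ∏ k ∈ Finset.range N, f (k + 1) := by
  rw [← Finset.prod_range_reflect]
  refine Finset.prod_congr rfl fun c hc => ?_
  have := Finset.mem_range.1 hc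
  congr 1
  omega

/-- The classical complement principle: without lower rows the hook lengths are `1, ..., N`; every
lower row extends this interval by one number at its end and creates one gap, which the extra factor
fills. -/
theorem prod_legs_one (f : ℕ → M) {N l : ℕ} (hl : l ≤ N) :
    (∏ c ∈ Finset.range N, f (N - c + if c < l then 1 else 0)) * f (N - l + 1) =
      ∏ k ∈ Finset.range (N + 1), f (k + 1) := by
  rw [Finset.prod_range_succ, ← prod_legs_zero]
  exact prod_leg f (n := 0) hl (fun c => N - c) fun c _ => rfl

theorem prod_legs_two (f : ℕ → M) {N l l' : ℕ} (hl : l ≤ N) (hl' : l' ≤ l) :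
    (∏ c ∈ Finset.range N, f (N - c + (if c < l then 1 else 0) + if c < l' then 1 else 0)) *
      f (N - l + 1) * f (N - l' + 2) = ∏ k ∈ Finset.range (N + 2), f (k + 1) := by
  rw [mul_right_comm, prod_leg f (n := 1) (hl'.trans hl)
    (fun c => N - c + if c < l then 1 else 0) fun c hc => by rw [if_pos (by omega)],
    mul_right_comm, prod_legs_one f hl, ← Finset.prod_range_succ]

theorem prod_legs_three (f : ℕ → M) {N l l' l'' : ℕ} (hl : l ≤ N) (hl' : l' ≤ l) (hl'' : l'' ≤ l') :
    (∏ c ∈ Finset.range N, f (N - c + (if c < l then 1 else 0) + (if c < l' then 1 else 0) +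
      if c < l'' then 1 else 0)) * f (N - l + 1) * f (N - l' + 2) * f (N - l'' + 3) =
      ∏ k ∈ Finset.range (N + 3), f (k + 1) := by
  rw [mul_right_comm, mul_right_comm (∏ c ∈ Finset.range N, _), prod_leg f (n := 2)
    (hl''.trans (hl'.trans hl))
    (fun c => N - c + (if c < l then 1 else 0) + if c < l' then 1 else 0)
    fun c hc => by rw [if_pos (by omega), if_pos (by omega)],
    mul_right_comm _ _ (f (N - l + 1)), mul_right_comm, prod_legs_two f hl hl',
    ← Finset.prod_range_succ]

theorem prod_legs_four (f : ℕ → M) {N l l' l'' l₄ : ℕ} (hl : l ≤ N) (hl' : l' ≤ l) (hl'' : l'' ≤ l')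
    (hl₄ : l₄ ≤ l'') :
    (∏ c ∈ Finset.range N, f (N - c + (if c < l then 1 else 0) + (if c < l' then 1 else 0) +
      (if c < l'' then 1 else 0) + if c < l₄ then 1 else 0)) * f (N - l + 1) * f (N - l' + 2) *
      f (N - l'' + 3) * f (N - l₄ + 4) = ∏ k ∈ Finset.range (N + 4), f (k + 1) := by
  rw [mul_right_comm, mul_right_comm _ (f (N - l' + 2)), mul_right_comm (∏ c ∈ Finset.range N, _),
    prod_leg f (n := 3) (hl₄.trans (hl''.trans (hl'.trans hl)))
    (fun c => N - c + (if c < l then 1 else 0) + (if c < l' then 1 else 0) +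
      if c < l'' then 1 else 0)
    fun c hc => by rw [if_pos (by omega), if_pos (by omega), if_pos (by omega)],
    mul_right_comm _ _ (f (N - l + 1)), mul_right_comm _ _ (f (N - l' + 2)), mul_right_comm,
    prod_legs_three f hl hl' hl'', ← Finset.prod_range_succ]

end

/-- The hook lengths of a tagged swivel in terms of the numbers of off-diagonal cells in the rows
of the large diagram. -/
def armHook (M1 M2 M3 M4 M5 : ℕ) (u v : ℤ) : ℕ :=
  (hookSwivel (M1 + 1) (M2 + 2) (M3 + 3) (M4 + 4) (M5 + 5) u v).toNat

section

variable {M : Type*} [CommMonoid M] (f : ℕ → M) {M1 M2 M3 M4 M5 : ℕ}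

theorem prod_armHook_five :
    ∏ c ∈ Finset.range (M5 + 1), f (armHook M1 M2 M3 M4 M5 10 (5 + c)) =
      ∏ k ∈ Finset.range (M5 + 1), f (k + 1) := by
  rw [← prod_legs_zero]
  refine Finset.prod_congr rfl fun c hc => ?_
  have := Finset.mem_range.1 hc
  congr 1
  norm_num [armHook, hookSwivel, hookRow]
  omega

/-- Only columns from `5` on are used. There rows two to five have `M2 - 2`, `M3 - 1`, `M4` and `M5
+ 1` cells; with these lengths the gaps of the complement principle are the differences of the
`M_i`, here and for the longer rows. -/
theorem prod_armHook_four (h5 : M5 < M4) :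
    (∏ c ∈ Finset.range M4, f (armHook M1 M2 M3 M4 M5 8 (5 + c))) * f (M4 - M5) =
      ∏ k ∈ Finset.range (M4 + 1), f (k + 1) := by
  rw [← prod_legs_one f (l := M5 + 1) (by omega)]
  congr 1
  · refine Finset.prod_congr rfl fun c hc => ?_
    have := Finset.mem_range.1 hc
    congr 1
    norm_num [armHook, hookSwivel, hookRow, columnStep]
    split_ifs <;> omega
  · congr 1
    omega

theorem prod_armHook_three (h5 : M5 < M4) (h4 : M4 < M3) :
    (∏ c ∈ Finset.range (M3 - 1), f (armHook M1 M2 M3 M4 M5 6 (5 + c))) * f (M3 - M4) *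
      f (M3 - M5) = ∏ k ∈ Finset.range (M3 + 1), f (k + 1) := by
  have hN : M3 + 1 = M3 - 1 + 2 := by omega
  rw [hN, ← prod_legs_two f (l := M4) (l' := M5 + 1) (by omega) (by omega)]
  congr 2
  · refine Finset.prod_congr rfl fun c hc => ?_
    have := Finset.mem_range.1 hc
    congr 1
    norm_num [armHook, hookSwivel, hookRow, columnStep]
    split_ifs <;> omega
  all_goals congr 1; omega

theorem prod_armHook_two (h5 : M5 < M4) (h4 : M4 < M3) (h3 : M3 < M2) :
    (∏ c ∈ Finset.range (M2 - 2), f (armHook M1 M2 M3 M4 M5 4 (5 + c))) * f (M2 - M3) *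
      f (M2 - M4) * f (M2 - M5) = ∏ k ∈ Finset.range (M2 + 1), f (k + 1) := by
  have hN : M2 + 1 = M2 - 2 + 3 := by omega
  rw [hN, ← prod_legs_three f (l := M3 - 1) (l' := M4) (l'' := M5 + 1) (by omega) (by omega)
    (by omega)]
  congr 3
  · refine Finset.prod_congr rfl fun c hc => ?_
    have := Finset.mem_range.1 hc
    congr 1
    norm_num [armHook, hookSwivel, hookRow, columnStep]
    split_ifs <;> omega
  all_goals congr 1; omega

theorem armHook_row_one {c : ℕ} (hc : c < M1 - 3) : armHook M1 M2 M3 M4 M5 2 (5 + c) =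
    M1 - 3 - c + (if c < M2 - 2 then 1 else 0) + (if c < M3 - 1 then 1 else 0) +
      (if c < M4 then 1 else 0) + if c < M5 + 1 then 1 else 0 := by
  norm_num [armHook, hookSwivel, hookRow, columnStep]
  split_ifs <;> omega

theorem armHook_chain (h5 : M5 < M4) (h4 : M4 < M3) (h3 : M3 < M2) (h2 : M2 < M1) {c : ℕ}
    (hc : c < M1 - 3) : armHook M1 M2 M3 M4 M5 (-4 - c) (-4 - c) =
    M1 + M2 + M3 + M4 + M5 + M1 + 14 - armHook M1 M2 M3 M4 M5 2 (5 + c) := by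
  have h0 := hookRow_pos (L1 := M1 + 1) (L2 := M2 + 2) (L3 := M3 + 3) (L4 := M4 + 4)
    (L5 := M5 + 5) (u := 2) (v := 5 + c) (by omega) (by omega) (by omega) (by omega) (by omega)
    (Or.inl ⟨rfl, by omega⟩)
  have h1 : hookSwivel (M1 + 1) (M2 + 2) (M3 + 3) (M4 + 4) (M5 + 5) 2 (5 + c) =
      hookRow (M1 + 1) (M2 + 2) (M3 + 3) (M4 + 4) (M5 + 5) 2 (5 + c) := by
    simp [hookSwivel]
  have h6 : hookSwivel (M1 + 1) (M2 + 2) (M3 + 3) (M4 + 4) (M5 + 5) (-4 - c) (-4 - c) =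
      M1 + M2 + M3 + M4 + M5 + M1 + 14 -
        hookRow (M1 + 1) (M2 + 2) (M3 + 3) (M4 + 4) (M5 + 5) 2 (5 + c) := by
    unfold hookSwivel
    rw [if_neg (by omega), if_neg (by omega), if_neg (by omega), if_neg (by omega),
      if_neg (by omega), if_neg (by omega), if_neg (by omega), if_pos (by omega),
      show (1 - (-4 - c) : ℤ) = 5 + c by ring]
    ring
  unfold armHook
  rw [h1, h6]
  omega

theorem prod_armHook_one (h5 : M5 < M4) (h4 : M4 < M3) (h3 : M3 < M2) (h2 : M2 < M1) :
    (∏ c ∈ Finset.range (M1 - 3), f (armHook M1 M2 M3 M4 M5 2 (5 + c))) * f (M1 - M2) *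
      f (M1 - M3) * f (M1 - M4) * f (M1 - M5) = ∏ k ∈ Finset.range (M1 + 1), f (k + 1) := by
  have hN : M1 + 1 = M1 - 3 + 4 := by omega
  rw [hN, ← prod_legs_four f (l := M2 - 2) (l' := M3 - 1) (l'' := M4) (l₄ := M5 + 1) (by omega)
    (by omega) (by omega) (by omega)]
  congr 4
  · exact Finset.prod_congr rfl fun c hc => congrArg f (armHook_row_one (Finset.mem_range.1 hc))
  all_goals congr 1; omega

/-- The chain hook lengths are the first-row hook lengths reflected in `K = 2 M1 + M2 + M3 + M4 + M5
+ 14`, so the first-row product is applied to `k ↦ f (K - k)`. -/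
theorem prod_armHook_chain (h5 : M5 < M4) (h4 : M4 < M3) (h3 : M3 < M2) (h2 : M2 < M1) :
    (∏ c ∈ Finset.range (M1 - 3), f (armHook M1 M2 M3 M4 M5 (-4 - c) (-4 - c))) *
      f (M1 + M2 + M3 + M4 + M5 + 14 + M2) * f (M1 + M2 + M3 + M4 + M5 + 14 + M3) *
      f (M1 + M2 + M3 + M4 + M5 + 14 + M4) * f (M1 + M2 + M3 + M4 + M5 + 14 + M5) =
      ∏ k ∈ Finset.range (M1 + 1), f (M1 + M2 + M3 + M4 + M5 + 13 + k) := by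
  have h := prod_armHook_one (fun k => f (M1 + M2 + M3 + M4 + M5 + M1 + 14 - k)) h5 h4 h3 h2
  have h6 : ∏ k ∈ Finset.range (M1 + 1), f (M1 + M2 + M3 + M4 + M5 + M1 + 14 - (k + 1)) =
      ∏ k ∈ Finset.range (M1 + 1), f (M1 + M2 + M3 + M4 + M5 + 13 + k) := by
    rw [← Finset.prod_range_reflect]
    refine Finset.prod_congr rfl fun k hk => ?_
    have := Finset.mem_range.1 hk
    congr 1
    omega
  rw [← h6, ← h]
  congr 4
  · exact Finset.prod_congr rfl fun c hc =>
      congrArg f (armHook_chain h5 h4 h3 h2 (Finset.mem_range.1 hc))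
  all_goals congr 1; omega

end

theorem DiagPoset.prod_eq {M : Type*} [CommMonoid M] {n m : ℕ} {X : List (Attachment n)}
    (F : DiagPoset n m X → M) : ∏ x, F x = (∏ i, F (.diag i)) * (∏ j, F (.top j)) *
      ∏ t, ∏ r, ∏ j, F (.cell t r j) := by
  rw [← (equivSum n m X).symm.prod_comp, Fintype.prod_sum_type, Fintype.prod_sum_type,
    Fintype.prod_sigma]
  simp only [Fintype.prod_sigma]
  rfl

namespace TaggedSwivel

open DiagPoset

theorem prod_cells {M : Type*} [CommMonoid M] {lam : Par 5} (F : TaggedSwivel lam → M) :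
    (∏ t, ∏ r, ∏ j, F (.cell t r j)) =
      (∏ r : Fin 5, ∏ j : Fin (arm lam r), F (.cell (0 : Fin 6) r j)) *
      F (.cell (1 : Fin 6) (0 : Fin 2) (0 : Fin 1)) *
      (F (.cell (2 : Fin 6) (0 : Fin 2) (0 : Fin 2)) *
        F (.cell (2 : Fin 6) (0 : Fin 2) (1 : Fin 2))) *
      F (.cell (3 : Fin 6) (0 : Fin 2) (0 : Fin 1)) *
      (F (.cell (4 : Fin 6) (0 : Fin 3) (0 : Fin 2)) *
        F (.cell (4 : Fin 6) (0 : Fin 3) (1 : Fin 2)) *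
        F (.cell (4 : Fin 6) (1 : Fin 3) (0 : Fin 1))) *
      F (.cell (5 : Fin 6) (0 : Fin 2) (0 : Fin 1)) := by
  change ∏ t : Fin 6, _ = _
  rw [Fin.prod_univ_six]
  refine congrArg₂ (· * ·) (congrArg₂ (· * ·) (congrArg₂ (· * ·) (congrArg₂ (· * ·)
    (congrArg₂ (· * ·) rfl ?_) ?_) ?_) ?_) ?_
  · exact (Fin.prod_univ_two fun r : Fin 2 => ∏ j, F (.cell (1 : Fin 6) r j)).trans
      ((congrArg₂ (· * ·) (Fin.prod_univ_one fun j : Fin 1 => F (.cell (1 : Fin 6) (0 : Fin 2) j))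
        (Fin.prod_univ_zero fun j : Fin 0 => F (.cell (1 : Fin 6) (1 : Fin 2) j))).trans
          (mul_one _))
  · exact (Fin.prod_univ_two fun r : Fin 2 => ∏ j, F (.cell (2 : Fin 6) r j)).trans
      ((congrArg₂ (· * ·) (Fin.prod_univ_two fun j : Fin 2 => F (.cell (2 : Fin 6) (0 : Fin 2) j))
        (Fin.prod_univ_zero fun j : Fin 0 => F (.cell (2 : Fin 6) (1 : Fin 2) j))).trans
          (mul_one _))
  · exact (Fin.prod_univ_two fun r : Fin 2 => ∏ j, F (.cell (3 : Fin 6) r j)).trans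
      ((congrArg₂ (· * ·) (Fin.prod_univ_one fun j : Fin 1 => F (.cell (3 : Fin 6) (0 : Fin 2) j))
        (Fin.prod_univ_zero fun j : Fin 0 => F (.cell (3 : Fin 6) (1 : Fin 2) j))).trans
          (mul_one _))
  · exact (Fin.prod_univ_three fun r : Fin 3 => ∏ j, F (.cell (4 : Fin 6) r j)).trans
      ((congrArg₂ (· * ·) (congrArg₂ (· * ·)
        (Fin.prod_univ_two fun j : Fin 2 => F (.cell (4 : Fin 6) (0 : Fin 3) j))
        (Fin.prod_univ_one fun j : Fin 1 => F (.cell (4 : Fin 6) (1 : Fin 3) j)))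
        (Fin.prod_univ_zero fun j : Fin 0 => F (.cell (4 : Fin 6) (2 : Fin 3) j))).trans
          (mul_one _))
  · exact (Fin.prod_univ_two fun r : Fin 2 => ∏ j, F (.cell (5 : Fin 6) r j)).trans
      ((congrArg₂ (· * ·) (Fin.prod_univ_one fun j : Fin 1 => F (.cell (5 : Fin 6) (0 : Fin 2) j))
        (Fin.prod_univ_zero fun j : Fin 0 => F (.cell (5 : Fin 6) (1 : Fin 2) j))).trans
          (mul_one _))

theorem arm_zero (lam : Par 5) : arm lam 0 = lam.part 0 + 4 := by
  have := arm_add lam 0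
  change arm lam 0 + (0 + 1) = lam.part 0 + 5 at this
  omega

/-- A product over a tagged swivel in coordinates. -/
theorem prod_coord {M : Type*} [CommMonoid M] (lam : Par 5) (G : ℤ → ℤ → M) :
    ∏ x : TaggedSwivel lam, G (coordU x) (coordV x) =
      (G 10 5 * G 8 4 * G 6 3 * G 4 2 * G 2 1 * G 0 0) *
      (∏ j ∈ Finset.range (arm lam 0), G (-1 - (j : ℤ)) (-1 - j)) *
      ((∏ j ∈ Finset.range (arm lam 0), G 2 (2 + j)) *
        (∏ j ∈ Finset.range (arm lam 1), G 4 (3 + j)) *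
        (∏ j ∈ Finset.range (arm lam 2), G 6 (4 + j)) *
        (∏ j ∈ Finset.range (arm lam 3), G 8 (5 + j)) *
        (∏ j ∈ Finset.range (arm lam 4), G 10 (6 + j)) * G 9 4 * (G 7 3 * G 12 3) * G 5 2 *
        (G 1 0 * G 3 0 * G 3 1) * G 0 1) := by
  have hrow : ∀ r : Fin 5, ∏ j : Fin (arm lam r),
      G (coordU (.cell (0 : Fin 6) r j : TaggedSwivel lam))
      (coordV (.cell (0 : Fin 6) r j : TaggedSwivel lam)) =
      ∏ j ∈ Finset.range (arm lam r), G (2 * ((r : ℕ) + 1)) ((r : ℕ) + 2 + j) := by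
    intro r
    rw [← Fin.prod_univ_eq_prod_range (fun j => G (2 * ((r : ℕ) + 1)) ((r : ℕ) + 2 + j))]
    refine Finset.prod_congr rfl fun j _ => ?_
    change G (2 * ((r : ℕ) + 1)) ((r : ℕ) + 1 + ((j : ℕ) + 1 : ℕ)) = _
    congr 1
    push_cast
    ring
  have htop : ∏ j ∈ Finset.range (arm lam 0), G (-1 - (j : ℤ)) (-1 - j) =
      ∏ j ∈ Finset.range (lam.part 0 + 4), G (-1 - (j : ℤ)) (-1 - j) := by
    rw [arm_zero]
  rw [htop, DiagPoset.prod_eq, prod_cells fun x => G (coordU x) (coordV x), Finset.prod_congr rfl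
    fun r _ => hrow r, Fin.prod_univ_five, Fin.prod_univ_six,
    ← Fin.prod_univ_eq_prod_range (fun j => G (-1 - (j : ℤ)) (-1 - j))]
  rfl

end TaggedSwivel

/-- The product of `f` over the hook lengths, cleared of denominators. -/
theorem prod_armHook {f : ℕ → ℝ} {M1 M2 M3 M4 M5 : ℕ} (h5 : M5 < M4) (h4 : M4 < M3) (h3 : M3 < M2)
    (h2 : M2 < M1) {G : ℤ → ℤ → ℝ} (hG : G = fun u v => f (armHook M1 M2 M3 M4 M5 u v)) :
    (G 10 5 * G 8 4 * G 6 3 * G 4 2 * G 2 1 * G 0 0) *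
      (∏ j ∈ Finset.range M1, G (-1 - (j : ℤ)) (-1 - j)) *
      ((∏ j ∈ Finset.range M1, G 2 (2 + j)) * (∏ j ∈ Finset.range M2, G 4 (3 + j)) *
        (∏ j ∈ Finset.range M3, G 6 (4 + j)) * (∏ j ∈ Finset.range M4, G 8 (5 + j)) *
        (∏ j ∈ Finset.range M5, G 10 (6 + j)) * G 9 4 * (G 7 3 * G 12 3) * G 5 2 *
        (G 1 0 * G 3 0 * G 3 1) * G 0 1) *
      ((f (M1 - M2) * f (M1 - M3) * f (M1 - M4) * f (M1 - M5)) *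
        (f (M2 - M3) * f (M2 - M4) * f (M2 - M5)) * (f (M3 - M4) * f (M3 - M5)) * f (M4 - M5)) *
      (f (M1 + M2 + M3 + M4 + M5 + 14 + M2) * f (M1 + M2 + M3 + M4 + M5 + 14 + M3) *
        f (M1 + M2 + M3 + M4 + M5 + 14 + M4) * f (M1 + M2 + M3 + M4 + M5 + 14 + M5)) =
    ((∏ k ∈ Finset.range M1, f (k + 1)) * (∏ k ∈ Finset.range M2, f (k + 1)) *
      (∏ k ∈ Finset.range M3, f (k + 1)) * (∏ k ∈ Finset.range M4, f (k + 1)) *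
      (∏ k ∈ Finset.range M5, f (k + 1))) *
      ((f (M1 + 1) * f (M1 + 2)) * (f (M2 + 1) * f (M2 + 2)) * (f (M3 + 1) * f (M3 + 2)) *
        (f (M4 + 1) * f (M4 + 2)) * (f (M5 + 1) * f (M5 + 2))) *
      (f (M1 + M2 + 5) * f (M1 + M3 + 5) * f (M1 + M4 + 5) * f (M1 + M5 + 5) *
        f (M2 + M3 + 5) * f (M2 + M4 + 5) * f (M2 + M5 + 5) * f (M3 + M4 + 5) * f (M3 + M5 + 5) *
        f (M4 + M5 + 5)) *
      (f 1 * f (M1 + M2 + M3 + M4 + M5 + 12)) *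
      (f (M2 + M3 + M4 + M5 + 9) * f (M1 + M3 + M4 + M5 + 9) * f (M1 + M2 + M4 + M5 + 9) *
        f (M1 + M2 + M3 + M5 + 9) * f (M1 + M2 + M3 + M4 + 9)) *
      ∏ k ∈ Finset.range (M1 + 1), f (M1 + M2 + M3 + M4 + M5 + 13 + k) := by
  have r1 := prod_armHook_one f h5 h4 h3 h2
  have r2 := prod_armHook_two f (M1 := M1) h5 h4 h3
  have r3 := prod_armHook_three f (M1 := M1) (M2 := M2) h5 h4
  have r4 := prod_armHook_four f (M1 := M1) (M2 := M2) (M3 := M3) h5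
  have r5 := prod_armHook_five f (M1 := M1) (M2 := M2) (M3 := M3) (M4 := M4) (M5 := M5)
  have rc := prod_armHook_chain f h5 h4 h3 h2
  have split3 : ∀ g : ℕ → ℝ, ∏ j ∈ Finset.range M1, g j =
      g 0 * g 1 * g 2 * ∏ c ∈ Finset.range (M1 - 3), g (3 + c) := by
    intro g
    obtain ⟨N, rfl⟩ : ∃ N, M1 = 3 + N := ⟨M1 - 3, by omega⟩
    rw [Finset.prod_range_add, Nat.add_sub_cancel_left]
    simp [Finset.prod_range_succ]
  have split2 : ∀ g : ℕ → ℝ, ∏ j ∈ Finset.range M2, g j =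
      g 0 * g 1 * ∏ c ∈ Finset.range (M2 - 2), g (2 + c) := by
    intro g
    obtain ⟨N, rfl⟩ : ∃ N, M2 = 2 + N := ⟨M2 - 2, by omega⟩
    rw [Finset.prod_range_add, Nat.add_sub_cancel_left]
    simp [Finset.prod_range_succ]
  have split1 : ∀ g : ℕ → ℝ, ∏ j ∈ Finset.range M3, g j =
      g 0 * ∏ c ∈ Finset.range (M3 - 1), g (1 + c) := by
    intro g
    obtain ⟨N, rfl⟩ : ∃ N, M3 = 1 + N := ⟨M3 - 1, by omega⟩
    rw [Finset.prod_range_add, Nat.add_sub_cancel_left]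
    simp
  have ec : ∏ j ∈ Finset.range M1, G (-1 - (j : ℤ)) (-1 - j) =
      G (-1) (-1) * G (-2) (-2) * G (-3) (-3) *
        ∏ c ∈ Finset.range (M1 - 3), f (armHook M1 M2 M3 M4 M5 (-4 - c) (-4 - c)) := by
    rw [split3]
    congr 1
    refine Finset.prod_congr rfl fun c _ => ?_
    rw [show (-1 - ((3 + c : ℕ) : ℤ)) = -4 - c by push_cast; ring, hG]
  have e1 : ∏ j ∈ Finset.range M1, G 2 (2 + j) = G 2 2 * G 2 3 * G 2 4 *
        ∏ c ∈ Finset.range (M1 - 3), f (armHook M1 M2 M3 M4 M5 2 (5 + c)) := by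
    rw [split3]
    congr 1
    refine Finset.prod_congr rfl fun c _ => ?_
    rw [show (2 + ((3 + c : ℕ) : ℤ)) = 5 + c by push_cast; ring, hG]
  have e2 : ∏ j ∈ Finset.range M2, G 4 (3 + j) = G 4 3 * G 4 4 *
        ∏ c ∈ Finset.range (M2 - 2), f (armHook M1 M2 M3 M4 M5 4 (5 + c)) := by
    rw [split2]
    congr 1
    refine Finset.prod_congr rfl fun c _ => ?_
    rw [show (3 + ((2 + c : ℕ) : ℤ)) = 5 + c by push_cast; ring, hG]
  have e3 : ∏ j ∈ Finset.range M3, G 6 (4 + j) = G 6 4 *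
        ∏ c ∈ Finset.range (M3 - 1), f (armHook M1 M2 M3 M4 M5 6 (5 + c)) := by
    rw [split1]
    congr 1
    refine Finset.prod_congr rfl fun c _ => ?_
    rw [show (4 + ((1 + c : ℕ) : ℤ)) = 5 + c by push_cast; ring, hG]
  have e4 : ∏ j ∈ Finset.range M4, G 8 (5 + j) =
      ∏ c ∈ Finset.range M4, f (armHook M1 M2 M3 M4 M5 8 (5 + c)) := by rw [hG]
  have e5 : G 10 5 * ∏ j ∈ Finset.range M5, G 10 (6 + j) =
      ∏ c ∈ Finset.range (M5 + 1), f (armHook M1 M2 M3 M4 M5 10 (5 + c)) := by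
    rw [Finset.prod_range_succ', mul_comm, hG]
    congr 1
    refine Finset.prod_congr rfl fun c _ => ?_
    rw [show (5 + ((c + 1 : ℕ) : ℤ)) = 6 + c by push_cast; ring]
  rw [Finset.prod_range_succ (fun k => f (k + 1))] at r1 r2 r3 r4 r5
  have val : ∀ {u v : ℤ} {n : ℕ}, armHook M1 M2 M3 M4 M5 u v = n → G u v = f n := by
    rintro u v n rfl
    rw [hG]
  -- Outside the parts treated row by row, `22` elements remain. Their hook lengths are the five
  -- `M_i + 2`, the ten `M_i + M_j + 5`, the five sums of four of the `M_i` plus `9`, the sum of all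
  -- plus `12`, and `1`.
  have v84 : G 8 4 = f (M4 + 2) := val (by norm_num [armHook, hookSwivel, hookRow]; omega)
  have v63 : G 6 3 = f (M3 + M5 + 5) := val (by norm_num [armHook, hookSwivel, hookRow]; omega)
  have v42 : G 4 2 = f (M2 + M4 + 5) := val (by norm_num [armHook, hookSwivel, hookRow]; omega)
  have v21 : G 2 1 = f (M1 + M3 + 5) := val (by norm_num [armHook, hookSwivel, hookRow]; omega)
  have v00 : G 0 0 = f (M1 + M2 + M4 + M5 + 9) :=
    val (by norm_num [armHook, hookSwivel, hookRow]; omega)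
  have c1 : G (-1) (-1) = f (M1 + M2 + M3 + M5 + 9) :=
    val (by norm_num [armHook, hookSwivel, hookRow]; omega)
  have c2 : G (-2) (-2) = f (M1 + M2 + M3 + M4 + 9) :=
    val (by norm_num [armHook, hookSwivel, hookRow]; omega)
  have c3 : G (-3) (-3) = f (M1 + M2 + M3 + M4 + M5 + 12) :=
    val (by norm_num [armHook, hookSwivel, hookRow]; omega)
  have v22 : G 2 2 = f (M1 + M4 + 5) := val (by norm_num [armHook, hookSwivel, hookRow]; omega)
  have v23 : G 2 3 = f (M1 + M5 + 5) := val (by norm_num [armHook, hookSwivel, hookRow]; omega)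
  have v24 : G 2 4 = f (M1 + 2) := val (by norm_num [armHook, hookSwivel, hookRow]; omega)
  have v43 : G 4 3 = f (M2 + M5 + 5) := val (by norm_num [armHook, hookSwivel, hookRow]; omega)
  have v44 : G 4 4 = f (M2 + 2) := val (by norm_num [armHook, hookSwivel, hookRow]; omega)
  have v64 : G 6 4 = f (M3 + 2) := val (by norm_num [armHook, hookSwivel, hookRow]; omega)
  have v94 : G 9 4 = f (M5 + 2) := val (by norm_num [armHook, hookSwivel, hookRow]; omega)
  have v73 : G 7 3 = f (M4 + M5 + 5) := val (by norm_num [armHook, hookSwivel, hookRow]; omega)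
  have v123 : G 12 3 = f 1 := val (by norm_num [armHook, hookSwivel, hookRow])
  have v52 : G 5 2 = f (M3 + M4 + 5) := val (by norm_num [armHook, hookSwivel, hookRow]; omega)
  have v10 : G 1 0 = f (M1 + M3 + M4 + M5 + 9) :=
    val (by norm_num [armHook, hookSwivel, hookRow]; omega)
  have v30 : G 3 0 = f (M2 + M3 + M4 + M5 + 9) :=
    val (by norm_num [armHook, hookSwivel, hookRow]; omega)
  have v31 : G 3 1 = f (M2 + M3 + 5) := val (by norm_num [armHook, hookSwivel, hookRow]; omega)
  have v01 : G 0 1 = f (M1 + M2 + 5) := val (by norm_num [armHook, hookSwivel, hookRow]; omega)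
  rw [ec, e1, e2, e3, e4, v84, v63, v42, v21, v00, c1, c2, c3, v22, v23, v24, v43, v44, v64, v94,
    v73, v123, v52, v10, v30, v31, v01]
  generalize hD5 : ∏ j ∈ Finset.range M5, G 10 (6 + j) = D5 at e5 ⊢
  clear hD5 ec e1 e2 e3 e4 val
  rw [← e5] at r5
  generalize ∏ c ∈ Finset.range (M1 - 3), f (armHook M1 M2 M3 M4 M5 (-4 - c) (-4 - c)) = Dc at *
  generalize ∏ c ∈ Finset.range (M1 - 3), f (armHook M1 M2 M3 M4 M5 2 (5 + c)) = D1 at *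
  generalize ∏ c ∈ Finset.range (M2 - 2), f (armHook M1 M2 M3 M4 M5 4 (5 + c)) = D2 at *
  generalize ∏ c ∈ Finset.range (M3 - 1), f (armHook M1 M2 M3 M4 M5 6 (5 + c)) = D3 at *
  generalize ∏ c ∈ Finset.range M4, f (armHook M1 M2 M3 M4 M5 8 (5 + c)) = D4 at *
  calc _ = (Dc * f (M1 + M2 + M3 + M4 + M5 + 14 + M2) * f (M1 + M2 + M3 + M4 + M5 + 14 + M3) *
        f (M1 + M2 + M3 + M4 + M5 + 14 + M4) * f (M1 + M2 + M3 + M4 + M5 + 14 + M5)) *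
      (D1 * f (M1 - M2) * f (M1 - M3) * f (M1 - M4) * f (M1 - M5)) *
      (D2 * f (M2 - M3) * f (M2 - M4) * f (M2 - M5)) * (D3 * f (M3 - M4) * f (M3 - M5)) *
      (D4 * f (M4 - M5)) * (G 10 5 * D5) *
      (f (M1 + 2) * f (M2 + 2) * f (M3 + 2) * f (M4 + 2) * f (M5 + 2)) *
      (f (M1 + M2 + 5) * f (M1 + M3 + 5) * f (M1 + M4 + 5) * f (M1 + M5 + 5) *
        f (M2 + M3 + 5) * f (M2 + M4 + 5) * f (M2 + M5 + 5) * f (M3 + M4 + 5) * f (M3 + M5 + 5) *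
        f (M4 + M5 + 5)) *
      (f 1 * f (M1 + M2 + M3 + M4 + M5 + 12)) *
      (f (M2 + M3 + M4 + M5 + 9) * f (M1 + M3 + M4 + M5 + 9) * f (M1 + M2 + M4 + M5 + 9) *
        f (M1 + M2 + M3 + M5 + 9) * f (M1 + M2 + M3 + M4 + 9)) := by ring
    _ = _ := by
      rw [rc, r1, r2, r3, r4, r5]
      ring

/-- The sum over the chain of the large diagram, in terms of the exponents of the variables. -/
theorem chainFive_pow {q : ℝ} (hq0 : 0 < q) {M1 M2 M3 M4 M5 : ℕ} (h5 : M5 < M4)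
    (h4 : M4 < M3) (h3 : M3 < M2) (h2 : M2 < M1) {f : ℕ → ℝ} (hf : ∀ n, f n = 1 - q ^ n)
    (hf0 : ∀ n, 0 < n → f n ≠ 0) :
    chainFive q (q ^ M1) (q ^ M2) (q ^ M3) (q ^ M4) (q ^ M5) *
      (((f (M1 + 1) * f (M1 + 2)) * (f (M2 + 1) * f (M2 + 2)) * (f (M3 + 1) * f (M3 + 2)) *
        (f (M4 + 1) * f (M4 + 2)) * (f (M5 + 1) * f (M5 + 2))) *
      (f (M1 + M2 + 5) * f (M1 + M3 + 5) * f (M1 + M4 + 5) * f (M1 + M5 + 5) *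
        f (M2 + M3 + 5) * f (M2 + M4 + 5) * f (M2 + M5 + 5) * f (M3 + M4 + 5) * f (M3 + M5 + 5) *
        f (M4 + M5 + 5)) *
      (f (M1 + M2 + M3 + M4 + M5 + 12) * f (M1 + M2 + M3 + M4 + M5 + 13)) *
      (f (M2 + M3 + M4 + M5 + 9) * f (M1 + M3 + M4 + M5 + 9) * f (M1 + M2 + M4 + M5 + 9) *
        f (M1 + M2 + M3 + M5 + 9) * f (M1 + M2 + M3 + M4 + 9))) =
    q ^ 28 * q ^ (M1 + M2 + M3 + M4 + M5) * q ^ (M2 + 2 * M3 + 3 * M4 + 4 * M5) *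
      (f 1 ^ 5 * f 2 ^ 2) *
      ((f (M1 - M2) * f (M1 - M3) * f (M1 - M4) * f (M1 - M5)) *
        (f (M2 - M3) * f (M2 - M4) * f (M2 - M5)) * (f (M3 - M4) * f (M3 - M5)) * f (M4 - M5)) *
      (f (M1 + M2 + M3 + M4 + M5 + 14 + M1) * f (M1 + M2 + M3 + M4 + M5 + 14 + M2) *
        f (M1 + M2 + M3 + M4 + M5 + 14 + M3) * f (M1 + M2 + M3 + M4 + M5 + 14 + M4) *
        f (M1 + M2 + M3 + M4 + M5 + 14 + M5)) := by
  have hsub : ∀ {a b : ℕ}, a < b → q ^ a - q ^ b = q ^ a * f (b - a) := by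
    intro a b hab
    rw [hf, mul_sub, mul_one, ← pow_add, Nat.add_sub_cancel' hab.le]
  have hpair : ∀ a, hookPair q (q ^ a) = f (a + 1) * f (a + 2) := by
    intro a
    rw [hookPair, hf, hf]
    ring
  have hfive : ∀ a b, 1 - q ^ 5 * (q ^ a * q ^ b) = f (a + b + 5) := by
    intro a b
    rw [hf]
    ring
  have hall : ∀ n, 1 - q ^ n * (q ^ M1 * q ^ M2 * q ^ M3 * q ^ M4 * q ^ M5) =
      f (M1 + M2 + M3 + M4 + M5 + n) := by
    intro n
    rw [hf]
    ring
  have hall' : ∀ a, 1 - q ^ 14 * (q ^ M1 * q ^ M2 * q ^ M3 * q ^ M4 * q ^ M5) * q ^ a =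
      f (M1 + M2 + M3 + M4 + M5 + 14 + a) := by
    intro a
    rw [hf]
    ring
  have hone : 1 - q = f 1 := by rw [hf, pow_one]
  -- In `z_a - q ^ 9 Z` the variable `z_a` splits off; the other factor involves the sum of the
  -- remaining four exponents.
  have hnine : ∀ {a b : ℕ} {Z : ℝ}, Z = q ^ a * q ^ b → q ^ a - q ^ 9 * Z = q ^ a * f (b + 9) := by
    rintro a b Z rfl
    rw [hf]
    ring
  have hq : ∀ n, q ^ n ≠ 0 := fun n => (pow_pos hq0 n).ne'
  unfold chainFive
  dsimp only
  rw [hsub h2, hsub (h3.trans h2), hsub (h4.trans (h3.trans h2)),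
    hsub (h5.trans (h4.trans (h3.trans h2))), hsub h3, hsub (h4.trans h3),
    hsub (h5.trans (h4.trans h3)), hsub h4, hsub (h5.trans h4), hsub h5,
    hpair, hpair, hpair, hpair, hpair,
    hnine (a := M1) (b := M2 + M3 + M4 + M5) (by ring),
    hnine (a := M2) (b := M1 + M3 + M4 + M5) (by ring),
    hnine (a := M3) (b := M1 + M2 + M4 + M5) (by ring),
    hnine (a := M4) (b := M1 + M2 + M3 + M5) (by ring),
    hnine (a := M5) (b := M1 + M2 + M3 + M4) (by ring),
    hall, hall, hone, ← hf 2]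
  simp only [hfive, hall']
  -- The differences `z_j - z_i` yield `q ^ (M2 + 2 M3 + 3 M4 + 4 M5)`, and `Z ^ 2` divided by the
  -- powers split off in `hnine` yields one factor `Z`.
  have e1 : q ^ (M1 + M2 + M3 + M4 + M5) = q ^ M1 * q ^ M2 * q ^ M3 * q ^ M4 * q ^ M5 := by ring
  have e2 : q ^ (M2 + 2 * M3 + 3 * M4 + 4 * M5) =
      q ^ M2 * (q ^ M3) ^ 2 * (q ^ M4) ^ 3 * (q ^ M5) ^ 4 := by ring
  rw [e1, e2]
  have key : ∀ {A B C D : ℝ}, B ≠ 0 → A * C = D * B → A / B * C = D := by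
    intro A B C D hB h
    rw [div_mul_eq_mul_div, h, mul_div_assoc, div_self hB, mul_one]
  refine key ?_ ?_
  · repeat' refine mul_ne_zero ?_ ?_
    all_goals first | exact hf0 _ (by omega) | exact hq _
  · clear e1 e2 hone hnine hall hall' hfive hpair hsub
    generalize q ^ M1 = z1
    generalize q ^ M2 = z2
    generalize q ^ M3 = z3
    generalize q ^ M4 = z4
    generalize q ^ M5 = z5
    ring

namespace TaggedSwivel

/-- The final cancellation with every product replaced by a letter: `P` is the hook product, `C` the
five-variable sum, `T` the product for `x_6` and the top chain, `V` the factors of the differences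
`M_i - M_j`, and `W`, `W'` the families of five and four factors from `chainFive_pow` and
`prod_armHook`, which differ by `g`. -/
theorem inv_eq_of_hook_product {C P Q T R V W W' g X Y Z p f1 f2 f12 f13 : ℝ}
    (hA : P * V * W' = p * X * Y * (f1 * f12) * Z * R)
    (hB : C * (X * Y * (f12 * f13) * Z) = Q * (f1 ^ 5 * f2 ^ 2) * V * W) (hW : W = g * W')
    (hT' : f13 * T = R * g) (hT : T ≠ 0) (hP : P ≠ 0) (hQ : Q ≠ 0) (hp : p ≠ 0) (h1 : f1 ≠ 0)
    (h2 : f2 ≠ 0) (h12 : f12 ≠ 0) (h13 : f13 ≠ 0) (hX : X ≠ 0) (hY : Y ≠ 0) (hZ : Z ≠ 0) :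
    (p * (f1 ^ 6 * f2 ^ 2))⁻¹ * C / Q * T⁻¹ = P⁻¹ := by
  have h : C * P = p * (f1 ^ 6 * f2 ^ 2) * Q * T := by
    refine mul_right_cancel₀ (b := X * Y * (f12 * f13) * Z) (by positivity) ?_
    subst hW
    linear_combination P * hB + Q * f1 ^ 5 * f2 ^ 2 * g * hA -
      Q * f1 ^ 6 * f2 ^ 2 * p * X * Y * Z * f12 * hT'
  field_simp
  linear_combination h

/-- The hook lengths of a tagged swivel. -/
def hook (lam : Par 5) : TaggedSwivel lam → ℕ :=
  hookLength (rowEnd lam 0) (rowEnd lam 1) (rowEnd lam 2) (rowEnd lam 3) (rowEnd lam 4)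
    coordU coordV

theorem hook_eq_armHook (lam : Par 5) (x : TaggedSwivel lam) : hook lam x =
    armHook (arm lam 0) (arm lam 1) (arm lam 2) (arm lam 3) (arm lam 4) (coordU x) (coordV x) := by
  unfold hook hookLength armHook
  rw [← arm_add lam 0, ← arm_add lam 1, ← arm_add lam 2, ← arm_add lam 3, ← arm_add lam 4]
  push_cast
  rfl

theorem prod_hook {q : ℝ} (hq0 : 0 < q) (hq1 : q < 1) (lam : Par 5) :
    rawValue q lam * (∏ i ∈ Finset.range (lam.part 0 + 4 + 1),
      (1 - q ^ (∑ r, arm lam r + 14 + i))⁻¹) = ∏ x, (1 - q ^ hook lam x)⁻¹ := by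
  have h2 : arm lam 1 < arm lam 0 := arm_strictAnti lam (by decide)
  have h3 : arm lam 2 < arm lam 1 := arm_strictAnti lam (by decide)
  have h4 : arm lam 3 < arm lam 2 := arm_strictAnti lam (by decide)
  have h5 : arm lam 4 < arm lam 3 := arm_strictAnti lam (by decide)
  obtain ⟨f, hf⟩ : ∃ f : ℕ → ℝ, ∀ n, f n = 1 - q ^ n := ⟨_, fun _ => rfl⟩
  have hf0 : ∀ n, 0 < n → f n ≠ 0 := fun n hn => by
    rw [hf]
    have := pow_lt_one₀ hq0.le hq1 hn.ne'
    linarith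
  have hA := prod_armHook (f := f) h5 h4 h3 h2 rfl
  have hC := prod_coord lam fun u v =>
    f (armHook (arm lam 0) (arm lam 1) (arm lam 2) (arm lam 3) (arm lam 4) u v)
  rw [← hC] at hA
  have hB := chainFive_pow hq0 h5 h4 h3 h2 hf hf0
  have hpoch : ∀ m, ∏ k ∈ Finset.range m, f (k + 1) = qPoch q m := fun m =>
    Finset.prod_congr rfl fun k _ => hf _
  have hpoch0 : ∀ m, qPoch q m ≠ 0 := fun m => (qPoch_pos hq0 hq1 m).ne'
  simp only [← hook_eq_armHook, hpoch] at hA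
  simp only [rawValue, normalizer, armPow, Fin.prod_univ_five, Fin.sum_univ_five, ← arm_zero, ← hf]
  rw [Finset.prod_inv_distrib, Finset.prod_inv_distrib]
  have hP : ∏ x, f (hook lam x) ≠ 0 := Finset.prod_ne_zero_iff.2 fun x _ =>
    hf0 _ ((swivelCoord lam).hookLength_pos x)
  have hT : ∏ i ∈ Finset.range (arm lam 0 + 1),
      f (arm lam 0 + arm lam 1 + arm lam 2 + arm lam 3 + arm lam 4 + 14 + i) ≠ 0 :=
    Finset.prod_ne_zero_iff.2 fun x _ => hf0 _ (by omega)
  -- The two products over consecutive exponents are shifted against each other by one, so they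
  -- differ only in their end factors.
  have hT' : f (arm lam 0 + arm lam 1 + arm lam 2 + arm lam 3 + arm lam 4 + 13) *
      ∏ i ∈ Finset.range (arm lam 0 + 1),
        f (arm lam 0 + arm lam 1 + arm lam 2 + arm lam 3 + arm lam 4 + 14 + i) =
      (∏ i ∈ Finset.range (arm lam 0 + 1),
        f (arm lam 0 + arm lam 1 + arm lam 2 + arm lam 3 + arm lam 4 + 13 + i)) *
      f (arm lam 0 + arm lam 1 + arm lam 2 + arm lam 3 + arm lam 4 + 14 + arm lam 0) := by
    have e1 := Finset.prod_range_succ (fun i =>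
      f (arm lam 0 + arm lam 1 + arm lam 2 + arm lam 3 + arm lam 4 + 13 + i)) (arm lam 0 + 1)
    have e2 := Finset.prod_range_succ' (fun i =>
      f (arm lam 0 + arm lam 1 + arm lam 2 + arm lam 3 + arm lam 4 + 13 + i)) (arm lam 0 + 1)
    rw [show arm lam 0 + arm lam 1 + arm lam 2 + arm lam 3 + arm lam 4 + 14 + arm lam 0 =
      arm lam 0 + arm lam 1 + arm lam 2 + arm lam 3 + arm lam 4 + 13 + (arm lam 0 + 1) by ring,
      ← e1, e2, mul_comm]
    congr 1
    refine Finset.prod_congr rfl fun i _ => ?_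
    congr 1
    omega
  rw [show 1 - q = f 1 by rw [hf, pow_one]]
  refine inv_eq_of_hook_product hA hB (by ring) hT' hT hP (by positivity) ?_ ?_ ?_ ?_ ?_ ?_ ?_ ?_
  all_goals
    repeat' refine mul_ne_zero ?_ ?_
    all_goals first | exact hf0 _ (by omega) | exact hpoch0 _

end TaggedSwivel

theorem mainTheorem9 (lam : Par 5) : HasHookLengthProperty (TaggedSwivel lam) := by
  have hc := TaggedSwivel.swivelCoord lam
  refine ⟨hc.isDComplete, TaggedSwivel.hook lam, hc.isHookLength,
    pPartitionGF_eq_prod _ hc.hookLength_pos fun q hq0 hq1 => ?_⟩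
  have hpos : ∀ n, 0 < n → 0 < 1 - q ^ n := fun n hn => by
    have := pow_lt_one₀ hq0.le hq1 hn.ne'
    linarith
  refine (TaggedSwivel.tsum_partition_eq hq0 hq1 lam _).trans ?_
  have h : ∏ i ∈ Finset.range (lam.part 0 + 4 + 1),
      (1 - ENNReal.ofReal q ^ (∑ r, TaggedSwivel.arm lam r + 14 + i))⁻¹ =
      ENNReal.ofReal (∏ i ∈ Finset.range (lam.part 0 + 4 + 1),
        (1 - q ^ (∑ r, TaggedSwivel.arm lam r + 14 + i))⁻¹) := by
    rw [ENNReal.ofReal_prod_of_nonneg fun i _ => inv_nonneg.2 (hpos _ (by omega)).le]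
    refine Finset.prod_congr rfl fun i _ => ?_
    rw [ENNReal.ofReal_inv_of_pos (hpos _ (by omega)), ENNReal.ofReal_sub _ (by positivity),
      ENNReal.ofReal_one, ENNReal.ofReal_pow hq0.le]
  rw [h, ← ENNReal.ofReal_mul' (Finset.prod_nonneg fun i _ => inv_nonneg.2 (hpos _ (by omega)).le),
    TaggedSwivel.prod_hook hq0 hq1 lam]
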